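/- Let $p\ge 1$. Let $\mathbb{Z}_p\subset U(1)$ be the group of $p$-th roots of unity, acting on $S^3\subset\mathbb{C}^2$ by scalar multiplication, let $\mathbb{L}_p=S^3/\mathbb{Z}_p$ be the lens space with the projection $q\colon\mathbb{L}_p\to S^2$ induced by the Hopf fibration, and let $M_p=\mathbb{L}_p\times S^1$. Let $K\to S^2$ be the hermitean line bundle associated with the Hopf fibration (the quotient of $S^3\times\mathbb{C}$ by $(y,z)\cdot\lambda=(y\lambda,\lambda^{-1}z)$, $\lambda\in U(1)$), with its connection of curvature $2\pi\mathrm{i}\,\omega$, where $\omega$ is the volume form of $S^2$ normalised to total volume $1$, and let $J=q^*K$. Let $(\mathcal{G},\nabla^{\mathcal{G}})$ be the hermitean bundle gerbe with connection on $M_p$ given by the surjective submersion $\pi\colon Y=\mathbb{L}_p\times\mathbb{R}\to M_p$, $(x,r)\mapsto(x,e^{2\pi\mathrm{i}r})$, the line bundle with connection on $Y\times_{M_p}Y\cong\mathbb{L}_p\times\mathbb{R}\times\mathbb{Z}$ whose restriction to $\{((x,r),(x,r+n))\}$ is $J^{\otimes n}$ for each $n\in\mathbb{Z}$, the canonical multiplication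 $J^{\otimes m}\otimes J^{\otimes n}\to J^{\otimes(m+n)}$, and the 2-form $B_{|(x,r)}=2\pi\mathrm{i}\,r\,\omega_{|x}$ on $Y$ (pullbacks omitted). Then: (1) $B$ is a curving for $\mathcal{G}$, and the curvature 3-form of $(\mathcal{G},\nabla^{\mathcal{G}})$ is $2\pi\mathrm{i}\,\omega\wedge\mathrm{d}r$. (2) The Dixmier-Douady class of $\mathcal{G}$ in $\mathrm{H}^3(M_p,\mathbb{Z})$ is torsion of order exactly $p$. (3) For $k\in\mathbb{Z}$, let $\mathcal{C}_k$ be the category whose objects are hermitean vector bundles with connection $E$ on $S^3\times\mathbb{R}$ with a $\mathbb{Z}_p$-equivariant structure $\phi_{(y,\zeta,r)}\colon E_{(y\zeta,r)}\to E_{(y,r)}$ and a $\mathbb{Z}$-equivariant structure $\gamma_{(y,r,n)}\colon E_{(y,r+n)}\to E_{(y,r)}$, both unitary and parallel, such that $$\gamma_{(y,r,n)}\circ\phi_{(y,\zeta,r+n)}=\zeta^{kn}\,\phi_{(y,\zeta,r)}\circ\gamma_{(y\zeta,r,n)}$$ for all $y\in S^3$, $r\in\mathbb{R}$, $n\in\mathbb{Z}$,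 $\zeta\in\mathbb{Z}_p$, and whose morphisms are the smooth parallel bundle morphisms that commute with both equivariant structures. Pullback along $S^3\times\mathbb{R}\to M_p$ is an equivalence from the category of hermitean vector bundles with connection on $M_p$ and smooth parallel morphisms to $\mathcal{C}_0$; let $\mathrm{Desc}$ be an inverse of it. Let $\Gamma(M_p,(\mathcal{G},\nabla^{\mathcal{G}}))$ be the category of sections of the gerbe, i.e. the category of parallel 1-morphisms from the trivial gerbe to $(\mathcal{G},\nabla^{\mathcal{G}})$ and of parallel 2-morphisms between them. Then there is an equivalence $$\Phi\colon\Gamma(M_p,(\mathcal{G},\nabla^{\mathcal{G}}))\;\cong\;\mathcal{C}_1=\mathscr{HVB}\mathrm{dl}^\nabla_{\mathrm{par},(\mathbb{Z}_p-\mathbb{Z})_+}(S^3\times\mathbb{R})$$ under which the 2-Hilbert inner product of sections is $\mathrm{Desc}(\Theta(-)\otimes(-))$. Here $\Theta\colon\mathcal{C}_1^{\mathrm{op}}\to\mathcal{C}_{-1}$ takes the dual bundle with the inverse transposes of $\phi$ and $\gamma$, and $\otimes\colon\mathcal{C}_{-1}\times\mathcal{C}_1\to\mathcal{C}_0$ is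 the tensor product. Explicitly: for sections $S=(Z\to Y,E,\alpha)$ and $T=(Z'\to Y,F,\beta)$ the bundle $\mathrm{Desc}(\Theta(\Phi S)\otimes\Phi T)$ on $M_p$ is, isometrically, compatibly with the connections and naturally in $S$ and $T$, the bundle obtained from $E^*\otimes F\to Z\times_Y Z'$ by descent along the isomorphisms induced by $\alpha$ and $\beta$, and its smooth parallel sections correspond bijectively to the morphisms $S\to T$. (4) The category of sections is also equivalent to $\mathcal{C}_{-1}$, in which the factor $\zeta^n$ stands on the other side of the relation. -/

import Mathlib

open scoped Manifold ContDiff TensorProduct Topology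
open Diffeology CategoryTheory

set_option linter.unusedSectionVars false
set_option linter.unusedVariables false

noncomputable section

namespace CupGerbe

/-- `ℝⁿ`, the domain of the plots of a diffeology. -/
abbrev Euc (n : ℕ) : Type := EuclideanSpace ℝ (Fin n)

/-- Smooth manifolds: finite-dimensional, without boundary, Hausdorff and second countable. -/
structure Mfd where
  carrier : Type
  V : Type
  H : Type
  [nacg : NormedAddCommGroup V]
  [nsp : NormedSpace ℝ V]
  [findim : FiniteDimensional ℝ V]
  [topH : TopologicalSpace H]
  I : ModelWithCorners ℝ V H
  [bdless : I.Boundaryless]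
  [top : TopologicalSpace carrier]
  [charted : ChartedSpace H carrier]
  [mfd : IsManifold I ∞ carrier]
  [t2 : T2Space carrier]
  [sct : SecondCountableTopology carrier]

attribute [instance] Mfd.nacg Mfd.nsp Mfd.findim Mfd.topH Mfd.bdless Mfd.top Mfd.charted
  Mfd.mfd Mfd.t2 Mfd.sct

instance : CoeSort Mfd Type := ⟨Mfd.carrier⟩

/-- The product manifold. -/
def Mfd.prod (X Y : Mfd) : Mfd where
  carrier := X.carrier × Y.carrier
  V := X.V × Y.V
  H := ModelProd X.H Y.H
  I := X.I.prod Y.I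

/-- Smooth maps between manifolds. -/
def Mfd.Smooth {X Y : Mfd} (f : X → Y) : Prop := ContMDiff X.I Y.I ∞ f

/-- The diffeology of a manifold: the plots are the smooth maps `ℝⁿ → X`. -/
instance Mfd.diffeology (X : Mfd) : DiffeologicalSpace X.carrier :=
  .ofCorePlotsOn {
    isPlotOn := fun {n u} _ p => ContMDiffOn 𝓘(ℝ, Euc n) X.I ∞ p u
    isPlotOn_congr := fun _ _ _ h => contMDiffOn_congr (fun x hx => h hx)
    isPlot := fun {n} p => ContMDiff 𝓘(ℝ, Euc n) X.I ∞ p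
    isPlotOn_univ := contMDiffOn_univ
    isPlot_const := fun _ => contMDiff_const
    isPlotOn_reparam := fun _ _ _ h hp hf => hp.comp hf.contMDiffOn h
    locality := fun _ _ h x hx => by
      obtain ⟨v, hv, hxv, hv'⟩ := h x hx
      exact ((hv' x hxv).contMDiffAt (hv.mem_nhds hxv)).contMDiffWithinAt }

theorem Mfd.isPlot_iff {X : Mfd} {n : ℕ} {p : Euc n → X} :
    IsPlot p ↔ ContMDiff 𝓘(ℝ, Euc n) X.I ∞ p := Iff.rfl

theorem Mfd.Smooth.dSmooth {X Y : Mfd} {f : X → Y} (hf : Mfd.Smooth f) : DSmooth f :=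
  fun _ _ hp => ContMDiff.comp hf hp

/-- Pulling back a diffeology along a map into a diffeological space. -/
@[reducible]
def inducedDiffeology {X Y : Type} [DiffeologicalSpace Y] (f : X → Y) :
    DiffeologicalSpace X where
  plots n := {p | IsPlot (f ∘ p)}
  constant_plots _ := isPlot_const
  plot_reparam hp hf := isPlot_reparam hp hf
  locality {n p} hp := DiffeologicalSpace.locality (p := f ∘ p) fun x => by
    obtain ⟨u, hu, hx, h⟩ := hp x
    exact ⟨u, hu, hx, fun hf1 hf2 => h hf1 hf2⟩

/-- The fibre product of `f` and `g`. -/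
def FibProd {X Y M : Type} (f : X → M) (g : Y → M) : Type := {z : X × Y // f z.1 = g z.2}

/-- The point `(x, y)` of a fibre product. -/
@[reducible] def FibProd.mk {X Y M : Type} {f : X → M} {g : Y → M} (x : X) (y : Y) (h : f x = g y) :
    FibProd f g := ⟨(x, y), h⟩

/-- The fibre product carries the subspace diffeology of the product; when `f` and `g` are
submersions of manifolds, this is the diffeology of the submanifold `X ×_M Y` of `X × Y`. -/
instance {X Y M : Type} [DiffeologicalSpace X] [DiffeologicalSpace Y] (f : X → M) (g : Y → M) :
    DiffeologicalSpace (FibProd f g) :=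
  inducedDiffeology (fun z : FibProd f g => z.1.1) ⊓ inducedDiffeology (fun z => z.1.2)

section FibProd
variable {X Y M : Type} [DiffeologicalSpace X] [DiffeologicalSpace Y] {f : X → M} {g : Y → M}

theorem FibProd.isPlot_iff {n : ℕ} {p : Euc n → FibProd f g} :
    IsPlot p ↔ IsPlot (fun u => (p u).1.1) ∧ IsPlot (fun u => (p u).1.2) :=
  DiffeologicalSpace.isPlot_inf_iff

theorem FibProd.dSmooth_fst : DSmooth (fun z : FibProd f g => z.1.1) :=
  fun _ _ hp => (FibProd.isPlot_iff.1 hp).1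

theorem FibProd.dSmooth_snd : DSmooth (fun z : FibProd f g => z.1.2) :=
  fun _ _ hp => (FibProd.isPlot_iff.1 hp).2

end FibProd

/-- A plot of a diffeological space. -/
def Plot (X : Type) [DiffeologicalSpace X] (n : ℕ) : Type := {p : Euc n → X // IsPlot p}

instance (X : Type) [DiffeologicalSpace X] (n : ℕ) : CoeFun (Plot X n) (fun _ => Euc n → X) :=
  ⟨Subtype.val⟩

/-- The plot `f ∘ p`. -/
def Plot.map {X Y : Type} [DiffeologicalSpace X] [DiffeologicalSpace Y] {n : ℕ} (p : Plot X n)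
    (f : X → Y) (hf : DSmooth f) : Plot Y n := ⟨f ∘ p.1, hf n p.1 p.2⟩

/-- The plot `p ∘ h`. -/
def Plot.reparam {X : Type} [DiffeologicalSpace X] {n m : ℕ} (p : Plot X n) (h : Euc m → Euc n)
    (hh : ContDiff ℝ ∞ h) : Plot X m := ⟨p.1 ∘ h, isPlot_reparam p.2 hh⟩

/-- A hermitean vector bundle with (unitary) connection on a diffeological space `X`: a family of
finite-dimensional Hilbert spaces with local unitary frames over open sets, whose transition
functions are smooth, and with local connection 1-forms.  The frames trivialise `E` over `dom i` by
Hilbert spaces `model i`; `coframe i x` is inverse to `frame i x` for `x ∈ dom i` (the values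
outside of `dom i` are irrelevant).  `conn i p` is the pullback along the plot `p` of the connection
1-form of the frame `i`, with values in skew-adjoint endomorphisms. -/
structure HVB (X : Type) [DiffeologicalSpace X] where
  fib : X → Type
  [fibN : ∀ x, NormedAddCommGroup (fib x)]
  [fibI : ∀ x, InnerProductSpace ℂ (fib x)]
  [fibF : ∀ x, FiniteDimensional ℂ (fib x)]
  ι : Type
  dom : ι → Set X
  model : ι → Type
  [modN : ∀ i, NormedAddCommGroup (model i)]
  [modI : ∀ i, InnerProductSpace ℂ (model i)]
  [modF : ∀ i, FiniteDimensional ℂ (model i)]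
  frame : ∀ i x, model i →L[ℂ] fib x
  coframe : ∀ i x, fib x →L[ℂ] model i
  isOpen_dom : ∀ {n : ℕ} (p : Plot X n) i, IsOpen (p ⁻¹' dom i)
  cover : ∀ x, ∃ i, x ∈ dom i
  coframe_frame : ∀ i x, x ∈ dom i → ∀ v, coframe i x (frame i x v) = v
  frame_coframe : ∀ i x, x ∈ dom i → ∀ e, frame i x (coframe i x e) = e
  norm_frame : ∀ i x, x ∈ dom i → ∀ v, ‖frame i x v‖ = ‖v‖
  smooth_trans : ∀ {n : ℕ} (p : Plot X n) i j,
    ContDiffOn ℝ ∞ (fun u => coframe j (p u) ∘L frame i (p u)) (p ⁻¹' (dom i ∩ dom j))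
  conn : ∀ (i : ι) {n : ℕ} (_ : Plot X n), Euc n → Euc n →L[ℝ] (model i →L[ℂ] model i)
  smooth_conn : ∀ i {n : ℕ} (p : Plot X n), ContDiffOn ℝ ∞ (conn i p) (p ⁻¹' dom i)
  skew_conn : ∀ i {n : ℕ} (p : Plot X n) (u : Euc n), p u ∈ dom i → ∀ v a b,
    inner ℂ (conn i p u v a) b + inner ℂ a (conn i p u v b) = 0
  conn_reparam : ∀ i {n m : ℕ} (p : Plot X n) (h : Euc m → Euc n) (hh : ContDiff ℝ ∞ h)
    (u : Euc m), p (h u) ∈ dom i → ∀ v,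
    conn i (p.reparam h hh) u v = conn i p (h u) (fderiv ℝ h u v)
  gauge : ∀ {n : ℕ} (p : Plot X n) i j (u : Euc n), p u ∈ dom i → p u ∈ dom j → ∀ v,
    fderiv ℝ (fun u => coframe j (p u) ∘L frame i (p u)) u v
      + conn j p u v ∘L (coframe j (p u) ∘L frame i (p u))
      = (coframe j (p u) ∘L frame i (p u)) ∘L conn i p u v

attribute [instance] HVB.fibN HVB.fibI HVB.fibF HVB.modN HVB.modI HVB.modF

namespace HVB
variable {X X' : Type} [DiffeologicalSpace X] [DiffeologicalSpace X']

/-- The pullback of a hermitean vector bundle with connection. -/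
def pb (E : HVB X) (f : X' → X) (hf : DSmooth f) : HVB X' where
  fib x := E.fib (f x)
  ι := E.ι
  dom i := f ⁻¹' E.dom i
  model := E.model
  frame i x := E.frame i (f x)
  coframe i x := E.coframe i (f x)
  isOpen_dom p i := E.isOpen_dom (p.map f hf) i
  cover x := E.cover (f x)
  coframe_frame i x := E.coframe_frame i (f x)
  frame_coframe i x := E.frame_coframe i (f x)
  norm_frame i x := E.norm_frame i (f x)
  smooth_trans p := E.smooth_trans (p.map f hf)
  conn i _ p := E.conn i (p.map f hf)
  smooth_conn i _ p := E.smooth_conn i (p.map f hf)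
  skew_conn i _ p := E.skew_conn i (p.map f hf)
  conn_reparam i _ _ p := E.conn_reparam i (p.map f hf)
  gauge p := E.gauge (p.map f hf)

/-- The matrix of a family of linear maps `E_x → F_x` with respect to local frames. -/
def mat (E F : HVB X) (ψ : ∀ x, E.fib x →L[ℂ] F.fib x) {n : ℕ} (p : Plot X n)
    (i : E.ι) (j : F.ι) (u : Euc n) : E.model i →L[ℂ] F.model j :=
  F.coframe j (p u) ∘L ψ (p u) ∘L E.frame i (p u)

/-- A family of linear maps `E_x → F_x` is a smooth parallel morphism `E → F`: its matrices in
local frames are smooth, and `∇^F ∘ ψ = ψ ∘ ∇^E`. -/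
structure IsPar (E F : HVB X) (ψ : ∀ x, E.fib x →L[ℂ] F.fib x) : Prop where
  smooth : ∀ {n : ℕ} (p : Plot X n) i j,
    ContDiffOn ℝ ∞ (mat E F ψ p i j) (p ⁻¹' (E.dom i ∩ F.dom j))
  parallel : ∀ {n : ℕ} (p : Plot X n) i j (u : Euc n), p u ∈ E.dom i → p u ∈ F.dom j → ∀ v,
    fderiv ℝ (mat E F ψ p i j) u v + F.conn j p u v ∘L mat E F ψ p i j u
      = mat E F ψ p i j u ∘L E.conn i p u v

end HVB

/-! ### Linear algebra of fibres -/

section LinAlg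
variable {V W V' W' V'' W'' U : Type}
  [NormedAddCommGroup V] [InnerProductSpace ℂ V] [FiniteDimensional ℂ V]
  [NormedAddCommGroup W] [InnerProductSpace ℂ W] [FiniteDimensional ℂ W]
  [NormedAddCommGroup V'] [InnerProductSpace ℂ V'] [FiniteDimensional ℂ V']
  [NormedAddCommGroup W'] [InnerProductSpace ℂ W'] [FiniteDimensional ℂ W']
  [NormedAddCommGroup V''] [InnerProductSpace ℂ V''] [FiniteDimensional ℂ V'']
  [NormedAddCommGroup W''] [InnerProductSpace ℂ W''] [FiniteDimensional ℂ W'']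
  [NormedAddCommGroup U] [InnerProductSpace ℂ U] [FiniteDimensional ℂ U]

/-- The tensor product of Hilbert spaces. -/
def Ten (V W : Type) [NormedAddCommGroup V] [InnerProductSpace ℂ V] [NormedAddCommGroup W]
    [InnerProductSpace ℂ W] : Type := V ⊗[ℂ] W

instance : NormedAddCommGroup (Ten V W) := inferInstanceAs (NormedAddCommGroup (V ⊗[ℂ] W))
instance : InnerProductSpace ℂ (Ten V W) := inferInstanceAs (InnerProductSpace ℂ (V ⊗[ℂ] W))
instance : FiniteDimensional ℂ (Ten V W) := inferInstanceAs (FiniteDimensional ℂ (V ⊗[ℂ] W))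

/-- The pure tensor `v ⊗ w`. -/
def tmul (v : V) (w : W) : Ten V W := v ⊗ₜ[ℂ] w

infixl:100 " ⊠ " => tmul

theorem zero_tmul (w : W) : (0 : V) ⊠ w = 0 := TensorProduct.zero_tmul V w

theorem tmul_add (v : V) (w w' : W) : v ⊠ (w + w') = v ⊠ w + v ⊠ w' := TensorProduct.tmul_add v w w'

theorem add_tmul (v v' : V) (w : W) : (v + v') ⊠ w = v ⊠ w + v' ⊠ w := TensorProduct.add_tmul v v' w

theorem tmul_sub (v : V) (w w' : W) : v ⊠ (w - w') = v ⊠ w - v ⊠ w' := TensorProduct.tmul_sub v w w'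

theorem sub_tmul (v v' : V) (w : W) : (v - v') ⊠ w = v ⊠ w - v' ⊠ w := TensorProduct.sub_tmul v v' w

theorem smul_tmul (c : ℂ) (v : V) (w : W) : (c • v) ⊠ w = c • v ⊠ w := TensorProduct.smul_tmul' c v w

theorem tmul_smul (c : ℂ) (v : V) (w : W) : v ⊠ (c • w) = c • v ⊠ w := TensorProduct.tmul_smul c v w

theorem inner_tmul (v v' : V) (w w' : W) :
    inner ℂ (v ⊠ w) (v' ⊠ w') = inner ℂ v v' * inner ℂ w w' := TensorProduct.inner_tmul ..

theorem Ten.induction {motive : Ten V W → Prop} (h0 : motive 0) (ht : ∀ v w, motive (v ⊠ w))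
    (ha : ∀ x y, motive x → motive y → motive (x + y)) (z : Ten V W) : motive z :=
  TensorProduct.induction_on (motive := motive) z h0 ht ha

theorem clm_tensor_ext {f g : Ten V W →L[ℂ] U} (h : ∀ v w, f (v ⊠ w) = g (v ⊠ w)) : f = g := by
  ext x
  induction x using Ten.induction with
  | h0 => simp
  | ht v w => exact h v w
  | ha x y hx hy => rw [map_add, map_add, hx, hy]

/-- Linear maps out of a tensor product. -/
def tlift {U : Type} [NormedAddCommGroup U] [NormedSpace ℂ U] (f : V →ₗ[ℂ] W →ₗ[ℂ] U) : Ten V W →L[ℂ] U :=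
  LinearMap.toContinuousLinearMap (E := Ten V W) (TensorProduct.lift f)

@[simp] theorem tlift_tmul {U : Type} [NormedAddCommGroup U] [NormedSpace ℂ U]
    (f : V →ₗ[ℂ] W →ₗ[ℂ] U) (v : V) (w : W) : tlift f (v ⊠ w) = f v w :=
  TensorProduct.lift.tmul v w

/-- The tensor product of linear maps. -/
def tmap : (V →L[ℂ] V') →L[ℂ] (W →L[ℂ] W') →L[ℂ] (Ten V W →L[ℂ] Ten V' W') :=
  LinearMap.toContinuousLinearMap
    { toFun := fun f : V →L[ℂ] V' => LinearMap.toContinuousLinearMap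
        { toFun := fun g : W →L[ℂ] W' => tlift (LinearMap.mk₂ ℂ (fun v w => f v ⊠ g w)
            (fun v v' w => by rw [map_add, add_tmul]) (fun c v w => by rw [map_smul, smul_tmul])
            (fun v w w' => by rw [map_add, tmul_add]) (fun c v w => by rw [map_smul, tmul_smul]))
          map_add' := fun g g' => clm_tensor_ext fun v w => by simp [tmul_add]
          map_smul' := fun c g => clm_tensor_ext fun v w => by simp [tmul_smul] }
      map_add' := fun f f' => ContinuousLinearMap.ext fun g => clm_tensor_ext fun v w => by
        simp [add_tmul]
      map_smul' := fun c f => ContinuousLinearMap.ext fun g => clm_tensor_ext fun v w => by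
        simp [smul_tmul] }

@[simp] theorem tmap_tmul (f : V →L[ℂ] V') (g : W →L[ℂ] W') (v : V) (w : W) :
    tmap f g (v ⊠ w) = f v ⊠ g w := tlift_tmul _ v w

theorem tmap_comp (f : V →L[ℂ] V') (g : W →L[ℂ] W') (f' : V' →L[ℂ] V'') (g' : W' →L[ℂ] W'') :
    tmap f' g' ∘L tmap f g = tmap (f' ∘L f) (g' ∘L g) :=
  clm_tensor_ext fun _ _ => by simp

theorem tmap_id : tmap (ContinuousLinearMap.id ℂ V) (ContinuousLinearMap.id ℂ W)
    = ContinuousLinearMap.id ℂ _ := clm_tensor_ext fun _ _ => by simp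

/-- `tmap` as a real bilinear map. -/
def tmapR : (V →L[ℂ] V') →L[ℝ] (W →L[ℂ] W') →L[ℝ] (Ten V W →L[ℂ] Ten V' W') :=
  tmap.bilinearRestrictScalars ℝ

theorem tmapR_apply (f : V →L[ℂ] V') (g : W →L[ℂ] W') : tmapR f g = tmap f g := rfl

/-- The dual of a Hilbert space. -/
def Du (V : Type) [NormedAddCommGroup V] [InnerProductSpace ℂ V] : Type := StrongDual ℂ V

instance : NormedAddCommGroup (Du V) := inferInstanceAs (NormedAddCommGroup (StrongDual ℂ V))

/-- The Riesz isomorphism. -/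
def riesz (V : Type) [NormedAddCommGroup V] [InnerProductSpace ℂ V] [FiniteDimensional ℂ V] :
    V ≃ₗᵢ⋆[ℂ] StrongDual ℂ V :=
  haveI : CompleteSpace V := FiniteDimensional.complete ℂ V
  InnerProductSpace.toDual ℂ V

/-- The inner product of the dual is transported along the Riesz isomorphism. -/
instance : InnerProductSpace ℂ (Du V) :=
  { (inferInstanceAs (NormedSpace ℂ (StrongDual ℂ V)) : NormedSpace ℂ (Du V)) with
    inner := fun ξ η => inner ℂ ((riesz V).symm η) ((riesz V).symm ξ)
    norm_sq_eq_re_inner := fun ξ => by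
      rw [← norm_sq_eq_re_inner (𝕜 := ℂ) ((riesz V).symm ξ), (riesz V).symm.norm_map ξ]; rfl
    conj_inner_symm := fun ξ η => inner_conj_symm _ _
    add_left := fun ξ η θ =>
      (congrArg (inner ℂ ((riesz V).symm θ)) (map_add (riesz V).symm ξ η)).trans
        (inner_add_right ..)
    smul_left := fun ξ η c =>
      (congrArg (inner ℂ ((riesz V).symm η)) (map_smulₛₗ (riesz V).symm c ξ)).trans
        (inner_smul_right ..) }

theorem du_inner (ξ η : Du V) :
    inner ℂ ξ η = inner ℂ ((riesz V).symm η) ((riesz V).symm ξ) := rfl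

instance : FiniteDimensional ℂ (Du V) := inferInstanceAs (FiniteDimensional ℂ (StrongDual ℂ V))
instance : FunLike (Du V) V ℂ := inferInstanceAs (FunLike (StrongDual ℂ V) V ℂ)
instance : ContinuousLinearMapClass (Du V) ℂ V ℂ :=
  inferInstanceAs (ContinuousLinearMapClass (StrongDual ℂ V) ℂ V ℂ)

@[ext] theorem Du.ext {ξ η : Du V} (h : ∀ v, ξ v = η v) : ξ = η := DFunLike.ext _ _ h

@[simp] theorem Du.add_apply (ξ η : Du V) (v : V) : (ξ + η) v = ξ v + η v := rfl
@[simp] theorem Du.smul_apply (c : ℂ) (ξ : Du V) (v : V) : (c • ξ) v = c * ξ v := rfl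
@[simp] theorem Du.neg_apply (ξ : Du V) (v : V) : (-ξ) v = -ξ v := rfl
@[simp] theorem Du.sub_apply (ξ η : Du V) (v : V) : (ξ - η) v = ξ v - η v := rfl

/-- The transpose of a linear map. -/
def trp : (V →L[ℂ] W) →L[ℂ] (Du W →L[ℂ] Du V) := (ContinuousLinearMap.compL ℂ V W ℂ).flip

@[simp] theorem trp_apply (f : V →L[ℂ] W) (ξ : Du W) (v : V) : trp f ξ v = ξ (f v) := rfl

/-- The transpose as a real linear map. -/
def trpR : (V →L[ℂ] W) →L[ℝ] (Du W →L[ℂ] Du V) := trp.restrictScalars ℝ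

theorem trpR_apply (f : V →L[ℂ] W) : trpR f = trp f := rfl

theorem trp_comp (f : V →L[ℂ] W) (g : W →L[ℂ] U) : trp f ∘L trp g = trp (g ∘L f) := rfl

/-- The rank-one map `v ↦ ξ(v) w`. -/
def rankOne (ξ : Du V) (w : W) : V →L[ℂ] W :=
  LinearMap.toContinuousLinearMap
    { toFun := fun v => ξ v • w
      map_add' := by simp [add_smul]
      map_smul' := by simp [mul_smul] }

@[simp] theorem rankOne_apply (ξ : Du V) (w : W) (v : V) : rankOne ξ w v = ξ v • w := rfl

/-- The canonical isomorphism `V* ⊗ W → Hom(V, W)`. -/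
def homOf : Ten (Du V) W →L[ℂ] (V →L[ℂ] W) :=
  tlift (LinearMap.mk₂ ℂ rankOne
    (fun _ _ _ => by ext; simp [add_smul]) (fun _ _ _ => by ext; simp [mul_smul])
    (fun _ _ _ => by ext; simp) (fun c ξ w => by
      ext x; simp only [rankOne_apply, smul_apply, smul_smul, mul_comm]))

@[simp] theorem homOf_tmul (ξ : Du V) (w : W) : homOf (ξ ⊠ w) = rankOne ξ w := tlift_tmul _ ξ w

/-- The underlying continuous linear map of an isometric isomorphism. -/
abbrev clm (e : V ≃ₗᵢ[ℂ] W) : V →L[ℂ] W := (e.toContinuousLinearEquiv : V →L[ℂ] W)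

theorem norm_trp {f : V →L[ℂ] W} {g : W →L[ℂ] V} (hfg : ∀ w, f (g w) = w) (hgf : ∀ v, g (f v) = v)
    (hf : ∀ v, ‖f v‖ = ‖v‖) (ξ : Du V) : ‖trp g ξ‖ = ‖ξ‖ := by
  apply le_antisymm
  · refine ContinuousLinearMap.opNorm_le_bound _ (norm_nonneg ξ) fun w => ?_
    have := ContinuousLinearMap.le_opNorm (ξ : StrongDual ℂ V) (g w)
    rwa [← hf (g w), hfg] at this
  · refine ContinuousLinearMap.opNorm_le_bound _ (norm_nonneg (trp g ξ)) fun w => ?_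
    have := ContinuousLinearMap.le_opNorm (trp g ξ : StrongDual ℂ W) (f w)
    rw [hf] at this
    calc ‖ξ w‖ = ‖(trp g ξ) (f w)‖ := by rw [trp_apply, hgf]
      _ ≤ _ := this

/-- A skew-adjoint map has a skew-adjoint transpose. -/
theorem skew_trp {A : V →L[ℂ] V} (hA : ∀ a b, inner ℂ (A a) b + inner ℂ a (A b) = 0)
    (ξ η : Du V) : inner ℂ (-(trp A ξ)) η + inner ℂ ξ (-(trp A η)) = 0 := by
  have key : ∀ ξ : Du V, (riesz V).symm (-(trp A ξ)) = A ((riesz V).symm ξ) := fun ξ => by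
    apply (riesz V).injective
    refine ((riesz V).apply_symm_apply _).trans (Du.ext fun b => ?_)
    change -(ξ (A b)) = inner ℂ (A ((riesz V).symm ξ)) b
    rw [eq_neg_of_add_eq_zero_left (hA _ b)]
    have := congrArg (fun θ : Du V => θ (A b)) ((riesz V).apply_symm_apply ξ)
    exact congrArg Neg.neg this.symm
  rw [du_inner, du_inner, key, key, add_comm]
  exact hA _ _

/-- The transpose of the inverse of an isometric isomorphism, as an isometric isomorphism. -/
def dualIso (e : V ≃ₗᵢ[ℂ] W) : Du V ≃ₗᵢ[ℂ] Du W where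
  toFun ξ := trp (clm e.symm) ξ
  invFun η := trp (clm e) η
  left_inv ξ := by ext; simp
  right_inv ξ := by ext; simp
  map_add' := by simp
  map_smul' := by simp
  norm_map' ξ := norm_trp (f := clm e) (by simp) (by simp) (by simp) ξ

/-- The tensor product of isometric isomorphisms. -/
def tensorIso (e : V ≃ₗᵢ[ℂ] V') (f : W ≃ₗᵢ[ℂ] W') : Ten V W ≃ₗᵢ[ℂ] Ten V' W' :=
  TensorProduct.congrIsometry e f

theorem clm_tensorIso (e : V ≃ₗᵢ[ℂ] V') (f : W ≃ₗᵢ[ℂ] W') :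
    clm (tensorIso e f) = tmap (clm e) (clm f) := clm_tensor_ext fun v w => by
  rw [tmap_tmul]
  exact TensorProduct.congr_tmul e.toLinearEquiv f.toLinearEquiv v w

/-- The associativity isomorphism `(U ⊗ V) ⊗ W → U ⊗ (V ⊗ W)`. -/
def tassoc (U V W : Type) [NormedAddCommGroup U] [InnerProductSpace ℂ U] [FiniteDimensional ℂ U]
    [NormedAddCommGroup V] [InnerProductSpace ℂ V] [FiniteDimensional ℂ V]
    [NormedAddCommGroup W] [InnerProductSpace ℂ W] [FiniteDimensional ℂ W] :
    Ten (Ten U V) W →L[ℂ] Ten U (Ten V W) :=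
  LinearMap.toContinuousLinearMap (E := Ten (Ten U V) W) (F' := Ten U (Ten V W))
    (TensorProduct.assoc ℂ U V W).toLinearMap

@[simp] theorem tassoc_tmul (u : U) (v : V) (w : W) : tassoc U V W (u ⊠ v ⊠ w) = u ⊠ (v ⊠ w) := rfl

/-- The contraction `v ⊗ w ↦ ⟨l, w⟩ v`. -/
def contract (V : Type) {W : Type} [NormedAddCommGroup V] [InnerProductSpace ℂ V]
    [FiniteDimensional ℂ V] [NormedAddCommGroup W] [InnerProductSpace ℂ W] [FiniteDimensional ℂ W]
    (l : W) : Ten V W →L[ℂ] V :=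
  tlift (LinearMap.mk₂ ℂ (fun v w => inner ℂ l w • v) (fun _ _ _ => by simp)
    (fun _ _ _ => by rw [smul_comm]) (fun _ _ _ => by simp [add_smul])
    (fun _ _ _ => by simp [mul_smul]))

@[simp] theorem contract_tmul (l : W) (v : V) (w : W) :
    contract V l (v ⊠ w) = inner ℂ l w • v := tlift_tmul _ v w

theorem clm_dualIso (e : V ≃ₗᵢ[ℂ] W) : clm (dualIso e) = trp (clm e.symm) := rfl

end LinAlg

section Calculus
variable {n : ℕ} {P Q R : Type} [NormedAddCommGroup P] [NormedSpace ℝ P]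
  [NormedAddCommGroup Q] [NormedSpace ℝ Q] [NormedAddCommGroup R] [NormedSpace ℝ R]

theorem fderiv_bilin (B : P →L[ℝ] Q →L[ℝ] R) {f : Euc n → P} {g : Euc n → Q} {u : Euc n}
    (hf : DifferentiableAt ℝ f u) (hg : DifferentiableAt ℝ g u) (v : Euc n) :
    fderiv ℝ (fun u => B (f u) (g u)) u v = B (f u) (fderiv ℝ g u v) + B (fderiv ℝ f u v) (g u) := by
  rw [(B.hasFDerivAt_of_bilinear hf.hasFDerivAt hg.hasFDerivAt).fderiv]
  simp

theorem contDiffAt_bilin (B : P →L[ℝ] Q →L[ℝ] R) {f : Euc n → P} {g : Euc n → Q} {u : Euc n}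
    (hf : ContDiffAt ℝ ∞ f u) (hg : ContDiffAt ℝ ∞ g u) :
    ContDiffAt ℝ ∞ (fun u => B (f u) (g u)) u :=
  B.isBoundedBilinearMap.contDiff.contDiffAt.comp u (hf.prodMk hg)

theorem contDiffOn_bilin (B : P →L[ℝ] Q →L[ℝ] R) {f : Euc n → P} {g : Euc n → Q} {s : Set (Euc n)}
    (hf : ContDiffOn ℝ ∞ f s) (hg : ContDiffOn ℝ ∞ g s) :
    ContDiffOn ℝ ∞ (fun u => B (f u) (g u)) s :=
  B.isBoundedBilinearMap.contDiff.comp_contDiffOn (hf.prodMk hg)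

variable {V W U V' W' : Type} [NormedAddCommGroup V] [NormedSpace ℂ V] [NormedAddCommGroup W]
  [NormedSpace ℂ W] [NormedAddCommGroup U] [NormedSpace ℂ U]

/-- Composition as a real bilinear map. -/
def compR : (W →L[ℂ] U) →L[ℝ] (V →L[ℂ] W) →L[ℝ] (V →L[ℂ] U) :=
  (ContinuousLinearMap.compL ℂ V W U).bilinearRestrictScalars ℝ

theorem fderiv_clm_comp {f : Euc n → W →L[ℂ] U} {g : Euc n → V →L[ℂ] W} {u : Euc n}
    (hf : DifferentiableAt ℝ f u) (hg : DifferentiableAt ℝ g u) (v : Euc n) :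
    fderiv ℝ (fun u => f u ∘L g u) u v = f u ∘L fderiv ℝ g u v + fderiv ℝ f u v ∘L g u :=
  fderiv_bilin compR hf hg v

theorem contDiffOn_clm_comp {f : Euc n → W →L[ℂ] U} {g : Euc n → V →L[ℂ] W} {s : Set (Euc n)}
    (hf : ContDiffOn ℝ ∞ f s) (hg : ContDiffOn ℝ ∞ g s) :
    ContDiffOn ℝ ∞ (fun u => f u ∘L g u) s := contDiffOn_bilin compR hf hg

/-- The connection form `A ⊗ 1 + 1 ⊗ B` of a tensor product. -/
def tconn {V W : Type} [NormedAddCommGroup V] [InnerProductSpace ℂ V] [FiniteDimensional ℂ V]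
    [NormedAddCommGroup W] [InnerProductSpace ℂ W] [FiniteDimensional ℂ W]
    (A : Euc n →L[ℝ] (V →L[ℂ] V)) (B : Euc n →L[ℝ] (W →L[ℂ] W)) :
    Euc n →L[ℝ] (Ten V W →L[ℂ] Ten V W) :=
  ((tmap (V := V) (V' := V) (W := W) (W' := W)).flip (.id ℂ W)).restrictScalars ℝ ∘L A
    + (tmap (V := V) (V' := V) (W := W) (W' := W) (.id ℂ V)).restrictScalars ℝ ∘L B

theorem tconn_apply {V W : Type} [NormedAddCommGroup V] [InnerProductSpace ℂ V]
    [FiniteDimensional ℂ V] [NormedAddCommGroup W] [InnerProductSpace ℂ W] [FiniteDimensional ℂ W]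
    (A : Euc n →L[ℝ] (V →L[ℂ] V)) (B : Euc n →L[ℝ] (W →L[ℂ] W)) (v : Euc n) :
    tconn A B v = tmap (A v) (.id ℂ W) + tmap (.id ℂ V) (B v) := rfl

theorem contDiffOn_tconn {V W : Type} [NormedAddCommGroup V] [InnerProductSpace ℂ V]
    [FiniteDimensional ℂ V] [NormedAddCommGroup W] [InnerProductSpace ℂ W] [FiniteDimensional ℂ W]
    {A : Euc n → Euc n →L[ℝ] (V →L[ℂ] V)} {B : Euc n → Euc n →L[ℝ] (W →L[ℂ] W)} {s : Set (Euc n)}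
    (hA : ContDiffOn ℝ ∞ A s) (hB : ContDiffOn ℝ ∞ B s) :
    ContDiffOn ℝ ∞ (fun u => tconn (A u) (B u)) s :=
  (contDiffOn_const.clm_comp hA).add (contDiffOn_const.clm_comp hB)

section
variable {V W V' W' : Type}
  [NormedAddCommGroup V] [InnerProductSpace ℂ V] [FiniteDimensional ℂ V]
  [NormedAddCommGroup W] [InnerProductSpace ℂ W] [FiniteDimensional ℂ W]
  [NormedAddCommGroup V'] [InnerProductSpace ℂ V'] [FiniteDimensional ℂ V']
  [NormedAddCommGroup W'] [InnerProductSpace ℂ W'] [FiniteDimensional ℂ W']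

theorem contDiffAt_tmap {f : Euc n → V →L[ℂ] V'} {g : Euc n → W →L[ℂ] W'} {u : Euc n}
    (hf : ContDiffAt ℝ ∞ f u) (hg : ContDiffAt ℝ ∞ g u) :
    ContDiffAt ℝ ∞ (fun u => tmap (f u) (g u)) u := by
  simp only [← tmapR_apply]
  exact contDiffAt_bilin (P := V →L[ℂ] V') (Q := W →L[ℂ] W') (R := Ten V W →L[ℂ] Ten V' W') tmapR hf hg

theorem contDiffOn_tmap {f : Euc n → V →L[ℂ] V'} {g : Euc n → W →L[ℂ] W'} {s : Set (Euc n)}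
    (hf : ContDiffOn ℝ ∞ f s) (hg : ContDiffOn ℝ ∞ g s) :
    ContDiffOn ℝ ∞ (fun u => tmap (f u) (g u)) s := by
  simp only [← tmapR_apply]
  exact contDiffOn_bilin (P := V →L[ℂ] V') (Q := W →L[ℂ] W') (R := Ten V W →L[ℂ] Ten V' W') tmapR hf hg

theorem fderiv_tmap {f : Euc n → V →L[ℂ] V'} {g : Euc n → W →L[ℂ] W'} {u : Euc n}
    (hf : DifferentiableAt ℝ f u) (hg : DifferentiableAt ℝ g u) (v : Euc n) :
    fderiv ℝ (fun u => tmap (f u) (g u)) u v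
      = tmap (f u) (fderiv ℝ g u v) + tmap (fderiv ℝ f u v) (g u) := by
  simp only [← tmapR_apply]
  exact fderiv_bilin (P := V →L[ℂ] V') (Q := W →L[ℂ] W') (R := Ten V W →L[ℂ] Ten V' W') tmapR hf hg v

theorem contDiffAt_trp {f : Euc n → V →L[ℂ] W} {u : Euc n} (hf : ContDiffAt ℝ ∞ f u) :
    ContDiffAt ℝ ∞ (fun u => trp (f u)) u :=
  (trpR (V := V) (W := W)).contDiff.contDiffAt.comp u hf

theorem contDiffOn_trp {f : Euc n → V →L[ℂ] W} {s : Set (Euc n)} (hf : ContDiffOn ℝ ∞ f s) :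
    ContDiffOn ℝ ∞ (fun u => trp (f u)) s :=
  (trpR (V := V) (W := W)).contDiff.comp_contDiffOn hf

theorem fderiv_trp {f : Euc n → V →L[ℂ] W} {u : Euc n} (hf : DifferentiableAt ℝ f u) (v : Euc n) :
    fderiv ℝ (fun u => trp (f u)) u v = trp (fderiv ℝ f u v) := by
  have := ((trpR (V := V) (W := W)).hasFDerivAt.comp u hf.hasFDerivAt).fderiv
  exact congrArg (fun g => g v) this

end

end Calculus

/-- A smooth map that is the identity near `u₀` and takes values in a given neighbourhood. -/
theorem exists_retract {n : ℕ} (u₀ : Euc n) {s : Set (Euc n)} (hs : s ∈ 𝓝 u₀) :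
    ∃ c : Euc n → Euc n, ContDiff ℝ ∞ c ∧ (∀ u, c u ∈ s) ∧ ∀ᶠ u in 𝓝 u₀, c u = u := by
  obtain ⟨ε, hε, hs⟩ := Metric.mem_nhds_iff.1 hs
  let χ : ContDiffBump u₀ := ⟨ε / 3, ε / 2, by positivity, by linarith⟩
  refine ⟨fun u => u₀ + χ u • (u - u₀),
    contDiff_const.add (χ.contDiff.smul (contDiff_id.sub contDiff_const)), fun u => hs ?_, ?_⟩
  · rw [Metric.mem_ball, dist_eq_norm, add_sub_cancel_left, norm_smul, Real.norm_eq_abs,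
      abs_of_nonneg χ.nonneg]
    by_cases h : dist u u₀ < ε / 2
    · rw [dist_eq_norm] at h
      calc _ ≤ 1 * ‖u - u₀‖ := by gcongr; exact χ.le_one
        _ < ε := by linarith
    · rw [χ.zero_of_le_dist (not_lt.1 h)]
      simpa using hε
  · filter_upwards [χ.eventuallyEq_one] with u hu
    simp [hu]

namespace HVB
variable {X X' : Type} [DiffeologicalSpace X] [DiffeologicalSpace X'] {E F G : HVB X}

theorem nhds_dom (E : HVB X) {n : ℕ} (p : Plot X n) {i : E.ι} {u : Euc n} (hi : p u ∈ E.dom i) :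
    p ⁻¹' E.dom i ∈ 𝓝 u := (E.isOpen_dom p i).mem_nhds hi

theorem conn_congr (E : HVB X) {n : ℕ} (p q : Plot X n) (i : E.ι) {u : Euc n} (hi : p u ∈ E.dom i)
    (h : ∀ᶠ w in 𝓝 u, p w = q w) : E.conn i p u = E.conn i q u := by
  obtain ⟨c, hc, hcs, hcu⟩ := exists_retract u h
  have hcu' : c u = u := hcu.self_of_nhds
  have hD : fderiv ℝ c u = ContinuousLinearMap.id ℝ _ := by
    rw [(show c =ᶠ[𝓝 u] id from hcu).fderiv_eq, fderiv_id]
  have hq : q (c u) ∈ E.dom i := by rw [hcu', ← h.self_of_nhds]; exact hi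
  have hr : p.reparam c hc = q.reparam c hc := Subtype.ext (funext fun w => hcs w)
  ext1 v
  have h1 := E.conn_reparam i p c hc u (by rwa [hcu']) v
  have h2 := E.conn_reparam i q c hc u hq v
  rw [hr, h2, hcu', hD] at h1
  exact h1.symm

theorem IsPar.contDiffAt {ψ : ∀ x, E.fib x →L[ℂ] F.fib x} (h : IsPar E F ψ) {n : ℕ} (p : Plot X n)
    {i : E.ι} {j : F.ι} {u : Euc n} (hi : p u ∈ E.dom i) (hj : p u ∈ F.dom j) :
    ContDiffAt ℝ ∞ (mat E F ψ p i j) u :=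
  (h.smooth p i j).contDiffAt (Filter.inter_mem (E.nhds_dom p hi) (F.nhds_dom p hj))

theorem IsPar.differentiableAt {ψ : ∀ x, E.fib x →L[ℂ] F.fib x} (h : IsPar E F ψ) {n : ℕ}
    (p : Plot X n) {i : E.ι} {j : F.ι} {u : Euc n} (hi : p u ∈ E.dom i) (hj : p u ∈ F.dom j) :
    DifferentiableAt ℝ (mat E F ψ p i j) u := (h.contDiffAt p hi hj).differentiableAt (by simp)

theorem IsPar.of_at {ψ : ∀ x, E.fib x →L[ℂ] F.fib x}
    (h : ∀ {n : ℕ} (p : Plot X n) (i : E.ι) (j : F.ι) (u : Euc n), p u ∈ E.dom i → p u ∈ F.dom j →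
      ContDiffAt ℝ ∞ (mat E F ψ p i j) u ∧ ∀ v, fderiv ℝ (mat E F ψ p i j) u v
        + F.conn j p u v ∘L mat E F ψ p i j u = mat E F ψ p i j u ∘L E.conn i p u v) :
    IsPar E F ψ :=
  ⟨fun p i j u hu => (h p i j u hu.1 hu.2).1.contDiffWithinAt, fun p i j u hi hj =>
    (h p i j u hi hj).2⟩

theorem IsPar.congr {ψ χ : ∀ x, E.fib x →L[ℂ] F.fib x} (h : IsPar E F ψ)
    (e : ∀ x a, ψ x a = χ x a) : IsPar E F χ := by
  obtain rfl : ψ = χ := funext fun x => ContinuousLinearMap.ext (e x)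
  exact h

theorem isPar_id (E : HVB X) : IsPar E E (fun _ => ContinuousLinearMap.id ℂ _) :=
  ⟨fun p i j => E.smooth_trans p i j, fun p i j => E.gauge p i j⟩

theorem IsPar.comp {χ : ∀ x, F.fib x →L[ℂ] G.fib x} {ψ : ∀ x, E.fib x →L[ℂ] F.fib x}
    (hχ : IsPar F G χ) (hψ : IsPar E F ψ) : IsPar E G (fun x => χ x ∘L ψ x) := by
  refine .of_at fun p i k u hi hk => ?_
  obtain ⟨j, hj⟩ := F.cover (p u)
  have key : ∀ w, p w ∈ F.dom j → mat E G (fun x => χ x ∘L ψ x) p i k w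
      = mat F G χ p j k w ∘L mat E F ψ p i j w := fun w hw => by
    ext a
    simp [mat, F.frame_coframe j _ hw]
  have ev : mat E G (fun x => χ x ∘L ψ x) p i k =ᶠ[𝓝 u]
      fun w => mat F G χ p j k w ∘L mat E F ψ p i j w :=
    Filter.mem_of_superset (F.nhds_dom p hj) key
  refine ⟨?_, fun v => ?_⟩
  · have h1 := hχ.contDiffAt p hj hk
    have h2 := hψ.contDiffAt p hi hj
    refine ContDiffAt.congr_of_eventuallyEq ?_ ev
    exact ((compR (V := E.model i) (W := F.model j) (U := G.model k)).isBoundedBilinearMap.contDiff.contDiffAt).comp u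
      (h1.prodMk h2)
  · rw [ev.fderiv_eq, fderiv_clm_comp (hχ.differentiableAt p hj hk) (hψ.differentiableAt p hi hj),
      key u hj]
    have e1 := hχ.parallel p j k u hj hk v
    have e2 := hψ.parallel p i j u hi hj v
    rw [← eq_sub_iff_add_eq] at e1 e2
    rw [e1, e2]
    ext a
    simp

theorem IsPar.inv {χ : ∀ x, F.fib x →L[ℂ] E.fib x} {ψ : ∀ x, E.fib x →L[ℂ] F.fib x}
    (hψ : IsPar E F ψ) (h1 : ∀ x e, χ x (ψ x e) = e) (h2 : ∀ x e, ψ x (χ x e) = e) :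
    IsPar F E χ := by
  refine .of_at fun p j i u hj hi => ?_
  have k1 : ∀ w, p w ∈ F.dom j → p w ∈ E.dom i →
      mat F E χ p j i w ∘L mat E F ψ p i j w = .id ℂ _ := fun w hw hw' => by
    ext a
    simp [mat, F.frame_coframe j _ hw, h1, E.coframe_frame i _ hw']
  have k2 : ∀ w, p w ∈ F.dom j → p w ∈ E.dom i →
      mat E F ψ p i j w ∘L mat F E χ p j i w = .id ℂ _ := fun w hw hw' => by
    ext a
    simp [mat, E.frame_coframe i _ hw', h2, F.coframe_frame j _ hw]
  let e : ∀ w, p w ∈ F.dom j → p w ∈ E.dom i → (E.model i ≃L[ℂ] F.model j) := fun w hw hw' =>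
    ContinuousLinearEquiv.equivOfInverse (mat E F ψ p i j w) (mat F E χ p j i w)
      (fun a => congrArg (fun f => f a) (k1 w hw hw')) (fun a => congrArg (fun f => f a) (k2 w hw hw'))
  have ev : mat F E χ p j i =ᶠ[𝓝 u] fun w => ContinuousLinearMap.inverse (mat E F ψ p i j w) := by
    filter_upwards [F.nhds_dom p hj, E.nhds_dom p hi] with w hw hw'
    exact (ContinuousLinearMap.inverse_equiv (e w hw hw')).symm
  have : CompleteSpace (E.model i) := FiniteDimensional.complete ℂ _
  have sm : ContDiffAt ℝ ∞ (mat F E χ p j i) u := by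
    refine ContDiffAt.congr_of_eventuallyEq ?_ ev
    exact ContDiffAt.comp u ((contDiffAt_map_inverse (𝕜 := ℂ) (e u hj hi)).restrict_scalars ℝ)
      (hψ.contDiffAt p hi hj)
  refine ⟨sm, fun v => ?_⟩
  have dN := sm.differentiableAt (by simp)
  have dM := hψ.differentiableAt p hi hj
  have ev1 : (fun w => mat F E χ p j i w ∘L mat E F ψ p i j w) =ᶠ[𝓝 u]
      fun _ => .id ℂ _ := by
    filter_upwards [F.nhds_dom p hj, E.nhds_dom p hi] with w hw hw'
    exact k1 w hw hw'
  have D := fderiv_clm_comp dN dM v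
  rw [ev1.fderiv_eq, fderiv_fun_const] at D
  have e2 := hψ.parallel p i j u hi hj v
  rw [← eq_sub_iff_add_eq] at e2
  rw [e2] at D
  have D' := congrArg (fun f => f ∘L mat F E χ p j i u) D
  have a1 := fun a => congrArg (fun f => f a) (k1 u hj hi)
  have a2 := fun a => congrArg (fun f => f a) (k2 u hj hi)
  simp only [ContinuousLinearMap.comp_apply, ContinuousLinearMap.id_apply] at a1 a2
  ext b
  have D'' := congrArg (fun f => f b) D'
  simp [a1, a2] at D''
  simp only [add_apply, ContinuousLinearMap.comp_apply]
  rw [← sub_eq_zero, D'']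
  abel

/-- Smooth parallel morphisms pull back. -/
theorem IsPar.pb {ψ : ∀ x, E.fib x →L[ℂ] F.fib x} (h : IsPar E F ψ) (f : X' → X) (hf : DSmooth f) :
    IsPar (E.pb f hf) (F.pb f hf) (fun x => ψ (f x)) :=
  ⟨fun p => h.smooth (p.map f hf), fun p => h.parallel (p.map f hf)⟩

/-- Being smooth and parallel may be checked after pulling back along maps that lift plots
locally. -/
theorem IsPar.of_lift {ψ : ∀ x, E.fib x →L[ℂ] F.fib x} (f : X' → X) (hf : DSmooth f)
    (hl : ∀ {n : ℕ} (p : Plot X n) (u : Euc n), ∃ q : Plot X' n, ∀ᶠ w in 𝓝 u, f (q w) = p w)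
    (h : IsPar (E.pb f hf) (F.pb f hf) (fun x => ψ (f x))) : IsPar E F ψ := by
  refine .of_at fun {n} p i j u hi hj => ?_
  obtain ⟨q, hq⟩ := hl p u
  have hi' : f (q u) ∈ E.dom i := by rw [hq.self_of_nhds]; exact hi
  have hj' : f (q u) ∈ F.dom j := by rw [hq.self_of_nhds]; exact hj
  let m : Euc n → (E.model i →L[ℂ] F.model j) := fun w =>
    F.coframe j (f (q w)) ∘L ψ (f (q w)) ∘L E.frame i (f (q w))
  have k : ∀ w, f (q w) = p w → m w = mat E F ψ p i j w := fun w hw => by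
    simp only [m]
    rw [hw]; rfl
  have ev : mat E F ψ p i j =ᶠ[𝓝 u] m := by
    filter_upwards [hq] with w hw using (k w hw).symm
  have hm : ContDiffAt ℝ ∞ m u := h.contDiffAt q hi' hj'
  refine ⟨hm.congr_of_eventuallyEq ev, fun v => ?_⟩
  have := h.parallel q i j u hi' hj' v
  change fderiv ℝ m u v + F.conn j (q.map f hf) u v ∘L m u = m u ∘L E.conn i (q.map f hf) u v at this
  rwa [← ev.fderiv_eq, k u hq.self_of_nhds, E.conn_congr (q.map f hf) p i hi' hq,
    F.conn_congr (q.map f hf) p j hj' hq] at this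

end HVB

namespace HVB
variable {X X' : Type} [DiffeologicalSpace X] [DiffeologicalSpace X'] {E F G E' F' : HVB X}

/-- Smooth parallel morphisms of hermitean vector bundles with connection. -/
@[ext] structure ParHom (E F : HVB X) where
  toFun : ∀ x, E.fib x →L[ℂ] F.fib x
  isPar : IsPar E F toFun

/-- The category of hermitean vector bundles with connection and smooth parallel morphisms. -/
instance : Category (HVB X) where
  Hom := ParHom
  id E := ⟨_, isPar_id E⟩
  comp ψ χ := ⟨_, χ.isPar.comp ψ.isPar⟩

/-- The identification of fibres over equal points. -/
def tr (E : HVB X) {x x' : X} (h : x = x') : E.fib x ≃ₗᵢ[ℂ] E.fib x' := h ▸ LinearIsometryEquiv.refl ℂ _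

@[simp] theorem tr_rfl (E : HVB X) {x : X} (h : x = x) (e : E.fib x) : E.tr h e = e := rfl

theorem tr_par (E : HVB X) (f g : X' → X) (hf : DSmooth f) (hg : DSmooth g) (h : ∀ x, f x = g x) :
    IsPar (E.pb f hf) (E.pb g hg) (fun x => clm (E.tr (h x))) := by
  obtain rfl : f = g := funext h
  exact isPar_id _

/-- The trivial line bundle with the trivial connection. -/
def triv (X : Type) [DiffeologicalSpace X] : HVB X where
  fib _ := ℂ
  ι := Unit
  dom _ := Set.univ
  model _ := ℂ
  frame _ _ := .id ℂ ℂ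
  coframe _ _ := .id ℂ ℂ
  isOpen_dom _ _ := by simp
  cover x := ⟨(), trivial⟩
  coframe_frame _ _ _ _ := rfl
  frame_coframe _ _ _ _ := rfl
  norm_frame _ _ _ _ := rfl
  smooth_trans _ _ _ := contDiffOn_const
  conn _ _ _ _ := 0
  smooth_conn _ _ _ := contDiffOn_const
  skew_conn _ _ _ _ _ _ _ _ := by simp
  conn_reparam _ _ _ _ _ _ _ _ _ := by simp
  gauge _ _ _ _ _ _ _ := by simp

/-- The section `s` of `E` is smooth and parallel. -/
def IsParSection (E : HVB X) (s : ∀ x, E.fib x) : Prop :=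
  IsPar (triv X) E (fun x => ContinuousLinearMap.toSpanSingleton ℂ (s x))

theorem tensor_par {n : ℕ} {V W V' W' : Type}
    [NormedAddCommGroup V] [InnerProductSpace ℂ V] [FiniteDimensional ℂ V]
    [NormedAddCommGroup W] [InnerProductSpace ℂ W] [FiniteDimensional ℂ W]
    [NormedAddCommGroup V'] [InnerProductSpace ℂ V'] [FiniteDimensional ℂ V']
    [NormedAddCommGroup W'] [InnerProductSpace ℂ W'] [FiniteDimensional ℂ W'] {v : Euc n}
    {A : Euc n →L[ℝ] (V →L[ℂ] V)} {A' : Euc n →L[ℝ] (V' →L[ℂ] V')} {T DT : V →L[ℂ] V'}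
    {B : Euc n →L[ℝ] (W →L[ℂ] W)} {B' : Euc n →L[ℝ] (W' →L[ℂ] W')} {S DS : W →L[ℂ] W'}
    (hT : DT + A' v ∘L T = T ∘L A v) (hS : DS + B' v ∘L S = S ∘L B v) :
    tmap T DS + tmap DT S + tconn A' B' v ∘L tmap T S = tmap T S ∘L tconn A B v := by
  rw [← eq_sub_iff_add_eq] at hT hS
  rw [hT, hS]
  refine clm_tensor_ext fun a b => ?_
  simp [tconn_apply]
  abel

/-- The tensor product of hermitean vector bundles with connection, with the connection
`∇ ⊗ 1 + 1 ⊗ ∇`. -/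
def tensor (E F : HVB X) : HVB X where
  fib x := Ten (E.fib x) (F.fib x)
  ι := E.ι × F.ι
  dom i := E.dom i.1 ∩ F.dom i.2
  model i := Ten (E.model i.1) (F.model i.2)
  frame i x := tmap (E.frame i.1 x) (F.frame i.2 x)
  coframe i x := tmap (E.coframe i.1 x) (F.coframe i.2 x)
  isOpen_dom p i := (E.isOpen_dom p i.1).inter (F.isOpen_dom p i.2)
  cover x := by
    obtain ⟨i, hi⟩ := E.cover x
    obtain ⟨j, hj⟩ := F.cover x
    exact ⟨(i, j), hi, hj⟩
  coframe_frame i x hx v := by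
    induction v using Ten.induction with
    | h0 => simp
    | ha a b ha hb => simp only [map_add, ha, hb]
    | ht a b => simp [E.coframe_frame _ _ hx.1, F.coframe_frame _ _ hx.2]
  frame_coframe i x hx v := by
    induction v using Ten.induction with
    | h0 => simp
    | ha a b ha hb => simp only [map_add, ha, hb]
    | ht a b => simp [E.frame_coframe _ _ hx.1, F.frame_coframe _ _ hx.2]
  norm_frame i x hx v := by
    exact (TensorProduct.mapIsometry ⟨(E.frame i.1 x).toLinearMap, E.norm_frame _ _ hx.1⟩
      ⟨(F.frame i.2 x).toLinearMap, F.norm_frame _ _ hx.2⟩).norm_map v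
  smooth_trans p i j := by
    simp only [tmap_comp]
    exact contDiffOn_tmap ((E.smooth_trans p i.1 j.1).mono fun x hx => ⟨hx.1.1, hx.2.1⟩)
      ((F.smooth_trans p i.2 j.2).mono fun x hx => ⟨hx.1.2, hx.2.2⟩)
  conn i _ p u := tconn (E.conn i.1 p u) (F.conn i.2 p u)
  smooth_conn i _ p := contDiffOn_tconn ((E.smooth_conn i.1 p).mono fun _ h => h.1)
    ((F.smooth_conn i.2 p).mono fun _ h => h.2)
  skew_conn i _ p u hu v a b := by
    induction a using Ten.induction with
    | h0 => simp
    | ha a a' ha ha' =>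
      simp only [map_add, inner_add_left]
      linear_combination ha + ha'
    | ht a a' =>
      induction b using Ten.induction with
      | h0 => simp
      | ha b b' hb hb' =>
        simp only [map_add, inner_add_right]
        linear_combination hb + hb'
      | ht b b' =>
        have h1 := E.skew_conn i.1 p u hu.1 v a b
        have h2 := F.skew_conn i.2 p u hu.2 v a' b'
        simp only [tconn_apply, add_apply, tmap_tmul, inner_add_left, inner_add_right, inner_tmul,
          ContinuousLinearMap.id_apply]
        linear_combination h1 * inner ℂ a' b' + h2 * inner ℂ a b
  conn_reparam i _ _ p h hh u hu v := by
    simp only [tconn_apply, E.conn_reparam i.1 p h hh u hu.1,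
      F.conn_reparam i.2 p h hh u hu.2]
  gauge p i j u hi hj v := by
    have h1 := E.gauge p i.1 j.1 u hi.1 hj.1 v
    have h2 := F.gauge p i.2 j.2 u hi.2 hj.2 v
    simp only [tmap_comp]
    have d1 := (isPar_id E).differentiableAt p hi.1 hj.1
    have d2 := (isPar_id F).differentiableAt p hi.2 hj.2
    refine (congrArg (· + _) (fderiv_tmap d1 d2 v)).trans ?_
    exact tensor_par h1 h2

theorem IsPar.tensor {ψ : ∀ x, E.fib x →L[ℂ] F.fib x} {χ : ∀ x, E'.fib x →L[ℂ] F'.fib x}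
    (hψ : IsPar E F ψ) (hχ : IsPar E' F' χ) :
    IsPar (E.tensor E') (F.tensor F') (fun x => tmap (ψ x) (χ x)) := by
  refine .of_at fun {n} p i j u hi hj => ?_
  have d1 := hψ.contDiffAt p hi.1 hj.1
  have d2 := hχ.contDiffAt p hi.2 hj.2
  have e : mat (E.tensor E') (F.tensor F') (fun x => tmap (ψ x) (χ x)) p i j =
      fun u => tmap (mat E F ψ p i.1 j.1 u) (mat E' F' χ p i.2 j.2 u) :=
    funext fun w => by
      change tmap _ _ ∘L tmap _ _ ∘L tmap _ _ = _
      rw [tmap_comp, tmap_comp]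
      rfl
  rw [e]
  refine ⟨contDiffAt_tmap d1 d2, fun v => ?_⟩
  have h := tensor_par (hψ.parallel p i.1 j.1 u hi.1 hj.1 v) (hχ.parallel p i.2 j.2 u hi.2 hj.2 v)
  rw [← fderiv_tmap (d1.differentiableAt (by simp)) (d2.differentiableAt (by simp)) v] at h
  exact h

end HVB

namespace HVB
variable {X : Type} [DiffeologicalSpace X] {E F : HVB X}

theorem dual_par {n : ℕ} {V W : Type}
    [NormedAddCommGroup V] [InnerProductSpace ℂ V] [FiniteDimensional ℂ V]
    [NormedAddCommGroup W] [InnerProductSpace ℂ W] [FiniteDimensional ℂ W] {v : Euc n}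
    {A : Euc n →L[ℝ] (V →L[ℂ] V)} {B : Euc n →L[ℝ] (W →L[ℂ] W)} {T DT : V →L[ℂ] W}
    (hT : DT + B v ∘L T = T ∘L A v) :
    CupGerbe.trp DT + (-(trpR ∘L A)) v ∘L CupGerbe.trp T
      = CupGerbe.trp T ∘L (-(trpR ∘L B)) v := by
  rw [← eq_sub_iff_add_eq] at hT
  rw [hT]
  ext ξ a
  simp [trpR_apply]
  ring

/-- The dual of a hermitean vector bundle with connection. -/
def dual (E : HVB X) : HVB X where
  fib x := Du (E.fib x)
  ι := E.ι
  dom := E.dom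
  model i := Du (E.model i)
  frame i x := trp (E.coframe i x)
  coframe i x := trp (E.frame i x)
  isOpen_dom := E.isOpen_dom
  cover := E.cover
  coframe_frame i x hx v := by ext a; simp [E.coframe_frame i x hx]
  frame_coframe i x hx v := by ext a; simp [E.frame_coframe i x hx]
  norm_frame i x hx v := norm_trp (E.frame_coframe i x hx) (E.coframe_frame i x hx)
    (E.norm_frame i x hx) v
  smooth_trans p i j := contDiffOn_trp ((E.smooth_trans p j i).mono fun _ h => ⟨h.2, h.1⟩)
  conn i _ p u := -(trpR ∘L E.conn i p u)
  smooth_conn i _ p := (contDiffOn_const.clm_comp (E.smooth_conn i p)).neg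
  skew_conn i _ p u hu v a b := skew_trp (E.skew_conn i p u hu v) a b
  conn_reparam i _ _ p h hh u hu v :=
    congrArg (fun T => -(trpR T)) (E.conn_reparam i p h hh u hu v)
  gauge p i j u hi hj v := by
    have h := dual_par (E.gauge p j i u hj hi v)
    have e := fderiv_trp ((isPar_id E).differentiableAt p hj hi) v
    change _ = trp (fderiv ℝ (mat E E (fun _ => .id ℂ _) p j i) u v) at e
    exact (congrArg (· + _) e).trans h

theorem IsPar.trp {ψ : ∀ x, E.fib x →L[ℂ] F.fib x} (h : IsPar E F ψ) :
    IsPar F.dual E.dual (fun x => CupGerbe.trp (ψ x)) := by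
  refine .of_at fun {n} p (j : F.ι) (i : E.ι) u (hj : p u ∈ F.dom j) (hi : p u ∈ E.dom i) => ?_
  have d := h.contDiffAt p hi hj
  have e : mat F.dual E.dual (fun x => CupGerbe.trp (ψ x)) p j i
      = fun u => CupGerbe.trp (mat E F ψ p i j u) := rfl
  rw [e]
  refine ⟨contDiffAt_trp d, fun v => ?_⟩
  have g := dual_par (h.parallel p i j u hi hj v)
  rw [← fderiv_trp (d.differentiableAt (by simp)) v] at g
  exact g

end HVB

section Forms

/-- Real differential `k`-forms on a diffeological space, given by their pullbacks along plots.
An imaginary form `i η` is recorded by the real form `η`. -/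
structure DForm (k : ℕ) (X : Type) [DiffeologicalSpace X] where
  val : ∀ {n : ℕ}, Plot X n → Euc n → Euc n [⋀^Fin k]→L[ℝ] ℝ
  smooth : ∀ {n : ℕ} (p : Plot X n) (v : Fin k → Euc n), ContDiff ℝ ∞ (fun u => val p u v)
  reparam : ∀ {n m : ℕ} (p : Plot X n) (h : Euc m → Euc n) (hh : ContDiff ℝ ∞ h) (u : Euc m),
    val (p.reparam h hh) u = (val p (h u)).compContinuousLinearMap (fderiv ℝ h u)

variable {X X' : Type} [DiffeologicalSpace X] [DiffeologicalSpace X'] {k : ℕ}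

/-- The pullback of a differential form. -/
def DForm.pb (η : DForm k X) (f : X' → X) (hf : DSmooth f) : DForm k X' where
  val p := η.val (p.map f hf)
  smooth p := η.smooth (p.map f hf)
  reparam p := η.reparam (p.map f hf)

/-- The product of a smooth function and a differential form. -/
def DForm.smul (f : X → ℝ) (hf : ∀ {n : ℕ} (p : Plot X n), ContDiff ℝ ∞ (fun u => f (p u)))
    (η : DForm k X) : DForm k X where
  val p u := f (p u) • η.val p u
  smooth p v := (hf p).mul (η.smooth p v)
  reparam p h hh u := by
    rw [η.reparam p h hh u]
    rfl

/-- `η` is the exterior derivative of `θ`. -/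
def IsExtDeriv (θ : DForm k X) (η : DForm (k + 1) X) : Prop :=
  ∀ {n : ℕ} (p : Plot X n) (u : Euc n), extDeriv (θ.val p) u = η.val p u

/-- The curvature of a bundle with connection is `i η`. -/
def HVB.HasCurv (E : HVB X) (η : DForm 2 X) : Prop :=
  ∀ {n : ℕ} (p : Plot X n) (i : E.ι) (u : Euc n), p u ∈ E.dom i → ∀ v w : Euc n,
    fderiv ℝ (E.conn i p) u v w - fderiv ℝ (E.conn i p) u w v
      + (E.conn i p u v ∘L E.conn i p u w - E.conn i p u w ∘L E.conn i p u v)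
      = (Complex.I * (η.val p u ![v, w] : ℝ)) • ContinuousLinearMap.id ℂ (E.model i)

end Forms

/-! ### Bundle gerbes -/

/-- Surjective submersions, by means of smooth local sections through every point. -/
structure IsSurjSubm {Z Y : Mfd} (f : Z → Y) : Prop where
  smooth : Mfd.Smooth f
  surj : Function.Surjective f
  sec : ∀ z, ∃ U ∈ 𝓝 (f z), ∃ s : Y → Z, ContMDiffOn Y.I Z.I ∞ s U ∧ s (f z) = z ∧
    ∀ y ∈ U, f (s y) = y

/-- Plots lift locally along surjective submersions. -/
theorem IsSurjSubm.lift {Z Y : Mfd} {f : Z → Y} (hf : IsSurjSubm f) {n : ℕ} (p : Plot Y n)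
    (u : Euc n) : ∃ (q : Plot Z n) (c : Euc n → Euc n), ContDiff ℝ ∞ c ∧
      (∀ w, f (q w) = p (c w)) ∧ ∀ᶠ w in 𝓝 u, c w = w := by
  obtain ⟨z, hz⟩ := hf.surj (p u)
  obtain ⟨U, hU, s, hs, -, hfs⟩ := hf.sec z
  rw [hz] at hU
  have hp : ContMDiff 𝓘(ℝ, Euc n) Y.I ∞ p.1 := p.2
  obtain ⟨c, hc, hcU, hcu⟩ := exists_retract u (hp.continuous.continuousAt hU)
  refine ⟨⟨s ∘ p.1 ∘ c, Mfd.isPlot_iff.2 ?_⟩, c, hc, fun w => hfs _ (hcU w), hcu⟩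
  exact hs.comp_contMDiff (hp.comp hc.contMDiff) hcU

/-- The triple fibre product, with points `((a, b), c)`. -/
abbrev Fib3 {A B C M : Type} (a : A → M) (b : B → M) (c : C → M) : Type :=
  FibProd (fun z : FibProd a b => b z.1.2) c

section
variable {A B C M : Type} [DiffeologicalSpace A] [DiffeologicalSpace B] [DiffeologicalSpace C]
  {a : A → M} {b : B → M} {c : C → M}

/-- The map into a fibre product given by two smooth maps. -/
theorem FibProd.dSmooth_mk {T : Type} [DiffeologicalSpace T] {f : T → A} {g : T → B}
    (hf : DSmooth f) (hg : DSmooth g) (h : ∀ t, a (f t) = b (g t)) :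
    DSmooth (fun t => (FibProd.mk (f t) (g t) (h t) : FibProd a b)) :=
  fun n p hp => FibProd.isPlot_iff.2 ⟨hf n p hp, hg n p hp⟩

theorem Fib3.dSmooth_0 : DSmooth (fun t : Fib3 a b c => t.1.1.1.1) :=
  fun n p hp => FibProd.dSmooth_fst n _ (FibProd.dSmooth_fst n p hp)
theorem Fib3.dSmooth_1 : DSmooth (fun t : Fib3 a b c => t.1.1.1.2) :=
  fun n p hp => FibProd.dSmooth_snd n _ (FibProd.dSmooth_fst n p hp)
theorem Fib3.dSmooth_2 : DSmooth (fun t : Fib3 a b c => t.1.2) := FibProd.dSmooth_snd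
end

theorem dSmooth_id {A : Type} [DiffeologicalSpace A] : DSmooth (fun x : A => x) := fun _ _ hp => hp

/-- A hermitean bundle gerbe on `M` with connection (without curving): a surjective submersion
`π : Y → M`, a hermitean line bundle `L` with connection on `Y ×_M Y` and a unitary, parallel,
associative multiplication `μ : L_(y₀,y₁) ⊗ L_(y₁,y₂) → L_(y₀,y₂)`; `unit` is its unit, i.e. the
canonical trivialisation of the restriction of `L` to the diagonal. -/
structure Gerbe (M : Mfd) where
  Y : Mfd
  π : Y → M
  subm : IsSurjSubm π
  L : HVB (FibProd π π)
  rank : ∀ x, Module.finrank ℂ (L.fib x) = 1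
  μ : ∀ (y₀ y₁ y₂ : Y) (h : π y₀ = π y₁) (h' : π y₁ = π y₂),
    Ten (L.fib (.mk y₀ y₁ h)) (L.fib (.mk y₁ y₂ h')) ≃ₗᵢ[ℂ] L.fib (.mk y₀ y₂ (h.trans h'))
  μ_par : HVB.IsPar (X := Fib3 π π π)
    ((L.pb _ (FibProd.dSmooth_mk Fib3.dSmooth_0 Fib3.dSmooth_1 fun t => t.1.1.2)).tensor
      (L.pb _ (FibProd.dSmooth_mk Fib3.dSmooth_1 Fib3.dSmooth_2 fun t => t.2)))
    (L.pb _ (FibProd.dSmooth_mk Fib3.dSmooth_0 Fib3.dSmooth_2 fun t => t.1.1.2.trans t.2))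
    (fun t => clm (μ t.1.1.1.1 t.1.1.1.2 t.1.2 t.1.1.2 t.2))
  assoc : ∀ (y₀ y₁ y₂ y₃ : Y) (h₁ : π y₀ = π y₁) (h₂ : π y₁ = π y₂) (h₃ : π y₂ = π y₃)
    (a : L.fib (.mk y₀ y₁ h₁)) (b : L.fib (.mk y₁ y₂ h₂)) (c : L.fib (.mk y₂ y₃ h₃)),
    μ y₀ y₂ y₃ _ h₃ (μ y₀ y₁ y₂ h₁ h₂ (a ⊠ b) ⊠ c) = μ y₀ y₁ y₃ h₁ _ (a ⊠ μ y₁ y₂ y₃ h₂ h₃ (b ⊠ c))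
  unit : ∀ y, L.fib (.mk y y rfl)
  unit_mul : ∀ (y₀ y₁ : Y) (h : π y₀ = π y₁) (a : L.fib (.mk y₀ y₁ h)), μ y₀ y₀ y₁ rfl h (unit y₀ ⊠ a) = a
  mul_unit : ∀ (y₀ y₁ : Y) (h : π y₀ = π y₁) (a : L.fib (.mk y₀ y₁ h)), μ y₀ y₁ y₁ h rfl (a ⊠ unit y₁) = a
  unit_par : HVB.IsParSection (L.pb _ (FibProd.dSmooth_mk dSmooth_id dSmooth_id fun _ => rfl)) unit

namespace Gerbe
variable {M : Mfd} (G : Gerbe M)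

/-- The 2-form `i B` on `Y` is a curving: the curvature of `L` at `(y₀, y₁)` is
`i (B_{y₁} - B_{y₀})`. -/
def IsCurving (B : DForm 2 G.Y) : Prop :=
  ∃ η : DForm 2 (FibProd G.π G.π), G.L.HasCurv η ∧ ∀ {n : ℕ} (p : Plot (FibProd G.π G.π) n) (u : Euc n),
    η.val p u = (B.pb _ FibProd.dSmooth_snd).val p u - (B.pb _ FibProd.dSmooth_fst).val p u

/-- The curvature of the gerbe with the curving `i B` is the 3-form `i H` on `M`. -/
def HasCurvature (B : DForm 2 G.Y) (H : DForm 3 M.carrier) : Prop :=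
  IsExtDeriv B (H.pb G.π G.subm.smooth.dSmooth)

end Gerbe

/-- The map of fibre products induced by smooth maps. -/
theorem FibProd.dSmooth_map {A A' B B' M : Type} [DiffeologicalSpace A] [DiffeologicalSpace A']
    [DiffeologicalSpace B] [DiffeologicalSpace B'] {a : A' → M} {b : B' → M} {f : A → A'} {g : B → B'}
    (hf : DSmooth f) (hg : DSmooth g) :
    DSmooth (fun t : FibProd (fun x => a (f x)) (fun x => b (g x)) =>
      (FibProd.mk (f t.1.1) (g t.1.2) t.2 : FibProd a b)) :=
  fun n p hp => FibProd.isPlot_iff.2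
    ⟨hf n _ (FibProd.isPlot_iff.1 hp).1, hg n _ (FibProd.isPlot_iff.1 hp).2⟩

namespace HVB
variable {X X' : Type} [DiffeologicalSpace X] [DiffeologicalSpace X'] {E F L : HVB X}

/-- The map `a ↦ a ⊗ w`. -/
def tmulRight (V : Type) {W : Type} [NormedAddCommGroup V] [InnerProductSpace ℂ V]
    [FiniteDimensional ℂ V] [NormedAddCommGroup W] [InnerProductSpace ℂ W] [FiniteDimensional ℂ W]
    (w : W) : V →L[ℂ] Ten V W :=
  LinearMap.toContinuousLinearMap
    { toFun := fun v => v ⊠ w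
      map_add' := fun v v' => add_tmul v v' w
      map_smul' := fun c v => smul_tmul c v w }

@[simp] theorem tmulRight_apply {V W : Type} [NormedAddCommGroup V] [InnerProductSpace ℂ V]
    [FiniteDimensional ℂ V] [NormedAddCommGroup W] [InnerProductSpace ℂ W] [FiniteDimensional ℂ W]
    (w : W) (v : V) : tmulRight V w v = v ⊠ w := rfl

theorem isPar_rid (E : HVB X) :
    IsPar E (E.tensor (triv X)) (fun x => tmulRight (E.fib x) (1 : ℂ)) := by
  refine .of_at fun {n} p (i : E.ι) (j : E.ι × Unit) u hi hj => ?_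
  have d := (isPar_id E).contDiffAt p hi hj.1
  have e : mat E (E.tensor (triv X)) (fun x => tmulRight (E.fib x) (1 : ℂ)) p i j
      = fun u => tmulRight (E.model j.1) (1 : ℂ) ∘L mat E E (fun _ => .id ℂ _) p i j.1 u := by
    funext w
    refine ContinuousLinearMap.ext (M₁ := E.model i) (M₂ := Ten (E.model j.1) ℂ) fun a => ?_
    exact tmap_tmul (E.coframe j.1 (p w)) (.id ℂ ℂ) (E.frame i (p w) a) 1
  have hc : ContDiffAt ℝ ∞ (fun _ : Euc n => tmulRight (E.model j.1) (1 : ℂ)) u := contDiffAt_const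
  rw [e]
  refine ⟨contDiffAt_bilin compR hc d, fun v => ?_⟩
  have g := (isPar_id E).parallel p i j.1 u hi hj.1 v
  have D := fderiv_clm_comp (hc.differentiableAt (by simp)) (d.differentiableAt (by simp)) v
  rw [← eq_sub_iff_add_eq] at g
  rw [fderiv_fun_const, g] at D
  have D' : fderiv ℝ (fun u => tmulRight (E.model j.1) (1 : ℂ)
      ∘L mat E E (fun _ => .id ℂ _) p i j.1 u) u v
      + tconn (E.conn j.1 p u) 0 v ∘L tmulRight (E.model j.1) (1 : ℂ)
        ∘L mat E E (fun _ => .id ℂ _) p i j.1 u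
      = (tmulRight (E.model j.1) (1 : ℂ) ∘L mat E E (fun _ => .id ℂ _) p i j.1 u)
        ∘L E.conn i p u v := by
    rw [D]
    ext a
    simp [tconn_apply, tmulRight]
  exact D'

theorem IsParSection.tmulRight {s : ∀ x, L.fib x} (hs : IsParSection L s) (E : HVB X) :
    IsPar E (E.tensor L) (fun x => HVB.tmulRight (E.fib x) (s x)) := by
  have h := ((isPar_id E).tensor hs).comp (isPar_rid E)
  have e : (fun x => HVB.tmulRight (E.fib x) (s x)) = fun x =>
      tmap (ContinuousLinearMap.id ℂ (E.fib x)) (ContinuousLinearMap.toSpanSingleton ℂ (s x))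
        ∘L HVB.tmulRight (E.fib x) (1 : ℂ) := by
    funext x
    ext a
    exact ((tmap_tmul _ _ a (1 : ℂ)).trans (by simp)).symm
  rw [e]
  exact h

theorem contract_eq {V W : Type} [NormedAddCommGroup V] [InnerProductSpace ℂ V]
    [FiniteDimensional ℂ V] [NormedAddCommGroup W] [InnerProductSpace ℂ W] [FiniteDimensional ℂ W]
    (hW : Module.finrank ℂ W = 1) {l : W} (hl : ‖l‖ = 1) (x : Ten V W) : contract V l x ⊠ l = x := by
  have hl0 : l ≠ 0 := by rintro rfl; simp at hl
  induction x using Ten.induction with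
  | h0 => rw [map_zero, zero_tmul]
  | ha x y hx hy => rw [map_add, add_tmul, hx, hy]
  | ht v w =>
    obtain ⟨c, rfl⟩ := (finrank_eq_one_iff_of_nonzero' l hl0).1 hW w
    rw [contract_tmul, inner_smul_right, inner_self_eq_norm_sq_to_K, hl, smul_tmul, tmul_smul]
    simp

theorem IsParSection.contract {s : ∀ x, L.fib x} (hs : IsParSection L s) (E : HVB X)
    (hL : ∀ x, Module.finrank ℂ (L.fib x) = 1) (h1 : ∀ x, ‖s x‖ = 1) :
    IsPar (E.tensor L) E (fun x => CupGerbe.contract (E.fib x) (s x)) :=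
  (hs.tmulRight E).inv (fun x e => (contract_tmul _ _ _).trans (by
      rw [inner_self_eq_norm_sq_to_K, h1]; simp)) (fun x e => contract_eq (hL x) (h1 x) e)

end HVB

namespace Gerbe
variable {M : Mfd} (G : Gerbe M)

/-- A section of a bundle gerbe, i.e. a 1-morphism from the trivial gerbe: a surjective submersion
`ζ : Z → Y`, a hermitean vector bundle `E` with connection on `Z` and a unitary parallel isomorphism
`α_(z₀,z₁) : E_{z₁} → E_{z₀} ⊗ L_(ζ z₀, ζ z₁)` over `Z ×_M Z` compatible with `μ`. -/
structure Sec where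
  Z : Mfd
  ζ : Z → G.Y
  subm : IsSurjSubm ζ
  E : HVB Z.carrier
  α : ∀ (z₀ z₁ : Z) (h : G.π (ζ z₀) = G.π (ζ z₁)),
    E.fib z₁ ≃ₗᵢ[ℂ] Ten (E.fib z₀) (G.L.fib (.mk (ζ z₀) (ζ z₁) h))
  α_par : HVB.IsPar (X := FibProd (fun z => G.π (ζ z)) (fun z => G.π (ζ z)))
    (E.pb _ FibProd.dSmooth_snd)
    ((E.pb _ FibProd.dSmooth_fst).tensor (G.L.pb _
      (FibProd.dSmooth_map (a := G.π) (b := G.π) subm.smooth.dSmooth subm.smooth.dSmooth)))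
    (fun t => clm (α t.1.1 t.1.2 t.2))
  cocycle : ∀ (z₀ z₁ z₂ : Z) (h : G.π (ζ z₀) = G.π (ζ z₁)) (h' : G.π (ζ z₁) = G.π (ζ z₂))
    (e : E.fib z₂),
    tmap (.id ℂ _) (clm (G.μ _ _ _ h h')) (tassoc _ _ _
      (tmap (clm (α z₀ z₁ h)) (.id ℂ _) (α z₁ z₂ h' e))) = α z₀ z₂ (h.trans h') e

theorem pt_eq {y₀ y₁ y₀' y₁' : G.Y} (h : G.π y₀ = G.π y₁) (h' : G.π y₀' = G.π y₁') (h₀ : y₀ = y₀')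
    (h₁ : y₁ = y₁') : (FibProd.mk y₀ y₁ h : FibProd G.π G.π) = .mk y₀' y₁' h' :=
  Subtype.ext (Prod.ext h₀ h₁)

variable {G}

/-- A morphism of sections, i.e. a 2-morphism of the corresponding 1-morphisms (represented over the
smallest possible common refinement `Z ×_Y Z'`): a smooth parallel morphism
`ψ_(z,z') : E_z → E'_{z'}` over `Z ×_Y Z'` compatible with `α` and `α'`. -/
@[ext] structure Sec.Hom (S T : G.Sec) where
  toFun : ∀ (z : S.Z) (z' : T.Z), S.ζ z = T.ζ z' → (S.E.fib z →L[ℂ] T.E.fib z')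
  isPar : HVB.IsPar (X := FibProd S.ζ T.ζ) (S.E.pb _ FibProd.dSmooth_fst)
    (T.E.pb _ FibProd.dSmooth_snd) (fun x => toFun x.1.1 x.1.2 x.2)
  compat : ∀ (z₀ z₁ : S.Z) (z₀' z₁' : T.Z) (h₀ : S.ζ z₀ = T.ζ z₀') (h₁ : S.ζ z₁ = T.ζ z₁')
    (h : G.π (S.ζ z₀) = G.π (S.ζ z₁)) (h' : G.π (T.ζ z₀') = G.π (T.ζ z₁')) (e : S.E.fib z₁),
    tmap (toFun z₀ z₀' h₀) (clm (G.L.tr (G.pt_eq h h' h₀ h₁))) (S.α z₀ z₁ h e)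
      = T.α z₀' z₁' h' (toFun z₁ z₁' h₁ e)

theorem tassoc_contract {V V' K₀ K₁ K₂ : Type}
    [NormedAddCommGroup V] [InnerProductSpace ℂ V] [FiniteDimensional ℂ V]
    [NormedAddCommGroup V'] [InnerProductSpace ℂ V'] [FiniteDimensional ℂ V']
    [NormedAddCommGroup K₀] [InnerProductSpace ℂ K₀] [FiniteDimensional ℂ K₀]
    [NormedAddCommGroup K₁] [InnerProductSpace ℂ K₁] [FiniteDimensional ℂ K₁]
    [NormedAddCommGroup K₂] [InnerProductSpace ℂ K₂] [FiniteDimensional ℂ K₂]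
    (hr : Module.finrank ℂ K₀ = 1) {l : K₀} (hl : ‖l‖ = 1) (A : V →L[ℂ] Ten V' K₀)
    (m : Ten K₀ K₁ →L[ℂ] K₂) (t : K₁ →L[ℂ] K₂) (hm : ∀ b, m (l ⊠ b) = t b) :
    tmap (.id ℂ V') m ∘L tassoc V' K₀ K₁ ∘L tmap A (.id ℂ K₁) = tmap (contract V' l ∘L A) t :=
  clm_tensor_ext fun a b => by
    simp only [tmap_tmul, ContinuousLinearMap.comp_apply, ContinuousLinearMap.id_apply]
    conv_lhs => rw [← HVB.contract_eq hr hl (A a)]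
    rw [tassoc_tmul, tmap_tmul, hm, ContinuousLinearMap.id_apply]

theorem norm_unit (y : G.Y) : ‖G.unit y‖ = 1 := by
  have h0 : G.unit y ≠ 0 := fun h => by
    have hr := G.rank (.mk y y rfl)
    have : Nontrivial (G.L.fib (.mk y y rfl)) := Module.nontrivial_of_finrank_pos (R := ℂ) (by omega)
    obtain ⟨a, ha⟩ := exists_ne (0 : G.L.fib (.mk y y rfl))
    have := G.unit_mul y y rfl a
    rw [h] at this
    apply ha
    rw [← this]
    rw [zero_tmul, map_zero]
  have h := (G.μ y y y rfl rfl).norm_map (G.unit y ⊠ G.unit y)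
  rw [G.unit_mul] at h
  have h2 : ‖G.unit y ⊠ G.unit y‖ = ‖G.unit y‖ * ‖G.unit y‖ := TensorProduct.norm_tmul _ _
  rw [h2] at h
  have := norm_pos_iff.2 h0
  nlinarith

theorem tmul_right_inj {V : Type} [NormedAddCommGroup V] [InnerProductSpace ℂ V]
    [FiniteDimensional ℂ V] {W : Type} [NormedAddCommGroup W] [InnerProductSpace ℂ W]
    [FiniteDimensional ℂ W] {l : W} (hl : ‖l‖ = 1) {a b : V} (h : a ⊠ l = b ⊠ l) : a = b := by
  have := congrArg (contract V l) h
  simpa [inner_self_eq_norm_sq_to_K, hl] using this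

/-- The canonical element of `L_(y,y')` for `y = y'`. -/
def unit' (G : Gerbe M) (y y' : G.Y) (h : y = y') : G.L.fib (.mk y y' (congrArg G.π h)) :=
  G.L.tr (G.pt_eq rfl (congrArg G.π h) rfl h) (G.unit y)

theorem norm_unit' (y y' : G.Y) (h : y = y') : ‖G.unit' y y' h‖ = 1 := by
  rw [unit', LinearIsometryEquiv.norm_map, norm_unit]

theorem unit'_mul (y₀ y₀' y₁ : G.Y) (e : y₀ = y₀') (h : G.π y₀' = G.π y₁) (a : G.L.fib (.mk y₀' y₁ h)) :
    G.μ y₀ y₀' y₁ (congrArg G.π e) h (G.unit' y₀ y₀' e ⊠ a)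
      = G.L.tr (G.pt_eq h ((congrArg G.π e).trans h) e.symm rfl) a := by
  subst e
  exact G.unit_mul _ _ _ _

theorem mul_unit' (y₀ y₁ y₁' : G.Y) (e : y₁ = y₁') (h : G.π y₀ = G.π y₁) (a : G.L.fib (.mk y₀ y₁ h)) :
    G.μ y₀ y₁ y₁' h (congrArg G.π e) (a ⊠ G.unit' y₁ y₁' e)
      = G.L.tr (G.pt_eq h (h.trans (congrArg G.π e)) rfl e) a := by
  subst e
  exact G.mul_unit _ _ _ _

theorem tr_unit' (y₀ y₁ y₀' y₁' : G.Y) (e : y₀ = y₁) (e' : y₀' = y₁') (e₀ : y₀ = y₀')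
    (e₁ : y₁ = y₁') : G.L.tr (G.pt_eq (congrArg G.π e) (congrArg G.π e') e₀ e₁) (G.unit' y₀ y₁ e)
      = G.unit' y₀' y₁' e' := by
  subst e e₀ e'
  rfl

namespace Sec
variable {S T U R : G.Sec}

theorem id_aux (S : G.Sec) (z z' : S.Z) (h : S.ζ z = S.ζ z') (e : S.E.fib z) :
    contract _ (G.unit' (S.ζ z') (S.ζ z) h.symm) (S.α z' z (congrArg G.π h.symm) e)
      ⊠ G.unit' (S.ζ z') (S.ζ z) h.symm = S.α z' z (congrArg G.π h.symm) e :=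
  HVB.contract_eq (G.rank _) (norm_unit' _ _ _) _

theorem α_self (S : G.Sec) (z : S.Z) (e : S.E.fib z) : S.α z z rfl e = e ⊠ G.unit (S.ζ z) := by
  have k : ∀ e, ∃ e', S.α z z rfl e = e' ⊠ G.unit (S.ζ z) := fun e => ⟨_, (S.id_aux z z rfl e).symm⟩
  obtain ⟨e', he'⟩ := k e
  obtain ⟨e'', he''⟩ := k e'
  have h := S.cocycle z z z rfl rfl e
  rw [he'] at h
  simp only [tmap_tmul, LinearIsometryEquiv.coe_toContinuousLinearEquiv,
    ContinuousLinearEquiv.coe_coe, he'', tassoc_tmul, ContinuousLinearMap.id_apply, G.unit_mul] at h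
  have : e'' = e' := tmul_right_inj (norm_unit _) h
  rw [this, ← he'] at he''
  rw [he', (S.α z z rfl).injective he'']

/-- Two composites through points of the middle submersion agree. -/
theorem comp_indep (ψ : Hom S T) (χ : Hom T U) (z : S.Z) (w w' : T.Z) (z' : U.Z) (h : S.ζ z = T.ζ w)
    (h' : S.ζ z = T.ζ w') (k : T.ζ w = U.ζ z') (k' : T.ζ w' = U.ζ z') (e : S.E.fib z) :
    χ.toFun w z' k (ψ.toFun z w h e) = χ.toFun w' z' k' (ψ.toFun z w' h' e) := by
  have hw : T.ζ w = T.ζ w' := h.symm.trans h'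
  have h1 := ψ.compat z z w w' h h' rfl (congrArg G.π hw) e
  have h2 := χ.compat w w' z' z' k k' (congrArg G.π hw) rfl (ψ.toFun z w' h' e)
  rw [α_self] at h1 h2
  rw [← h1] at h2
  simp only [tmap_tmul, LinearIsometryEquiv.coe_toContinuousLinearEquiv,
    ContinuousLinearEquiv.coe_coe] at h2
  have e1 := tr_unit' (G := G) (S.ζ z) (S.ζ z) (T.ζ w) (T.ζ w') rfl hw h h'
  have e2 := tr_unit' (G := G) (T.ζ w) (T.ζ w') (U.ζ z') (U.ζ z') hw rfl k k'
  have e0 : ∀ y, G.unit' y y rfl = G.unit y := fun y => rfl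
  rw [e0] at e1 e2
  rw [e1, e2] at h2
  exact tmul_right_inj (norm_unit _) h2

theorem unit'_par {X : Type} [DiffeologicalSpace X] {f g : X → G.Y} (hf : DSmooth f)
    (hg : DSmooth g) (h : ∀ x, f x = g x) :
    HVB.IsParSection (G.L.pb _ (FibProd.dSmooth_mk hf hg fun x => congrArg G.π (h x)))
      (fun x => G.unit' (f x) (g x) (h x)) := by
  have h1 := HVB.IsPar.pb G.unit_par f hf
  have h2 := HVB.tr_par G.L (fun x => FibProd.mk (f x) (f x) rfl)
    (fun x => FibProd.mk (f x) (g x) (congrArg G.π (h x)))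
    (FibProd.dSmooth_mk hf hf fun x => rfl) (FibProd.dSmooth_mk hf hg fun x => congrArg G.π (h x))
    (fun x => G.pt_eq rfl _ rfl (h x))
  have h3 := h2.comp h1
  exact h3.congr fun x c => (G.L.tr _).map_smul (show ℂ from c) (G.unit (f x))

set_option maxHeartbeats 1000000 in
/-- The identity morphism. -/
def Hom.id (S : G.Sec) : Hom S S where
  toFun z z' h := contract _ (G.unit' (S.ζ z') (S.ζ z) h.symm) ∘L clm (S.α z' z (congrArg G.π h.symm))
  isPar := by
    have hf : DSmooth (fun x : FibProd S.ζ S.ζ => S.ζ x.1.1) := fun n p hp =>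
      S.subm.smooth.dSmooth n _ (FibProd.dSmooth_fst n p hp)
    have hg : DSmooth (fun x : FibProd S.ζ S.ζ => S.ζ x.1.2) := fun n p hp =>
      S.subm.smooth.dSmooth n _ (FibProd.dSmooth_snd n p hp)
    have h1 := HVB.IsParSection.contract (unit'_par hg hf fun x => x.2.symm)
      (S.E.pb _ FibProd.dSmooth_snd) (fun x => G.rank _) (fun x => norm_unit' _ _ _)
    have h2 := HVB.IsPar.pb S.α_par (fun x : FibProd S.ζ S.ζ =>
        (FibProd.mk x.1.2 x.1.1 (congrArg G.π x.2.symm) :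
          FibProd (fun z => G.π (S.ζ z)) (fun z => G.π (S.ζ z))))
      (FibProd.dSmooth_mk FibProd.dSmooth_snd FibProd.dSmooth_fst _)
    exact h1.comp h2
  compat z₀ z₁ z₀' z₁' h₀ h₁ h h' e := by
    have a0 := fun f => S.id_aux z₀ z₀' h₀ f
    have a1 := S.id_aux z₁ z₁' h₁ e
    have c0 := S.cocycle z₀' z₀ z₁ (congrArg G.π h₀.symm) h e
    have c1 := S.cocycle z₀' z₁' z₁ h' (congrArg G.π h₁.symm) e
    rw [← a1] at c1
    simp only [tmap_tmul, LinearIsometryEquiv.coe_toContinuousLinearEquiv,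
      ContinuousLinearEquiv.coe_coe, ContinuousLinearMap.id_apply] at c1
    set e' := contract _ (G.unit' (S.ζ z₁') (S.ζ z₁) h₁.symm)
      (S.α z₁' z₁ (congrArg G.π h₁.symm) e) with he'
    have k1 : tmap (.id ℂ (S.E.fib z₀')) (clm (G.μ _ _ _ h' (congrArg G.π h₁.symm)))
        ∘L tassoc _ _ _ ∘L HVB.tmulRight _ (G.unit' (S.ζ z₁') (S.ζ z₁) h₁.symm)
        = tmap (.id ℂ _) (clm (G.L.tr (G.pt_eq h' (h'.trans (congrArg G.π h₁.symm)) rfl h₁.symm))) :=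
      clm_tensor_ext fun a b => by simp [mul_unit']
    have k0 : tmap (.id ℂ (S.E.fib z₀')) (clm (G.μ _ _ _ (congrArg G.π h₀.symm) h))
        ∘L tassoc _ _ _ ∘L tmap (clm (S.α z₀' z₀ (congrArg G.π h₀.symm))) (.id ℂ _)
        = tmap (contract _ (G.unit' (S.ζ z₀') (S.ζ z₀) h₀.symm)
            ∘L clm (S.α z₀' z₀ (congrArg G.π h₀.symm)))
          (clm (G.L.tr (G.pt_eq h ((congrArg G.π h₀.symm).trans h) h₀ rfl))) :=
      tassoc_contract (G.rank _) (norm_unit' _ _ _) _ _ _ (fun b => unit'_mul _ _ _ _ _ b)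
    replace k1 := fun x => congrArg (fun f => f x) k1
    replace k0 := fun x => congrArg (fun f => f x) k0
    simp only [ContinuousLinearMap.comp_apply, HVB.tmulRight_apply] at k1 k0
    rw [k1] at c1
    rw [k0, ← c1] at c0
    have tt := congrArg (tmap (.id ℂ _) (clm (G.L.tr (G.pt_eq (h'.trans (congrArg G.π h₁.symm)) h' rfl h₁)))) c0
    have m1 : ∀ {y y' y'' : FibProd G.π G.π} (q : y = y') (q' : y' = y''),
        clm (G.L.tr q') ∘L clm (G.L.tr q) = clm (G.L.tr (q.trans q')) := fun q q' => by
      subst q q'; rfl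
    rw [← ContinuousLinearMap.comp_apply, ← ContinuousLinearMap.comp_apply, tmap_comp, tmap_comp, m1,
      m1] at tt
    have m2 : clm (G.L.tr (rfl : (FibProd.mk (S.ζ z₀') (S.ζ z₁') h' : FibProd G.π G.π) = _))
      = .id ℂ _ := rfl
    simp only [ContinuousLinearMap.id_comp, m2, tmap_id] at tt
    exact tt

/-- Composition of morphisms, through an arbitrary point of the middle submersion. -/
def Hom.comp (ψ : Hom S T) (χ : Hom T U) : Hom S U where
  toFun z z' h := χ.toFun (T.subm.surj (S.ζ z)).choose z' ((T.subm.surj (S.ζ z)).choose_spec.trans h)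
    ∘L ψ.toFun z _ (T.subm.surj (S.ζ z)).choose_spec.symm
  isPar := by
    have hf : DSmooth (fun t : Fib3 S.ζ T.ζ U.ζ =>
        (FibProd.mk t.1.1.1.1 t.1.2 (t.1.1.2.trans t.2) : FibProd S.ζ U.ζ)) :=
      FibProd.dSmooth_mk Fib3.dSmooth_0 Fib3.dSmooth_2 _
    refine HVB.IsPar.of_lift _ hf (fun {n} p u => ?_) ?_
    · obtain ⟨q, c, hc, hq, hcu⟩ := T.subm.lift ((p.map _ FibProd.dSmooth_fst).map _ S.subm.smooth.dSmooth) u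
      have hq' : ∀ w, T.ζ (q w) = S.ζ (p (c w)).1.1 := hq
      have h1 := FibProd.isPlot_iff.1 (p.reparam c hc).2
      refine ⟨⟨fun w => FibProd.mk (FibProd.mk (p (c w)).1.1 (q w) (hq' w).symm) (p (c w)).1.2
        ((hq' w).trans (p (c w)).2), FibProd.isPlot_iff.2 ⟨FibProd.isPlot_iff.2 ⟨h1.1, q.2⟩, h1.2⟩⟩, ?_⟩
      filter_upwards [hcu] with w hw
      exact congrArg p.1 hw
    · have h1 := HVB.IsPar.pb ψ.isPar (fun t : Fib3 S.ζ T.ζ U.ζ => t.1.1) FibProd.dSmooth_fst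
      have h2 := HVB.IsPar.pb χ.isPar (fun t : Fib3 S.ζ T.ζ U.ζ =>
          (FibProd.mk t.1.1.1.2 t.1.2 t.2 : FibProd T.ζ U.ζ))
        (FibProd.dSmooth_mk Fib3.dSmooth_1 Fib3.dSmooth_2 _)
      have h3 := h2.comp h1
      have e : ∀ t : Fib3 S.ζ T.ζ U.ζ, χ.toFun (T.subm.surj (S.ζ t.1.1.1.1)).choose t.1.2
            ((T.subm.surj (S.ζ t.1.1.1.1)).choose_spec.trans (t.1.1.2.trans t.2))
          ∘L ψ.toFun t.1.1.1.1 _ (T.subm.surj (S.ζ t.1.1.1.1)).choose_spec.symm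
          = χ.toFun t.1.1.1.2 t.1.2 t.2 ∘L ψ.toFun t.1.1.1.1 t.1.1.1.2 t.1.1.2 := fun t =>
        ContinuousLinearMap.ext fun a => comp_indep ψ χ _ _ _ _ _ _ _ _ a
      simp only [e]
      exact h3
  compat z₀ z₁ z₀' z₁' h₀ h₁ h h' e := by
    obtain ⟨w₀, k₀⟩ : ∃ w, w = (T.subm.surj (S.ζ z₀)).choose := ⟨_, rfl⟩
    obtain ⟨w₁, k₁⟩ : ∃ w, w = (T.subm.surj (S.ζ z₁)).choose := ⟨_, rfl⟩
    have s₀ : S.ζ z₀ = T.ζ w₀ := k₀ ▸ (T.subm.surj (S.ζ z₀)).choose_spec.symm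
    have s₁ : S.ζ z₁ = T.ζ w₁ := k₁ ▸ (T.subm.surj (S.ζ z₁)).choose_spec.symm
    have hw : G.π (T.ζ w₀) = G.π (T.ζ w₁) := by rw [← s₀, ← s₁]; exact h
    have c1 := ψ.compat z₀ z₁ w₀ w₁ s₀ s₁ h hw e
    have c2 := χ.compat w₀ w₁ z₀' z₁' (s₀.symm.trans h₀) (s₁.symm.trans h₁) hw h' (ψ.toFun z₁ w₁ s₁ e)
    rw [← c1, ← ContinuousLinearMap.comp_apply, tmap_comp] at c2
    have m1 : ∀ {y y' y'' : FibProd G.π G.π} (q : y = y') (q' : y' = y''),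
        clm (G.L.tr q') ∘L clm (G.L.tr q) = clm (G.L.tr (q.trans q')) := fun q q' => by
      subst q q'; rfl
    rw [m1] at c2
    subst k₀ k₁
    exact c2

theorem Hom.comp_apply (ψ : Hom S T) (χ : Hom T U) (z : S.Z) (w : T.Z) (z' : U.Z) (h : S.ζ z = U.ζ z')
    (h₁ : S.ζ z = T.ζ w) (h₂ : T.ζ w = U.ζ z') (e : S.E.fib z) :
    (ψ.comp χ).toFun z z' h e = χ.toFun w z' h₂ (ψ.toFun z w h₁ e) :=
  comp_indep ψ χ _ _ _ _ _ _ _ _ e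

/-- The category of sections of a bundle gerbe. -/
instance : Category G.Sec where
  Hom := Hom
  id := Hom.id
  comp := Hom.comp
  id_comp {S T} ψ := by
    refine Hom.ext (funext fun z => funext fun z' => funext fun h => ContinuousLinearMap.ext fun e => ?_)
    rw [Hom.comp_apply _ _ z z z' h rfl h]
    congr 1
    apply tmul_right_inj (norm_unit (S.ζ z))
    exact (S.id_aux z z rfl e).trans (S.α_self z e)
  comp_id {S T} ψ := by
    refine Hom.ext (funext fun z => funext fun z' => funext fun h => ContinuousLinearMap.ext fun e => ?_)
    rw [Hom.comp_apply _ _ z z' z' h h rfl]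
    apply tmul_right_inj (norm_unit (T.ζ z'))
    exact (T.id_aux z' z' rfl _).trans (T.α_self z' _)
  assoc {S T U R} ψ χ φ := by
    refine Hom.ext (funext fun z => funext fun z' => funext fun h => ContinuousLinearMap.ext fun e => ?_)
    obtain ⟨w, hw⟩ := T.subm.surj (S.ζ z)
    obtain ⟨w', hw'⟩ := U.subm.surj (S.ζ z)
    rw [Hom.comp_apply _ _ z w' z' h hw'.symm (hw'.trans h),
      Hom.comp_apply _ _ z w w' hw'.symm hw.symm (hw.trans hw'.symm),
      Hom.comp_apply _ _ z w z' h hw.symm (hw.trans h),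
      Hom.comp_apply _ _ w w' z' (hw.trans h) (hw.trans hw'.symm) (hw'.trans h)]

end Sec
end Gerbe

/-! ### The manifolds -/

section Quotient
open MulAction
variable {V H X G : Type} [NormedAddCommGroup V] [NormedSpace ℝ V] [TopologicalSpace H]
  {I : ModelWithCorners ℝ V H} [TopologicalSpace X] [ChartedSpace H X] [IsManifold I ∞ X]
  [Group G] [MulAction G X] [ProperlyDiscontinuousSMul G X] [ContinuousConstSMul G X]
  [IsCancelSMul G X] [T2Space X] [LocallyCompactSpace X]

theorem quot_locHomeo : IsLocalHomeomorph (Quotient.mk _ : X → orbitRel.Quotient G X) :=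
  isQuotientCoveringMap_quotientMk_of_properlyDiscontinuousSMul.isCoveringMap.isLocalHomeomorph

theorem quot_local (x y : X) (h : (Quotient.mk _ y : orbitRel.Quotient G X) ∈ (quot_locHomeo.localInverseAt x).source) :
    ∃ g : G, ∀ᶠ z in 𝓝 y, quot_locHomeo.localInverseAt x (Quotient.mk _ z : orbitRel.Quotient G X) = g • z := by
  have h1 := quot_locHomeo.apply_localInverseAt_of_mem h
  obtain ⟨g, hg⟩ := Quotient.exact h1
  refine ⟨g, ?_⟩
  have ht : g • y ∈ (quot_locHomeo.localInverseAt x : OpenPartialHomeomorph (orbitRel.Quotient G X) X).target := by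
    have := (quot_locHomeo.localInverseAt x).map_source h
    rw [← hg] at this
    exact this
  have hc : Filter.Tendsto (fun z : X => g • z) (𝓝 y) (𝓝 (g • y)) := (continuous_const_smul g).continuousAt
  filter_upwards [hc ((quot_locHomeo.localInverseAt x).open_target.mem_nhds ht)] with z hz
  have h2 : quot_locHomeo.localInverseAt x (Quotient.mk _ (g • z) : orbitRel.Quotient G X) = g • z := by
    have := (quot_locHomeo.localInverseAt x).right_inv hz
    rwa [quot_locHomeo.localInverseAt_symm] at this
  rw [← h2]
  congr 1
  exact Quotient.sound ⟨g⁻¹, by simp⟩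

theorem quot_local_smooth (hs : ∀ g : G, ContMDiff I I ∞ (fun x : X => g • x)) (x y : X)
    (h : (Quotient.mk _ y : orbitRel.Quotient G X) ∈ (quot_locHomeo.localInverseAt x).source) :
    ContMDiffAt I I ∞ (fun z => quot_locHomeo.localInverseAt x
      (Quotient.mk _ z : orbitRel.Quotient G X)) y := by
  obtain ⟨g, hg⟩ := quot_local x y h
  exact (hs g y).congr_of_eventuallyEq hg

theorem quot_atlas {e : OpenPartialHomeomorph (orbitRel.Quotient G X) H}
    (he : e ∈ atlas H (orbitRel.Quotient G X)) :
    ∃ x : X, e = (quot_locHomeo.localInverseAt x).trans (chartAt H x) := by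
  obtain ⟨q, rfl⟩ := he
  exact ⟨_, rfl⟩

theorem quot_isManifold [I.Boundaryless] (hs : ∀ g : G, ContMDiff I I ∞ (fun x : X => g • x)) :
    IsManifold I ∞ (orbitRel.Quotient G X) := by
  apply isManifold_of_contDiffOn
  intro e e' he he'
  obtain ⟨x, rfl⟩ := quot_atlas he
  obtain ⟨x', rfl⟩ := quot_atlas he'
  rintro u ⟨hu, -⟩
  simp only [mfld_simps, IsLocalHomeomorph.localInverseAt_symm] at hu
  obtain ⟨⟨h1, h2⟩, h3, h4⟩ := hu
  have a1 : ContMDiffAt 𝓘(ℝ, V) I ∞ (extChartAt I x).symm u :=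
    (contMDiffOn_extChartAt_symm x).contMDiffAt ((isOpen_extChartAt_target x).mem_nhds (by
      simpa only [mfld_simps, I.range_eq_univ] using h1))
  have a2 := quot_local_smooth (I := I) hs x' _ h3
  have a3 : ContMDiffAt I 𝓘(ℝ, V) ∞ (extChartAt I x') _ := contMDiffAt_extChartAt' h4
  have a4 := ContMDiffAt.comp (f := fun z => quot_locHomeo.localInverseAt x'
      (Quotient.mk _ z : orbitRel.Quotient G X)) (g := extChartAt I x') _ a3 a2
  refine (a4.comp u a1).contDiffAt.contDiffWithinAt.congr_of_eventuallyEq (.of_forall fun w => ?_) ?_ <;>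
    simp only [mfld_simps, IsLocalHomeomorph.localInverseAt_symm]

theorem quot_mk_smooth [I.Boundaryless] (hs : ∀ g : G, ContMDiff I I ∞ (fun x : X => g • x)) :
    ContMDiff I I ∞ (Quotient.mk _ : X → orbitRel.Quotient G X) := by
  intro y
  rw [contMDiffAt_iff_target]
  refine ⟨quot_locHomeo.continuous.continuousAt, ?_⟩
  have h1 := mem_chart_source H (Quotient.mk _ y : orbitRel.Quotient G X)
  obtain ⟨x, hx⟩ := quot_atlas (chart_mem_atlas H (Quotient.mk _ y : orbitRel.Quotient G X))
  rw [hx] at h1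
  have h := quot_local_smooth (I := I) hs x y h1.1
  have h' := contMDiffAt_extChartAt' (I := I) (n := ∞) h1.2
  have := ContMDiffAt.comp (f := fun z => quot_locHomeo.localInverseAt x
      (Quotient.mk _ z : orbitRel.Quotient G X)) (g := extChartAt I x) y h' h
  rw [extChartAt, hx]
  exact this

theorem quot_smooth_of_comp [I.Boundaryless] {V' H' Y : Type} [NormedAddCommGroup V'] [NormedSpace ℝ V']
    [TopologicalSpace H'] {J : ModelWithCorners ℝ V' H'} [TopologicalSpace Y] [ChartedSpace H' Y]
    {f : orbitRel.Quotient G X → Y} (hf : ContMDiff I J ∞ (fun x : X => f (Quotient.mk _ x))) :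
    ContMDiff I J ∞ f := by
  intro q
  have h1 := mem_chart_source H q
  obtain ⟨x, h2⟩ := quot_atlas (chart_mem_atlas H q)
  rw [h2] at h1
  rw [contMDiffAt_iff_source]
  have h3 : f ∘ (extChartAt I q).symm = (fun z : X => f (Quotient.mk _ z)) ∘ (extChartAt I x).symm := by
    funext v
    simp only [extChartAt, h2, mfld_simps, IsLocalHomeomorph.localInverseAt_symm]
  have h4 : extChartAt I q q = extChartAt I x (quot_locHomeo.localInverseAt x q) := by
    simp only [extChartAt, h2, mfld_simps]
  have h5 : extChartAt I q q ∈ (extChartAt I x).target := by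
    rw [h4]
    apply (extChartAt I x).map_source
    simpa only [mfld_simps] using h1.2
  rw [h3]
  have a1 : ContMDiffAt 𝓘(ℝ, V) I ∞ (extChartAt I x).symm (extChartAt I q q) :=
    (contMDiffOn_extChartAt_symm x).contMDiffAt ((isOpen_extChartAt_target x).mem_nhds h5)
  exact ((hf _).comp _ a1).contMDiffWithinAt

end Quotient

abbrev C2 : Type := EuclideanSpace ℂ (Fin 2)

instance : Fact (Module.finrank ℝ C2 = 3 + 1) := ⟨by
  rw [← Module.finrank_mul_finrank ℝ ℂ C2]; simp⟩

instance : Fact (Module.finrank ℝ (EuclideanSpace ℝ (Fin 3)) = 2 + 1) := ⟨by simp⟩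

/-- The unit sphere in `ℂ²`. -/
abbrev Sph3 : Type := Metric.sphere (0 : C2) 1

/-- The unit sphere in `ℝ³`. -/
abbrev Sph2 : Type := Metric.sphere (0 : EuclideanSpace ℝ (Fin 3)) 1

def S3 : Mfd where
  carrier := Sph3
  V := EuclideanSpace ℝ (Fin 3)
  H := EuclideanSpace ℝ (Fin 3)
  I := 𝓡 3

def S2 : Mfd where
  carrier := Sph2
  V := EuclideanSpace ℝ (Fin 2)
  H := EuclideanSpace ℝ (Fin 2)
  I := 𝓡 2

def S1 : Mfd where
  carrier := Circle
  V := EuclideanSpace ℝ (Fin 1)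
  H := EuclideanSpace ℝ (Fin 1)
  I := 𝓡 1

def R1 : Mfd where
  carrier := ℝ
  V := ℝ
  H := ℝ
  I := 𝓘(ℝ, ℝ)

/-- The action of `U(1)` on `S³ ⊂ ℂ²` by scalar multiplication. -/
instance : MulAction Circle Sph3 where
  smul c y := ⟨(c : ℂ) • (y : C2), by
    rw [mem_sphere_zero_iff_norm, norm_smul, norm_eq_of_mem_sphere y, Circle.norm_coe, one_mul]⟩
  one_smul y := Subtype.ext (one_smul ℂ (y : C2))
  mul_smul c d y := Subtype.ext (mul_smul (c : ℂ) (d : ℂ) (y : C2))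

theorem coe_smul (c : Circle) (y : Sph3) : ((c • y : Sph3) : C2) = (c : ℂ) • (y : C2) := rfl

theorem contMDiff_smul3 (c : Circle) : ContMDiff (𝓡 3) (𝓡 3) ∞ (fun y : Sph3 => c • y) := by
  have h : ContMDiff 𝓘(ℝ, C2) 𝓘(ℝ, C2) ∞ (fun y : C2 => (c : ℂ) • y) := by
    apply ContDiff.contMDiff
    fun_prop
  exact (h.comp contMDiff_coe_sphere).codRestrict_sphere _

/-- The group of `p`-th roots of unity. -/
abbrev Zp (p : ℕ) : Type := rootsOfUnity p ℂ

section Lens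
variable (p : ℕ) [NeZero p]

/-- The action of the `p`-th roots of unity on `S³`. -/
instance : MulAction (Zp p) Sph3 := MulAction.compHom Sph3 (rootsOfUnitytoCircle p)

instance : ContinuousConstSMul (Zp p) Sph3 := ⟨fun c => (contMDiff_smul3 (rootsOfUnitytoCircle p c)).continuous⟩

theorem coe_smul_zp (c : Zp p) (y : Sph3) : ((c • y : Sph3) : C2) = ((c : ℂˣ) : ℂ) • (y : C2) := rfl

instance : IsCancelSMul (Zp p) Sph3 where
  right_cancel' c d y h := by
    have h1 := congrArg (Subtype.val) h
    rw [coe_smul_zp, coe_smul_zp] at h1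
    have hy : (y : C2) ≠ 0 := fun h0 => by simpa [h0] using norm_eq_of_mem_sphere y
    exact Subtype.ext (Units.ext (smul_left_injective ℂ hy h1))

/-- The lens space `L_p = S³ / ℤ_p`. -/
def Lens : Mfd where
  carrier := MulAction.orbitRel.Quotient (Zp p) Sph3
  V := EuclideanSpace ℝ (Fin 3)
  H := EuclideanSpace ℝ (Fin 3)
  I := 𝓡 3
  mfd := quot_isManifold fun _ => contMDiff_smul3 _
  t2 := t2Space_of_properlyDiscontinuousSMul_of_t2Space
  sct := ContinuousConstSMul.secondCountableTopology

end Lens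

section Hopf

/-- The Hopf map `(a, b) ↦ (2 Re(ā b), 2 Im(ā b), |a|² - |b|²)`. -/
def hopfR3 (y : C2) : EuclideanSpace ℝ (Fin 3) :=
  !₂[2 * (starRingEnd ℂ (y 0) * y 1).re, 2 * (starRingEnd ℂ (y 0) * y 1).im,
    ‖y 0‖ ^ 2 - ‖y 1‖ ^ 2]

theorem contDiff_re {f : C2 → ℂ} (hf : ContDiff ℝ ∞ f) : ContDiff ℝ ∞ (fun y => (f y).re) :=
  Complex.reCLM.contDiff.comp hf

theorem contDiff_im {f : C2 → ℂ} (hf : ContDiff ℝ ∞ f) : ContDiff ℝ ∞ (fun y => (f y).im) :=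
  Complex.imCLM.contDiff.comp hf

theorem contDiff_coord (i : Fin 2) : ContDiff ℝ ∞ (fun y : C2 => y i) :=
  ((EuclideanSpace.proj i : C2 →L[ℂ] ℂ).restrictScalars ℝ).contDiff

theorem contDiff_hopfR3 : ContDiff ℝ ∞ hopfR3 := by
  have h0 := contDiff_coord 0
  have h1 := contDiff_coord 1
  have hc : ContDiff ℝ ∞ (fun y : C2 => starRingEnd ℂ (y 0) * y 1) :=
    (Complex.conjCLE.contDiff.comp h0).mul h1
  rw [contDiff_euclidean]
  intro i
  fin_cases i
  · exact contDiff_const.mul (contDiff_re hc)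
  · exact contDiff_const.mul (contDiff_im hc)
  · exact (h0.norm_sq ℝ).sub (h1.norm_sq ℝ)

theorem norm_hopfR3 (y : C2) : ‖hopfR3 y‖ = ‖y‖ ^ 2 := by
  have h : ‖hopfR3 y‖ ^ 2 = (‖y‖ ^ 2) ^ 2 := by
    rw [EuclideanSpace.norm_sq_eq, EuclideanSpace.norm_sq_eq]
    simp [hopfR3, Fin.sum_univ_three, Complex.sq_norm, Complex.normSq_apply]
    ring
  exact (sq_eq_sq₀ (norm_nonneg _) (by positivity)).1 h

theorem hopfR3_smul (c : ℂ) (y : C2) : hopfR3 (c • y) = (‖c‖ ^ 2) • hopfR3 y := by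
  ext i
  fin_cases i <;> simp [hopfR3, mul_pow, Complex.sq_norm, Complex.normSq_apply] <;> ring

/-- The Hopf fibration `S³ → S²`. -/
def hopf (y : Sph3) : Sph2 := ⟨hopfR3 y, by simp [norm_hopfR3]⟩

theorem hopf_smul (c : Circle) (y : Sph3) : hopf (c • y) = hopf y := by
  apply Subtype.ext
  change hopfR3 ((c : ℂ) • (y : C2)) = hopfR3 y
  rw [hopfR3_smul, Circle.norm_coe, one_pow, one_smul]

theorem contMDiff_hopf : ContMDiff (𝓡 3) (𝓡 2) ∞ hopf :=
  (contDiff_hopfR3.contMDiff.comp contMDiff_coe_sphere).codRestrict_sphere _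

/-- The points of a fibre of the Hopf fibration differ by the action of `U(1)`. -/
theorem hopf_eq {y y' : Sph3} (h : hopf y = hopf y') :
    (y' : C2) = inner ℂ (y : C2) (y' : C2) • (y : C2) := by
  have h' : hopfR3 y = hopfR3 y' := congrArg Subtype.val h
  have n1 : ‖(y : C2)‖ ^ 2 = 1 := by rw [norm_eq_of_mem_sphere, one_pow]
  have n2 : ‖(y' : C2)‖ ^ 2 = 1 := by rw [norm_eq_of_mem_sphere, one_pow]
  generalize (y : C2) = u at *
  generalize (y' : C2) = v at *
  have e0 := congrArg (fun v => v 0) h'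
  have e1 := congrArg (fun v => v 1) h'
  have e2 := congrArg (fun v => v 2) h'
  rw [EuclideanSpace.norm_sq_eq, Fin.sum_univ_two] at n1 n2
  simp only [hopfR3, PiLp.toLp_apply, Matrix.cons_val_zero, Matrix.cons_val_one, Matrix.cons_val,
    mul_eq_mul_left_iff, OfNat.ofNat_ne_zero, or_false] at e0 e1 e2
  have c1 : starRingEnd ℂ (u 0) * u 1 = starRingEnd ℂ (v 0) * v 1 := Complex.ext e0 e1
  have c2 := congrArg (starRingEnd ℂ) c1
  rw [map_mul, map_mul, Complex.conj_conj, Complex.conj_conj] at c2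
  have m0 : starRingEnd ℂ (u 0) * u 0 = starRingEnd ℂ (v 0) * v 0 := by
    rw [Complex.conj_mul', Complex.conj_mul']
    exact_mod_cast (by linarith : ‖u 0‖ ^ 2 = ‖v 0‖ ^ 2)
  have m1 : starRingEnd ℂ (u 1) * u 1 = starRingEnd ℂ (v 1) * v 1 := by
    rw [Complex.conj_mul', Complex.conj_mul']
    exact_mod_cast (by linarith : ‖u 1‖ ^ 2 = ‖v 1‖ ^ 2)
  have m : starRingEnd ℂ (v 0) * v 0 + starRingEnd ℂ (v 1) * v 1 = 1 := by
    rw [Complex.conj_mul', Complex.conj_mul']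
    exact_mod_cast n2
  ext i
  fin_cases i
  · simp only [PiLp.inner_apply, Fin.sum_univ_two, RCLike.inner_apply, PiLp.smul_apply, smul_eq_mul,
      Fin.zero_eta]
    linear_combination (-v 0) * m - (v 0) * m0 - v 1 * c2
  · simp only [PiLp.inner_apply, Fin.sum_univ_two, RCLike.inner_apply, PiLp.smul_apply, smul_eq_mul,
      Fin.mk_one]
    linear_combination (-v 1) * m - (v 0) * c1 - v 1 * m1

/-- A section of the Hopf fibration that is smooth on an open set. -/
structure LocSec where
  U : Set Sph2
  isOpen : IsOpen U
  σ : Sph2 → Sph3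
  smooth : ContMDiffOn (𝓡 2) 𝓘(ℝ, C2) ∞ (fun s => (σ s : C2)) U
  hopf_σ : ∀ s ∈ U, hopf (σ s) = s

theorem exists_locSec_of (w : EuclideanSpace ℝ (Fin 3) → C2) (hw : ContDiff ℝ ∞ w)
    (h : ∀ s : Sph2, hopfR3 (w s) = (‖w s‖ ^ 2) • (s : EuclideanSpace ℝ (Fin 3))) (s : Sph2)
    (hs : w s ≠ 0) : ∃ σ : LocSec, s ∈ σ.U := by
  classical
  let y₀ : Sph3 := ⟨EuclideanSpace.single 0 1, by simp⟩
  let σ : Sph2 → Sph3 := fun s => if hs : w s = 0 then y₀ else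
    ⟨(‖w s‖⁻¹ : ℂ) • w s, by simp [norm_smul, hs]⟩
  have hσ : ∀ s : Sph2, w s ≠ 0 → (σ s : C2) = (‖w s‖⁻¹ : ℝ) • w s := fun s hs => by
    simp only [σ, dif_neg hs]
    ext i
    simp
  have hc : ContMDiff (𝓡 2) 𝓘(ℝ, C2) ∞ (fun s : Sph2 => w s) :=
    hw.contMDiff.comp contMDiff_coe_sphere
  refine ⟨⟨{s | w s ≠ 0}, isOpen_ne.preimage hc.continuous, σ, ?_, ?_⟩, hs⟩
  · refine ContMDiffOn.congr (f := fun s : Sph2 => (‖w s‖⁻¹ : ℝ) • w s) ?_ hσ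
    have h1 : ContDiffOn ℝ ∞ (fun v : EuclideanSpace ℝ (Fin 3) => (‖w v‖⁻¹ : ℝ) • w v) {v | w v ≠ 0} :=
      fun v hv => (((hw.contDiffAt.norm ℂ hv).inv (by simpa using hv)).smul hw.contDiffAt).contDiffWithinAt
    exact h1.contMDiffOn.comp (contMDiff_coe_sphere.contMDiffOn) fun s hs => hs
  · intro s hs
    apply Subtype.ext
    change hopfR3 (σ s) = s
    rw [hσ s hs]
    have e : (‖w s‖⁻¹ : ℝ) • w s = ((‖w s‖⁻¹ : ℝ) : ℂ) • w s := by ext i; simp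
    rw [e, hopfR3_smul, h, smul_smul]
    have : ‖w s‖ ≠ 0 := by simpa using hs
    have e2 : ‖((‖w s‖⁻¹ : ℝ) : ℂ)‖ = ‖w s‖⁻¹ := by simp
    rw [e2, ← mul_pow, inv_mul_cancel₀ this, one_pow, one_smul]

theorem contDiff_C2 {f g : EuclideanSpace ℝ (Fin 3) → ℂ} (hf : ContDiff ℝ ∞ f) (hg : ContDiff ℝ ∞ g) :
    ContDiff ℝ ∞ (fun s => (!₂[f s, g s] : C2)) := by
  have e : (fun s => (!₂[f s, g s] : C2)) = fun s => f s • EuclideanSpace.single (0 : Fin 2) (1 : ℂ)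
      + g s • EuclideanSpace.single (1 : Fin 2) (1 : ℂ) := by
    funext s
    ext i
    fin_cases i <;> simp
  rw [e]
  exact (hf.smul contDiff_const).add (hg.smul contDiff_const)

theorem contDiff_ofReal {f : EuclideanSpace ℝ (Fin 3) → ℝ} (hf : ContDiff ℝ ∞ f) :
    ContDiff ℝ ∞ (fun s => (f s : ℂ)) := Complex.ofRealCLM.contDiff.comp hf

theorem sph2_eq (s : Sph2) : s.1 0 ^ 2 + s.1 1 ^ 2 + s.1 2 ^ 2 = 1 := by
  have := norm_eq_of_mem_sphere s
  rw [EuclideanSpace.norm_eq, Real.sqrt_eq_one] at this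
  simpa [Fin.sum_univ_three] using this

theorem contDiff_coord3 (i : Fin 3) : ContDiff ℝ ∞ (fun y : EuclideanSpace ℝ (Fin 3) => y i) :=
  (EuclideanSpace.proj i : EuclideanSpace ℝ (Fin 3) →L[ℝ] ℝ).contDiff

theorem exists_locSec (s : Sph2) : ∃ σ : LocSec, s ∈ σ.U := by
  by_cases hs : s.1 2 = -1
  · refine exists_locSec_of (fun s => !₂[((s 0 : ℝ) : ℂ) - Complex.I * (s 1 : ℝ), ((1 - s 2 : ℝ) : ℂ)])
      ?_ (fun s => ?_) s ?_
    · exact contDiff_C2 ((contDiff_ofReal (contDiff_coord3 0)).sub (contDiff_const.mul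
        (contDiff_ofReal (contDiff_coord3 1)))) (contDiff_ofReal (contDiff_const.sub (contDiff_coord3 2)))
    · have e := sph2_eq s
      rw [EuclideanSpace.norm_sq_eq]
      ext i
      fin_cases i <;> simp [hopfR3, Complex.sq_norm, Complex.normSq_apply]
      · linear_combination (-s.1 0) * e
      · linear_combination (-s.1 1) * e
      · linear_combination ((1 - s.1 2)) * e
    · intro h
      have := congrArg (fun v => v 1) h
      simp [hs] at this
  · refine exists_locSec_of (fun s => !₂[((1 + s 2 : ℝ) : ℂ), ((s 0 : ℝ) : ℂ) + Complex.I * (s 1 : ℝ)])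
      ?_ (fun s => ?_) s ?_
    · exact contDiff_C2 (contDiff_ofReal (contDiff_const.add (contDiff_coord3 2)))
        ((contDiff_ofReal (contDiff_coord3 0)).add (contDiff_const.mul
        (contDiff_ofReal (contDiff_coord3 1)))) 
    · have e := sph2_eq s
      rw [EuclideanSpace.norm_sq_eq]
      ext i
      fin_cases i <;> simp [hopfR3, Complex.sq_norm, Complex.normSq_apply]
      · linear_combination (-s.1 0) * e
      · linear_combination (-s.1 1) * e
      · linear_combination (-(1 + s.1 2)) * e
    · intro h
      have := congrArg (fun v => (v 0).re) h
      simp at this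
      apply hs
      linarith

theorem hopf_surj : Function.Surjective hopf := fun s =>
  let ⟨σ, h⟩ := exists_locSec s
  ⟨σ.σ s, σ.hopf_σ s h⟩

/-- The projection `q : L_p → S²` induced by the Hopf fibration. -/
def lensToS2 (p : ℕ) [NeZero p] : Lens p → S2 := Quotient.lift hopf fun _ _ h => by
  obtain ⟨c, rfl⟩ := h
  exact hopf_smul _ _

theorem lensToS2_smooth (p : ℕ) [NeZero p] : Mfd.Smooth (lensToS2 p) :=
  quot_smooth_of_comp (X := Sph3) (G := Zp p) (I := 𝓡 3) (J := 𝓡 2) (Y := Sph2) contMDiff_hopf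

/-- The quotient map `S³ → L_p`. -/
def toLens (p : ℕ) [NeZero p] : S3 → Lens p :=
  (Quotient.mk _ : Sph3 → MulAction.orbitRel.Quotient (Zp p) Sph3)

theorem toLens_smooth (p : ℕ) [NeZero p] : Mfd.Smooth (toLens p) :=
  quot_mk_smooth (X := Sph3) (G := Zp p) (I := 𝓡 3) fun _ => contMDiff_smul3 _

end Hopf

/-! ### The powers of the Hopf line bundle -/

namespace HVB
variable {X : Type} [DiffeologicalSpace X] {E F : HVB X}

/-- Being smooth and parallel may be checked in one pair of frames around every point. -/
theorem IsPar.of_cover {ψ : ∀ x, E.fib x →L[ℂ] F.fib x}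
    (h : ∀ {n : ℕ} (p : Plot X n) (u : Euc n), ∃ i j, p u ∈ E.dom i ∧ p u ∈ F.dom j ∧
      ContDiffAt ℝ ∞ (mat E F ψ p i j) u ∧ ∀ v, fderiv ℝ (mat E F ψ p i j) u v
        + F.conn j p u v ∘L mat E F ψ p i j u = mat E F ψ p i j u ∘L E.conn i p u v) :
    IsPar E F ψ := by
  refine .of_at fun {n} p i' j' u hi' hj' => ?_
  obtain ⟨i, j, hi, hj, hs, hp⟩ := h p u
  let g : Euc n → (F.model j →L[ℂ] F.model j') := mat F F (fun _ => .id ℂ _) p j j'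
  let k : Euc n → (E.model i' →L[ℂ] E.model i) := mat E E (fun _ => .id ℂ _) p i' i
  let m : Euc n → (E.model i →L[ℂ] F.model j) := mat E F ψ p i j
  have key : ∀ w, p w ∈ E.dom i → p w ∈ F.dom j →
      mat E F ψ p i' j' w = g w ∘L (m w ∘L k w) := fun w h1 h2 => by
    ext a
    simp [g, k, m, mat, E.frame_coframe i _ h1, F.frame_coframe j _ h2]
  have ev : mat E F ψ p i' j' =ᶠ[𝓝 u] fun w => g w ∘L (m w ∘L k w) := by
    filter_upwards [E.nhds_dom p hi, F.nhds_dom p hj] with w h1 h2 using key w h1 h2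
  have sg : ContDiffAt ℝ ∞ g u := (isPar_id F).contDiffAt p hj hj'
  have sk : ContDiffAt ℝ ∞ k u := (isPar_id E).contDiffAt p hi' hi
  have smk : ContDiffAt ℝ ∞ (fun w => m w ∘L k w) u := contDiffAt_bilin compR hs sk
  refine ⟨ContDiffAt.congr_of_eventuallyEq (contDiffAt_bilin compR sg smk) ev, fun v => ?_⟩
  have t : (∞ : WithTop ℕ∞) ≠ 0 := by simp
  rw [ev.fderiv_eq, fderiv_clm_comp (sg.differentiableAt t) (smk.differentiableAt t),
    fderiv_clm_comp (hs.differentiableAt t) (sk.differentiableAt t), key u hi hj]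
  have e1 : fderiv ℝ g u v + F.conn j' p u v ∘L g u = g u ∘L F.conn j p u v := F.gauge p j j' u hj hj' v
  have e2 : fderiv ℝ k u v + E.conn i p u v ∘L k u = k u ∘L E.conn i' p u v := E.gauge p i' i u hi' hi v
  have e3 : fderiv ℝ m u v + F.conn j p u v ∘L m u = m u ∘L E.conn i p u v := hp v
  rw [← eq_sub_iff_add_eq] at e1 e2 e3
  rw [e1, e2, e3]
  change _ = (g u ∘L (m u ∘L k u)) ∘L E.conn i' p u v
  ext a
  change g u (m u (k u (E.conn i' p u v a) - E.conn i p u v (k u a))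
    + (m u (E.conn i p u v (k u a)) - F.conn j p u v (m u (k u a))))
    + (g u (F.conn j p u v (m u (k u a))) - F.conn j' p u v (g u (m u (k u a))))
    + F.conn j' p u v (g u (m u (k u a))) = g u (m u (k u (E.conn i' p u v a)))
  simp only [map_add, map_sub]
  abel

theorem IsPar.of_const {ψ : ∀ x, E.fib x →L[ℂ] F.fib x}
    (h : ∀ {n : ℕ} (p : Plot X n) (u : Euc n), ∃ (i : E.ι) (j : F.ι) (C : E.model i →L[ℂ] F.model j),
      p u ∈ E.dom i ∧ p u ∈ F.dom j ∧
      (∀ᶠ w in 𝓝 u, ∀ a, F.coframe j (p w) (ψ (p w) (E.frame i (p w) a)) = C a) ∧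
      ∀ v a, F.conn j p u v (C a) = C (E.conn i p u v a)) :
    IsPar E F ψ := by
  refine .of_cover fun {n} p u => ?_
  obtain ⟨i, j, C, hi, hj, hC, hc⟩ := h p u
  have ev : mat E F ψ p i j =ᶠ[𝓝 u] fun _ => C := by
    filter_upwards [hC] with w hw using ContinuousLinearMap.ext hw
  refine ⟨i, j, hi, hj, contDiffAt_const.congr_of_eventuallyEq ev, fun v => ?_⟩
  have e0 : mat E F ψ p i j u = C := ev.self_of_nhds
  rw [ev.fderiv_eq, e0, fderiv_fun_const]
  refine ContinuousLinearMap.ext fun a => ?_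
  change 0 + F.conn j p u v (C a) = C (E.conn i p u v a)
  rw [zero_add, hc]

end HVB

section Hopf

/-- The space `ℤ` is discrete: its plots are constant. -/
instance : DiffeologicalSpace ℤ := inducedDiffeology (fun n : ℤ => (n : ℝ))

theorem plot_int {k : ℕ} {p : Euc k → ℤ} (hp : IsPlot p) (u w : Euc k) : p u = p w := by
  have h : ContDiff ℝ ∞ (fun u => (p u : ℝ)) := hp
  have hc : Continuous p := Int.isClosedEmbedding_coe_real.isEmbedding.continuous_iff.2 h.continuous
  exact PreconnectedSpace.constant inferInstance hc

/-- The product `S² × ℤ`. -/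
abbrev S2Z : Type := FibProd (fun _ : S2 => ()) (fun _ : ℤ => ())

/-- The component in `S²`. -/
def S2Z.s (x : S2Z) : Sph2 := x.1.1

/-- The component in `ℤ`. -/
def S2Z.n (x : S2Z) : ℤ := x.1.2

/-- Functions `f` on the fibre of the Hopf fibration over `s` (extended by zero) with
`f (y λ) = λ⁻ⁿ f(y)` for `λ ∈ U(1)`. -/
def powSub (s : Sph2) (n : ℤ) : Submodule ℂ (Sph3 → ℂ) where
  carrier := {f | (∀ (c : Circle) (y : Sph3), f (c • y) = (c : ℂ) ^ (-n) * f y) ∧ ∀ y, hopf y ≠ s → f y = 0}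
  zero_mem' := ⟨fun _ _ => by simp, fun _ _ => rfl⟩
  add_mem' {f g} hf hg := ⟨fun c y => by simp [hf.1, hg.1, mul_add], fun y h => by
    simp [hf.2 y h, hg.2 y h]⟩
  smul_mem' a f hf := ⟨fun c y => by simp [hf.1]; ring, fun y h => by simp [hf.2 y h]⟩

/-- The fibre over `s ∈ S²` of the `n`-th power of the line bundle `K` associated with the Hopf
fibration, where `[y, z] = [y λ, λ⁻ⁿ z]`: the vector `[y, z]` is the function with the value `z` at
`y`. -/
def KF (s : Sph2) (n : ℤ) : Type := powSub s n

namespace KF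
variable {s : Sph2} {n : ℤ}

instance : AddCommGroup (KF s n) := inferInstanceAs (AddCommGroup (powSub s n))
instance : Module ℂ (KF s n) := inferInstanceAs (Module ℂ (powSub s n))

instance : CoeFun (KF s n) (fun _ => Sph3 → ℂ) := ⟨fun f => f.1⟩

/-- Evaluation at `y`. -/
def ev (y : Sph3) : KF s n →ₗ[ℂ] ℂ := (LinearMap.proj y).comp (powSub s n).subtype

@[simp] theorem ev_apply (y : Sph3) (f : KF s n) : ev y f = f y := rfl

@[ext] theorem ext {f g : KF s n} (h : ∀ y, f y = g y) : f = g := Subtype.ext (funext h)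

theorem inner_norm {y y' : Sph3} (h : hopf y = hopf y') : ‖inner ℂ (y : C2) (y' : C2)‖ = 1 := by
  have e := congrArg norm (hopf_eq h)
  rwa [norm_smul, norm_eq_of_mem_sphere, norm_eq_of_mem_sphere, mul_one, eq_comm] at e

theorem apply_eq (f : KF s n) {y y' : Sph3} (h : hopf y = hopf y') :
    f y' = (inner ℂ (y : C2) (y' : C2)) ^ (-n) * f y := by
  let c : Circle := ⟨_, mem_sphere_zero_iff_norm.2 (inner_norm h)⟩
  have e : y' = c • y := Subtype.ext (hopf_eq h)
  have := f.2.1 c y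
  rwa [← e] at this

theorem norm_apply (f : KF s n) {y y' : Sph3} (h : hopf y = hopf y') : ‖f y'‖ = ‖f y‖ := by
  rw [apply_eq f h, norm_mul, norm_zpow, inner_norm h]; simp

/-- A point in the fibre over `s`. -/
def pt (s : Sph2) : Sph3 := (hopf_surj s).choose

theorem hopf_pt (s : Sph2) : hopf (pt s) = s := (hopf_surj s).choose_spec

theorem ev_inj {y : Sph3} (hy : hopf y = s) : Function.Injective (ev y : KF s n →ₗ[ℂ] ℂ) := by
  intro f g h
  ext y'
  by_cases hy' : hopf y' = s
  · rw [apply_eq f (hy.trans hy'.symm), apply_eq g (hy.trans hy'.symm)]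
    rw [ev_apply, ev_apply] at h
    rw [h]
  · rw [f.2.2 _ hy', g.2.2 _ hy']

/-- The norm of `f` is the absolute value of `f` at any point of the fibre. -/
instance : NormedAddCommGroup (KF s n) :=
  NormedAddCommGroup.induced (KF s n) ℂ (ev (pt s)) (ev_inj (hopf_pt s))

theorem norm_def (f : KF s n) : ‖f‖ = ‖f (pt s)‖ := rfl

theorem norm_eq (f : KF s n) {y : Sph3} (hy : hopf y = s) : ‖f‖ = ‖f y‖ :=
  norm_apply f (hy.trans (hopf_pt s).symm)

instance : InnerProductSpace ℂ (KF s n) where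
  norm_smul_le c f := (norm_mul_le c (f (pt s)) : _)
  inner f g := inner ℂ (f (pt s)) (g (pt s))
  norm_sq_eq_re_inner f := norm_sq_eq_re_inner (𝕜 := ℂ) (f (pt s))
  conj_inner_symm f g := inner_conj_symm (f (pt s)) (g (pt s))
  add_left f g h := inner_add_left (f (pt s)) (g (pt s)) (h (pt s))
  smul_left f g c := inner_smul_left (f (pt s)) (g (pt s)) c

open scoped Classical in
/-- The function `y λ ↦ λ⁻ⁿ z` on the fibre over `s`. -/
def inclFun (s : Sph2) (n : ℤ) (y : Sph3) (z : ℂ) (y' : Sph3) : ℂ :=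
  if hopf y' = s then inner ℂ (y : C2) (y' : C2) ^ (-n) * z else 0

/-- The map `z ↦ [y, z]`. -/
def incl (s : Sph2) (n : ℤ) (y : Sph3) : ℂ →ₗ[ℂ] KF s n where
  toFun z := ⟨inclFun s n y z, by
    refine ⟨fun c y' => ?_, fun y' h => if_neg h⟩
    unfold inclFun
    rw [hopf_smul]
    split_ifs
    · rw [coe_smul, inner_smul_right, mul_zpow]; ring
    · simp⟩
  map_add' z z' := by
    ext y'
    change inclFun s n y (z + z') y' = inclFun s n y z y' + inclFun s n y z' y'
    unfold inclFun
    split_ifs <;> ring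
  map_smul' c z := by
    ext y'
    change inclFun s n y (c * z) y' = c * inclFun s n y z y'
    unfold inclFun
    split_ifs <;> ring

theorem incl_apply (y : Sph3) {y' : Sph3} (h : hopf y' = s) (z : ℂ) :
    incl s n y z y' = inner ℂ (y : C2) (y' : C2) ^ (-n) * z := if_pos h

theorem incl_self {y : Sph3} (h : hopf y = s) (z : ℂ) : incl s n y z y = z := by
  rw [incl_apply y h, inner_self_eq_norm_sq_to_K, norm_eq_of_mem_sphere]; simp

theorem incl_ev {y : Sph3} (h : hopf y = s) (f : KF s n) : incl s n y (f y) = f :=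
  ev_inj h (incl_self h _)

instance : FiniteDimensional ℂ (KF s n) := FiniteDimensional.of_injective _ (ev_inj (hopf_pt s))

theorem finrank : Module.finrank ℂ (KF s n) = 1 := by
  have e : ℂ ≃ₗ[ℂ] KF s n := LinearEquiv.ofBijective (incl s n (pt s))
    ⟨fun z z' h => by rw [← incl_self (hopf_pt s) z, h, incl_self (hopf_pt s)],
      fun f => ⟨_, incl_ev (hopf_pt s) f⟩⟩
  rw [← e.finrank_eq, Module.finrank_self]

end KF
end Hopf

section Hopf

/-- The local connection form `Im ⟨σ, dσ⟩` along a plot. -/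
def LocSec.form (σ : LocSec) {k : ℕ} (p : Euc k → Sph2) (u : Euc k) : Euc k →L[ℝ] ℝ :=
  Complex.imCLM ∘L ((innerSL ℂ (σ.σ (p u) : C2)).restrictScalars ℝ)
    ∘L fderiv ℝ (fun w => (σ.σ (p w) : C2)) u

theorem LocSec.form_apply (σ : LocSec) {k : ℕ} (p : Euc k → Sph2) (u v : Euc k) :
    σ.form p u v = (inner ℂ (σ.σ (p u) : C2) (fderiv ℝ (fun w => (σ.σ (p w) : C2)) u v)).im := rfl

variable {k : ℕ}

theorem plot_S2 (p : Plot S2Z k) : ContMDiff 𝓘(ℝ, Euc k) (𝓡 2) ∞ (fun u => (p u).s) :=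
  (FibProd.isPlot_iff.1 p.2).1

theorem plot_Z (p : Plot S2Z k) (u w : Euc k) : (p u).n = (p w).n :=
  plot_int (FibProd.isPlot_iff.1 p.2).2 u w

theorem LocSec.contDiffOn (σ : LocSec) (p : Plot S2Z k) :
    ContDiffOn ℝ ∞ (fun w => (σ.σ (p w).s : C2)) {w | (p w).s ∈ σ.U} :=
  (σ.smooth.comp (plot_S2 p).contMDiffOn fun _ h => h).contDiffOn

theorem LocSec.isOpen_dom (σ : LocSec) (p : Plot S2Z k) : IsOpen {w | (p w).s ∈ σ.U} :=
  σ.isOpen.preimage (plot_S2 p).continuous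

theorem LocSec.contDiffAt (σ : LocSec) (p : Plot S2Z k) {u : Euc k} (h : (p u).s ∈ σ.U) :
    ContDiffAt ℝ ∞ (fun w => (σ.σ (p w).s : C2)) u :=
  (σ.contDiffOn p).contDiffAt ((σ.isOpen_dom p).mem_nhds h)

theorem LocSec.form_smooth (σ : LocSec) (p : Plot S2Z k) :
    ContDiffOn ℝ ∞ (fun u => σ.form (fun w => (p w).s) u) {w | (p w).s ∈ σ.U} := by
  rw [contDiffOn_clm_apply]
  intro v
  have h1 := σ.contDiffOn p
  have h2 := (h1.fderiv_of_isOpen (σ.isOpen_dom p) (m := ∞) (by simp)).clm_apply (contDiffOn_const (c := v))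
  exact Complex.imCLM.contDiff.comp_contDiffOn (h1.inner ℂ h2)

/-- The skew-adjoint map `i t` on `ℂ`, scaled by `n`. -/
def iSkew (n : ℤ) : ℝ →L[ℝ] (ℂ →L[ℂ] ℂ) :=
  ContinuousLinearMap.toSpanSingleton ℝ ((n * Complex.I : ℂ) • ContinuousLinearMap.id ℂ ℂ)

theorem iSkew_apply (n : ℤ) (t : ℝ) (z : ℂ) : iSkew n t z = n * Complex.I * t * z := by
  simp [iSkew]; ring

theorem LocSec.inner_self_fderiv (σ : LocSec) (p : Plot S2Z k) {u : Euc k} (h : (p u).s ∈ σ.U) (v : Euc k) :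
    inner ℂ (σ.σ (p u).s : C2) (fderiv ℝ (fun w => (σ.σ (p w).s : C2)) u v)
      = Complex.I * (σ.form (fun w => (p w).s) u v : ℝ) ∧
    inner ℂ (fderiv ℝ (fun w => (σ.σ (p w).s : C2)) u v) (σ.σ (p u).s : C2)
      = - (Complex.I * (σ.form (fun w => (p w).s) u v : ℝ)) := by
  have hd := (σ.contDiffAt p h).differentiableAt (by simp)
  have h1 := fderiv_inner_apply ℂ hd hd v
  have h2 : (fun w => inner ℂ (σ.σ (p w).s : C2) (σ.σ (p w).s : C2)) = fun _ => (1 : ℂ) := by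
    funext w
    rw [inner_self_eq_norm_sq_to_K, norm_eq_of_mem_sphere]; simp
  rw [h2, fderiv_fun_const] at h1
  have h3 := inner_conj_symm (𝕜 := ℂ) (fderiv ℝ (fun w => (σ.σ (p w).s : C2)) u v) (σ.σ (p u).s : C2)
  rw [LocSec.form_apply]
  generalize inner ℂ (σ.σ (p u).s : C2) (fderiv ℝ (fun w => (σ.σ (p w).s : C2)) u v) = a at *
  generalize inner ℂ (fderiv ℝ (fun w => (σ.σ (p w).s : C2)) u v) (σ.σ (p u).s : C2) = b at *
  have hb : b = -a := by
    have : (0 : ℂ) = a + b := h1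
    linear_combination -this
  have hre : a.re = 0 := by
    have := congrArg Complex.re h3
    rw [hb] at this
    simp at this
    linarith
  have ha : a = Complex.I * (a.im : ℝ) := by
    apply Complex.ext <;> simp [hre]
  exact ⟨ha, by rw [hb]; exact congrArg Neg.neg ha⟩

/-- The coefficients of the transition functions. -/
theorem LocSec.trans_scalar (σ τ : LocSec) (p : Plot S2Z k) (n : ℤ) {u : Euc k}
    (hσ : (p u).s ∈ σ.U) (hτ : (p u).s ∈ τ.U) :
    ContDiffAt ℝ ∞ (fun w => inner ℂ (σ.σ (p w).s : C2) (τ.σ (p w).s : C2) ^ (-n)) u ∧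
    ∀ v, fderiv ℝ (fun w => inner ℂ (σ.σ (p w).s : C2) (τ.σ (p w).s : C2) ^ (-n)) u v
      + n * Complex.I * (τ.form (fun w => (p w).s) u v : ℝ)
        * inner ℂ (σ.σ (p u).s : C2) (τ.σ (p u).s : C2) ^ (-n)
      = inner ℂ (σ.σ (p u).s : C2) (τ.σ (p u).s : C2) ^ (-n)
        * (n * Complex.I * (σ.form (fun w => (p w).s) u v : ℝ)) := by
  have cF := σ.contDiffAt p hσ
  have cG := τ.contDiffAt p hτ
  have cl : ContDiffAt ℝ ∞ (fun w => inner ℂ (σ.σ (p w).s : C2) (τ.σ (p w).s : C2)) u := cF.inner ℂ cG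
  have hst : hopf (σ.σ (p u).s) = hopf (τ.σ (p u).s) := (σ.hopf_σ _ hσ).trans (τ.hopf_σ _ hτ).symm
  have hn := KF.inner_norm hst
  have h0 : inner ℂ (σ.σ (p u).s : C2) (τ.σ (p u).s : C2) ≠ 0 := fun h => by simp [h] at hn
  have cz : ContDiffAt ℝ ∞ (fun z : ℂ => z ^ (-n)) (inner ℂ (σ.σ (p u).s : C2) (τ.σ (p u).s : C2)) := by
    have : AnalyticAt ℂ (fun z : ℂ => z ^ (-n)) (inner ℂ (σ.σ (p u).s : C2) (τ.σ (p u).s : C2)) :=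
      analyticAt_id.zpow h0
    exact this.contDiffAt.restrict_scalars ℝ
  refine ⟨ContDiffAt.comp (g := fun z : ℂ => z ^ (-n)) u cz cl, fun v => ?_⟩
  have t : (∞ : WithTop ℕ∞) ≠ 0 := by simp
  have dl := (cl.differentiableAt t).hasFDerivAt
  have dz := ((hasDerivAt_zpow (-n) _ (Or.inl h0)).hasFDerivAt.restrictScalars ℝ).comp u dl
  have e1 : fderiv ℝ (fun w => inner ℂ (σ.σ (p w).s : C2) (τ.σ (p w).s : C2) ^ (-n)) u v
      = fderiv ℝ (fun w => inner ℂ (σ.σ (p w).s : C2) (τ.σ (p w).s : C2)) u v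
        * (((-n : ℤ) : ℂ) * inner ℂ (σ.σ (p u).s : C2) (τ.σ (p u).s : C2) ^ (-n - 1)) := by
    have := congrArg (fun f => f v) dz.fderiv
    exact this
  have e2 := fderiv_inner_apply ℂ (cF.differentiableAt t) (cG.differentiableAt t) v
  have e3 := hopf_eq hst
  obtain ⟨a1, a2⟩ := σ.inner_self_fderiv p hσ v
  obtain ⟨b1, b2⟩ := τ.inner_self_fderiv p hτ v
  rw [e1, e2, zpow_sub₀ h0, zpow_one]
  have b1' := b1
  rw [e3, inner_smul_left] at b1
  generalize fderiv ℝ (fun w => (τ.σ (p w).s : C2)) u v = G' at *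
  have a2' : inner ℂ (fderiv ℝ (fun w => (σ.σ (p w).s : C2)) u v) (τ.σ (p u).s : C2)
      = inner ℂ (σ.σ (p u).s : C2) (τ.σ (p u).s : C2) *
        - (Complex.I * (σ.form (fun w => (p w).s) u v : ℝ)) := by
    conv_lhs => rw [e3]
    rw [inner_smul_right, a2]
  rw [a2']
  have hc : starRingEnd ℂ (inner ℂ (σ.σ (p u).s : C2) (τ.σ (p u).s : C2))
      * inner ℂ (σ.σ (p u).s : C2) (τ.σ (p u).s : C2) = 1 := by
    rw [Complex.conj_mul', hn]; simp
  generalize inner ℂ (σ.σ (p u).s : C2) (τ.σ (p u).s : C2) = l at *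
  generalize inner ℂ (σ.σ (p u).s : C2) G' = m at *
  have b3 : m = l * (Complex.I * (τ.form (fun w => (p w).s) u v : ℝ)) := by
    rw [← b1]; linear_combination (-m) * hc
  rw [b3]
  push_cast
  field_simp
  ring

/-- Multiplication by a complex number. -/
def cmul : ℂ →L[ℝ] (ℂ →L[ℂ] ℂ) := (ContinuousLinearMap.mul ℂ ℂ).restrictScalars ℝ

theorem cmul_apply (a z : ℂ) : cmul a z = a * z := rfl

theorem LocSec.trans_eq (σ τ : LocSec) (p : Plot S2Z k) {u : Euc k} (hτ : (p u).s ∈ τ.U)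
    (u₀ : Euc k) (z : ℂ) :
    KF.ev (τ.σ (p u).s) (KF.incl (p u).s (p u).n (σ.σ (p u).s) z)
      = inner ℂ (σ.σ (p u).s : C2) (τ.σ (p u).s : C2) ^ (-(p u₀).n) * z :=
  (KF.incl_apply _ (τ.hopf_σ _ hτ) z).trans (by rw [show (p u).n = (p u₀).n from plot_Z p u u₀])

/-- The line bundle on `S² × ℤ` which restricts to the `n`-th power of the Hopf line bundle `K` on
`S² × {n}`.  A local section `σ` of the Hopf fibration yields the frame `[σ, 1]`, with the connection
form `n i Im⟨σ, dσ⟩`. -/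
def hopfPowers : HVB S2Z where
  fib x := KF x.s x.n
  ι := LocSec
  dom σ := {x | x.s ∈ σ.U}
  model _ := ℂ
  frame σ x := LinearMap.toContinuousLinearMap (KF.incl x.s x.n (σ.σ x.s))
  coframe σ x := LinearMap.toContinuousLinearMap (KF.ev (σ.σ x.s))
  isOpen_dom p σ := σ.isOpen_dom p
  cover x := exists_locSec x.s
  coframe_frame σ x hx z := KF.incl_self (σ.hopf_σ _ hx) z
  frame_coframe σ x hx f := KF.incl_ev (σ.hopf_σ _ hx) f
  norm_frame σ x hx z := (KF.norm_eq _ (σ.hopf_σ _ hx)).trans (congrArg norm (KF.incl_self (σ.hopf_σ _ hx) z))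
  smooth_trans p σ τ := by
    intro u hu
    have h := (σ.trans_scalar τ p (p u).n hu.1 hu.2).1
    have h' : ContDiffAt ℝ ∞ (fun w => cmul
        (inner ℂ (σ.σ (p w).s : C2) (τ.σ (p w).s : C2) ^ (-(p u).n))) u :=
      cmul.contDiff.contDiffAt.comp u h
    refine h'.contDiffWithinAt.congr_of_mem (fun w hw => ?_) hu
    exact ContinuousLinearMap.ext fun z => σ.trans_eq τ p hw.2 u z
  conn σ _ p u := iSkew (p u).n ∘L σ.form (fun w => (p w).s) u
  smooth_conn σ _ p := by
    intro u hu
    have h := (contDiffOn_const (c := iSkew (p u).n)).clm_comp (σ.form_smooth p)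
    refine (h u hu).congr_of_mem (fun w _ => ?_) hu
    rw [show (p w).n = (p u).n from plot_Z p w u]
  skew_conn σ _ p u hu v a b := by
    simp only [ContinuousLinearMap.comp_apply, iSkew_apply, RCLike.inner_apply, map_mul,
      Complex.conj_I, Complex.conj_ofReal, map_intCast]
    ring
  conn_reparam σ _ _ p h hh u hu v := by
    have h1 := (σ.contDiffAt p hu).differentiableAt (by simp)
    have h2 := fderiv_comp u h1 (hh.contDiffAt.differentiableAt (by simp))
    have h3 : σ.form (fun w => ((p.reparam h hh) w).s) u v = σ.form (fun w => (p w).s) (h u) (fderiv ℝ h u v) := by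
      rw [LocSec.form_apply, LocSec.form_apply]
      change (inner ℂ _ (fderiv ℝ ((fun w => (σ.σ (p w).s : C2)) ∘ h) u v)).im = _
      rw [h2]
      rfl
    exact congrArg (iSkew (p (h u)).n) h3
  gauge p σ τ u hσ hτ v := by
    obtain ⟨hs, h⟩ := σ.trans_scalar τ p (p u).n hσ hτ
    have ev : (fun w => LinearMap.toContinuousLinearMap (KF.ev (s := (p w).s) (n := (p w).n) (τ.σ (p w).s))
        ∘L LinearMap.toContinuousLinearMap (KF.incl (p w).s (p w).n (σ.σ (p w).s))) =ᶠ[𝓝 u]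
        fun w => cmul
          (inner ℂ (σ.σ (p w).s : C2) (τ.σ (p w).s : C2) ^ (-(p u).n)) := by
      filter_upwards [(τ.isOpen_dom p).mem_nhds hτ] with w h2
      exact ContinuousLinearMap.ext fun z => σ.trans_eq τ p h2 u z
    have ev' := ev.self_of_nhds
    simp only at ev'
    rw [ev.fderiv_eq, ev']
    have hd : fderiv ℝ (fun w => cmul
          (inner ℂ (σ.σ (p w).s : C2) (τ.σ (p w).s : C2) ^ (-(p u).n))) u v
        = cmul
          (fderiv ℝ (fun w => inner ℂ (σ.σ (p w).s : C2) (τ.σ (p w).s : C2) ^ (-(p u).n)) u v) := by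
      have := cmul.hasFDerivAt.comp u
        (hs.differentiableAt (by simp)).hasFDerivAt
      exact congrArg (fun f => f v) this.fderiv
    rw [hd]
    refine ContinuousLinearMap.ext fun z => ?_
    have := h v
    simp only [ContinuousLinearMap.comp_apply, iSkew_apply, cmul_apply, add_apply]
    linear_combination z * this

end Hopf

/-! ### The bundle gerbe -/

section Spaces
variable (p : ℕ) [NeZero p]

/-- The manifold `M_p = L_p × S¹`. -/
def Mp : Mfd := (Lens p).prod S1

/-- The covering space `L_p × ℝ` of `M_p`. -/
def Yp : Mfd := (Lens p).prod R1

variable {p}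

/-- The components of a point of `L_p × S¹` and of `L_p × ℝ`. -/
def Mp.x (m : Mp p) : Lens p := m.1
def Mp.z (m : Mp p) : Circle := m.2
def Yp.x (y : Yp p) : Lens p := y.1
def Yp.r (y : Yp p) : ℝ := y.2

/-- The point `(x, r)`. -/
def Yp.mk (x : Lens p) (r : ℝ) : Yp p := (x, r)

variable (p)

/-- The projection `L_p × ℝ → L_p × S¹`, `(x, r) ↦ (x, exp(2πir))`. -/
def proj : Yp p → Mp p := fun y => (Yp.x y, Circle.exp (2 * Real.pi * Yp.r y))

theorem Yp.x_smooth : Mfd.Smooth (X := Yp p) Yp.x := contMDiff_fst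

theorem Yp.r_smooth : ContMDiff (Yp p).I 𝓘(ℝ, ℝ) ∞ (Yp.r : Yp p → ℝ) := contMDiff_snd (I := (Lens p).I) (J := 𝓘(ℝ, ℝ))

theorem Mp.x_smooth : Mfd.Smooth (X := Mp p) Mp.x := contMDiff_fst

theorem Mp.z_smooth : ContMDiff (Mp p).I (𝓡 1) ∞ (Mp.z : Mp p → Circle) := contMDiff_snd (I := (Lens p).I) (J := 𝓡 1)

theorem proj_smooth : Mfd.Smooth (proj p) := by
  have h1 : ContMDiff 𝓘(ℝ, ℝ) (𝓡 1) ∞ (fun r : ℝ => Circle.exp (2 * Real.pi * r)) :=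
    contMDiff_circleExp.comp (contDiff_const.mul contDiff_id).contMDiff
  exact (Yp.x_smooth p).prodMk (h1.comp (Yp.r_smooth p))

theorem exp_eq {r s : ℝ} (h : Circle.exp (2 * Real.pi * r) = Circle.exp (2 * Real.pi * s)) :
    ∃ n : ℤ, s = r + n := by
  obtain ⟨m, hm⟩ := Circle.exp_eq_exp.1 h
  refine ⟨-m, ?_⟩
  have : 2 * Real.pi ≠ 0 := by positivity
  have h2 : 2 * Real.pi * (s - (r - m)) = 0 := by linarith
  have := (mul_eq_zero.1 h2).resolve_left this
  push_cast
  linarith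

theorem contMDiff_coe_circle : ContMDiff (𝓡 1) 𝓘(ℝ, ℂ) ∞ (fun z : Circle => (z : ℂ)) :=
  haveI := finrank_real_complex_fact'
  contMDiff_coe_sphere (n := 1) (E := ℂ)

/-- The local inverses of the covering `ℝ → S¹`. -/
def localLog (r : ℝ) (z : Circle) : ℝ :=
  r + (Complex.log ((z : ℂ) * (Circle.exp (-(2 * Real.pi * r)) : Circle))).im / (2 * Real.pi)

theorem localLog_exp (r : ℝ) (z : Circle) : Circle.exp (2 * Real.pi * localLog r z) = z := by
  have : 2 * Real.pi * localLog r z = 2 * Real.pi * r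
      + Complex.arg ((z * Circle.exp (-(2 * Real.pi * r)) : Circle) : ℂ) := by
    rw [localLog, Complex.log_im, Circle.coe_mul]
    field_simp
  rw [this, Circle.exp_add, Circle.exp_arg, mul_comm, mul_assoc, ← Circle.exp_add]
  simp

theorem localLog_self (r : ℝ) : localLog r (Circle.exp (2 * Real.pi * r)) = r := by
  rw [localLog, ← Circle.coe_mul, ← Circle.exp_add]
  simp

theorem localLog_smooth (r : ℝ) : ∃ U : Set Circle, U ∈ 𝓝 (Circle.exp (2 * Real.pi * r)) ∧
    ContMDiffOn (𝓡 1) 𝓘(ℝ, ℝ) ∞ (localLog r) U := by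
  let U : Set Circle := {z | ((z : ℂ) * (Circle.exp (-(2 * Real.pi * r)) : Circle)) ∈ Complex.slitPlane}
  have hU : IsOpen U := Complex.isOpen_slitPlane.preimage (by fun_prop)
  refine ⟨U, hU.mem_nhds ?_, ?_⟩
  · change (_ : ℂ) ∈ Complex.slitPlane
    rw [← Circle.coe_mul, ← Circle.exp_add]
    simp
  · intro z hz
    have h1 : ContDiffAt ℝ ∞ (fun w : ℂ => r + (Complex.log (w * (Circle.exp (-(2 * Real.pi * r)) : Circle))).im
        / (2 * Real.pi)) (z : ℂ) := by
      have h2 : ContDiffAt ℝ ∞ (fun w : ℂ => Complex.log (w * (Circle.exp (-(2 * Real.pi * r)) : Circle))) (z : ℂ) :=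
        ((Complex.contDiffAt_log hz).restrict_scalars ℝ).comp (z : ℂ) (contDiffAt_id.mul contDiffAt_const)
      exact contDiffAt_const.add ((Complex.imCLM.contDiff.contDiffAt.comp (z : ℂ) h2).div_const _)
    exact (h1.contMDiffAt.comp z (contMDiff_coe_circle z)).contMDiffWithinAt

theorem proj_subm : IsSurjSubm (proj p) where
  smooth := proj_smooth p
  surj m := ⟨Yp.mk (Mp.x m) (localLog 0 (Mp.z m)), Prod.ext rfl (localLog_exp 0 _)⟩
  sec y := by
    obtain ⟨U, hU, hs⟩ := localLog_smooth (Yp.r y)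
    refine ⟨Mp.z ⁻¹' U, (Mp.z_smooth p).continuous.continuousAt.preimage_mem_nhds hU,
      fun m => Yp.mk (Mp.x m) (localLog (Yp.r y) (Mp.z m)), ?_, ?_, fun m _ => Prod.ext rfl (localLog_exp _ _)⟩
    · exact (Mp.x_smooth p).contMDiffOn.prodMk (hs.comp (Mp.z_smooth p).contMDiffOn fun _ h => h)
    · exact Prod.ext rfl (localLog_self _)

theorem proj_eq {y y' : Yp p} (h : proj p y = proj p y') : Yp.x y = Yp.x y' ∧ ∃ n : ℤ, Yp.r y' = Yp.r y + n :=
  ⟨congrArg (fun m : Mp p => Mp.x m) h, exp_eq (congrArg (fun m : Mp p => Mp.z m) h)⟩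

variable {p}

/-- A point `((x, r), (x, r + n))` of the fibre product is mapped to `(q(x), n)`. -/
def toS2Z (t : FibProd (proj p) (proj p)) : S2Z :=
  .mk (lensToS2 p (Yp.x t.1.1)) (round (Yp.r t.1.2 - Yp.r t.1.1)) rfl

theorem round_sub {y y' : Yp p} (h : proj p y = proj p y') : (round (Yp.r y' - Yp.r y) : ℝ) = Yp.r y' - Yp.r y := by
  obtain ⟨-, n, hn⟩ := proj_eq p h
  rw [hn]; simp

theorem toS2Z_smooth : DSmooth (toS2Z (p := p)) := by
  intro n c hc
  obtain ⟨h0, h1⟩ := FibProd.isPlot_iff.1 hc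
  refine FibProd.isPlot_iff.2 ⟨?_, ?_⟩
  · exact (lensToS2_smooth p).dSmooth _ _ ((Yp.x_smooth p).dSmooth _ _ h0)
  · change IsPlot (fun u => ((round (Yp.r (c u).1.2 - Yp.r (c u).1.1) : ℤ) : ℝ))
    have e : (fun u => ((round (Yp.r (c u).1.2 - Yp.r (c u).1.1) : ℤ) : ℝ))
        = fun u => Yp.r (c u).1.2 - Yp.r (c u).1.1 := funext fun u => round_sub (c u).2
    rw [e]
    have g0 := (Yp.r_smooth p).comp (Mfd.isPlot_iff.1 h0)
    have g1 := (Yp.r_smooth p).comp (Mfd.isPlot_iff.1 h1)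
    exact (g1.contDiff.sub g0.contDiff : ContDiff ℝ ∞ _)

end Spaces

namespace KF
variable {s s' t : Sph2} {m n k : ℤ}

/-- The canonical isomorphism `K^m ⊗ K^n → K^{m+n}`, as a linear map: the product of functions. -/
def mulL (hs : s = t) (hs' : s' = t) (hk : k = m + n) : Ten (KF s m) (KF s' n) →L[ℂ] KF t k :=
  tlift (LinearMap.mk₂ ℂ (fun f g => (⟨fun y => f y * g y, by
      subst hs hs' hk
      have hf := f.2
      have hg := g.2
      refine ⟨fun c y => ?_, fun y h => ?_⟩
      · have h1 := hf.1 c y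
        have h2 := hg.1 c y
        simp only [neg_add, zpow_add₀ c.coe_ne_zero, h1, h2]
        ring
      · have h1 := hf.2 y h
        simp only [h1, zero_mul]⟩ : KF t k))
    (fun f f' g => ext fun y => add_mul (f y) (f' y) (g y))
    (fun c f g => ext fun y => mul_assoc c (f y) (g y))
    (fun f g g' => ext fun y => mul_add (f y) (g y) (g' y))
    (fun c f g => ext fun y => mul_left_comm (f y) c (g y)))

theorem mulL_apply (hs : s = t) (hs' : s' = t) (hk : k = m + n) (f : KF s m) (g : KF s' n)
    (y : Sph3) : mulL hs hs' hk (f ⊠ g) y = f y * g y :=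
  congrArg (fun h : KF t k => h y) (tlift_tmul _ f g)

/-- The canonical isomorphism `K^m ⊗ K^n → K^{m+n}`. -/
def mul (hs : s = t) (hs' : s' = t) (hk : k = m + n) : Ten (KF s m) (KF s' n) ≃ₗᵢ[ℂ] KF t k :=
  .ofSurjective ⟨(mulL hs hs' hk).toLinearMap, fun x => by
      subst hs hs'
      let l : KF s' n := incl s' n (pt s') 1
      have hl : ‖l‖ = 1 := by rw [norm_def, incl_self (hopf_pt s'), norm_one]
      rw [← HVB.contract_eq finrank hl x]
      generalize contract (KF s' m) l x = f
      change ‖mulL rfl rfl hk (f ⊠ l) (pt s')‖ = ‖f ⊠ l‖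
      rw [mulL_apply, norm_mul, ← norm_def, ← norm_def]
      exact (TensorProduct.norm_tmul f l).symm⟩ fun h => by
    subst hs hs'
    refine ⟨incl s' m (pt s') (h (pt s')) ⊠ incl s' n (pt s') 1, ev_inj (hopf_pt s') ?_⟩
    change mulL rfl rfl hk (incl s' m (pt s') (h (pt s')) ⊠ incl s' n (pt s') 1) (pt s') = h (pt s')
    rw [mulL_apply, incl_self (hopf_pt s'), incl_self (hopf_pt s'), mul_one]

theorem mul_apply (hs : s = t) (hs' : s' = t) (hk : k = m + n) (f : KF s m) (g : KF s' n)
    (y : Sph3) : mul hs hs' hk (f ⊠ g) y = f y * g y := mulL_apply hs hs' hk f g y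

/-- The unit of the multiplication, for `n = 0`: the function `1` on the fibre over `s`. -/
def one (s : Sph2) (n : ℤ) : KF s n := incl s n (pt s) 1

theorem one_apply (hn : n = 0) {y : Sph3} (hy : hopf y = s) : one s n y = 1 := by
  subst hn
  exact (incl_apply _ hy 1).trans (by simp)

theorem assoc' {s₀ s₁ s₂ t₀₁ t₁₂ : Sph2} {n₀ n₁ n₂ m₀₁ m₁₂ : ℤ} (h1 : s₀ = t₀₁) (h2 : s₁ = t₀₁)
    (h3 : m₀₁ = n₀ + n₁) (h4 : t₀₁ = t) (h5 : s₂ = t) (h6 : k = m₀₁ + n₂) (h7 : s₁ = t₁₂) (h8 : s₂ = t₁₂)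
    (h9 : m₁₂ = n₁ + n₂) (h10 : s₀ = t) (h11 : t₁₂ = t) (h12 : k = n₀ + m₁₂) (a : KF s₀ n₀) (b : KF s₁ n₁)
    (c : KF s₂ n₂) : mul h4 h5 h6 (mul h1 h2 h3 (a ⊠ b) ⊠ c) = mul h10 h11 h12 (a ⊠ mul h7 h8 h9 (b ⊠ c)) :=
  ext fun y => by rw [mul_apply, mul_apply, mul_apply, mul_apply, mul_assoc]

theorem one_mul' (hs : s = t) (hs' : t = t) (hk : n = m + n) (a : KF t n) :
    mul hs hs' hk (one s m ⊠ a) = a := ev_inj (hopf_pt t) <| by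
  rw [ev_apply, ev_apply, mul_apply, one_apply (by omega) (by rw [hopf_pt, hs]), one_mul]

theorem mul_one' (hs : t = t) (hs' : s = t) (hk : n = n + m) (a : KF t n) :
    mul hs hs' hk (a ⊠ one s m) = a := ev_inj (hopf_pt t) <| by
  rw [ev_apply, ev_apply, mul_apply, one_apply (by omega) (by rw [hopf_pt, hs']), mul_one]

variable {X : Type} [DiffeologicalSpace X]

/-- Multiplication of complex numbers. -/
def mulC : Ten ℂ ℂ →L[ℂ] ℂ := tlift (LinearMap.mul ℂ ℂ)

theorem mulC_apply (a b : ℂ) : mulC (a ⊠ b) = a * b := tlift_tmul _ a b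

theorem mul_par {f g h : X → S2Z} (hf : DSmooth f) (hg : DSmooth g) (hh : DSmooth h)
    (e1 : ∀ x, (f x).s = (h x).s) (e2 : ∀ x, (g x).s = (h x).s) (e3 : ∀ x, (h x).n = (f x).n + (g x).n) :
    HVB.IsPar ((hopfPowers.pb f hf).tensor (hopfPowers.pb g hg)) (hopfPowers.pb h hh)
      (fun x => clm (mul (e1 x) (e2 x) (e3 x))) := by
  refine .of_const fun {d} p u => ?_
  obtain ⟨σ, hσ⟩ := exists_locSec (h (p u)).s
  have h1 : (f (p u)).s ∈ σ.U := by rw [e1]; exact hσ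
  have h2 : (g (p u)).s ∈ σ.U := by rw [e2]; exact hσ
  refine ⟨(σ, σ), σ, mulC, ⟨h1, h2⟩, hσ, ?_, fun v z => ?_⟩
  · filter_upwards [(σ.isOpen_dom (p.map h hh)).mem_nhds hσ] with w hw z
    replace hw : (h (p w)).s ∈ σ.U := hw
    have s1 : ∀ a, incl (f (p w)).s (f (p w)).n (σ.σ (f (p w)).s) a (σ.σ (h (p w)).s) = a := fun a => by
      rw [← e1]; exact incl_self (σ.hopf_σ _ (by rw [e1]; exact hw)) a
    have s2 : ∀ b, incl (g (p w)).s (g (p w)).n (σ.σ (g (p w)).s) b (σ.σ (h (p w)).s) = b := fun b => by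
      rw [← e2]; exact incl_self (σ.hopf_σ _ (by rw [e2]; exact hw)) b
    have key : ∀ a b : ℂ, mul (e1 (p w)) (e2 (p w)) (e3 (p w))
        (incl (f (p w)).s (f (p w)).n (σ.σ (f (p w)).s) a
          ⊠ incl (g (p w)).s (g (p w)).n (σ.σ (g (p w)).s) b) (σ.σ (h (p w)).s) = a * b := fun a b => by
      rw [mul_apply, s1, s2]
    have k2 : LinearMap.toContinuousLinearMap (ev (s := (h (p w)).s) (n := (h (p w)).n) (σ.σ (h (p w)).s))
        ∘L clm (mul (e1 (p w)) (e2 (p w)) (e3 (p w)))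
        ∘L tmap (LinearMap.toContinuousLinearMap (incl (f (p w)).s (f (p w)).n (σ.σ (f (p w)).s)))
          (LinearMap.toContinuousLinearMap (incl (g (p w)).s (g (p w)).n (σ.σ (g (p w)).s))) = mulC := by
      refine clm_tensor_ext fun a b => ?_
      simp only [ContinuousLinearMap.comp_apply, tmap_tmul]
      exact (key a b).trans (mulC_apply a b).symm
    exact congrArg (fun T => T z) k2
  · have q1 : (fun w => (h (p w)).s) = fun w => (f (p w)).s := funext fun w => (e1 _).symm
    have q2 : (fun w => (h (p w)).s) = fun w => (g (p w)).s := funext fun w => (e2 _).symm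
    have k3 : (iSkew (h (p u)).n (σ.form (fun w => (h (p w)).s) u v)) ∘L mulC
        = mulC ∘L tconn (iSkew (f (p u)).n ∘L σ.form (fun w => (f (p w)).s) u)
          (iSkew (g (p u)).n ∘L σ.form (fun w => (g (p w)).s) u) v := by
      refine clm_tensor_ext fun a b => ?_
      rw [← q1, ← q2, e3]
      simp only [ContinuousLinearMap.comp_apply, tconn_apply, add_apply, tmap_tmul, map_add, mulC_apply,
        iSkew_apply, ContinuousLinearMap.id_apply]
      push_cast
      ring
    exact congrArg (fun T => T z) k3

theorem one_par {f : X → S2Z} (hf : DSmooth f) (h : ∀ x, (f x).n = 0) :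
    HVB.IsParSection (hopfPowers.pb f hf) (fun x => one (f x).s (f x).n) := by
  refine .of_const fun {d} p u => ?_
  obtain ⟨σ, hσ⟩ := exists_locSec (f (p u)).s
  refine ⟨(), σ, ContinuousLinearMap.id ℂ ℂ, trivial, hσ, ?_, fun v a => ?_⟩
  · filter_upwards [(σ.isOpen_dom (p.map f hf)).mem_nhds hσ] with w hw a
    have := one_apply (h (p w)) (σ.hopf_σ _ hw)
    exact (congrArg (fun z : ℂ => (show ℂ from a) * z) this).trans (mul_one (show ℂ from a))
  · have e : ∀ (t : ℝ) (z : ℂ), ((f (p u)).n : ℂ) * Complex.I * t * z = 0 := fun t z => by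
      rw [h]; simp
    exact (iSkew_apply (f (p u)).n _ _).trans (e _ _)

end KF

section Gerbe
variable (p : ℕ) [NeZero p]

theorem toS2Z_s {y₀ y₁ y₂ : Yp p} (h : proj p y₀ = proj p y₁) (h' : proj p y₁ = proj p y₂) :
    (toS2Z (.mk y₁ y₂ h')).s = (toS2Z (.mk y₀ y₂ (h.trans h'))).s := congrArg (lensToS2 p) (proj_eq p h).1.symm

theorem toS2Z_n {y₀ y₁ y₂ : Yp p} (h : proj p y₀ = proj p y₁) (h' : proj p y₁ = proj p y₂) :
    (toS2Z (.mk y₀ y₂ (h.trans h'))).n = (toS2Z (.mk y₀ y₁ h)).n + (toS2Z (.mk y₁ y₂ h')).n := by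
  have h1 := round_sub h
  have h2 := round_sub h'
  have h3 := round_sub (h.trans h')
  have : ((round (Yp.r y₂ - Yp.r y₀) : ℤ) : ℝ)
      = ((round (Yp.r y₁ - Yp.r y₀) + round (Yp.r y₂ - Yp.r y₁) : ℤ) : ℝ) := by
    push_cast
    linarith
  exact Int.cast_injective this

theorem toS2Z_diag (y : Yp p) : (toS2Z (.mk y y rfl)).n = 0 := by
  change round (Yp.r y - Yp.r y) = 0
  simp

/-- The decomposable bundle gerbe on `M_p = L_p × S¹`: over `((x, r), (x, r + n))` the fibre of its
line bundle is the `n`-th power of the fibre of the pullback of `K` along `q : L_p → S²` at `x`. -/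
def cupGerbe : Gerbe (Mp p) where
  Y := Yp p
  π := proj p
  subm := proj_subm p
  L := hopfPowers.pb toS2Z toS2Z_smooth
  rank _ := KF.finrank
  μ y₀ y₁ y₂ h h' := KF.mul rfl (toS2Z_s p h h') (toS2Z_n p h h')
  μ_par := KF.mul_par (X := Fib3 (proj p) (proj p) (proj p)) (fun _ _ h => toS2Z_smooth _ _ (FibProd.dSmooth_mk Fib3.dSmooth_0 Fib3.dSmooth_1 (fun t => t.1.1.2) _ _ h)) (fun _ _ h => toS2Z_smooth _ _ (FibProd.dSmooth_mk Fib3.dSmooth_1 Fib3.dSmooth_2 (fun t => t.2) _ _ h)) (fun _ _ h => toS2Z_smooth _ _ (FibProd.dSmooth_mk Fib3.dSmooth_0 Fib3.dSmooth_2 (fun t => t.1.1.2.trans t.2) _ _ h)) _ _ _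
  assoc y₀ y₁ y₂ y₃ h₁ h₂ h₃ a b c := KF.assoc' _ _ _ _ _ _ _ _ _ _ _ _ a b c
  unit y := KF.one _ _
  unit_mul y₀ y₁ h a := KF.one_mul' _ _ _ a
  mul_unit y₀ y₁ h a := KF.mul_one' _ _ _ a
  unit_par := KF.one_par (f := fun y => toS2Z (.mk y y rfl)) (fun _ _ h =>
    toS2Z_smooth _ _ (FibProd.dSmooth_mk dSmooth_id dSmooth_id (fun _ => rfl) _ _ h)) (toS2Z_diag p)

end Gerbe

/-! ### The curving and the curvature -/

section Forms
variable {X X' : Type} [DiffeologicalSpace X] [DiffeologicalSpace X'] {k : ℕ}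

/-- Smooth real functions on a diffeological space. -/
def SmoothFun (f : X → ℝ) : Prop := ∀ {n : ℕ} (p : Plot X n), ContDiff ℝ ∞ (fun u => f (p u))

namespace DForm

/-- The exterior derivative of a smooth function. -/
def d (f : X → ℝ) (hf : SmoothFun f) : DForm 1 X where
  val p u := ContinuousAlternatingMap.ofSubsingleton ℝ _ _ 0 (fderiv ℝ (fun w => f (p w)) u)
  smooth p v := ((hf p).fderiv_right (m := ∞) (by simp)).clm_apply contDiff_const
  reparam p h hh u := by
    have e : fderiv ℝ ((fun w => f (p w)) ∘ h) u = fderiv ℝ (fun w => f (p w)) (h u) ∘L fderiv ℝ h u :=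
      fderiv_comp u ((hf p).contDiffAt.differentiableAt (by simp)) (hh.contDiffAt.differentiableAt (by simp))
    ext v
    exact congrArg (fun T => T (v 0)) e

/-- The exterior product `θ ∧ η` of a 1-form `θ` and a `k`-form `η`. -/
def wedge (θ : DForm 1 X) (η : DForm k X) : DForm (k + 1) X where
  val p u := ContinuousAlternatingMap.alternatizeUncurryFin
    (((ContinuousAlternatingMap.ofSubsingleton ℝ _ _ 0).symm (θ.val p u)).smulRight (η.val p u))
  smooth p v := by
    simp only [ContinuousAlternatingMap.alternatizeUncurryFin_apply]
    refine ContDiff.sum fun i _ => ?_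
    have := (θ.smooth p (fun _ => v i)).mul (η.smooth p (i.removeNth v))
    exact ContDiff.const_smul ((-1 : ℤ) ^ (i : ℕ)) this
  reparam p h hh u := by
    ext v
    simp only [ContinuousAlternatingMap.alternatizeUncurryFin_apply,
      ContinuousAlternatingMap.compContinuousLinearMap_apply, θ.reparam p h hh u, η.reparam p h hh u]
    rfl

/-- The sum of differential forms. -/
def sum {m : ℕ} (η : Fin m → DForm k X) : DForm k X where
  val p u := ∑ i, (η i).val p u
  smooth p v := by
    simp only [ContinuousAlternatingMap.sum_apply]
    exact ContDiff.sum fun i _ => (η i).smooth p v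
  reparam p h hh u := by
    ext v
    simp only [(η _).reparam p h hh u, ContinuousAlternatingMap.sum_apply,
      ContinuousAlternatingMap.compContinuousLinearMap_apply]

end DForm

theorem SmoothFun.of_contMDiff {X : Mfd} {f : X → ℝ} (hf : ContMDiff X.I 𝓘(ℝ, ℝ) ∞ f) : SmoothFun f :=
  fun p => (hf.comp (Mfd.isPlot_iff.1 p.2)).contDiff

/-- The cartesian coordinates on `S² ⊂ ℝ³`. -/
def S2.coord (a : Fin 3) (s : S2) : ℝ := (s : Sph2).1 a

theorem S2.coord_smooth (a : Fin 3) : SmoothFun (S2.coord a) :=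
  SmoothFun.of_contMDiff (X := S2) ((contDiff_coord3 a).contMDiff.comp contMDiff_coe_sphere)

/-- The volume form of `S²`, normalised to total volume 1:
`ω = (4π)⁻¹ (s₀ ds₁ ∧ ds₂ + s₁ ds₂ ∧ ds₀ + s₂ ds₀ ∧ ds₁)`. -/
def omega : DForm 2 S2 :=
  .sum fun a : Fin 3 => .smul (fun s => (4 * Real.pi)⁻¹ * S2.coord a s)
    (fun p => contDiff_const.mul (S2.coord_smooth a p))
    ((DForm.d _ (S2.coord_smooth (a + 1))).wedge (DForm.d _ (S2.coord_smooth (a + 2))))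

/-- The real and imaginary part of a point of `S¹`. -/
def S1.re (z : S1) : ℝ := ((show Circle from z) : ℂ).re
def S1.im (z : S1) : ℝ := ((show Circle from z) : ℂ).im

theorem S1.re_smooth : SmoothFun S1.re :=
  SmoothFun.of_contMDiff (X := S1) (Complex.reCLM.contDiff.contMDiff.comp contMDiff_coe_circle)
theorem S1.im_smooth : SmoothFun S1.im :=
  SmoothFun.of_contMDiff (X := S1) (Complex.imCLM.contDiff.contMDiff.comp contMDiff_coe_circle)

/-- The 1-form `dr` on `S¹ = ℝ / ℤ`: in terms of `z = x + i y = exp(2πir)` this is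
`(2π)⁻¹ (x dy - y dx)`. -/
def drForm : DForm 1 S1 :=
  .sum ![.smul (fun z => (2 * Real.pi)⁻¹ * S1.re z) (fun p => contDiff_const.mul (S1.re_smooth p))
      (.d _ S1.im_smooth),
    .smul (fun z => -(2 * Real.pi)⁻¹ * S1.im z) (fun p => contDiff_const.mul (S1.im_smooth p))
      (.d _ S1.re_smooth)]

variable (p : ℕ) [NeZero p]

/-- The curving of the bundle gerbe: at `(x, r)` it is `2πi r q^*ω` (as always, the real form
`2π r q^*ω` is recorded). -/
def cupCurving : DForm 2 (cupGerbe p).Y :=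
  .smul (fun y : Yp p => 2 * Real.pi * Yp.r y)
    (fun c => contDiff_const.mul (SmoothFun.of_contMDiff (X := Yp p) (Yp.r_smooth p) c))
    (omega.pb (fun y : Yp p => lensToS2 p (Yp.x y))
      (fun _ _ h => (lensToS2_smooth p).dSmooth _ _ ((Yp.x_smooth p).dSmooth _ _ h)))

/-- The 3-form `2πi ω ∧ dr = 2πi dr ∧ ω` on `M_p = L_p × S¹`, where `ω` is pulled back along
`L_p → S²` (the real form `2π ω ∧ dr` is recorded). -/
def cupCurvature : DForm 3 (Mp p).carrier :=
  .smul (fun _ => 2 * Real.pi) (fun _ => contDiff_const)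
    ((drForm.pb (fun m : Mp p => (Mp.z m : S1)) (Mfd.Smooth.dSmooth (X := Mp p) (Y := S1) (Mp.z_smooth p))).wedge
      (omega.pb (fun m : Mp p => lensToS2 p (Mp.x m))
        (fun _ _ h => (lensToS2_smooth p).dSmooth _ _ ((Mp.x_smooth p).dSmooth _ _ h))))

end Forms

/-! ### Twisted equivariant bundles -/

section LinAlg2
variable {V₀ V₁ V₂ V₃ W₀ W₁ W₂ W₃ : Type}
  [NormedAddCommGroup V₀] [InnerProductSpace ℂ V₀] [FiniteDimensional ℂ V₀]
  [NormedAddCommGroup V₁] [InnerProductSpace ℂ V₁] [FiniteDimensional ℂ V₁]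
  [NormedAddCommGroup V₂] [InnerProductSpace ℂ V₂] [FiniteDimensional ℂ V₂]
  [NormedAddCommGroup V₃] [InnerProductSpace ℂ V₃] [FiniteDimensional ℂ V₃]
  [NormedAddCommGroup W₀] [InnerProductSpace ℂ W₀] [FiniteDimensional ℂ W₀]
  [NormedAddCommGroup W₁] [InnerProductSpace ℂ W₁] [FiniteDimensional ℂ W₁]
  [NormedAddCommGroup W₂] [InnerProductSpace ℂ W₂] [FiniteDimensional ℂ W₂]
  [NormedAddCommGroup W₃] [InnerProductSpace ℂ W₃] [FiniteDimensional ℂ W₃]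

theorem dualIso_apply (e : V₀ ≃ₗᵢ[ℂ] V₁) (ξ : Du V₀) (w : V₁) : dualIso e ξ w = ξ (e.symm w) := rfl

theorem dualIso_dualIso {f : V₀ ≃ₗᵢ[ℂ] V₁} {g : V₁ ≃ₗᵢ[ℂ] V₂} {k : V₀ ≃ₗᵢ[ℂ] V₂}
    (h : ∀ v, g (f v) = k v) (ξ : Du V₀) : dualIso g (dualIso f ξ) = dualIso k ξ := by
  refine Du.ext fun u => ?_
  rw [dualIso_apply, dualIso_apply, dualIso_apply]
  congr 1
  apply k.injective
  rw [← h]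
  simp

theorem dualIso_twist {f : V₀ ≃ₗᵢ[ℂ] V₁} {g : V₁ ≃ₗᵢ[ℂ] V₂} {f' : V₀ ≃ₗᵢ[ℂ] V₃} {g' : V₃ ≃ₗᵢ[ℂ] V₂}
    {c d : ℂ} (hc : c * d = 1) (h : ∀ v, g (f v) = d • g' (f' v)) (ξ : Du V₀) :
    dualIso g (dualIso f ξ) = c • dualIso g' (dualIso f' ξ) := by
  refine Du.ext fun u => ?_
  rw [Du.smul_apply, dualIso_apply, dualIso_apply, dualIso_apply, dualIso_apply]
  have e : f.symm (g.symm u) = c • f'.symm (g'.symm u) := by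
    apply f.injective
    apply g.injective
    rw [map_smul, map_smul, h (f'.symm _), smul_smul, hc, one_smul, f.apply_symm_apply, g.apply_symm_apply,
      f'.apply_symm_apply, g'.apply_symm_apply]
  rw [e, map_smul, smul_eq_mul]

theorem dualIso_nat {f : V₀ ≃ₗᵢ[ℂ] V₁} {g : W₀ ≃ₗᵢ[ℂ] W₁} {T : V₀ →L[ℂ] W₀} {S : V₁ →L[ℂ] W₁}
    (h : ∀ v, S (f v) = g (T v)) (ξ : Du W₀) : trp S (dualIso g ξ) = dualIso f (trp T ξ) := by
  refine Du.ext fun u => ?_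
  rw [trp_apply, dualIso_apply, dualIso_apply, trp_apply]
  have := h (f.symm u)
  rw [f.apply_symm_apply] at this
  rw [this, g.symm_apply_apply]

theorem tensorIso_tmul (e : V₀ ≃ₗᵢ[ℂ] V₁) (f : W₀ ≃ₗᵢ[ℂ] W₁) (v : V₀) (w : W₀) :
    tensorIso e f (v ⊠ w) = e v ⊠ f w :=
  (congrArg (fun T => T (v ⊠ w)) (clm_tensorIso e f)).trans (tmap_tmul _ _ _ _)

theorem tensorIso_tensorIso {f : V₀ ≃ₗᵢ[ℂ] V₁} {g : V₁ ≃ₗᵢ[ℂ] V₂} {k : V₀ ≃ₗᵢ[ℂ] V₂}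
    {f' : W₀ ≃ₗᵢ[ℂ] W₁} {g' : W₁ ≃ₗᵢ[ℂ] W₂} {k' : W₀ ≃ₗᵢ[ℂ] W₂}
    (h : ∀ v, g (f v) = k v) (h' : ∀ v, g' (f' v) = k' v) (e : Ten V₀ W₀) :
    tensorIso g g' (tensorIso f f' e) = tensorIso k k' e := by
  induction e using Ten.induction with
  | h0 => simp only [map_zero]
  | ht v w => rw [tensorIso_tmul, tensorIso_tmul, tensorIso_tmul, h, h']
  | ha x y hx hy => simp only [map_add, hx, hy]

theorem tensorIso_twist {f : V₀ ≃ₗᵢ[ℂ] V₁} {g : V₁ ≃ₗᵢ[ℂ] V₂} {k : V₀ ≃ₗᵢ[ℂ] V₃} {l : V₃ ≃ₗᵢ[ℂ] V₂}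
    {f' : W₀ ≃ₗᵢ[ℂ] W₁} {g' : W₁ ≃ₗᵢ[ℂ] W₂} {k' : W₀ ≃ₗᵢ[ℂ] W₃} {l' : W₃ ≃ₗᵢ[ℂ] W₂}
    {b c d : ℂ} (hb : b = c * d) (h : ∀ v, g (f v) = c • l (k v)) (h' : ∀ v, g' (f' v) = d • l' (k' v))
    (e : Ten V₀ W₀) :
    tensorIso g g' (tensorIso f f' e) = b • tensorIso l l' (tensorIso k k' e) := by
  induction e using Ten.induction with
  | h0 => simp only [map_zero, smul_zero]
  | ht v w =>
    rw [tensorIso_tmul, tensorIso_tmul, tensorIso_tmul, tensorIso_tmul, h, h', smul_tmul, tmul_smul,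
      smul_smul, hb]
  | ha x y hx hy => simp only [map_add, hx, hy, smul_add]

theorem tensorIso_nat {f : V₀ ≃ₗᵢ[ℂ] V₁} {g : W₀ ≃ₗᵢ[ℂ] W₁} {T : V₀ →L[ℂ] W₀} {S : V₁ →L[ℂ] W₁}
    {f' : V₂ ≃ₗᵢ[ℂ] V₃} {g' : W₂ ≃ₗᵢ[ℂ] W₃} {T' : V₂ →L[ℂ] W₂} {S' : V₃ →L[ℂ] W₃}
    (h : ∀ v, S (f v) = g (T v)) (h' : ∀ v, S' (f' v) = g' (T' v)) (e : Ten V₀ V₂) :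
    tmap S S' (tensorIso f f' e) = tensorIso g g' (tmap T T' e) := by
  induction e using Ten.induction with
  | h0 => simp only [map_zero]
  | ht v w => rw [tensorIso_tmul, tmap_tmul, tmap_tmul, tensorIso_tmul, h, h']
  | ha x y hx hy => simp only [map_add, hx, hy]

end LinAlg2

namespace HVB
variable {X : Type} [DiffeologicalSpace X]

theorem IsPar.dualIso {E F : HVB X} {e : ∀ x, E.fib x ≃ₗᵢ[ℂ] F.fib x}
    (h : IsPar E F (fun x => clm (e x))) : IsPar E.dual F.dual (fun x => clm (CupGerbe.dualIso (e x))) :=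
  (h.inv (χ := fun x => clm ((e x).symm)) (fun x v => (e x).symm_apply_apply v)
    (fun x v => (e x).apply_symm_apply v)).trp

theorem IsPar.tensorIso {E F E' F' : HVB X} {e : ∀ x, E.fib x ≃ₗᵢ[ℂ] F.fib x}
    {e' : ∀ x, E'.fib x ≃ₗᵢ[ℂ] F'.fib x}
    (h : IsPar E F (fun x => clm (e x))) (h' : IsPar E' F' (fun x => clm (e' x))) :
    IsPar (E.tensor E') (F.tensor F') (fun x => clm (CupGerbe.tensorIso (e x) (e' x))) :=
  (h.tensor h').congr fun x v => (congrArg (fun T => T v) (clm_tensorIso (e x) (e' x))).symm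

theorem tr_tr (F : HVB X) {a b c : X} (h : a = b) (h' : b = c)
    (h'' : a = c) (e : F.fib a) : F.tr h' (F.tr h e) = F.tr h'' e := by
  subst h h'
  rfl

theorem tr_nat {F F' : HVB X} (f : F ⟶ F') {a b : X} (h : a = b)
    (e : F.fib a) : f.toFun b (F.tr h e) = F'.tr h (f.toFun a e) := by
  subst h
  rfl

end HVB

theorem dSmooth_comp {A B C : Type} [DiffeologicalSpace A] [DiffeologicalSpace B]
    [DiffeologicalSpace C] {g : B → C} {f : A → B} (hg : DSmooth g) (hf : DSmooth f) :
    DSmooth (fun x => g (f x)) := fun n q hq => hg n _ (hf n q hq)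

section Twisted

/-- The manifold `S³ × ℝ`. -/
def S3R : Mfd := S3.prod R1

/-- The components of a point of `S³ × ℝ`. -/
def S3R.y (x : S3R) : Sph3 := x.1
def S3R.r (x : S3R) : ℝ := x.2

/-- The point `(y, r)`. -/
def S3R.mk (y : Sph3) (r : ℝ) : S3R := (y, r)

theorem S3R.y_smooth : Mfd.Smooth (X := S3R) (Y := S3) S3R.y := contMDiff_fst

theorem S3R.r_smooth : Mfd.Smooth (X := S3R) (Y := R1) S3R.r := contMDiff_snd

variable {p : ℕ} [NeZero p]

/-- The action of `ℤ_p` on `S³ × ℝ`. -/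
def rot (ζ : Zp p) (x : S3R) : S3R := .mk (ζ • (S3R.y x)) (S3R.r x)

/-- The action of `ℤ` on `S³ × ℝ`. -/
def shift (n : ℤ) (x : S3R) : S3R := .mk (S3R.y x) (S3R.r x + (n : ℝ))

theorem rot_smooth (ζ : Zp p) : DSmooth (rot ζ) :=
  Mfd.Smooth.dSmooth (X := S3R) (Y := S3R) (((contMDiff_smul3 _).comp S3R.y_smooth).prodMk S3R.r_smooth)

theorem add_smooth (n : ℤ) : Mfd.Smooth (X := R1) (Y := R1) (fun r : ℝ => r + (n : ℝ)) :=
  (contDiff_id.add contDiff_const).contMDiff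

theorem shift_smooth (n : ℤ) : DSmooth (shift n) :=
  Mfd.Smooth.dSmooth (X := S3R) (Y := S3R) (S3R.y_smooth.prodMk ((add_smooth n).comp S3R.r_smooth))

theorem twist_inv (ζ : Zp p) (k n : ℤ) :
    (((ζ : ℂˣ) ^ (-k * n) : ℂˣ) : ℂ) * (((ζ : ℂˣ) ^ (k * n) : ℂˣ) : ℂ) = 1 := by
  rw [← Units.val_mul, ← zpow_add]
  simp

theorem twist_mul (ζ : Zp p) (n : ℤ) {k l m : ℤ} (hm : m = k + l) :
    (((ζ : ℂˣ) ^ (m * n) : ℂˣ) : ℂ) = (((ζ : ℂˣ) ^ (k * n) : ℂˣ) : ℂ) * (((ζ : ℂˣ) ^ (l * n) : ℂˣ) : ℂ) := by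
  rw [← Units.val_mul, ← zpow_add, hm, add_mul]

variable (p) in
/-- Hermitean vector bundles with connection on `S³ × ℝ` with a `ℤ_p`-equivariant structure
`φ_(y,ζ,r) : E_(yζ,r) → E_(y,r)` and a `ℤ`-equivariant structure `γ_(y,r,n) : E_(y,r+n) → E_(y,r)`
(unitary and parallel) satisfying
`γ_(y,r,n) ∘ φ_(y,ζ,r+n) = ζ^(kn) φ_(y,ζ,r) ∘ γ_(yζ,r,n)`. -/
structure Tw (k : ℤ) where
  E : HVB S3R.carrier
  φ : ∀ (ζ : Zp p) (x x' : S3R), x' = rot ζ x → (E.fib x' ≃ₗᵢ[ℂ] E.fib x)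
  φ_par : ∀ ζ, HVB.IsPar (E.pb _ (rot_smooth ζ)) E (fun x => clm (φ ζ x _ rfl))
  φ_mul : ∀ (ζ ζ' : Zp p) (x x' x'' : S3R) (h : x' = rot ζ x) (h' : x'' = rot ζ' x')
    (h'' : x'' = rot (ζ * ζ') x) (e : E.fib x''), φ ζ x x' h (φ ζ' x' x'' h' e) = φ (ζ * ζ') x x'' h'' e
  γ : ∀ (n : ℤ) (x x' : S3R), x' = shift n x → (E.fib x' ≃ₗᵢ[ℂ] E.fib x)
  γ_par : ∀ n, HVB.IsPar (E.pb _ (shift_smooth n)) E (fun x => clm (γ n x _ rfl))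
  γ_add : ∀ (n n' : ℤ) (x x' x'' : S3R) (h : x' = shift n x) (h' : x'' = shift n' x')
    (h'' : x'' = shift (n + n') x) (e : E.fib x''), γ n x x' h (γ n' x' x'' h' e) = γ (n + n') x x'' h'' e
  twist : ∀ (ζ : Zp p) (n : ℤ) (x x₁ x₂ x₃ : S3R) (h₁ : x₁ = shift n x) (h₂ : x₂ = rot ζ x₁)
    (h₃ : x₃ = rot ζ x) (h₄ : x₂ = shift n x₃) (e : E.fib x₂),
    γ n x x₁ h₁ (φ ζ x₁ x₂ h₂ e) = (((ζ : ℂˣ) ^ (k * n) : ℂˣ) : ℂ) • φ ζ x x₃ h₃ (γ n x₃ x₂ h₄ e)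

namespace Tw
variable {k l m : ℤ}

/-- Morphisms: smooth parallel morphisms of bundles that commute with both equivariant structures. -/
@[ext] structure Hom (A B : Tw p k) where
  toHom : A.E ⟶ B.E
  map_φ : ∀ (ζ : Zp p) (x x' : S3R) (h : x' = rot ζ x) (e : A.E.fib x'),
    toHom.toFun x (A.φ ζ x x' h e) = B.φ ζ x x' h (toHom.toFun x' e)
  map_γ : ∀ (n : ℤ) (x x' : S3R) (h : x' = shift n x) (e : A.E.fib x'),
    toHom.toFun x (A.γ n x x' h e) = B.γ n x x' h (toHom.toFun x' e)

instance : Category (Tw p k) where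
  Hom := Hom
  id A := ⟨𝟙 _, fun _ _ _ _ _ => rfl, fun _ _ _ _ _ => rfl⟩
  comp f g := ⟨f.toHom ≫ g.toHom,
    fun ζ x x' h e => (congrArg (g.toHom.toFun x) (f.map_φ ζ x x' h e)).trans (g.map_φ ζ x x' h _),
    fun n x x' h e => (congrArg (g.toHom.toFun x) (f.map_γ n x x' h e)).trans (g.map_γ n x x' h _)⟩
  id_comp _ := Hom.ext rfl
  comp_id _ := Hom.ext rfl
  assoc _ _ _ := Hom.ext rfl

/-- The dual bundle, with the inverse transposes of the equivariant structures. -/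
def dual (A : Tw p k) : Tw p (-k) where
  E := A.E.dual
  φ ζ x x' h := dualIso (A.φ ζ x x' h)
  φ_par ζ := (A.φ_par ζ).dualIso
  φ_mul ζ ζ' x x' x'' h h' h'' e := dualIso_dualIso (A.φ_mul ζ ζ' x x' x'' h h' h'') e
  γ n x x' h := dualIso (A.γ n x x' h)
  γ_par n := (A.γ_par n).dualIso
  γ_add n n' x x' x'' h h' h'' e := dualIso_dualIso (A.γ_add n n' x x' x'' h h' h'') e
  twist ζ n x x₁ x₂ x₃ h₁ h₂ h₃ h₄ e :=
    dualIso_twist (twist_inv ζ k n) (A.twist ζ n x x₁ x₂ x₃ h₁ h₂ h₃ h₄) e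

/-- The functor `Θ`: dual bundles and inverse transposes of the equivariant structures. -/
def Theta (k : ℤ) : (Tw p k)ᵒᵖ ⥤ Tw p (-k) where
  obj A := dual A.unop
  map {A B} f := ⟨⟨_, f.unop.toHom.isPar.trp⟩,
    fun ζ x x' h e => dualIso_nat (f.unop.map_φ ζ x x' h) e,
    fun n x x' h e => dualIso_nat (f.unop.map_γ n x x' h) e⟩
  map_id _ := rfl
  map_comp _ _ := rfl

/-- The tensor product of twisted equivariant bundles; the twists add up. -/
def tensor (hm : m = k + l) (A : Tw p k) (B : Tw p l) : Tw p m where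
  E := A.E.tensor B.E
  φ ζ x x' h := tensorIso (A.φ ζ x x' h) (B.φ ζ x x' h)
  φ_par ζ := (A.φ_par ζ).tensorIso (B.φ_par ζ)
  φ_mul ζ ζ' x x' x'' h h' h'' e :=
    tensorIso_tensorIso (A.φ_mul ζ ζ' x x' x'' h h' h'') (B.φ_mul ζ ζ' x x' x'' h h' h'') e
  γ n x x' h := tensorIso (A.γ n x x' h) (B.γ n x x' h)
  γ_par n := (A.γ_par n).tensorIso (B.γ_par n)
  γ_add n n' x x' x'' h h' h'' e :=
    tensorIso_tensorIso (A.γ_add n n' x x' x'' h h' h'') (B.γ_add n n' x x' x'' h h' h'') e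
  twist ζ n x x₁ x₂ x₃ h₁ h₂ h₃ h₄ e :=
    tensorIso_twist (twist_mul ζ n hm) (A.twist ζ n x x₁ x₂ x₃ h₁ h₂ h₃ h₄)
      (B.twist ζ n x x₁ x₂ x₃ h₁ h₂ h₃ h₄) e

/-- The tensor product functor. -/
def tensorF (hm : m = k + l) : Tw p k × Tw p l ⥤ Tw p m where
  obj A := tensor hm A.1 A.2
  map {A B} f := ⟨⟨_, f.1.toHom.isPar.tensor f.2.toHom.isPar⟩,
    fun ζ x x' h e => tensorIso_nat (f.1.map_φ ζ x x' h) (f.2.map_φ ζ x x' h) e,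
    fun n x x' h e => tensorIso_nat (f.1.map_γ n x x' h) (f.2.map_γ n x x' h) e⟩
  map_id A := Hom.ext (HVB.ParHom.ext (funext fun x => tmap_id))
  map_comp f g := Hom.ext (HVB.ParHom.ext (funext fun x => (tmap_comp _ _ _ _).symm))

/-- The pairing `Θ(-) ⊗ (-)`. -/
def pairing (p : ℕ) [NeZero p] (k : ℤ) : (Tw p k)ᵒᵖ × Tw p k ⥤ Tw p 0 :=
  (Theta k).prod (𝟭 _) ⋙ tensorF (by ring)

/-- The projection `S³ × ℝ → M_p`. -/
def toMp (p : ℕ) [NeZero p] (x : S3R) : Mp p := proj p (.mk (toLens p (S3R.y x)) (S3R.r x))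

theorem toMp_smooth (p : ℕ) [NeZero p] : DSmooth (toMp p) :=
  Mfd.Smooth.dSmooth (X := S3R) (Y := Mp p) ((proj_smooth p).comp
    (((toLens_smooth p).comp S3R.y_smooth).prodMk S3R.r_smooth))

theorem toMp_rot (ζ : Zp p) (x x' : S3R) (h : x' = rot ζ x) : toMp p x' = toMp p x := by
  subst h
  exact Prod.ext (Quotient.sound ⟨ζ, rfl⟩) rfl

theorem toMp_shift (n : ℤ) (x x' : S3R) (h : x' = shift n x) : toMp p x' = toMp p x := by
  subst h
  refine Prod.ext rfl (Circle.exp_eq_exp.2 ⟨n, ?_⟩)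
  change 2 * Real.pi * (S3R.r x + (n : ℝ)) = 2 * Real.pi * S3R.r x + _
  ring

/-- The pullback of bundles on `M_p` to `ℤ_p × ℤ`-equivariant bundles on `S³ × ℝ`. -/
def pull (p : ℕ) [NeZero p] : HVB (Mp p).carrier ⥤ Tw p 0 where
  obj F :=
    { E := F.pb _ (toMp_smooth p)
      φ := fun ζ x x' h => F.tr (toMp_rot ζ x x' h)
      φ_par := fun ζ => HVB.tr_par F (fun x => toMp p (rot ζ x)) _ (dSmooth_comp (toMp_smooth p) (rot_smooth ζ))
        (toMp_smooth p) fun x => toMp_rot ζ x _ rfl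
      φ_mul := fun ζ ζ' x x' x'' h h' h'' e => F.tr_tr _ _ _ e
      γ := fun n x x' h => F.tr (toMp_shift n x x' h)
      γ_par := fun n => HVB.tr_par F (fun x => toMp p (shift n x)) _ (dSmooth_comp (toMp_smooth p) (shift_smooth n))
        (toMp_smooth p) fun x => toMp_shift n x _ rfl
      γ_add := fun n n' x x' x'' h h' h'' e => F.tr_tr _ _ _ e
      twist := fun ζ n x x₁ x₂ x₃ h₁ h₂ h₃ h₄ e => by
        rw [zero_mul, zpow_zero, Units.val_one, one_smul]
        exact (F.tr_tr _ _ ((toMp_rot ζ x₁ x₂ h₂).trans (toMp_shift n x x₁ h₁)) e).trans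
          (F.tr_tr _ _ _ e).symm }
  map {F F'} f := ⟨⟨_, f.isPar.pb _ (toMp_smooth p)⟩, fun ζ x x' h e => HVB.tr_nat f _ e, fun n x x' h e => HVB.tr_nat f _ e⟩
  map_id _ := rfl
  map_comp _ _ := rfl

end Tw
end Twisted

/-! ### The inner product of sections -/

section Metric
variable {M : Mfd}

theorem dSmooth_base (G : Gerbe M) (S T : G.Sec) :
    DSmooth (fun t : FibProd S.ζ T.ζ => G.π (S.ζ t.1.1)) :=
  dSmooth_comp G.subm.smooth.dSmooth (dSmooth_comp S.subm.smooth.dSmooth FibProd.dSmooth_fst)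

/-- `P` is the bundle metric of the category of sections of `G`, i.e. `P(S, T)` is the bundle on `M`
obtained from the bundle `E^* ⊗ F` (with fibre `E_z^* ⊗ F_{z'} = Hom(E_z, F_{z'})` over
`(z, z') ∈ Z ×_Y Z'`) by descent along the isomorphisms induced by those of `S = (E, α)` and
`T = (F, β)`, functorially in `S` and `T`.  The smooth parallel sections of `P(S, T)` are
(under `χ`) the morphisms `S → T`. -/
structure BundleMetric (G : Gerbe M) (P : G.Secᵒᵖ × G.Sec ⥤ HVB M.carrier) where
  χ : ∀ (S T : G.Sec) (z : S.Z) (z' : T.Z), S.ζ z = T.ζ z' →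
    ((P.obj (Opposite.op S, T)).fib (G.π (S.ζ z)) ≃ₗᵢ[ℂ] Ten (Du (S.E.fib z)) (T.E.fib z'))
  χ_par : ∀ S T, HVB.IsPar ((P.obj (Opposite.op S, T)).pb _ (dSmooth_base G S T))
    ((S.E.pb _ FibProd.dSmooth_fst).dual.tensor (T.E.pb _ FibProd.dSmooth_snd))
    (fun t => clm (χ S T t.1.1 t.1.2 t.2))
  χ_descent : ∀ (S T : G.Sec) (z₀ z₁ : S.Z) (z₀' z₁' : T.Z) (h₀ : S.ζ z₀ = T.ζ z₀')
    (h₁ : S.ζ z₁ = T.ζ z₁') (h : G.π (S.ζ z₀) = G.π (S.ζ z₁)) (h' : G.π (T.ζ z₀') = G.π (T.ζ z₁'))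
    (v : (P.obj (Opposite.op S, T)).fib (G.π (S.ζ z₁))) (e : S.E.fib z₁),
    tmap (homOf (χ S T z₀ z₀' h₀ ((P.obj (Opposite.op S, T)).tr h.symm v)))
        (clm (G.L.tr (G.pt_eq h h' h₀ h₁))) (S.α z₀ z₁ h e)
      = T.α z₀' z₁' h' (homOf (χ S T z₁ z₁' h₁ v) e)
  χ_nat : ∀ (S S' T T' : G.Sec) (f : S' ⟶ S) (g : T ⟶ T') (w : S'.Z) (z : S.Z) (z' : T.Z) (w' : T'.Z)
    (h : S'.ζ w = S.ζ z) (h' : S.ζ z = T.ζ z') (h'' : T.ζ z' = T'.ζ w')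
    (v : (P.obj (Opposite.op S, T)).fib (G.π (S.ζ z))),
    homOf (χ S' T' w w' (h.trans (h'.trans h'')) ((P.obj (Opposite.op S', T')).tr (congrArg G.π h.symm)
      ((P.map (X := (Opposite.op S, T)) (Y := (Opposite.op S', T')) (f.op, g)).toFun _ v)))
      = g.toFun z' w' h'' ∘L homOf (χ S T z z' h' v) ∘L f.toFun w z h
  hom : ∀ S T : G.Sec, (S ⟶ T) ≃ {s : ∀ x, (P.obj (Opposite.op S, T)).fib x // HVB.IsParSection _ s}
  hom_χ : ∀ (S T : G.Sec) (f : S ⟶ T) (z : S.Z) (z' : T.Z) (h : S.ζ z = T.ζ z'),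
    homOf (χ S T z z' h ((hom S T f).1 (G.π (S.ζ z)))) = f.toFun z z' h

end Metric

/-! ### Čech cohomology and the Dixmier-Douady class -/

section Cech

/-- Open covers of a space indexed by its points: `x ∈ U_x`.  Such covers refine every open
cover. -/
structure Cover (X : Type) [TopologicalSpace X] where
  U : X → Set X
  isOpen : ∀ x, IsOpen (U x)
  mem : ∀ x, x ∈ U x

namespace Cover
variable {X : Type} [TopologicalSpace X]

/-- The order by refinement. -/
instance : Preorder (Cover X) where
  le U V := ∀ x, V.U x ⊆ U.U x
  le_refl U x := subset_rfl
  le_trans U V W h h' x := (h' x).trans (h x)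

instance : DecidableEq (Cover X) := Classical.decEq _

/-- The intersection `U_{x₀} ∩ … ∩ U_{x_k}`. -/
def inter (U : Cover X) {k : ℕ} (x : Fin (k + 1) → X) : Set X := ⋂ i, U.U (x i)

/-- Čech cochains with integer coefficients: families of locally constant functions on the
intersections. -/
abbrev Cochain (U : Cover X) (k : ℕ) : Type := ∀ x : Fin (k + 1) → X, LocallyConstant (U.inter x) ℤ

/-- The restriction of locally constant functions. -/
def resLC {S T : Set X} (h : S ⊆ T) : LocallyConstant T ℤ →+ LocallyConstant S ℤ where
  toFun f := f.comap ⟨Set.inclusion h, continuous_inclusion h⟩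
  map_zero' := rfl
  map_add' _ _ := rfl

theorem inter_succAbove (U : Cover X) {k : ℕ} (x : Fin (k + 2) → X) (i : Fin (k + 2)) :
    U.inter x ⊆ U.inter (x ∘ i.succAbove) := Set.subset_iInter fun j => Set.iInter_subset _ _

theorem inter_mono {U V : Cover X} (h : U ≤ V) {k : ℕ} (x : Fin (k + 1) → X) : V.inter x ⊆ U.inter x :=
  Set.iInter_mono fun j => h _

/-- The Čech differential. -/
def δ (U : Cover X) (k : ℕ) : U.Cochain k →+ U.Cochain (k + 1) where
  toFun c x := ∑ i : Fin (k + 2), (-1 : ℤ) ^ (i : ℕ) • resLC (U.inter_succAbove x i) (c (x ∘ i.succAbove))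
  map_zero' := by
    funext x
    simp
  map_add' c c' := by
    funext x
    simp [Finset.sum_add_distrib]

/-- The refinement map. -/
def refine {U V : Cover X} (h : U ≤ V) (k : ℕ) : U.Cochain k →+ V.Cochain k where
  toFun c x := resLC (inter_mono h x) (c x)
  map_zero' := by
    funext x
    simp
  map_add' c c' := by
    funext x
    simp

theorem δ_refine {U V : Cover X} (h : U ≤ V) (k : ℕ) (c : U.Cochain k) :
    V.δ k (refine h k c) = refine h (k + 1) (U.δ k c) := by
  funext x
  change ∑ i : Fin (k + 2), (-1 : ℤ) ^ (i : ℕ) • resLC _ (resLC _ (c _)) = resLC _ (∑ i : Fin (k + 2), _)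
  rw [map_sum]
  refine Finset.sum_congr rfl fun i _ => ?_
  rw [map_zsmul]
  rfl

/-- The Čech cohomology of a cover in degree `k + 1`. -/
abbrev H (U : Cover X) (k : ℕ) : Type :=
  (U.δ (k + 1)).ker ⧸ ((U.δ k).range.addSubgroupOf (U.δ (k + 1)).ker)

/-- The refinement map on cocycles. -/
def refineKer {U V : Cover X} (h : U ≤ V) (k : ℕ) : (U.δ k).ker →+ (V.δ k).ker :=
  ((refine h k).comp (U.δ k).ker.subtype).codRestrict _ fun c => by
    have hc : U.δ k c.1 = 0 := c.2
    change V.δ k (refine h k c.1) = 0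
    rw [δ_refine, hc, map_zero]

/-- The refinement map on cohomology. -/
def refineH {U V : Cover X} (h : U ≤ V) (k : ℕ) : U.H k →+ V.H k :=
  QuotientAddGroup.map _ _ (refineKer h (k + 1)) fun c hc => by
    obtain ⟨b, hb⟩ := hc
    exact ⟨refine h k b, (δ_refine h k b).trans (congrArg (refine h (k + 1)) hb)⟩

end Cover

/-- The Čech cohomology group `H³(X, ℤ)`. -/
abbrev H3 (X : Type) [TopologicalSpace X] : Type :=
  AddCommGroup.DirectLimit (fun U : Cover X => U.H 2) (fun _ _ h => Cover.refineH h 2)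

end Cech

section DD
variable {M : Mfd}

/-- Subsets of manifolds carry the subspace diffeology. -/
instance (X : Mfd) (S : Set X.carrier) : DiffeologicalSpace S := inducedDiffeology Subtype.val

/-- The section `s` of `E` is smooth. -/
def HVB.IsSmoothSection {X : Type} [DiffeologicalSpace X] (E : HVB X) (s : ∀ x, E.fib x) : Prop :=
  ∀ {n : ℕ} (p : Plot X n) (i : E.ι), ContDiffOn ℝ ∞ (fun u => E.coframe i (p u) (s (p u))) (p ⁻¹' E.dom i)

/-- The Dixmier-Douady class of `G` is `c`: there are local sections `s_x : U_x → Y`, smooth unit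
sections `σ_xy` of `(s_x, s_y)^* L` and continuous functions `f_xyz` with
`μ(σ_xy ⊗ σ_yz) = exp(2πi f_xyz) σ_xz` such that `c` is represented by the integral cocycle `δf`. -/
def Gerbe.IsDDClass (G : Gerbe M) (c : H3 M.carrier) : Prop :=
  ∃ (U : Cover M.carrier) (s : ∀ x, U.U x → G.Y) (hs : ∀ x m, G.π (s x m) = m)
    (hsm : ∀ x, DSmooth (s x))
    (σ : ∀ (x y : M) (m : M) (hx : m ∈ U.U x) (hy : m ∈ U.U y),
      G.L.fib (.mk (s x ⟨m, hx⟩) (s y ⟨m, hy⟩) ((hs x ⟨m, hx⟩).trans (hs y ⟨m, hy⟩).symm)))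
    (f : (Fin 3 → M) → M → ℝ) (n : (U.δ 3).ker),
    (∀ x y, HVB.IsSmoothSection (X := (U.U x ∩ U.U y : Set M.carrier))
      (G.L.pb (fun m => .mk (s x ⟨m.1, m.2.1⟩) (s y ⟨m.1, m.2.2⟩) ((hs x ⟨m.1, m.2.1⟩).trans (hs y ⟨m.1, m.2.2⟩).symm))
        (FibProd.dSmooth_mk (fun k p hp => hsm x k (fun u => ⟨(p u).1, (p u).2.1⟩) hp)
          (fun k p hp => hsm y k (fun u => ⟨(p u).1, (p u).2.2⟩) hp) _))
      (fun m => σ x y m.1 m.2.1 m.2.2)) ∧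
    (∀ x y m hx hy, ‖σ x y m hx hy‖ = 1) ∧
    (∀ x : Fin 3 → M, ContinuousOn (f x) (U.inter x)) ∧
    (∀ (x : Fin 3 → M) (m : M) (h₀ : m ∈ U.U (x 0)) (h₁ : m ∈ U.U (x 1)) (h₂ : m ∈ U.U (x 2)),
      G.μ _ _ _ _ _ (σ (x 0) (x 1) m h₀ h₁ ⊠ σ (x 1) (x 2) m h₁ h₂)
        = Complex.exp (2 * Real.pi * Complex.I * f x m) • σ (x 0) (x 2) m h₀ h₂) ∧
    (∀ (x : Fin 4 → M) (m : U.inter x),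
      (n.1 x m : ℝ) = ∑ i : Fin 4, (-1 : ℝ) ^ (i : ℕ) * f (x ∘ i.succAbove) m) ∧
    AddCommGroup.DirectLimit.of (fun U : Cover M.carrier => U.H 2) (fun _ _ h => Cover.refineH h 2) U
      (QuotientAddGroup.mk n) = c

end DD

end CupGerbe

end

/-!
The assertions on the curving, on the sections and on the Dixmier–Douady class have separate proofs. All of
them use the Hopf line bundle through its sections `[y, 1]` for `y ∈ S³`. The section `[y, 1]` of the pullback
of the `n`-th power to `S³` has norm one and is multiplied by `ζⁿ` when `y` is multiplied by `ζ` (`ell_rot`).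
For the 1-form `η = Im⟨y, dy⟩` it satisfies `∇[y, 1] = n i η [y, 1]` (`incl_par`).

*Curving and curvature.* A local section of the Hopf fibration pulls the determinant which defines the
volume form of `S²` back to `4 Im⟨dσ, dσ⟩`, by a polynomial identity (`det_hopf`). This gives the curvature
`2πi n ω` of the powers of the Hopf bundle (`LocSec.curv`), hence the curving. The 3-form is
`d(2π r ω)`, and `ω` is closed because three tangent vectors of `S²` are linearly dependent.

*Sections as twisted equivariant bundles.* The first two equivalences rest on descent of hermitean bundles with
connection along surjective submersions (`DescentData.desc`). For the covering `S³ × ℝ → M_p` it yields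
`pullEquiv`. For a section of the gerbe, the identity morphism is a descent datum, so its bundle comes from
`Y = L_p × ℝ`. Pulling it back to `S³ × ℝ` and trivializing the line bundle of the gerbe by `[y, 1]` turns
the isomorphism of the section into an action of `ℤ`. As `[y, 1]` has weight `n` for `ℤ_p`, this action
commutes with `ℤ_p` up to `ζⁿ`; as `[y, 1]` is not parallel, the action of `ℤ` becomes parallel only after
the connection is changed by the 1-form `-i r η`, which `r ↦ r + n` changes by `-i n η`. To avoid computing
with composites of descended bundles, the relation between a section and a twisted bundle is expressed by
the structure `Rep`, and morphisms on both sides determine each other (`Rep.toTw`, `Rep.toSec`). The bundle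
metric (`bundleMetric`) follows from `E* ⊗ F ≅ Hom(E, F)`, and the opposite twist from the reflection of
`ℝ` (`Tw.reflectEquiv`).

*The Dixmier–Douady class.* A Čech description of the class amounts to local lifts `r_x` of `M_p → S¹`
to `ℝ` and unit functions `g_xy` on `S³ × S¹` of weight `r_y - r_x` under `ℤ_p`, whose coboundary is
`exp(2πi f)`; the class is that of the integral cocycle `δf` (`IsTwCocycle`). Local sections of the Hopf
fibration provide such data (`exists_isDDClass`), and any two choices differ by unit functions on `M_p`,
which do not change the class (`IsTwCocycle.cls_unique`). The functions `g_xy ^ p` have weight zero, so the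
`p`-fold class vanishes (`IsTwCocycle.smul_cls`).

Conversely, assume that the `m`-fold class vanishes. As real Čech cocycles are coboundaries, the functions
`g_xy ^ m` can be corrected by functions on `M_p` to a strict cocycle, that is, to transition functions of a
line bundle on `S³ × S¹` on which `ℤ_p` acts up to a phase. It is pulled back to a solid cylinder `D² × [0, 1]`
which is glued at its ends in `S³ × S¹` and whose boundary circle is a fibre of the Hopf fibration. There the
line bundle is trivial (`exists_trivialization`), so it is described by a gluing function `F` on `D²` and by
the rotation `D` on `S¹ × [0, 1]`. The weights force `F(ζz) / F(z) = ζ⁻ᵐ D(z, 1) / D(z, 0)`. As `F` extends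
over the disc, it has winding number zero, and taking logarithms along an orbit of `ζ` shows that `p`
divides `m` (`dvd_of_unit_functions`).
-/

open scoped Manifold ContDiff TensorProduct Topology
open Diffeology CategoryTheory

set_option linter.unusedSectionVars false
set_option linter.unusedVariables false

noncomputable section

namespace CupGerbe

/-! ### The curving and the curvature -/

section Curvature
variable {n : ℕ}

theorem two_le_infty : (2 : WithTop ℕ∞) ≤ ∞ :=
  WithTop.coe_le_coe.2 (le_top : (2 : ℕ∞) ≤ ⊤)

theorem wedge_d_apply (α β : Euc n →L[ℝ] ℝ) (v w : Euc n) :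
    ContinuousAlternatingMap.alternatizeUncurryFin
      (((ContinuousAlternatingMap.ofSubsingleton ℝ (Euc n) ℝ (0 : Fin 1)).symm
        (ContinuousAlternatingMap.ofSubsingleton ℝ (Euc n) ℝ 0 α)).smulRight
        (ContinuousAlternatingMap.ofSubsingleton ℝ (Euc n) ℝ (0 : Fin 1) β)) ![v, w]
      = α v * β w - α w * β v := by
  rw [ContinuousAlternatingMap.alternatizeUncurryFin_apply, Fin.sum_univ_two]
  simp [Fin.removeNth, sub_eq_add_neg, Fin.succAbove]

/-- The value of the volume form of `S²` along a plot with the coordinates `s_a`: it is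
`(4π)⁻¹ det (s, ∂_v s, ∂_w s)`. -/
theorem omega_apply (q : Plot S2 n) (u v w : Euc n) :
    omega.val q u ![v, w] = ∑ a : Fin 3, (4 * Real.pi)⁻¹ * S2.coord a (q u) *
      (fderiv ℝ (fun z => S2.coord (a + 1) (q z)) u v * fderiv ℝ (fun z => S2.coord (a + 2) (q z)) u w
        - fderiv ℝ (fun z => S2.coord (a + 1) (q z)) u w
          * fderiv ℝ (fun z => S2.coord (a + 2) (q z)) u v) := by
  refine (ContinuousAlternatingMap.sum_apply _ _).trans ?_
  exact Finset.sum_congr rfl fun a _ => congrArg (_ * ·) (wedge_d_apply _ _ v w)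

theorem differentiable_omega (q : Plot S2 n) : Differentiable ℝ (omega.val q) := by
  have hd : ∀ a, ContDiff ℝ ∞ (fun u => fderiv ℝ (fun z => S2.coord a (q z)) u) :=
    fun a => (S2.coord_smooth a q).fderiv_right (m := ∞) (by simp)
  have hA : ∀ a, ContDiff ℝ ∞ (fun u => ContinuousAlternatingMap.ofSubsingleton ℝ (Euc n) ℝ (0 : Fin 1)
      (fderiv ℝ (fun z => S2.coord a (q z)) u)) := fun a =>
    (ContinuousAlternatingMap.ofSubsingletonLIE (𝕜 := ℝ) (E := Euc n) (F := ℝ)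
      (0 : Fin 1)).toContinuousLinearEquiv.toContinuousLinearMap.contDiff.comp (hd a)
  have hS : ∀ a : Fin 3, ContDiff ℝ ∞ (fun u => ((4 * Real.pi)⁻¹ * S2.coord a (q u)) •
      ContinuousAlternatingMap.alternatizeUncurryFinCLM ℝ (Euc n) ℝ
        ((fderiv ℝ (fun z => S2.coord (a + 1) (q z)) u).smulRight
          (ContinuousAlternatingMap.ofSubsingleton ℝ (Euc n) ℝ (0 : Fin 1)
            (fderiv ℝ (fun z => S2.coord (a + 2) (q z)) u)))) := fun a =>
    (contDiff_const.mul (S2.coord_smooth a q)).smul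
      ((ContinuousAlternatingMap.alternatizeUncurryFinCLM ℝ (Euc n) ℝ).contDiff.comp
        ((hd (a + 1)).smulRight (hA (a + 2))))
  exact (ContDiff.sum (s := Finset.univ) fun a _ => hS a).differentiable (by simp)

theorem S2.sum_sq (s : S2) : S2.coord 0 s ^ 2 + S2.coord 1 s ^ 2 + S2.coord 2 s ^ 2 = 1 := sph2_eq s

theorem S2.sum_mul_fderiv (q : Plot S2 n) (u v : Euc n) :
    S2.coord 0 (q u) * fderiv ℝ (fun z => S2.coord 0 (q z)) u v
      + S2.coord 1 (q u) * fderiv ℝ (fun z => S2.coord 1 (q z)) u v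
      + S2.coord 2 (q u) * fderiv ℝ (fun z => S2.coord 2 (q z)) u v = 0 := by
  have hd : ∀ a, DifferentiableAt ℝ (fun z => S2.coord a (q z)) u :=
    fun a => (S2.coord_smooth a q).contDiffAt.differentiableAt (by simp)
  have h1 : (fun z => S2.coord 0 (q z) ^ 2 + S2.coord 1 (q z) ^ 2 + S2.coord 2 (q z) ^ 2)
      = fun _ => (1 : ℝ) := funext fun z => S2.sum_sq (q z)
  have h2 := (((hd 0).hasFDerivAt.pow 2).add ((hd 1).hasFDerivAt.pow 2)).add ((hd 2).hasFDerivAt.pow 2)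
  have h3 := h2.unique ((hasFDerivAt_const (1 : ℝ) u).congr_of_eventuallyEq
    (Filter.Eventually.of_forall fun z => S2.sum_sq (q z)))
  have h4 := DFunLike.congr_fun h3 v
  simp at h4
  linarith

/-- Three vectors orthogonal to a unit vector of `ℝ³` are linearly dependent. -/
theorem det_eq_zero_of_orthogonal {x₀ x₁ x₂ a₀ a₁ a₂ b₀ b₁ b₂ c₀ c₁ c₂ : ℝ}
    (h : x₀ ^ 2 + x₁ ^ 2 + x₂ ^ 2 = 1) (ha : x₀ * a₀ + x₁ * a₁ + x₂ * a₂ = 0)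
    (hb : x₀ * b₀ + x₁ * b₁ + x₂ * b₂ = 0) (hc : x₀ * c₀ + x₁ * c₁ + x₂ * c₂ = 0) :
    a₀ * (b₁ * c₂ - b₂ * c₁) + a₁ * (b₂ * c₀ - b₀ * c₂) + a₂ * (b₀ * c₁ - b₁ * c₀) = 0 := by
  set D := a₀ * (b₁ * c₂ - b₂ * c₁) + a₁ * (b₂ * c₀ - b₀ * c₂) + a₂ * (b₀ * c₁ - b₁ * c₀) with hD
  have e₀ : x₀ * D = 0 := by
    rw [hD]; linear_combination (b₁ * c₂ - b₂ * c₁) * ha + (c₁ * a₂ - c₂ * a₁) * hb + (a₁ * b₂ - a₂ * b₁) * hc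
  have e₁ : x₁ * D = 0 := by
    rw [hD]; linear_combination (b₂ * c₀ - b₀ * c₂) * ha + (c₂ * a₀ - c₀ * a₂) * hb + (a₂ * b₀ - a₀ * b₂) * hc
  have e₂ : x₂ * D = 0 := by
    rw [hD]; linear_combination (b₀ * c₁ - b₁ * c₀) * ha + (c₀ * a₁ - c₁ * a₀) * hb + (a₀ * b₁ - a₁ * b₀) * hc
  linear_combination x₀ * e₀ + x₁ * e₁ + x₂ * e₂ - D * h

/-- The determinant which defines the volume form of `S²`, pulled back along the Hopf map, is a multiple of
`Im⟨V, W⟩` on tangent vectors of `S³`. The function `D` is the differential of the Hopf map at `σ`. -/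
theorem det_hopf {σ V W : C2} (h : ‖σ‖ = 1) (hV : (inner ℂ σ V : ℂ).re = 0) (hW : (inner ℂ σ W : ℂ).re = 0)
    {D : C2 → Fin 3 → ℝ}
    (h0 : ∀ v, D v 0 = 2 * (starRingEnd ℂ (v 0) * σ 1 + starRingEnd ℂ (σ 0) * v 1).re)
    (h1 : ∀ v, D v 1 = 2 * (starRingEnd ℂ (v 0) * σ 1 + starRingEnd ℂ (σ 0) * v 1).im)
    (h2 : ∀ v, D v 2 = 2 * (starRingEnd ℂ (σ 0) * v 0 - starRingEnd ℂ (σ 1) * v 1).re) :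
    ∑ a : Fin 3, hopfR3 σ a * (D V (a + 1) * D W (a + 2) - D W (a + 1) * D V (a + 2))
      = 4 * (inner ℂ V W : ℂ).im := by
  have e : ‖σ 0‖ ^ 2 + ‖σ 1‖ ^ 2 = 1 := by
    have := EuclideanSpace.norm_sq_eq σ
    rw [h, Fin.sum_univ_two] at this
    linarith
  rw [Fin.sum_univ_three]
  simp only [show (0 + 1 : Fin 3) = 1 from rfl, show (0 + 2 : Fin 3) = 2 from rfl, show (1 + 1 : Fin 3) = 2 from rfl,
    show (1 + 2 : Fin 3) = 0 from rfl, show (2 + 1 : Fin 3) = 0 from rfl, show (2 + 2 : Fin 3) = 1 from rfl,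
    h0, h1, h2]
  simp only [PiLp.inner_apply, Fin.sum_univ_two, RCLike.inner_apply, hopfR3, PiLp.toLp_apply,
    Matrix.cons_val_zero, Matrix.cons_val_one, Matrix.cons_val, Complex.sq_norm, Complex.normSq_apply,
    Complex.add_re, Complex.add_im, Complex.mul_re, Complex.mul_im, Complex.conj_re, Complex.conj_im,
    Complex.sub_re] at e hV hW ⊢
  generalize (σ 0).re = a at *
  generalize (σ 0).im = b at *
  generalize (σ 1).re = c at *
  generalize (σ 1).im = d at *
  generalize (V 0).re = a' at *
  generalize (V 0).im = b' at *
  generalize (V 1).re = c' at *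
  generalize (V 1).im = d' at *
  generalize (W 0).re = a'' at *
  generalize (W 0).im = b'' at *
  generalize (W 1).re = c'' at *
  generalize (W 1).im = d'' at *
  -- Both sides are polynomials in twelve real variables; the coefficients express their difference in the
  -- ideal of the relations `‖σ‖ = 1`, `Re⟨σ, V⟩ = 0` and `Re⟨σ, W⟩ = 0`.
  linear_combination
    (4 * (a' * b'' - b' * a'' + c' * d'' - d' * c'') * (a * a + b * b + (c * c + d * d) + 1)) * e
    - (4 * (a * a + b * b + (c * c + d * d)) * (a * b'' - b * a'' + c * d'' - d * c'')) * hV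
    + (4 * (a * a + b * b + (c * c + d * d)) * (a * b' - b * a' + c * d' - d * c')) * hW

/-- The exterior derivative of `2π r ω` along a plot of `S²` and a smooth function `r`; the volume
form is closed since three tangent vectors of `S²` are linearly dependent. -/
theorem extDeriv_smul_omega (q : Plot S2 n) {r : Euc n → ℝ} (hr : ContDiff ℝ ∞ r) (u : Euc n)
    (v : Fin 3 → Euc n) :
    extDeriv (fun z => (2 * Real.pi * r z) • omega.val q z) u v
      = 2 * Real.pi * (fderiv ℝ r u (v 0) * omega.val q u ![v 1, v 2]
        - fderiv ℝ r u (v 1) * omega.val q u ![v 0, v 2]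
        + fderiv ℝ r u (v 2) * omega.val q u ![v 0, v 1]) := by
  have hx : ∀ a, ContDiff ℝ ∞ (fun z => S2.coord a (q z)) := fun a => S2.coord_smooth a q
  have hrd := hr.contDiffAt (x := u) |>.differentiableAt (by simp)
  have hd : ∀ a, DifferentiableAt ℝ (fun z => S2.coord a (q z)) u :=
    fun a => (hx a).contDiffAt.differentiableAt (by simp)
  have hdd : ∀ a, DifferentiableAt ℝ (fderiv ℝ (fun z => S2.coord a (q z))) u :=
    fun a => ((hx a).fderiv_right (m := ∞) (by simp)).contDiffAt.differentiableAt (by simp)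
  have hsym : ∀ a w w', fderiv ℝ (fderiv ℝ (fun z => S2.coord a (q z))) u w w'
      = fderiv ℝ (fderiv ℝ (fun z => S2.coord a (q z))) u w' w := fun a w w' =>
    (hx a).contDiffAt.isSymmSndFDerivAt (by rw [minSmoothness_of_isRCLikeNormedField]; exact two_le_infty) w w'
  have hw : ∀ a w, HasFDerivAt (fun z => fderiv ℝ (fun z => S2.coord a (q z)) z w)
      ((fderiv ℝ (fderiv ℝ (fun z => S2.coord a (q z))) u).flip w) u := fun a w => by
    have := (hdd a).hasFDerivAt.clm_apply (hasFDerivAt_const w u)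
    simpa using this
  have key : ∀ w w' t, fderiv ℝ (fun z => ((2 * Real.pi * r z) • omega.val q z) ![w, w']) u t
      = 2 * Real.pi * fderiv ℝ r u t * omega.val q u ![w, w'] + 2 * Real.pi * r u * ∑ a : Fin 3, (4 * Real.pi)⁻¹ *
        (fderiv ℝ (fun z => S2.coord a (q z)) u t *
          (fderiv ℝ (fun z => S2.coord (a + 1) (q z)) u w * fderiv ℝ (fun z => S2.coord (a + 2) (q z)) u w'
            - fderiv ℝ (fun z => S2.coord (a + 1) (q z)) u w' * fderiv ℝ (fun z => S2.coord (a + 2) (q z)) u w)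
        + S2.coord a (q u) *
          (fderiv ℝ (fderiv ℝ (fun z => S2.coord (a + 1) (q z))) u t w * fderiv ℝ (fun z => S2.coord (a + 2) (q z)) u w'
            + fderiv ℝ (fun z => S2.coord (a + 1) (q z)) u w * fderiv ℝ (fderiv ℝ (fun z => S2.coord (a + 2) (q z))) u t w'
            - fderiv ℝ (fderiv ℝ (fun z => S2.coord (a + 1) (q z))) u t w' * fderiv ℝ (fun z => S2.coord (a + 2) (q z)) u w
            - fderiv ℝ (fun z => S2.coord (a + 1) (q z)) u w'
              * fderiv ℝ (fderiv ℝ (fun z => S2.coord (a + 2) (q z))) u t w)) := by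
    intro w w' t
    have h1 : ∀ a : Fin 3, HasFDerivAt _ _ u := fun a =>
      (((hd a).hasFDerivAt.const_mul (4 * Real.pi)⁻¹).mul
        (((hw (a + 1) w).mul (hw (a + 2) w')).sub ((hw (a + 1) w').mul (hw (a + 2) w))))
    have h2 := (hrd.hasFDerivAt.const_mul (2 * Real.pi)).mul (HasFDerivAt.fun_sum (u := Finset.univ) fun a _ => h1 a)
    have h3 := h2.congr_of_eventuallyEq (f₁ := fun z => ((2 * Real.pi * r z) • omega.val q z) ![w, w'])
      (Filter.Eventually.of_forall fun z => congrArg (2 * Real.pi * r z * ·) (omega_apply q z w w'))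
    rw [h3.fderiv, omega_apply]
    simp [Fin.sum_univ_three]
    ring
  have h1 : DifferentiableAt ℝ (fun z => (2 * Real.pi * r z) • omega.val q z) u :=
    (hrd.const_mul _).smul (differentiable_omega q u)
  rw [extDeriv_apply h1, Fin.sum_univ_three]
  have e0 : Fin.removeNth 0 v = ![v 1, v 2] := by ext i : 1; fin_cases i <;> rfl
  have e1 : Fin.removeNth 1 v = ![v 0, v 2] := by ext i : 1; fin_cases i <;> rfl
  have e2 : Fin.removeNth 2 v = ![v 0, v 1] := by ext i : 1; fin_cases i <;> rfl
  rw [e0, e1, e2, key, key, key]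
  have h0 := det_eq_zero_of_orthogonal (S2.sum_sq (q u)) (S2.sum_mul_fderiv q u (v 0))
    (S2.sum_mul_fderiv q u (v 1)) (S2.sum_mul_fderiv q u (v 2))
  simp only [Fin.sum_univ_three, show (0 + 1 : Fin 3) = 1 from rfl, show (0 + 2 : Fin 3) = 2 from rfl,
    show (1 + 1 : Fin 3) = 2 from rfl, show (1 + 2 : Fin 3) = 0 from rfl, show (2 + 1 : Fin 3) = 0 from rfl,
    show (2 + 2 : Fin 3) = 1 from rfl, hsym _ (v 1) (v 0), hsym _ (v 2) (v 0), hsym _ (v 2) (v 1),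
    Fin.val_zero, Fin.val_one, Fin.val_two, pow_zero, pow_one]
  generalize fderiv ℝ (fderiv ℝ (fun z => S2.coord 0 (q z))) u = D0
  generalize fderiv ℝ (fderiv ℝ (fun z => S2.coord 1 (q z))) u = D1
  generalize fderiv ℝ (fderiv ℝ (fun z => S2.coord 2 (q z))) u = D2
  linear_combination (6 * Real.pi * r u * (4 * Real.pi)⁻¹) * h0

/-- The coordinates of the differential of the Hopf map at `y`. -/
def dHopf (y v : C2) : Fin 3 → ℝ :=
  ![2 * (starRingEnd ℂ (v 0) * y 1 + starRingEnd ℂ (y 0) * v 1).re,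
    2 * (starRingEnd ℂ (v 0) * y 1 + starRingEnd ℂ (y 0) * v 1).im,
    2 * (starRingEnd ℂ (y 0) * v 0 - starRingEnd ℂ (y 1) * v 1).re]

theorem fderiv_hopfR3_comp {g : Euc n → C2} {u : Euc n} (hg : DifferentiableAt ℝ g u) (a : Fin 3) (v : Euc n) :
    fderiv ℝ (fun z => hopfR3 (g z) a) u v = dHopf (g u) (fderiv ℝ g u v) a := by
  have hc : ∀ i : Fin 2, HasFDerivAt (fun z => g z i)
      (((EuclideanSpace.proj i : C2 →L[ℂ] ℂ).restrictScalars ℝ).comp (fderiv ℝ g u)) u := fun i =>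
    ((EuclideanSpace.proj i : C2 →L[ℂ] ℂ).restrictScalars ℝ).hasFDerivAt.comp u hg.hasFDerivAt
  have hj : ∀ i j : Fin 2, HasFDerivAt (fun z => starRingEnd ℂ (g z i) * g z j) _ u := fun i j =>
    (Complex.conjCLE.toContinuousLinearMap.hasFDerivAt.comp u (hc i)).mul (hc j)
  fin_cases a
  · have h := (Complex.reCLM.hasFDerivAt.comp u (hj 0 1)).const_mul 2
    refine (DFunLike.congr_fun (HasFDerivAt.fderiv (f := fun z => hopfR3 (g z) 0) h) v).trans ?_
    simp [dHopf]
    ring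
  · have h := (Complex.imCLM.hasFDerivAt.comp u (hj 0 1)).const_mul 2
    refine (DFunLike.congr_fun (HasFDerivAt.fderiv (f := fun z => hopfR3 (g z) 1) h) v).trans ?_
    simp [dHopf]
    ring
  · have h := Complex.reCLM.hasFDerivAt.comp u ((hj 0 0).sub (hj 1 1))
    have e : (fun z => hopfR3 (g z) 2) = fun z => (starRingEnd ℂ (g z 0) * g z 0 - starRingEnd ℂ (g z 1) * g z 1).re := by
      funext z
      simp [hopfR3, Complex.sq_norm, Complex.normSq_apply]
    refine (DFunLike.congr_fun ((congrArg (fun f => fderiv ℝ f u) e).trans h.fderiv) v).trans ?_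
    simp [dHopf]
    ring

/-- The connection form `Im⟨σ, dσ⟩` of the Hopf line bundle has the exterior derivative `2π ω`: the second
derivatives of `σ` cancel, and the rest is the pullback of the determinant along the Hopf map. -/
theorem LocSec.curv (σ : LocSec) (q : Plot S2Z n) {u : Euc n} (hu : (q u).s ∈ σ.U) (v w : Euc n) :
    fderiv ℝ (σ.form (fun w => (q w).s)) u v w - fderiv ℝ (σ.form (fun w => (q w).s)) u w v
      = 2 * Real.pi * omega.val ⟨fun u => (q u).s, plot_S2 q⟩ u ![v, w] := by
  have hg := σ.contDiffAt q hu
  have hev : ∀ᶠ z in 𝓝 u, (q z).s ∈ σ.U := (σ.isOpen_dom q).mem_nhds hu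
  have hgd := hg.differentiableAt (by simp)
  have hgdd : DifferentiableAt ℝ (fderiv ℝ (fun z => (σ.σ (q z).s : C2))) u :=
    (hg.fderiv_right (m := ∞) (by simp)).differentiableAt (by simp)
  have hsym := hg.isSymmSndFDerivAt (by rw [minSmoothness_of_isRCLikeNormedField]; exact two_le_infty)
  have hfd : DifferentiableAt ℝ (σ.form (fun w => (q w).s)) u :=
    ((σ.form_smooth q).contDiffAt ((σ.isOpen_dom q).mem_nhds hu)).differentiableAt (by simp)
  have h1 : ∀ v w, fderiv ℝ (σ.form (fun w => (q w).s)) u v w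
      = (inner ℂ (σ.σ (q u).s : C2) (fderiv ℝ (fderiv ℝ (fun z => (σ.σ (q z).s : C2))) u v w) : ℂ).im
        + (inner ℂ (fderiv ℝ (fun z => (σ.σ (q z).s : C2)) u v)
          (fderiv ℝ (fun z => (σ.σ (q z).s : C2)) u w) : ℂ).im := by
    intro v w
    have a1 : HasFDerivAt (fun z => σ.form (fun w => (q w).s) z w)
        ((fderiv ℝ (σ.form (fun w => (q w).s)) u).flip w) u := by
      simpa using hfd.hasFDerivAt.clm_apply (hasFDerivAt_const w u)
    have a2 : HasFDerivAt (fun z => fderiv ℝ (fun z => (σ.σ (q z).s : C2)) z w)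
        ((fderiv ℝ (fderiv ℝ (fun z => (σ.σ (q z).s : C2))) u).flip w) u := by
      simpa using hgdd.hasFDerivAt.clm_apply (hasFDerivAt_const w u)
    have a3 := Complex.imCLM.hasFDerivAt.comp u (hgd.hasFDerivAt.inner ℂ a2)
    exact DFunLike.congr_fun (a1.unique a3) v
  have hco : ∀ a v, fderiv ℝ (fun z => S2.coord a (q z).s) u v
      = dHopf (σ.σ (q u).s) (fderiv ℝ (fun z => (σ.σ (q z).s : C2)) u v) a := fun a v => by
    have e : (fun z => S2.coord a (q z).s) =ᶠ[𝓝 u] fun z => hopfR3 (σ.σ (q z).s) a :=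
      hev.mono fun z hz => congrArg (fun s : Sph2 => s.1 a) (σ.hopf_σ _ hz).symm
    rw [e.fderiv_eq]
    exact fderiv_hopfR3_comp hgd a v
  have hre : ∀ v, (inner ℂ (σ.σ (q u).s : C2) (fderiv ℝ (fun w => (σ.σ (q w).s : C2)) u v) : ℂ).re = 0 := fun v => by
    rw [(σ.inner_self_fderiv q hu v).1]
    simp
  have hd := det_hopf (D := dHopf (σ.σ (q u).s)) (norm_eq_of_mem_sphere _) (hre v) (hre w) (fun _ => rfl)
    (fun _ => rfl) (fun _ => rfl)
  have hs : ∀ a, hopfR3 (σ.σ (q u).s) a = S2.coord a (q u).s := fun a =>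
    congrArg (fun s : Sph2 => s.1 a) (σ.hopf_σ _ hu)
  have ho : omega.val ⟨fun u => (q u).s, plot_S2 q⟩ u ![v, w] = (4 * Real.pi)⁻¹ *
      (4 * (inner ℂ (fderiv ℝ (fun z => (σ.σ (q z).s : C2)) u v)
        (fderiv ℝ (fun z => (σ.σ (q z).s : C2)) u w) : ℂ).im) := by
    rw [← hd, Finset.mul_sum]
    refine (omega_apply _ u v w).trans (Finset.sum_congr rfl fun a _ => by
    rw [hs, ← hco, ← hco, ← hco, ← hco, ← mul_assoc])
  have hsw : (inner ℂ (fderiv ℝ (fun z => (σ.σ (q z).s : C2)) u w)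
      (fderiv ℝ (fun z => (σ.σ (q z).s : C2)) u v) : ℂ).im = -(inner ℂ (fderiv ℝ (fun z => (σ.σ (q z).s : C2)) u v)
        (fderiv ℝ (fun z => (σ.σ (q z).s : C2)) u w) : ℂ).im := by
    rw [← inner_conj_symm, Complex.conj_im]
  have hπ := Real.pi_ne_zero
  rw [h1, h1, ho, hsw, hsym v w]
  field_simp
  ring

theorem iSkew_comm (m : ℤ) (a b : ℝ) : iSkew m a ∘L iSkew m b - iSkew m b ∘L iSkew m a = 0 := by
  refine ContinuousLinearMap.ext fun z => ?_
  simp only [sub_apply, ContinuousLinearMap.comp_apply, iSkew_apply, zero_apply]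
  ring

/-- The curvature of the `n`-th power of the Hopf line bundle is `2πi n ω`, since line bundles have
commuting connection forms. -/
theorem hopfPowers_curv (σ : LocSec) (q : Plot S2Z n) {u : Euc n} (hu : (q u).s ∈ σ.U) (v w : Euc n)
    {C : Euc n → Euc n →L[ℝ] (ℂ →L[ℂ] ℂ)} (hC : C = fun z => iSkew (q z).n ∘L σ.form (fun w => (q w).s) z) :
    fderiv ℝ C u v w - fderiv ℝ C u w v + (C u v ∘L C u w - C u w ∘L C u v)
      = (Complex.I * ((q u).n * (2 * Real.pi * omega.val ⟨fun u => (q u).s, plot_S2 q⟩ u ![v, w]) : ℝ)) •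
        ContinuousLinearMap.id ℂ ℂ := by
  have hfd : DifferentiableAt ℝ (σ.form (fun w => (q w).s)) u :=
    ((σ.form_smooth q).contDiffAt ((σ.isOpen_dom q).mem_nhds hu)).differentiableAt (by simp)
  have e : C = fun z => iSkew (q u).n ∘L σ.form (fun w => (q w).s) z := hC.trans <|
    funext fun z => congrArg (fun m => iSkew m ∘L σ.form (fun w => (q w).s) z) (plot_Z q z u)
  have e2 : ∀ v w, fderiv ℝ C u v w = iSkew (q u).n (fderiv ℝ (σ.form (fun w => (q w).s)) u v w) := by
    intro v w
    have e1 := (hasFDerivAt_const (iSkew (q u).n) u).clm_comp hfd.hasFDerivAt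
    refine (congrArg (fun f : Euc n → Euc n →L[ℝ] (ℂ →L[ℂ] ℂ) => fderiv ℝ f u v w) e).trans ?_
    refine (congrArg (fun T : Euc n →L[ℝ] Euc n →L[ℝ] (ℂ →L[ℂ] ℂ) => T v w) e1.fderiv).trans ?_
    simp
  have e3 : C u = iSkew (q u).n ∘L σ.form (fun w => (q w).s) u := congrArg (fun f => f u) hC
  rw [e2, e2, ← map_sub, σ.curv q hu v w, e3]
  refine (congrArg (_ + ·) (iSkew_comm (q u).n (σ.form (fun w => (q w).s) u v) (σ.form (fun w => (q w).s) u w))).trans ?_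
  refine ContinuousLinearMap.ext fun z => ?_
  simp only [add_zero, iSkew_apply, smul_apply, ContinuousLinearMap.id_apply, smul_eq_mul]
  push_cast
  ring

variable (p : ℕ) [NeZero p]

/-- The difference of the two pullbacks of `B` to `Y ×_M Y`. -/
def cupCurvingDiff : DForm 2 (FibProd (cupGerbe p).π (cupGerbe p).π) where
  val q u := ((cupCurving p).pb _ FibProd.dSmooth_snd).val q u - ((cupCurving p).pb _ FibProd.dSmooth_fst).val q u
  smooth q v := (((cupCurving p).pb _ FibProd.dSmooth_snd).smooth q v).sub
    (((cupCurving p).pb _ FibProd.dSmooth_fst).smooth q v)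
  reparam q h hh u := by
    rw [((cupCurving p).pb _ FibProd.dSmooth_snd).reparam q h hh u,
      ((cupCurving p).pb _ FibProd.dSmooth_fst).reparam q h hh u]
    rfl

theorem cupGerbe_isCurving : (cupGerbe p).IsCurving (cupCurving p) := by
  refine ⟨cupCurvingDiff p, fun {n} q (σ : LocSec) u hu v w => ?_, fun _ _ => rfl⟩
  refine (hopfPowers_curv σ (q.map _ toS2Z_smooth) hu v w rfl).trans ?_
  have hr : (((q.map _ toS2Z_smooth : Plot S2Z n) u).n : ℝ) = Yp.r (q u).1.2 - Yp.r (q u).1.1 := round_sub (q u).2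
  have hx : ∀ z, Yp.x (q z).1.1 = Yp.x (q z).1.2 := fun z => (proj_eq p (q z).2).1
  have hv : (cupCurvingDiff p).val q u ![v, w] = 2 * Real.pi * Yp.r (q u).1.2 * omega.val
        ⟨fun u => ((q.map _ toS2Z_smooth : Plot S2Z n) u).s, plot_S2 _⟩ u ![v, w]
      - 2 * Real.pi * Yp.r (q u).1.1 * omega.val
        ⟨fun u => ((q.map _ toS2Z_smooth : Plot S2Z n) u).s, plot_S2 _⟩ u ![v, w] := by
    have e : (⟨fun u => ((q.map _ toS2Z_smooth : Plot S2Z n) u).s, plot_S2 _⟩ : Plot S2 n)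
        = ((q.map _ FibProd.dSmooth_snd).map (fun y : Yp p => lensToS2 p (Yp.x y))
          (fun _ _ h => (lensToS2_smooth p).dSmooth _ _ ((Yp.x_smooth p).dSmooth _ _ h))) :=
      Subtype.ext (funext fun z => congrArg (lensToS2 p) (hx z))
    have e' := congrArg (fun c : Plot S2 n => omega.val c u ![v, w]) e
    exact congrArg (2 * Real.pi * Yp.r (q u).1.2 * · - 2 * Real.pi * Yp.r (q u).1.1 * omega.val
        ⟨fun u => ((q.map _ toS2Z_smooth : Plot S2Z n) u).s, plot_S2 _⟩ u ![v, w]) e'.symm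
  rw [hv, hr]
  congr 3
  ring

theorem cupGerbe_hasCurvature : (cupGerbe p).HasCurvature (cupCurving p) (cupCurvature p) := by
  intro n (q : Plot (Yp p) n) u
  have hr : ContDiff ℝ ∞ (fun z => Yp.r (q z)) := SmoothFun.of_contMDiff (X := Yp p) (Yp.r_smooth p) q
  let c : Plot S2 n := q.map (fun y : Yp p => lensToS2 p (Yp.x y))
      (fun _ _ h => (lensToS2_smooth p).dSmooth _ _ ((Yp.x_smooth p).dSmooth _ _ h))
  -- The form `dr` on the circle pulls back to the differential of the coordinate of `ℝ`.
  have hd : ∀ z v, drForm.val (((q.map (proj p) (proj_smooth p).dSmooth)).map (fun m : Mp p => (Mp.z m : S1))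
      (Mfd.Smooth.dSmooth (X := Mp p) (Y := S1) (Mp.z_smooth p))) z v = fderiv ℝ (fun z => Yp.r (q z)) z (v 0) := by
    intro z v
    have hz := (hr.contDiffAt (x := z)).differentiableAt (by simp)
    have h1 : HasFDerivAt (fun z => 2 * Real.pi * Yp.r (q z)) _ z := hz.hasFDerivAt.const_mul (2 * Real.pi)
    have ec : ∀ y : Yp p, S1.re (Mp.z (proj p y)) = Real.cos (2 * Real.pi * Yp.r y) := fun y => by
      change (Circle.exp (2 * Real.pi * Yp.r y) : ℂ).re = _
      rw [Circle.coe_exp, Complex.exp_ofReal_mul_I_re]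
    have es : ∀ y : Yp p, S1.im (Mp.z (proj p y)) = Real.sin (2 * Real.pi * Yp.r y) := fun y => by
      change (Circle.exp (2 * Real.pi * Yp.r y) : ℂ).im = _
      rw [Circle.coe_exp, Complex.exp_ofReal_mul_I_im]
    have h2 : fderiv ℝ (fun z => S1.im (Mp.z (proj p (q z)))) z (v 0)
        = Real.cos (2 * Real.pi * Yp.r (q z)) * (2 * Real.pi * fderiv ℝ (fun z => Yp.r (q z)) z (v 0)) := by
      rw [funext fun z => es (q z), h1.sin.fderiv]
      simp
    have h3 : fderiv ℝ (fun z => S1.re (Mp.z (proj p (q z)))) z (v 0)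
        = -(Real.sin (2 * Real.pi * Yp.r (q z)) * (2 * Real.pi * fderiv ℝ (fun z => Yp.r (q z)) z (v 0))) := by
      rw [funext fun z => ec (q z), h1.cos.fderiv]
      simp
    refine (ContinuousAlternatingMap.sum_apply _ _).trans ((Fin.sum_univ_two _).trans ?_)
    change (2 * Real.pi)⁻¹ * S1.re (Mp.z (proj p (q z))) * fderiv ℝ (fun z => S1.im (Mp.z (proj p (q z)))) z (v 0)
      + -(2 * Real.pi)⁻¹ * S1.im (Mp.z (proj p (q z))) * fderiv ℝ (fun z => S1.re (Mp.z (proj p (q z)))) z (v 0) = _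
    rw [h2, h3, ec, es]
    have h4 := Real.sin_sq_add_cos_sq (2 * Real.pi * Yp.r (q z))
    have hπ := Real.pi_ne_zero
    field_simp
    linear_combination (fderiv ℝ (fun z => Yp.r (q z)) z (v 0)) * h4
  ext v
  refine (extDeriv_smul_omega c hr u v).trans ?_
  have e0 : Fin.removeNth 0 v = ![v 1, v 2] := by ext i : 1; fin_cases i <;> rfl
  have e1 : Fin.removeNth 1 v = ![v 0, v 2] := by ext i : 1; fin_cases i <;> rfl
  have e2 : Fin.removeNth 2 v = ![v 0, v 1] := by ext i : 1; fin_cases i <;> rfl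
  have hw : (cupCurvature p).val (q.map (proj p) (proj_smooth p).dSmooth) u v = 2 * Real.pi *
      ((-1 : ℤ) ^ 0 • (drForm.val (((q.map (proj p) (proj_smooth p).dSmooth)).map (fun m : Mp p => (Mp.z m : S1))
        (Mfd.Smooth.dSmooth (X := Mp p) (Y := S1) (Mp.z_smooth p))) u (fun _ => v 0) * omega.val c u (Fin.removeNth 0 v))
      + (-1 : ℤ) ^ 1 • (drForm.val (((q.map (proj p) (proj_smooth p).dSmooth)).map (fun m : Mp p => (Mp.z m : S1))
        (Mfd.Smooth.dSmooth (X := Mp p) (Y := S1) (Mp.z_smooth p))) u (fun _ => v 1) * omega.val c u (Fin.removeNth 1 v))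
      + (-1 : ℤ) ^ 2 • (drForm.val (((q.map (proj p) (proj_smooth p).dSmooth)).map (fun m : Mp p => (Mp.z m : S1))
        (Mfd.Smooth.dSmooth (X := Mp p) (Y := S1) (Mp.z_smooth p))) u (fun _ => v 2) * omega.val c u (Fin.removeNth 2 v))) :=
    congrArg (2 * Real.pi * ·) ((ContinuousAlternatingMap.alternatizeUncurryFin_apply
      (((ContinuousAlternatingMap.ofSubsingleton ℝ (Euc n) ℝ (0 : Fin 1)).symm
        (drForm.val (((q.map (proj p) (proj_smooth p).dSmooth)).map (fun m : Mp p => (Mp.z m : S1))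
        (Mfd.Smooth.dSmooth (X := Mp p) (Y := S1) (Mp.z_smooth p))) u)).smulRight (omega.val c u)) v).trans
        (Fin.sum_univ_three _))
  refine Eq.trans ?_ hw.symm
  rw [e0, e1, e2, hd, hd, hd]
  simp
  ring

end Curvature

/-! ### Descent of hermitean vector bundles with connection -/

/-- A section of a map of manifolds that is defined and smooth on an open set. -/
structure LocSect {Z Y : Mfd} (f : Z → Y) where
  U : Set Y
  isOpen : IsOpen U
  s : Y → Z
  smooth : ContMDiffOn Y.I Z.I ∞ s U
  sec : ∀ y ∈ U, f (s y) = y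

section Descent
variable {Z Y : Mfd} {f : Z → Y}

theorem IsSurjSubm.exists_locSect (hf : IsSurjSubm f) (y : Y) : ∃ σ : LocSect f, y ∈ σ.U := by
  obtain ⟨z, rfl⟩ := hf.surj y
  obtain ⟨U, hU, s, hs, -, hfs⟩ := hf.sec z
  exact ⟨⟨interior U, isOpen_interior, s, hs.mono interior_subset, fun y hy =>
    hfs y (interior_subset hy)⟩, mem_interior_iff_mem_nhds.2 hU⟩

theorem LocSect.isOpen_dom (σ : LocSect f) {n : ℕ} (p : Plot Y n) : IsOpen (p ⁻¹' σ.U) :=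
  σ.isOpen.preimage (Mfd.isPlot_iff.1 p.2).continuous

/-- Local sections lift plots locally. -/
theorem LocSect.exists_plot (σ : LocSect f) {n : ℕ} (p : Plot Y n) {u : Euc n} (h : p u ∈ σ.U) :
    ∃ q : Plot Z n, ∀ᶠ w in 𝓝 u, q w = σ.s (p w) := by
  obtain ⟨c, hc, hcU, hcu⟩ := exists_retract u ((σ.isOpen_dom p).mem_nhds h)
  have hp : ContMDiff 𝓘(ℝ, Euc n) Y.I ∞ p.1 := p.2
  refine ⟨⟨σ.s ∘ p.1 ∘ c, Mfd.isPlot_iff.2 (σ.smooth.comp_contMDiff (hp.comp hc.contMDiff) hcU)⟩, ?_⟩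
  filter_upwards [hcu] with w hw
  exact congrArg (fun v => σ.s (p.1 v)) hw

/-- Plots with the same image near a point form a plot of the fibre product near that point. -/
theorem FibProd.exists_plot {A B M : Type} [DiffeologicalSpace A] [DiffeologicalSpace B]
    {a : A → M} {b : B → M} {n : ℕ} (q₀ : Plot A n) (q₁ : Plot B n) {u : Euc n}
    (h : ∀ᶠ w in 𝓝 u, a (q₀ w) = b (q₁ w)) :
    ∃ t : Plot (FibProd a b) n, ∀ᶠ w in 𝓝 u, (t w).1.1 = q₀ w ∧ (t w).1.2 = q₁ w := by
  obtain ⟨c, hc, hcs, hcu⟩ := exists_retract u h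
  refine ⟨⟨fun w => FibProd.mk (q₀ (c w)) (q₁ (c w)) (hcs w),
    FibProd.isPlot_iff.2 ⟨isPlot_reparam q₀.2 hc, isPlot_reparam q₁.2 hc⟩⟩, ?_⟩
  filter_upwards [hcu] with w hw
  exact ⟨congrArg q₀.1 hw, congrArg q₁.1 hw⟩

/-- Descent data for the bundle `E` along `f`: parallel unitary isomorphisms between the fibres over
points with the same image, compatible with composition. -/
structure DescentData (f : Z → Y) (E : HVB Z.carrier) where
  θ : ∀ z₀ z₁ : Z, f z₀ = f z₁ → (E.fib z₁ ≃ₗᵢ[ℂ] E.fib z₀)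
  par : HVB.IsPar (X := FibProd f f) (E.pb _ FibProd.dSmooth_snd) (E.pb _ FibProd.dSmooth_fst)
    (fun t => clm (θ t.1.1 t.1.2 t.2))
  cocycle : ∀ (z₀ z₁ z₂ : Z) (h : f z₀ = f z₁) (h' : f z₁ = f z₂) (e : E.fib z₂),
    θ z₀ z₁ h (θ z₁ z₂ h' e) = θ z₀ z₂ (h.trans h') e

namespace DescentData
variable {E : HVB Z.carrier} (D : DescentData f E)

theorem θ_self (z : Z) (h : f z = f z) (e : E.fib z) : D.θ z z h e = e :=
  (D.θ z z h).injective (D.cocycle z z z h h e)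

/-- The isomorphisms of the descent data have smooth matrices and are compatible with the connection
along pairs of plots that have the same image near a point. -/
theorem par_plots {n : ℕ} (q₀ q₁ : Plot Z n) {u : Euc n} (h : ∀ᶠ w in 𝓝 u, f (q₀ w) = f (q₁ w))
    {i j : E.ι} (hi : q₁ u ∈ E.dom i) (hj : q₀ u ∈ E.dom j) (T : Euc n → E.model i →L[ℂ] E.model j)
    (hT : ∀ᶠ w in 𝓝 u, ∀ (h : f (q₀ w) = f (q₁ w)), T w
      = E.coframe j (q₀ w) ∘L clm (D.θ (q₀ w) (q₁ w) h) ∘L E.frame i (q₁ w)) :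
    ContDiffAt ℝ ∞ T u ∧ ∀ v, fderiv ℝ T u v + E.conn j q₀ u v ∘L T u = T u ∘L E.conn i q₁ u v := by
  obtain ⟨t, ht⟩ := FibProd.exists_plot q₀ q₁ h
  have hi' : (t u).1.2 ∈ E.dom i := by rwa [ht.self_of_nhds.2]
  have hj' : (t u).1.1 ∈ E.dom j := by rwa [ht.self_of_nhds.1]
  let m : Euc n → E.model i →L[ℂ] E.model j := fun w =>
    E.coframe j (t w).1.1 ∘L clm (D.θ (t w).1.1 (t w).1.2 (t w).2) ∘L E.frame i (t w).1.2
  have hm : ContDiffAt ℝ ∞ m u := D.par.contDiffAt t hi' hj'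
  have ev : T =ᶠ[𝓝 u] m := by
    filter_upwards [hT, ht] with w hw htw
    obtain ⟨x, hx⟩ : ∃ x, x = t w := ⟨_, rfl⟩
    simp only [m]
    rw [← hx] at htw ⊢
    obtain ⟨⟨x0, x1⟩, hx'⟩ := x
    obtain ⟨h0, h1⟩ := htw
    simp only at h0 h1
    subst h0 h1
    exact hw hx'
  refine ⟨hm.congr_of_eventuallyEq ev, fun v => ?_⟩
  have := D.par.parallel t i j u hi' hj' v
  rw [ev.fderiv_eq, ev.self_of_nhds]
  rw [← E.conn_congr (t.map _ FibProd.dSmooth_snd) q₁ i hi' (ht.mono fun w h => h.2),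
    ← E.conn_congr (t.map _ FibProd.dSmooth_fst) q₀ j hj' (ht.mono fun w h => h.1)]
  exact this

variable (hf : IsSurjSubm f)

/-- A point over `y`. -/
def pt (hf : IsSurjSubm f) (y : Y) : Z := (hf.surj y).choose

theorem f_pt (y : Y) : f (pt hf y) = y := (hf.surj y).choose_spec

open scoped Classical in
/-- The local frame given by a local section of `f` and a local frame of `E`. -/
def frm (σ : LocSect f) (i : E.ι) (y : Y) : E.model i →L[ℂ] E.fib (pt hf y) :=
  if h : y ∈ σ.U then clm (D.θ (pt hf y) (σ.s y) ((f_pt hf y).trans (σ.sec y h).symm))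
    ∘L E.frame i (σ.s y) else 0

open scoped Classical in
/-- The inverse of the local frame given by a local section of `f` and a local frame of `E`. -/
def cofrm (σ : LocSect f) (i : E.ι) (y : Y) : E.fib (pt hf y) →L[ℂ] E.model i :=
  if h : y ∈ σ.U then E.coframe i (σ.s y)
    ∘L clm (D.θ (σ.s y) (pt hf y) ((σ.sec y h).trans (f_pt hf y).symm)) else 0

theorem frm_apply (σ : LocSect f) (i : E.ι) {y : Y} (h : y ∈ σ.U) (a : E.model i) :
    D.frm hf σ i y a
      = D.θ (pt hf y) (σ.s y) ((f_pt hf y).trans (σ.sec y h).symm) (E.frame i (σ.s y) a) := by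
  rw [frm, dif_pos h]; rfl

theorem cofrm_apply (σ : LocSect f) (i : E.ι) {y : Y} (h : y ∈ σ.U) (e : E.fib (pt hf y)) :
    D.cofrm hf σ i y e
      = E.coframe i (σ.s y) (D.θ (σ.s y) (pt hf y) ((σ.sec y h).trans (f_pt hf y).symm) e) := by
  rw [cofrm, dif_pos h]; rfl

open scoped Classical in
/-- The connection form of the frame given by `σ` and `i`: that of `E` along a plot which agrees with
`σ ∘ p` near the given point. -/
def cform (E : HVB Z.carrier) (σ : LocSect f) (i : E.ι) {n : ℕ} (p : Plot Y n) (u : Euc n) :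
    Euc n →L[ℝ] (E.model i →L[ℂ] E.model i) :=
  if h : p u ∈ σ.U then E.conn i (σ.exists_plot p h).choose u else 0

theorem cform_eq (σ : LocSect f) (i : E.ι) {n : ℕ} (p : Plot Y n) {u : Euc n} (h : p u ∈ σ.U)
    (hi : σ.s (p u) ∈ E.dom i) (q : Plot Z n) (hq : ∀ᶠ w in 𝓝 u, q w = σ.s (p w)) :
    cform E σ i p u = E.conn i q u := by
  rw [cform, dif_pos h]
  have h' := (σ.exists_plot p h).choose_spec
  refine E.conn_congr _ _ i (by rwa [h'.self_of_nhds]) ?_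
  filter_upwards [hq, h'] with w h1 h2
  rw [h1, h2]

theorem cform_ev (σ : LocSect f) (i : E.ι) {n : ℕ} (p : Plot Y n) {u : Euc n} (h : p u ∈ σ.U)
    (hi : σ.s (p u) ∈ E.dom i) : ∃ q : Plot Z n, (∀ᶠ w in 𝓝 u, q w = σ.s (p w)) ∧
      cform E σ i p =ᶠ[𝓝 u] E.conn i q := by
  obtain ⟨q, hq⟩ := σ.exists_plot p h
  refine ⟨q, hq, ?_⟩
  have hi' : q u ∈ E.dom i := by rwa [hq.self_of_nhds]
  filter_upwards [hq.eventually_nhds, E.nhds_dom q hi', (σ.isOpen_dom p).mem_nhds h] with w h1 h2 h3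
  exact cform_eq σ i p h3 (h1.self_of_nhds ▸ h2) q h1

theorem isOpen_dom' (σ : LocSect f) (i : E.ι) {n : ℕ} (p : Plot Y n) :
    IsOpen (p ⁻¹' {y | y ∈ σ.U ∧ σ.s y ∈ E.dom i}) := by
  refine isOpen_iff_mem_nhds.2 fun u hu => ?_
  obtain ⟨q, hq⟩ := σ.exists_plot p hu.1
  have hi' : q u ∈ E.dom i := by rw [hq.self_of_nhds]; exact hu.2
  filter_upwards [hq, E.nhds_dom q hi', (σ.isOpen_dom p).mem_nhds hu.1] with w h1 h2 h3
  exact ⟨h3, h1 ▸ h2⟩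

theorem trans_eq (σ τ : LocSect f) (i j : E.ι) {y : Y} (hσ : y ∈ σ.U) (hτ : y ∈ τ.U) :
    D.cofrm hf τ j y ∘L D.frm hf σ i y = E.coframe j (τ.s y)
      ∘L clm (D.θ (τ.s y) (σ.s y) ((τ.sec y hτ).trans (σ.sec y hσ).symm)) ∘L E.frame i (σ.s y) := by
  ext a
  simp only [ContinuousLinearMap.comp_apply, D.frm_apply hf σ i hσ, D.cofrm_apply hf τ j hτ, D.cocycle]
  rfl

theorem trans_par (σ τ : LocSect f) (i j : E.ι) {n : ℕ} (p : Plot Y n) {u : Euc n} (hσ : p u ∈ σ.U)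
    (hi : σ.s (p u) ∈ E.dom i) (hτ : p u ∈ τ.U) (hj : τ.s (p u) ∈ E.dom j) :
    ContDiffAt ℝ ∞ (fun u => D.cofrm hf τ j (p u) ∘L D.frm hf σ i (p u)) u ∧
    ∀ v, fderiv ℝ (fun u => D.cofrm hf τ j (p u) ∘L D.frm hf σ i (p u)) u v
      + cform E τ j p u v ∘L (D.cofrm hf τ j (p u) ∘L D.frm hf σ i (p u))
      = (D.cofrm hf τ j (p u) ∘L D.frm hf σ i (p u)) ∘L cform E σ i p u v := by
  obtain ⟨q, hq⟩ := σ.exists_plot p hσ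
  obtain ⟨q', hq'⟩ := τ.exists_plot p hτ
  have hU : ∀ᶠ w in 𝓝 u, p w ∈ σ.U ∧ p w ∈ τ.U :=
    Filter.inter_mem ((σ.isOpen_dom p).mem_nhds hσ) ((τ.isOpen_dom p).mem_nhds hτ)
  rw [cform_eq σ i p hσ hi q hq, cform_eq τ j p hτ hj q' hq']
  refine D.par_plots q' q ?_ (by rwa [hq.self_of_nhds]) (by rwa [hq'.self_of_nhds]) _ ?_
  · filter_upwards [hq, hq', hU] with w h1 h2 h3
    rw [h1, h2, σ.sec _ h3.1, τ.sec _ h3.2]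
  · filter_upwards [hq, hq', hU] with w h1 h2 h3 h
    have k : ∀ z₀ z₁ : Z, z₀ = τ.s (p w) → z₁ = σ.s (p w) → ∀ h : f z₀ = f z₁,
        D.cofrm hf τ j (p w) ∘L D.frm hf σ i (p w)
          = E.coframe j z₀ ∘L clm (D.θ z₀ z₁ h) ∘L E.frame i z₁ := by
      rintro _ _ rfl rfl h
      exact D.trans_eq hf σ τ i j h3.1 h3.2
    exact k _ _ h2 h1 h

/-- The bundle obtained from `E` by descent along `f`.  Its fibre at `y` is that of `E` at a chosen
point over `y`. -/
def desc : HVB Y.carrier where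
  fib y := E.fib (pt hf y)
  ι := LocSect f × E.ι
  dom i := {y | y ∈ i.1.U ∧ i.1.s y ∈ E.dom i.2}
  model i := E.model i.2
  frame i y := D.frm hf i.1 i.2 y
  coframe i y := D.cofrm hf i.1 i.2 y
  isOpen_dom p i := isOpen_dom' i.1 i.2 p
  cover y := by
    obtain ⟨σ, hσ⟩ := hf.exists_locSect y
    obtain ⟨i, hi⟩ := E.cover (σ.s y)
    exact ⟨(σ, i), hσ, hi⟩
  coframe_frame i y h a := by
    rw [D.frm_apply hf _ _ h.1, D.cofrm_apply hf _ _ h.1, D.cocycle, D.θ_self, E.coframe_frame _ _ h.2]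
  frame_coframe i y h e := by
    rw [D.frm_apply hf _ _ h.1, D.cofrm_apply hf _ _ h.1, E.frame_coframe _ _ h.2, D.cocycle, D.θ_self]
  norm_frame i y h a := by
    rw [D.frm_apply hf _ _ h.1, LinearIsometryEquiv.norm_map, E.norm_frame _ _ h.2]
  smooth_trans p i j := fun u hu =>
    (D.trans_par hf i.1 j.1 i.2 j.2 p hu.1.1 hu.1.2 hu.2.1 hu.2.2).1.contDiffWithinAt
  conn i _ p := cform E i.1 i.2 p
  smooth_conn i _ p := fun u hu => by
    obtain ⟨q, hq, ev⟩ := cform_ev i.1 i.2 p hu.1 hu.2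
    have hi' : q u ∈ E.dom i.2 := by rw [hq.self_of_nhds]; exact hu.2
    exact (((E.smooth_conn i.2 q).contDiffAt (E.nhds_dom q hi')).congr_of_eventuallyEq ev).contDiffWithinAt
  skew_conn i _ p u hu v a b := by
    obtain ⟨q, hq, ev⟩ := cform_ev i.1 i.2 p hu.1 hu.2
    rw [ev.self_of_nhds]
    exact E.skew_conn i.2 q u (by rw [hq.self_of_nhds]; exact hu.2) v a b
  conn_reparam i _ _ p h hh u hu v := by
    obtain ⟨q, hq, ev⟩ := cform_ev i.1 i.2 p hu.1 hu.2
    rw [ev.self_of_nhds, cform_eq i.1 i.2 (p.reparam h hh) hu.1 hu.2 (q.reparam h hh)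
      (hh.continuous.continuousAt.eventually hq)]
    exact E.conn_reparam i.2 q h hh u (by rw [hq.self_of_nhds]; exact hu.2) v
  gauge p i j u hi hj := (D.trans_par hf i.1 j.1 i.2 j.2 p hi.1 hi.2 hj.1 hj.2).2

/-- The isomorphism of the pullback of the descended bundle with `E`. -/
def κ (z : Z) : (D.desc hf).fib (f z) ≃ₗᵢ[ℂ] E.fib z := D.θ z (pt hf (f z)) (f_pt hf (f z)).symm

theorem θ_κ (z₀ z₁ : Z) (h : f z₀ = f z₁) (e : (D.desc hf).fib (f z₁)) :
    D.θ z₀ z₁ h (D.κ hf z₁ e) = D.κ hf z₀ ((D.desc hf).tr h.symm e) := by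
  have : ∀ (y : Y) (hy : f z₁ = y) (h0 : f z₀ = y), D.θ z₀ z₁ h (D.κ hf z₁ e)
      = D.θ z₀ (pt hf y) (h0.trans (f_pt hf y).symm) ((D.desc hf).tr hy e) := by
    intro y hy h0
    subst hy
    exact D.cocycle _ _ _ _ _ _
  exact this (f z₀) h.symm rfl

theorem κ_par : HVB.IsPar ((D.desc hf).pb f hf.smooth.dSmooth) E (fun z => clm (D.κ hf z)) := by
  refine .of_at fun {n} p i j u hi hj => ?_
  obtain ⟨σ, i⟩ := i
  replace hi : f (p u) ∈ σ.U ∧ σ.s (f (p u)) ∈ E.dom i := hi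
  obtain ⟨q, hq⟩ := σ.exists_plot (p.map f hf.smooth.dSmooth) hi.1
  have e : ((D.desc hf).pb f hf.smooth.dSmooth).conn (σ, i) p u = E.conn i q u :=
    cform_eq σ i (p.map f hf.smooth.dSmooth) hi.1 hi.2 q hq
  have hq0 : q u = σ.s (f (p u)) := hq.self_of_nhds
  have hU : ∀ᶠ w in 𝓝 u, f (p w) ∈ σ.U := (σ.isOpen_dom (p.map f hf.smooth.dSmooth)).mem_nhds hi.1
  rw [e]
  let T : Euc n → E.model i →L[ℂ] E.model j := fun w =>
    E.coframe j (p w) ∘L clm (D.κ hf (p w)) ∘L D.frm hf σ i (f (p w))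
  have key := D.par_plots (i := i) (j := j) p q ?_ (by rw [hq0]; exact hi.2) hj T ?_
  · exact key
  · filter_upwards [hq, hU] with w h1 h2
    rw [h1]
    exact (σ.sec _ h2).symm
  · filter_upwards [hq, hU] with w h1 h2 h
    have k : ∀ z₁ : Z, z₁ = σ.s (f (p w)) → ∀ h : f (p w) = f z₁,
        T w = E.coframe j (p w) ∘L clm (D.θ (p w) z₁ h) ∘L E.frame i z₁ := by
      rintro _ rfl h
      refine ContinuousLinearMap.ext fun a => ?_
      change E.coframe j (p w) (D.θ (p w) _ _ (D.frm hf σ i (f (p w)) a)) = _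
      rw [D.frm_apply hf σ i h2, D.cocycle]
      rfl
    exact k _ h1 h

end DescentData
end Descent

namespace HVB
variable {X : Type} [DiffeologicalSpace X] {E F : HVB X}

/-- Being smooth and parallel is local: it suffices that every plot factors, near every point,
through a smooth map along which the pullback is smooth and parallel. -/
theorem IsPar.of_local_lift {ψ : ∀ x, E.fib x →L[ℂ] F.fib x}
    (hl : ∀ {n : ℕ} (p : Plot X n) (u : Euc n), ∃ (X' : Type) (_ : DiffeologicalSpace X') (f : X' → X)
      (hf : DSmooth f) (q : Plot X' n), (∀ᶠ w in 𝓝 u, f (q w) = p w) ∧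
      IsPar (E.pb f hf) (F.pb f hf) (fun x => ψ (f x))) : IsPar E F ψ := by
  refine .of_at fun {n} p i j u hi hj => ?_
  obtain ⟨X', _, f, hf, q, hq, h⟩ := hl p u
  have hi' : f (q u) ∈ E.dom i := by rw [hq.self_of_nhds]; exact hi
  have hj' : f (q u) ∈ F.dom j := by rw [hq.self_of_nhds]; exact hj
  let m : Euc n → (E.model i →L[ℂ] F.model j) := fun w =>
    F.coframe j (f (q w)) ∘L ψ (f (q w)) ∘L E.frame i (f (q w))
  have k : ∀ w, f (q w) = p w → m w = mat E F ψ p i j w := fun w hw => by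
    simp only [m]
    rw [hw]; rfl
  have ev : mat E F ψ p i j =ᶠ[𝓝 u] m := by
    filter_upwards [hq] with w hw using (k w hw).symm
  have hm : ContDiffAt ℝ ∞ m u := h.contDiffAt q hi' hj'
  refine ⟨hm.congr_of_eventuallyEq ev, fun v => ?_⟩
  have := h.parallel q i j u hi' hj' v
  change fderiv ℝ m u v + F.conn j (q.map f hf) u v ∘L m u = m u ∘L E.conn i (q.map f hf) u v at this
  rwa [← ev.fderiv_eq, k u hq.self_of_nhds, E.conn_congr (q.map f hf) p i hi' hq,
    F.conn_congr (q.map f hf) p j hj' hq] at this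

end HVB

/-! ### Morphisms that are parallel up to a 1-form -/

namespace HVB
variable {X X' : Type} [DiffeologicalSpace X] [DiffeologicalSpace X'] {E F G E' F' : HVB X}

/-- A family of linear maps `ψ : E_x → F_x` is smooth and `∇ψ = i b ψ`, where `b` stands for a real
1-form, given along plots. -/
structure IsParTw (b : ∀ {n : ℕ}, Plot X n → Euc n → Euc n → ℝ) (E F : HVB X)
    (ψ : ∀ x, E.fib x →L[ℂ] F.fib x) : Prop where
  smooth : ∀ {n : ℕ} (p : Plot X n) (i : E.ι) (j : F.ι) (u : Euc n), p u ∈ E.dom i → p u ∈ F.dom j →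
    ContDiffAt ℝ ∞ (mat E F ψ p i j) u
  parallel : ∀ {n : ℕ} (p : Plot X n) (i : E.ι) (j : F.ι) (u : Euc n), p u ∈ E.dom i → p u ∈ F.dom j →
    ∀ v, fderiv ℝ (mat E F ψ p i j) u v + F.conn j p u v ∘L mat E F ψ p i j u
      = mat E F ψ p i j u ∘L E.conn i p u v + (Complex.I * (b p u v : ℝ)) • mat E F ψ p i j u

/-- The Leibniz rule for the tensor product of two morphisms, at a point and for a tangent vector. -/
theorem tensor_parTw {n : ℕ} {V W V' W' : Type}
    [NormedAddCommGroup V] [InnerProductSpace ℂ V] [FiniteDimensional ℂ V]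
    [NormedAddCommGroup W] [InnerProductSpace ℂ W] [FiniteDimensional ℂ W]
    [NormedAddCommGroup V'] [InnerProductSpace ℂ V'] [FiniteDimensional ℂ V']
    [NormedAddCommGroup W'] [InnerProductSpace ℂ W'] [FiniteDimensional ℂ W'] {v : Euc n}
    {A : Euc n →L[ℝ] (V →L[ℂ] V)} {A' : Euc n →L[ℝ] (V' →L[ℂ] V')} {T DT : V →L[ℂ] V'}
    {B : Euc n →L[ℝ] (W →L[ℂ] W)} {B' : Euc n →L[ℝ] (W' →L[ℂ] W')} {S DS : W →L[ℂ] W'} {c d : ℝ}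
    (hT : DT + A' v ∘L T = T ∘L A v + (Complex.I * c) • T)
    (hS : DS + B' v ∘L S = S ∘L B v + (Complex.I * d) • S) :
    tmap T DS + tmap DT S + tconn A' B' v ∘L tmap T S
      = tmap T S ∘L tconn A B v + (Complex.I * (c + d : ℝ)) • tmap T S := by
  rw [← eq_sub_iff_add_eq] at hT hS
  rw [hT, hS]
  refine clm_tensor_ext fun a b => ?_
  simp [tconn_apply, mul_add, add_smul]
  abel

/-- The transpose is parallel up to the same 1-form, at a point and for a tangent vector. -/
theorem dual_parTw {n : ℕ} {V W : Type}
    [NormedAddCommGroup V] [InnerProductSpace ℂ V] [FiniteDimensional ℂ V]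
    [NormedAddCommGroup W] [InnerProductSpace ℂ W] [FiniteDimensional ℂ W] {v : Euc n}
    {A : Euc n →L[ℝ] (V →L[ℂ] V)} {B : Euc n →L[ℝ] (W →L[ℂ] W)} {T DT : V →L[ℂ] W} {c : ℝ}
    (hT : DT + B v ∘L T = T ∘L A v + (Complex.I * c) • T) :
    CupGerbe.trp DT + (-(trpR ∘L A)) v ∘L CupGerbe.trp T
      = CupGerbe.trp T ∘L (-(trpR ∘L B)) v + (Complex.I * c) • CupGerbe.trp T := by
  rw [← eq_sub_iff_add_eq] at hT
  rw [hT]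
  ext ξ a
  simp [trpR_apply]
  ring

variable {b b' : ∀ {n : ℕ}, Plot X n → Euc n → Euc n → ℝ}

theorem IsPar.isParTw {ψ : ∀ x, E.fib x →L[ℂ] F.fib x} (h : IsPar E F ψ) :
    IsParTw (fun _ _ _ => 0) E F ψ :=
  ⟨fun p i j u hi hj => h.contDiffAt p hi hj, fun p i j u hi hj v => by
    rw [h.parallel p i j u hi hj v]; simp⟩

namespace IsParTw

theorem isPar {ψ : ∀ x, E.fib x →L[ℂ] F.fib x} (h : IsParTw b E F ψ)
    (hb : ∀ {n : ℕ} (p : Plot X n) (u v : Euc n), b p u v = 0) : IsPar E F ψ :=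
  .of_at fun p i j u hi hj => ⟨h.smooth p i j u hi hj, fun v => by
    rw [h.parallel p i j u hi hj v, hb]; simp⟩

theorem congr {ψ χ : ∀ x, E.fib x →L[ℂ] F.fib x} (h : IsParTw b E F ψ)
    (hb : ∀ {n : ℕ} (p : Plot X n) (u v : Euc n), b p u v = b' p u v)
    (e : ∀ x a, ψ x a = χ x a) : IsParTw b' E F χ := by
  obtain rfl : ψ = χ := funext fun x => ContinuousLinearMap.ext (e x)
  exact ⟨h.smooth, fun p i j u hi hj v => by rw [← hb]; exact h.parallel p i j u hi hj v⟩

theorem pb {ψ : ∀ x, E.fib x →L[ℂ] F.fib x} (h : IsParTw b E F ψ) (f : X' → X) (hf : DSmooth f) :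
    IsParTw (fun p => b (p.map f hf)) (E.pb f hf) (F.pb f hf) (fun x => ψ (f x)) :=
  ⟨fun p => h.smooth (p.map f hf), fun p => h.parallel (p.map f hf)⟩

theorem comp {χ : ∀ x, F.fib x →L[ℂ] G.fib x} {ψ : ∀ x, E.fib x →L[ℂ] F.fib x}
    (hχ : IsParTw b F G χ) (hψ : IsParTw b' E F ψ) :
    IsParTw (fun p u v => b p u v + b' p u v) E G (fun x => χ x ∘L ψ x) := by
  have H : ∀ {n : ℕ} (p : Plot X n) (i : E.ι) (k : G.ι) (u : Euc n), p u ∈ E.dom i → p u ∈ G.dom k →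
      ContDiffAt ℝ ∞ (mat E G (fun x => χ x ∘L ψ x) p i k) u ∧
      ∀ v, fderiv ℝ (mat E G (fun x => χ x ∘L ψ x) p i k) u v
          + G.conn k p u v ∘L mat E G (fun x => χ x ∘L ψ x) p i k u
        = mat E G (fun x => χ x ∘L ψ x) p i k u ∘L E.conn i p u v
          + (Complex.I * (b p u v + b' p u v : ℝ)) • mat E G (fun x => χ x ∘L ψ x) p i k u := by
    intro n p i k u hi hk
    obtain ⟨j, hj⟩ := F.cover (p u)
    have key : ∀ w, p w ∈ F.dom j → mat E G (fun x => χ x ∘L ψ x) p i k w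
        = mat F G χ p j k w ∘L mat E F ψ p i j w := fun w hw => by
      ext a
      simp [mat, F.frame_coframe j _ hw]
    have ev : mat E G (fun x => χ x ∘L ψ x) p i k =ᶠ[𝓝 u]
        fun w => mat F G χ p j k w ∘L mat E F ψ p i j w :=
      Filter.mem_of_superset (F.nhds_dom p hj) key
    have h1 := hχ.smooth p j k u hj hk
    have h2 := hψ.smooth p i j u hi hj
    refine ⟨ContDiffAt.congr_of_eventuallyEq (contDiffAt_bilin (compR (V := E.model i)
      (W := F.model j) (U := G.model k)) h1 h2) ev, fun v => ?_⟩
    rw [ev.fderiv_eq, fderiv_clm_comp (h1.differentiableAt (by simp)) (h2.differentiableAt (by simp)),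
      key u hj]
    have e1 := hχ.parallel p j k u hj hk v
    have e2 := hψ.parallel p i j u hi hj v
    rw [← eq_sub_iff_add_eq] at e1 e2
    rw [e1, e2]
    ext a
    simp [add_smul, mul_add]
    abel
  exact ⟨fun p i k u hi hk => (H p i k u hi hk).1, fun p i k u hi hk => (H p i k u hi hk).2⟩

theorem inv {χ : ∀ x, F.fib x →L[ℂ] E.fib x} {ψ : ∀ x, E.fib x →L[ℂ] F.fib x}
    (hψ : IsParTw b E F ψ) (h1 : ∀ x e, χ x (ψ x e) = e) (h2 : ∀ x e, ψ x (χ x e) = e) :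
    IsParTw (fun p u v => -b p u v) F E χ := by
  have H : ∀ {n : ℕ} (p : Plot X n) (j : F.ι) (i : E.ι) (u : Euc n), p u ∈ F.dom j → p u ∈ E.dom i →
      ContDiffAt ℝ ∞ (mat F E χ p j i) u ∧
      ∀ v, fderiv ℝ (mat F E χ p j i) u v + E.conn i p u v ∘L mat F E χ p j i u
        = mat F E χ p j i u ∘L F.conn j p u v
          + (Complex.I * (-b p u v : ℝ)) • mat F E χ p j i u := by
    intro n p j i u hj hi
    have k1 : ∀ w, p w ∈ F.dom j → p w ∈ E.dom i →
        mat F E χ p j i w ∘L mat E F ψ p i j w = .id ℂ _ := fun w hw hw' => by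
      ext a
      simp [mat, F.frame_coframe j _ hw, h1, E.coframe_frame i _ hw']
    have k2 : ∀ w, p w ∈ F.dom j → p w ∈ E.dom i →
        mat E F ψ p i j w ∘L mat F E χ p j i w = .id ℂ _ := fun w hw hw' => by
      ext a
      simp [mat, E.frame_coframe i _ hw', h2, F.coframe_frame j _ hw]
    let e : ∀ w, p w ∈ F.dom j → p w ∈ E.dom i → (E.model i ≃L[ℂ] F.model j) := fun w hw hw' =>
      ContinuousLinearEquiv.equivOfInverse (mat E F ψ p i j w) (mat F E χ p j i w)
        (fun a => congrArg (fun f => f a) (k1 w hw hw')) (fun a => congrArg (fun f => f a) (k2 w hw hw'))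
    have ev : mat F E χ p j i =ᶠ[𝓝 u] fun w => ContinuousLinearMap.inverse (mat E F ψ p i j w) := by
      filter_upwards [F.nhds_dom p hj, E.nhds_dom p hi] with w hw hw'
      exact (ContinuousLinearMap.inverse_equiv (e w hw hw')).symm
    have : CompleteSpace (E.model i) := FiniteDimensional.complete ℂ _
    have hs := hψ.smooth p i j u hi hj
    have sm : ContDiffAt ℝ ∞ (mat F E χ p j i) u := by
      refine ContDiffAt.congr_of_eventuallyEq ?_ ev
      exact ContDiffAt.comp u ((contDiffAt_map_inverse (𝕜 := ℂ) (e u hj hi)).restrict_scalars ℝ) hs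
    refine ⟨sm, fun v => ?_⟩
    have ev1 : (fun w => mat F E χ p j i w ∘L mat E F ψ p i j w) =ᶠ[𝓝 u]
        fun _ => .id ℂ _ := by
      filter_upwards [F.nhds_dom p hj, E.nhds_dom p hi] with w hw hw'
      exact k1 w hw hw'
    have D := fderiv_clm_comp (sm.differentiableAt (by simp)) (hs.differentiableAt (by simp)) v
    rw [ev1.fderiv_eq, fderiv_fun_const] at D
    have e2 := hψ.parallel p i j u hi hj v
    rw [← eq_sub_iff_add_eq] at e2
    rw [e2] at D
    have D' := congrArg (fun f => f ∘L mat F E χ p j i u) D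
    have a1 := fun a => congrArg (fun f => f a) (k1 u hj hi)
    have a2 := fun a => congrArg (fun f => f a) (k2 u hj hi)
    simp only [ContinuousLinearMap.comp_apply, ContinuousLinearMap.id_apply] at a1 a2
    ext c
    have D'' := congrArg (fun f => f c) D'
    simp [a1, a2] at D''
    simp only [add_apply, ContinuousLinearMap.comp_apply, smul_apply]
    rw [← sub_eq_zero, D'']
    simp
    abel
  exact ⟨fun p i k u hi hk => (H p i k u hi hk).1, fun p i k u hi hk => (H p i k u hi hk).2⟩

theorem trp {ψ : ∀ x, E.fib x →L[ℂ] F.fib x} (h : IsParTw b E F ψ) :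
    IsParTw b F.dual E.dual (fun x => CupGerbe.trp (ψ x)) := by
  have e : ∀ {n : ℕ} (p : Plot X n) (i : E.ι) (j : F.ι), mat F.dual E.dual (fun x => CupGerbe.trp (ψ x)) p j i
      = fun u => CupGerbe.trp (mat E F ψ p i j u) := fun p i j => rfl
  refine ⟨fun {n} p (j : F.ι) (i : E.ι) u hj hi => contDiffAt_trp (h.smooth p i j u hi hj),
    fun {n} p (j : F.ι) (i : E.ι) u (hj : p u ∈ F.dom j) (hi : p u ∈ E.dom i) v => ?_⟩
  have g := dual_parTw (h.parallel p i j u hi hj v)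
  rw [← fderiv_trp ((h.smooth p i j u hi hj).differentiableAt (by simp)) v] at g
  exact g

theorem tensor {ψ : ∀ x, E.fib x →L[ℂ] F.fib x} {χ : ∀ x, E'.fib x →L[ℂ] F'.fib x}
    (hψ : IsParTw b E F ψ) (hχ : IsParTw b' E' F' χ) :
    IsParTw (fun p u v => b p u v + b' p u v) (E.tensor E') (F.tensor F')
      (fun x => tmap (ψ x) (χ x)) := by
  have e : ∀ {n : ℕ} (p : Plot X n) (i : (E.tensor E').ι) (j : (F.tensor F').ι),
      mat (E.tensor E') (F.tensor F') (fun x => tmap (ψ x) (χ x)) p i j =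
      fun u => tmap (mat E F ψ p i.1 j.1 u) (mat E' F' χ p i.2 j.2 u) := fun p i j =>
    funext fun w => by
      change tmap _ _ ∘L tmap _ _ ∘L tmap _ _ = _
      rw [tmap_comp, tmap_comp]
      rfl
  constructor
  · intro n p i j u hi hj
    rw [e]
    exact contDiffAt_tmap (hψ.smooth p i.1 j.1 u hi.1 hj.1) (hχ.smooth p i.2 j.2 u hi.2 hj.2)
  · intro n p i j u hi hj v
    rw [e]
    have h := tensor_parTw (hψ.parallel p i.1 j.1 u hi.1 hj.1 v) (hχ.parallel p i.2 j.2 u hi.2 hj.2 v)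
    rw [← fderiv_tmap ((hψ.smooth p i.1 j.1 u hi.1 hj.1).differentiableAt (by simp))
      ((hχ.smooth p i.2 j.2 u hi.2 hj.2).differentiableAt (by simp)) v] at h
    exact h

end IsParTw

/-- A section `s` of `E` with `∇s = i b s` defines a morphism `a ↦ a ⊗ s` with the same property. -/
theorem IsParTw.tmulRight {L : HVB X} {s : ∀ x, L.fib x}
    (hs : IsParTw b (triv X) L (fun x => ContinuousLinearMap.toSpanSingleton ℂ (s x))) (E : HVB X) :
    IsParTw b E (E.tensor L) (fun x => HVB.tmulRight (E.fib x) (s x)) := by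
  have h := ((isPar_id E).isParTw.tensor hs).comp (isPar_rid E).isParTw
  refine h.congr (fun p u v => by ring) fun x a => ?_
  exact (tmap_tmul _ _ a (1 : ℂ)).trans
    (by simp only [ContinuousLinearMap.id_apply, ContinuousLinearMap.toSpanSingleton_apply, one_smul]; rfl)

theorem IsParTw.contract {L : HVB X} {s : ∀ x, L.fib x}
    (hs : IsParTw b (triv X) L (fun x => ContinuousLinearMap.toSpanSingleton ℂ (s x))) (E : HVB X)
    (hL : ∀ x, Module.finrank ℂ (L.fib x) = 1) (h1 : ∀ x, ‖s x‖ = 1) :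
    IsParTw (fun p u v => -b p u v) (E.tensor L) E (fun x => CupGerbe.contract (E.fib x) (s x)) :=
  (hs.tmulRight E).inv (fun x e => (contract_tmul _ _ _).trans (by
      rw [inner_self_eq_norm_sq_to_K, h1]; simp)) (fun x e => contract_eq (hL x) (h1 x) e)

end HVB

/-- A real 1-form on a diffeological space, given along plots. -/
structure OneForm (X : Type) [DiffeologicalSpace X] where
  val : ∀ {n : ℕ}, Plot X n → Euc n → (Euc n →L[ℝ] ℝ)
  smooth : ∀ {n : ℕ} (p : Plot X n), ContDiff ℝ ∞ (val p)
  reparam : ∀ {n m : ℕ} (p : Plot X n) (h : Euc m → Euc n) (hh : ContDiff ℝ ∞ h) (u v : Euc m),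
    val (p.reparam h hh) u v = val p (h u) (fderiv ℝ h u v)

/-- The scalar endomorphism `i t`. -/
def iScal (V : Type) [NormedAddCommGroup V] [InnerProductSpace ℂ V] : ℝ →L[ℝ] (V →L[ℂ] V) :=
  ContinuousLinearMap.toSpanSingleton ℝ (Complex.I • ContinuousLinearMap.id ℂ V)

theorem iScal_apply {V : Type} [NormedAddCommGroup V] [InnerProductSpace ℂ V] (t : ℝ) (a : V) :
    iScal V t a = (Complex.I * (t : ℝ)) • a := by
  simp [iScal, mul_comm Complex.I, mul_smul]

theorem twist_parTw {n : ℕ} {V W : Type}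
    [NormedAddCommGroup V] [InnerProductSpace ℂ V] [FiniteDimensional ℂ V]
    [NormedAddCommGroup W] [InnerProductSpace ℂ W] [FiniteDimensional ℂ W] {v : Euc n}
    {A : Euc n →L[ℝ] (V →L[ℂ] V)} {B : Euc n →L[ℝ] (W →L[ℂ] W)} {T DT : V →L[ℂ] W}
    {β : Euc n →L[ℝ] ℝ} (hT : DT + B v ∘L T = T ∘L A v) :
    DT + (B + iScal W ∘L β) v ∘L T = T ∘L A v + (Complex.I * (β v : ℝ)) • T := by
  rw [← eq_sub_iff_add_eq] at hT
  rw [hT]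
  ext a
  simp [iScal_apply]
  abel

namespace HVB
variable {X : Type} [DiffeologicalSpace X]

/-- The bundle `E` with the connection `∇ + i β`, i.e. the tensor product of `E` with the trivial line
bundle with the connection form `i β`. -/
def twist (E : HVB X) (β : OneForm X) : HVB X where
  fib := E.fib
  ι := E.ι
  dom := E.dom
  model := E.model
  frame := E.frame
  coframe := E.coframe
  isOpen_dom := E.isOpen_dom
  cover := E.cover
  coframe_frame := E.coframe_frame
  frame_coframe := E.frame_coframe
  norm_frame := E.norm_frame
  smooth_trans := E.smooth_trans
  conn i _ p u := E.conn i p u + iScal (E.model i) ∘L β.val p u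
  smooth_conn i _ p := (E.smooth_conn i p).add (contDiffOn_const.clm_comp (β.smooth p).contDiffOn)
  skew_conn i _ p u hu v a b := by
    have := E.skew_conn i p u hu v a b
    simp only [add_apply, ContinuousLinearMap.comp_apply, iScal_apply, inner_add_left, inner_add_right,
      inner_smul_left, inner_smul_right, map_mul, Complex.conj_I, Complex.conj_ofReal]
    linear_combination this
  conn_reparam i _ _ p h hh u hu v := by
    simp only [add_apply, ContinuousLinearMap.comp_apply, E.conn_reparam i p h hh u hu v,
      β.reparam p h hh u v]
  gauge p i j u hi hj v := by
    have := E.gauge p i j u hi hj v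
    rw [← eq_sub_iff_add_eq] at this ⊢
    rw [this]
    ext a
    simp [iScal_apply]

theorem twist_par (E : HVB X) (β : OneForm X) :
    IsParTw (fun p u v => β.val p u v) E (E.twist β) (fun x => ContinuousLinearMap.id ℂ (E.fib x)) := by
  exact ⟨(isPar_id E).isParTw.smooth, fun p i j u hi hj v =>
    twist_parTw ((isPar_id E).parallel p i j u hi hj v)⟩

theorem untwist_par (E : HVB X) (β : OneForm X) :
    IsParTw (fun p u v => -β.val p u v) (E.twist β) E (fun x => ContinuousLinearMap.id ℂ (E.fib x)) :=
  (E.twist_par β).inv (fun _ _ => rfl) (fun _ _ => rfl)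

end HVB

/-! ### The coverings of `M_p` -/

section Quotient
open MulAction
variable {V H X G : Type} [NormedAddCommGroup V] [NormedSpace ℝ V] [TopologicalSpace H]
  {I : ModelWithCorners ℝ V H} [TopologicalSpace X] [ChartedSpace H X] [IsManifold I ∞ X]
  [Group G] [MulAction G X] [ProperlyDiscontinuousSMul G X] [ContinuousConstSMul G X]
  [IsCancelSMul G X] [T2Space X] [LocallyCompactSpace X]

theorem quot_smoothAt_of_comp [I.Boundaryless] {V' H' Y : Type} [NormedAddCommGroup V']
    [NormedSpace ℝ V'] [TopologicalSpace H'] {J : ModelWithCorners ℝ V' H'} [TopologicalSpace Y]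
    [ChartedSpace H' Y] {f : orbitRel.Quotient G X → Y} {q : orbitRel.Quotient G X}
    (hf : ∀ x : X, Quotient.mk _ x = q → ContMDiffAt I J ∞ (fun x : X => f (Quotient.mk _ x)) x) :
    ContMDiffAt I J ∞ f q := by
  have h1 := mem_chart_source H q
  obtain ⟨x, h2⟩ := quot_atlas (chart_mem_atlas H q)
  rw [h2] at h1
  rw [contMDiffAt_iff_source]
  have h3 : f ∘ (extChartAt I q).symm = (fun z : X => f (Quotient.mk _ z)) ∘ (extChartAt I x).symm := by
    funext v
    simp only [extChartAt, h2, mfld_simps, IsLocalHomeomorph.localInverseAt_symm]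
  have h4 : extChartAt I q q = extChartAt I x (quot_locHomeo.localInverseAt x q) := by
    simp only [extChartAt, h2, mfld_simps]
  have h6 : quot_locHomeo.localInverseAt x q ∈ (extChartAt I x).source := by
    simpa only [mfld_simps] using h1.2
  have h5 : extChartAt I q q ∈ (extChartAt I x).target := by
    rw [h4]
    exact (extChartAt I x).map_source h6
  rw [h3]
  have a1 : ContMDiffAt 𝓘(ℝ, V) I ∞ (extChartAt I x).symm (extChartAt I q q) :=
    (contMDiffOn_extChartAt_symm x).contMDiffAt ((isOpen_extChartAt_target x).mem_nhds h5)
  refine ((hf _ ?_).comp _ a1).contMDiffWithinAt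
  rw [h4, (extChartAt I x).left_inv h6]
  exact quot_locHomeo.apply_localInverseAt_of_mem h1.1

end Quotient

theorem IsSurjSubm.comp {A B C : Mfd} {g : B → C} {f : A → B} (hg : IsSurjSubm g)
    (hf : IsSurjSubm f) : IsSurjSubm (fun x => g (f x)) where
  smooth := ContMDiff.comp hg.smooth hf.smooth
  surj := hg.surj.comp hf.surj
  sec z := by
    obtain ⟨U, hU, s, hs, hsz, hfs⟩ := hf.sec z
    obtain ⟨V, hV, t, ht, htz, hgt⟩ := hg.sec (f z)
    have hc : ContinuousAt t (g (f z)) := ht.continuousOn.continuousAt hV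
    refine ⟨V ∩ t ⁻¹' U, Filter.inter_mem hV (hc (by rwa [htz])), fun c => s (t c),
      hs.comp (ht.mono Set.inter_subset_left) fun c hc => hc.2, ?_, fun c hc => ?_⟩
    · change s (t (g (f z))) = z
      rw [htz, hsz]
    · change g (f (s (t c))) = c
      rw [hfs _ hc.2, hgt _ hc.1]

section Coverings
variable (p : ℕ) [NeZero p]

theorem toLens_subm : IsSurjSubm (toLens p) where
  smooth := toLens_smooth p
  surj := Quotient.mk_surjective
  sec y := by
    let e := (quot_locHomeo (X := Sph3) (G := Zp p)).localInverseAt y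
    refine ⟨e.source, e.open_source.mem_nhds
      (quot_locHomeo (X := Sph3) (G := Zp p)).apply_self_mem_localInverseAt_source, e, ?_,
      (quot_locHomeo (X := Sph3) (G := Zp p)).localInverseAt_apply_self, fun l hl =>
      (quot_locHomeo (X := Sph3) (G := Zp p)).apply_localInverseAt_of_mem hl⟩
    intro l hl
    refine (quot_smoothAt_of_comp (X := Sph3) (G := Zp p) (I := 𝓡 3) (J := 𝓡 3) (Y := Sph3)
      fun z hz => ?_).contMDiffWithinAt
    subst hz
    exact quot_local_smooth (V := EuclideanSpace ℝ (Fin 3)) (X := Sph3) (G := Zp p) (I := 𝓡 3)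
      (fun c => contMDiff_smul3 _) y z hl

/-- The covering `S³ × ℝ → L_p × ℝ`. -/
def toYp (x : S3R) : Yp p := Yp.mk (toLens p (S3R.y x)) (S3R.r x)

theorem toYp_subm : IsSurjSubm (toYp p) where
  smooth := ((toLens_smooth p).comp S3R.y_smooth).prodMk S3R.r_smooth
  surj y := by
    obtain ⟨z, hz⟩ := (toLens_subm p).surj (Yp.x y)
    exact ⟨S3R.mk z (Yp.r y), Prod.ext hz rfl⟩
  sec x := by
    obtain ⟨U, hU, s, hs, hsz, hfs⟩ := (toLens_subm p).sec (S3R.y x)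
    refine ⟨Yp.x ⁻¹' U, (Yp.x_smooth p).continuous.continuousAt.preimage_mem_nhds hU,
      fun y => S3R.mk (s (Yp.x y)) (Yp.r y), ?_, Prod.ext hsz rfl,
      fun y hy => Prod.ext (hfs _ hy) rfl⟩
    exact (hs.comp (Yp.x_smooth p).contMDiffOn fun _ h => h).prodMk (Yp.r_smooth p).contMDiffOn

theorem toMp_subm : IsSurjSubm (Tw.toMp p) := (proj_subm p).comp (toYp_subm p)

variable {p}

theorem rot_one (x : S3R) : rot (1 : Zp p) x = x := Prod.ext (one_smul (Zp p) (S3R.y x)) rfl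

theorem rot_rot (ζ ζ' : Zp p) (x : S3R) : rot ζ (rot ζ' x) = rot (ζ * ζ') x :=
  Prod.ext (mul_smul ζ ζ' (S3R.y x)).symm rfl

theorem shift_zero (x : S3R) : shift 0 x = x := Prod.ext rfl (by
  change S3R.r x + ((0 : ℤ) : ℝ) = S3R.r x
  simp)

theorem shift_shift (n m : ℤ) (x : S3R) : shift n (shift m x) = shift (n + m) x := Prod.ext rfl (by
  change S3R.r x + (m : ℝ) + (n : ℝ) = S3R.r x + ((n + m : ℤ) : ℝ)
  push_cast
  ring)

theorem rot_shift (ζ : Zp p) (n : ℤ) (x : S3R) : rot ζ (shift n x) = shift n (rot ζ x) := rfl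

theorem toYp_rot (ζ : Zp p) (x : S3R) : toYp p (rot ζ x) = toYp p x :=
  Prod.ext (Quotient.sound ⟨ζ, rfl⟩) rfl

theorem proj_toYp_shift (n : ℤ) (x : S3R) : proj p (toYp p (shift n x)) = proj p (toYp p x) :=
  Tw.toMp_shift n x _ rfl

/-- Points of `S³ × ℝ` over the same point of `L_p × ℝ` differ by the action of `ℤ_p`. -/
theorem toYp_eq {x x' : S3R} (h : toYp p x = toYp p x') : ∃ ζ : Zp p, x' = rot ζ x := by
  obtain ⟨ζ, hζ⟩ := Quotient.exact (congrArg Prod.fst h).symm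
  exact ⟨ζ, Prod.ext hζ.symm (congrArg Prod.snd h).symm⟩

/-- Points of `S³ × ℝ` over the same point of `M_p` differ by the action of `ℤ_p × ℤ`. -/
theorem toMp_eq {x x' : S3R} (h : Tw.toMp p x = Tw.toMp p x') :
    ∃ (ζ : Zp p) (n : ℤ), x' = rot ζ (shift n x) := by
  obtain ⟨h1, n, hn⟩ := proj_eq p h
  obtain ⟨ζ, hζ⟩ := Quotient.exact h1.symm
  exact ⟨ζ, n, Prod.ext hζ.symm hn⟩

theorem rot_shift_inj {ζ ζ' : Zp p} {n n' : ℤ} {x : S3R}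
    (h : rot ζ (shift n x) = rot ζ' (shift n' x)) : ζ = ζ' ∧ n = n' := by
  constructor
  · exact IsCancelSMul.right_cancel ζ ζ' (S3R.y x) (congrArg Prod.fst h)
  · have : S3R.r x + (n : ℝ) = S3R.r x + (n' : ℝ) := congrArg Prod.snd h
    exact_mod_cast add_left_cancel this

theorem plot_y {n : ℕ} (q : Plot S3R n) :
    ContMDiff 𝓘(ℝ, Euc n) (𝓡 3) ∞ (fun w => S3R.y (q w)) := S3R.y_smooth.comp (Mfd.isPlot_iff.1 q.2)

theorem plot_r {n : ℕ} (q : Plot S3R n) : ContDiff ℝ ∞ (fun w => S3R.r (q w)) :=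
  (S3R.r_smooth.comp (Mfd.isPlot_iff.1 q.2)).contDiff

/-- Along two plots of `S³ × ℝ` with the same image in `M_p`, the element of `ℤ_p × ℤ` which relates
them is constant. -/
theorem exists_rot_shift {n : ℕ} (q₀ q₁ : Plot S3R n) (h : ∀ w, Tw.toMp p (q₀ w) = Tw.toMp p (q₁ w)) :
    ∃ (ζ : Zp p) (m : ℤ), ∀ w, q₁ w = rot ζ (shift m (q₀ w)) := by
  choose ζ m hm using fun w => toMp_eq (h w)
  have h1 : ∀ w, (m w : ℝ) = S3R.r (q₁ w) - S3R.r (q₀ w) := fun w => by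
    rw [hm w]
    exact (add_sub_cancel_left _ _).symm
  have h2 : ∀ w, (((ζ w : ℂˣ)) : ℂ) = inner ℂ (S3R.y (q₀ w) : C2) (S3R.y (q₁ w) : C2) := fun w => by
    conv_rhs => rw [hm w]
    change _ = inner ℂ (S3R.y (q₀ w) : C2) (((ζ w : ℂˣ) : ℂ) • (S3R.y (q₀ w) : C2))
    rw [inner_smul_right, inner_self_eq_norm_sq_to_K, norm_eq_of_mem_sphere]
    simp
  have c1 : Continuous m := Int.isClosedEmbedding_coe_real.isEmbedding.continuous_iff.2 (by
    refine Continuous.congr ?_ fun w => (h1 w).symm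
    exact (plot_r q₁).continuous.sub (plot_r q₀).continuous)
  have c2 : Continuous fun w => (((ζ w : ℂˣ)) : ℂ) := by
    refine Continuous.congr ?_ fun w => (h2 w).symm
    exact (continuous_subtype_val.comp (plot_y q₀).continuous).inner
      (continuous_subtype_val.comp (plot_y q₁).continuous)
  have hfin : (Set.range fun w => (((ζ w : ℂˣ)) : ℂ)).Finite :=
    (Set.finite_range fun z : Zp p => ((z : ℂˣ) : ℂ)).subset (by rintro _ ⟨w, rfl⟩; exact ⟨ζ w, rfl⟩)
  have hsub := hfin.countable.isTotallyDisconnected _ subset_rfl (isPreconnected_range c2)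
  refine ⟨ζ 0, m 0, fun w => ?_⟩
  have e1 : m w = m 0 := PreconnectedSpace.constant inferInstance c1
  have e2 : ζ w = ζ 0 := Subtype.ext (Units.ext (hsub ⟨w, rfl⟩ ⟨0, rfl⟩))
  rw [hm w, e1, e2]

end Coverings

/-! ### The canonical sections of the powers of the Hopf bundle -/

/-- A plot of `S³` as a map to the unit sphere. -/
def Plot.toSph {n : ℕ} (q : Plot S3 n) : Euc n → Sph3 := q.1

theorem plot_S3 {n : ℕ} (q : Plot S3 n) : ContDiff ℝ ∞ (fun w => (q.toSph w : C2)) := by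
  have h : ContMDiff 𝓘(ℝ, Euc n) (𝓡 3) ∞ q.toSph := q.2
  exact (contMDiff_coe_sphere.comp h).contDiff

/-- The 1-form `Im ⟨y, dy⟩` on `S³`. -/
def hopfForm : OneForm S3.carrier where
  val q u := Complex.imCLM ∘L ((innerSL ℂ (q.toSph u : C2)).restrictScalars ℝ)
    ∘L fderiv ℝ (fun w => (q.toSph w : C2)) u
  smooth q := by
    rw [contDiff_clm_apply_iff]
    intro v
    have h1 := plot_S3 q
    have h2 := (h1.fderiv_right (m := ∞) (by simp)).clm_apply (contDiff_const (c := v))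
    exact Complex.imCLM.contDiff.comp (h1.inner ℂ h2)
  reparam q h hh u v := by
    have e := fderiv_comp u ((plot_S3 q).contDiffAt.differentiableAt (by simp))
      (hh.contDiffAt.differentiableAt (by simp))
    change (inner ℂ _ (fderiv ℝ ((fun w => (q.toSph w : C2)) ∘ h) u v)).im = _
    rw [e]
    rfl

theorem hopfForm_apply {n : ℕ} (q : Plot S3 n) (u v : Euc n) : hopfForm.val q u v
    = (inner ℂ (q.toSph u : C2) (fderiv ℝ (fun w => (q.toSph w : C2)) u v)).im := rfl

section
variable {k : ℕ}

theorem inner_self_fderiv_sphere {F : Euc k → Sph3} {u : Euc k}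
    (hd : DifferentiableAt ℝ (fun w => (F w : C2)) u) (v : Euc k) :
    inner ℂ (F u : C2) (fderiv ℝ (fun w => (F w : C2)) u v)
      = Complex.I * ((inner ℂ (F u : C2) (fderiv ℝ (fun w => (F w : C2)) u v)).im : ℝ) ∧
    inner ℂ (fderiv ℝ (fun w => (F w : C2)) u v) (F u : C2)
      = - (Complex.I * ((inner ℂ (F u : C2) (fderiv ℝ (fun w => (F w : C2)) u v)).im : ℝ)) := by
  have h1 := fderiv_inner_apply ℂ hd hd v
  have h2 : (fun w => inner ℂ (F w : C2) (F w : C2)) = fun _ => (1 : ℂ) := by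
    funext w
    rw [inner_self_eq_norm_sq_to_K, norm_eq_of_mem_sphere]; simp
  rw [h2, fderiv_fun_const] at h1
  have h3 := inner_conj_symm (𝕜 := ℂ) (fderiv ℝ (fun w => (F w : C2)) u v) (F u : C2)
  generalize inner ℂ (F u : C2) (fderiv ℝ (fun w => (F w : C2)) u v) = a at *
  generalize inner ℂ (fderiv ℝ (fun w => (F w : C2)) u v) (F u : C2) = b at *
  have hb : b = -a := by
    have : (0 : ℂ) = a + b := h1
    linear_combination -this
  have hre : a.re = 0 := by
    have := congrArg Complex.re h3
    rw [hb] at this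
    simp at this
    linarith
  have ha : a = Complex.I * (a.im : ℝ) := by
    apply Complex.ext <;> simp [hre]
  exact ⟨ha, by rw [hb]; exact congrArg Neg.neg ha⟩

/-- The derivative of `⟨F, G⟩⁻ⁿ` for maps to `S³` with the same image under the Hopf fibration. -/
theorem inner_zpow_par {F G : Euc k → Sph3} {u : Euc k} (n : ℤ)
    (cF : ContDiffAt ℝ ∞ (fun w => (F w : C2)) u) (cG : ContDiffAt ℝ ∞ (fun w => (G w : C2)) u)
    (hst : hopf (F u) = hopf (G u)) :
    ContDiffAt ℝ ∞ (fun w => inner ℂ (F w : C2) (G w : C2) ^ (-n)) u ∧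
    ∀ v, fderiv ℝ (fun w => inner ℂ (F w : C2) (G w : C2) ^ (-n)) u v
      + n * Complex.I * ((inner ℂ (G u : C2) (fderiv ℝ (fun w => (G w : C2)) u v)).im : ℝ)
        * inner ℂ (F u : C2) (G u : C2) ^ (-n)
      = inner ℂ (F u : C2) (G u : C2) ^ (-n)
        * (n * Complex.I * ((inner ℂ (F u : C2) (fderiv ℝ (fun w => (F w : C2)) u v)).im : ℝ)) := by
  have cl : ContDiffAt ℝ ∞ (fun w => inner ℂ (F w : C2) (G w : C2)) u := cF.inner ℂ cG
  have hn := KF.inner_norm hst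
  have h0 : inner ℂ (F u : C2) (G u : C2) ≠ 0 := fun h => by simp [h] at hn
  have cz : ContDiffAt ℝ ∞ (fun z : ℂ => z ^ (-n)) (inner ℂ (F u : C2) (G u : C2)) := by
    have : AnalyticAt ℂ (fun z : ℂ => z ^ (-n)) (inner ℂ (F u : C2) (G u : C2)) :=
      analyticAt_id.zpow h0
    exact this.contDiffAt.restrict_scalars ℝ
  refine ⟨ContDiffAt.comp (g := fun z : ℂ => z ^ (-n)) u cz cl, fun v => ?_⟩
  have t : (∞ : WithTop ℕ∞) ≠ 0 := by simp
  have dl := (cl.differentiableAt t).hasFDerivAt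
  have dz := ((hasDerivAt_zpow (-n) _ (Or.inl h0)).hasFDerivAt.restrictScalars ℝ).comp u dl
  have e1 : fderiv ℝ (fun w => inner ℂ (F w : C2) (G w : C2) ^ (-n)) u v
      = fderiv ℝ (fun w => inner ℂ (F w : C2) (G w : C2)) u v
        * (((-n : ℤ) : ℂ) * inner ℂ (F u : C2) (G u : C2) ^ (-n - 1)) :=
    congrArg (fun f => f v) dz.fderiv
  have e2 := fderiv_inner_apply ℂ (cF.differentiableAt t) (cG.differentiableAt t) v
  have e3 := hopf_eq hst
  obtain ⟨a1, a2⟩ := inner_self_fderiv_sphere (cF.differentiableAt t) v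
  obtain ⟨b1, b2⟩ := inner_self_fderiv_sphere (cG.differentiableAt t) v
  generalize (inner ℂ (G u : C2) (fderiv ℝ (fun w => (G w : C2)) u v)).im = β at *
  generalize (inner ℂ (F u : C2) (fderiv ℝ (fun w => (F w : C2)) u v)).im = α at *
  rw [e1, e2, zpow_sub₀ h0, zpow_one]
  rw [e3, inner_smul_left] at b1
  generalize fderiv ℝ (fun w => (G w : C2)) u v = G' at *
  have a2' : inner ℂ (fderiv ℝ (fun w => (F w : C2)) u v) (G u : C2)
      = inner ℂ (F u : C2) (G u : C2) * - (Complex.I * (α : ℝ)) := by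
    conv_lhs => rw [e3]
    rw [inner_smul_right, a2]
  rw [a2']
  have hc : starRingEnd ℂ (inner ℂ (F u : C2) (G u : C2)) * inner ℂ (F u : C2) (G u : C2) = 1 := by
    rw [Complex.conj_mul', hn]; simp
  generalize inner ℂ (F u : C2) (G u : C2) = l at *
  generalize inner ℂ (F u : C2) G' = m at *
  have b3 : m = l * (Complex.I * (β : ℝ)) := by
    rw [← b1]; linear_combination (-m) * hc
  rw [b3]
  push_cast
  field_simp
  ring

end

theorem cmul_fderiv {k : ℕ} {g : Euc k → ℂ} {u : Euc k} (hg : ContDiffAt ℝ ∞ g u) :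
    ContDiffAt ℝ ∞ (fun w => cmul (g w)) u ∧
      ∀ v, fderiv ℝ (fun w => cmul (g w)) u v = cmul (fderiv ℝ g u v) :=
  ⟨cmul.contDiff.contDiffAt.comp u hg, fun v => congrArg (fun f => f v)
    (cmul.hasFDerivAt.comp u (hg.differentiableAt (by simp)).hasFDerivAt).fderiv⟩

theorem cmul_parTw {k : ℕ} {g : Euc k → ℂ} {M : Euc k → ℂ →L[ℂ] ℂ} {u : Euc k}
    (hg : ContDiffAt ℝ ∞ g u) (h : ∀ᶠ w in 𝓝 u, M w = cmul (g w)) {A : Euc k →L[ℝ] ℂ →L[ℂ] ℂ}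
    {a b : Euc k → ℂ} (hA : ∀ v z, A v z = a v * z)
    (hD : ∀ v, fderiv ℝ g u v + a v * g u = g u * b v) :
    ContDiffAt ℝ ∞ M u ∧ ∀ v, fderiv ℝ M u v + A v ∘L M u = M u ∘L 0 + b v • M u := by
  have h' : M =ᶠ[𝓝 u] fun w => cmul (g w) := h
  refine ⟨(cmul_fderiv hg).1.congr_of_eventuallyEq h', fun v => ContinuousLinearMap.ext fun z => ?_⟩
  rw [h'.fderiv_eq, (cmul_fderiv hg).2, h.self_of_nhds]
  simp [hA, cmul_apply]
  linear_combination z * hD v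

/-- The section `[y, 1]` of the pullback of the `n`-th power of the Hopf bundle to `S³` is not
parallel: its covariant derivative is `n i Im⟨y, dy⟩ [y, 1]`. -/
theorem incl_par {X : Type} [DiffeologicalSpace X] {y : X → S3} (hy : DSmooth y) {F : X → S2Z}
    (hF : DSmooth F) (h : ∀ x, hopf (y x) = (F x).s) :
    HVB.IsParTw (fun q u v => ((F (q u)).n : ℝ) * hopfForm.val (q.map y hy) u v) (HVB.triv X)
      (hopfPowers.pb F hF)
      (fun x => ContinuousLinearMap.toSpanSingleton ℂ (KF.incl (F x).s (F x).n (y x) 1)) := by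
  have K : ∀ {n : ℕ} (q : Plot X n) (σ : LocSec) (u : Euc n), (F (q u)).s ∈ σ.U → _ :=
    fun {n} q σ u hσ => cmul_parTw (inner_zpow_par (F := (q.map y hy).toSph)
      (G := fun w => σ.σ (F (q w)).s) (u := u) (F (q u)).n (plot_S3 (q.map y hy)).contDiffAt
      (σ.contDiffAt (q.map F hF) hσ) ((h _).trans (σ.hopf_σ _ hσ).symm)).1
      (M := HVB.mat (HVB.triv X) (hopfPowers.pb F hF)
        (fun x => ContinuousLinearMap.toSpanSingleton ℂ (KF.incl (F x).s (F x).n (y x) 1)) q () σ)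
      (Filter.mem_of_superset ((σ.isOpen_dom (q.map F hF)).mem_nhds hσ) fun w hw => by
        refine ContinuousLinearMap.ext (R₁ := ℂ) (M₁ := ℂ) (M₂ := ℂ) fun z => ?_
        have e := KF.incl_apply (n := (F (q w)).n) (y (q w)) (σ.hopf_σ _ hw) 1
        have e2 : (F (q w)).n = (F (q u)).n := plot_Z (q.map F hF) w u
        refine (congrArg (z * ·) e).trans ?_
        rw [e2]
        exact (mul_comm _ _).trans (congrArg (· * z) (mul_one _)))
      (A := hopfPowers.conn σ (q.map F hF) u)
      (a := fun v => Complex.I * (((F (q u)).n : ℂ) * (σ.form (fun w => (F (q w)).s) u v : ℝ)))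
      (b := fun v => Complex.I * (((F (q u)).n * hopfForm.val (q.map y hy) u v : ℝ) : ℂ))
      (fun v z => (iSkew_apply (F (q u)).n (σ.form (fun w => (F (q w)).s) u v) z).trans (by ring)) (fun v => by
        have D := (inner_zpow_par (F := (q.map y hy).toSph)
          (G := fun w => σ.σ (F (q w)).s) (u := u) (F (q u)).n (plot_S3 (q.map y hy)).contDiffAt
          (σ.contDiffAt (q.map F hF) hσ) ((h _).trans (σ.hopf_σ _ hσ).symm)).2 v
        rw [hopfForm_apply, LocSec.form_apply]
        push_cast
        change _ = _ * (Complex.I * (((F (q u)).n : ℂ) * ((inner ℂ ((q.map y hy).toSph u : C2)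
          (fderiv ℝ (fun w => ((q.map y hy).toSph w : C2)) u v)).im : ℝ)))
        linear_combination D)
  exact ⟨fun q _ σ u _ hσ => (K q σ u hσ).1, fun q _ σ u _ hσ => (K q σ u hσ).2⟩

/-! ### Bundles on `M_p` as equivariant bundles -/

namespace Tw
variable {p : ℕ} [NeZero p] {k : ℤ} (A : Tw p k)

/-- The action of `(ζ, n) ∈ ℤ_p × ℤ` on fibres; for `k ≠ 0` it is only projective. -/
def act (ζ : Zp p) (n : ℤ) (x x' : S3R) (h : x' = rot ζ (shift n x)) :
    A.E.fib x' ≃ₗᵢ[ℂ] A.E.fib x := (A.φ ζ (shift n x) x' h).trans (A.γ n x _ rfl)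

theorem act_eq (ζ : Zp p) (n : ℤ) (x x₁ x' : S3R) (h : x' = rot ζ (shift n x)) (h₁ : x₁ = shift n x)
    (h₂ : x' = rot ζ x₁) (e : A.E.fib x') : A.act ζ n x x' h e = A.γ n x x₁ h₁ (A.φ ζ x₁ x' h₂ e) := by
  subst h₁
  rfl

/-- The actions compose up to a root of unity, which is the value of the cocycle of the twist. -/
theorem act_act (ζ ζ' : Zp p) (n n' : ℤ) (x x' x'' : S3R) (h : x' = rot ζ (shift n x))
    (h' : x'' = rot ζ' (shift n' x')) (h'' : x'' = rot (ζ * ζ') (shift (n + n') x)) (e : A.E.fib x'') :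
    A.act ζ n x x' h (A.act ζ' n' x' x'' h' e)
      = (((ζ : ℂˣ) ^ (-k * n') : ℂˣ) : ℂ) • A.act (ζ * ζ') (n + n') x x'' h'' e := by
  have h1 : shift n' (shift n x) = shift (n + n') x := by rw [shift_shift, add_comm]
  have e1 : shift n' x' = rot ζ (shift n' (shift n x)) := by rw [h]; rfl
  rw [A.act_eq (ζ * ζ') (n + n') x _ x'' h'' h1 (by rw [h1]; exact h''),
    ← A.φ_mul ζ ζ' _ (shift n' x') x'' e1 h', ← A.γ_add n n' x (shift n x) _ rfl rfl h1]
  change A.γ n x _ rfl (A.φ ζ _ x' h (A.γ n' x' _ rfl (A.φ ζ' _ x'' h' e))) = _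
  rw [A.twist ζ n' (shift n x) _ _ x' rfl e1 h rfl, map_smul, smul_smul, twist_inv, one_smul]

theorem γ_zero (x x' : S3R) (h : x' = shift 0 x) (h' : x' = x) (e : A.E.fib x') :
    A.γ 0 x x' h e = A.E.tr h' e := by
  subst h'
  refine (A.γ 0 x' x' h).injective ?_
  have := A.γ_add 0 0 x' x' x' h h h e
  simpa using this

theorem φ_one (x x' : S3R) (h : x' = rot (1 : Zp p) x) (h' : x' = x) (e : A.E.fib x') :
    A.φ 1 x x' h e = A.E.tr h' e := by
  subst h'
  refine (A.φ 1 x' x' h).injective ?_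
  have h1 : x' = rot (1 * 1 : Zp p) x' := by rw [mul_one]; exact h
  have := A.φ_mul 1 1 x' x' x' h h h1 e
  rw [this]
  congr 2
  exact mul_one 1

theorem act_zero (ζ : Zp p) (x x' : S3R) (h : x' = rot ζ (shift 0 x)) (h' : x' = rot ζ x)
    (e : A.E.fib x') : A.act ζ 0 x x' h e = A.φ ζ x x' h' e := by
  rw [A.act_eq ζ 0 x x x' h (shift_zero x).symm h', A.γ_zero _ _ _ rfl]
  rfl

theorem act_one (n : ℤ) (x x' : S3R) (h : x' = rot (1 : Zp p) (shift n x)) (h' : x' = shift n x)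
    (e : A.E.fib x') : A.act 1 n x x' h e = A.γ n x x' h' e := by
  rw [A.act_eq 1 n x x' x' h h' (rot_one x').symm, A.φ_one _ _ _ rfl]
  rfl

theorem act_par {X : Type} [DiffeologicalSpace X] {f₀ f₁ : X → S3R} (hf₀ : DSmooth f₀)
    (hf₁ : DSmooth f₁) (ζ : Zp p) (n : ℤ) (h : ∀ x, f₁ x = rot ζ (shift n (f₀ x))) :
    HVB.IsPar (A.E.pb f₁ hf₁) (A.E.pb f₀ hf₀) (fun x => clm (A.act ζ n (f₀ x) (f₁ x) (h x))) := by
  obtain rfl : f₁ = fun x => rot ζ (shift n (f₀ x)) := funext h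
  exact ((A.γ_par n).pb f₀ hf₀).comp ((A.φ_par ζ).pb _ (dSmooth_comp (shift_smooth n) hf₀))

/-- The action of the element of `ℤ_p × ℤ` which relates two points over the same point of `M_p`. -/
def tp (x x' : S3R) (h : toMp p x = toMp p x') : A.E.fib x' ≃ₗᵢ[ℂ] A.E.fib x :=
  A.act (toMp_eq h).choose (toMp_eq h).choose_spec.choose x x' (toMp_eq h).choose_spec.choose_spec

theorem tp_eq (ζ : Zp p) (n : ℤ) (x x' : S3R) (h : toMp p x = toMp p x')
    (h' : x' = rot ζ (shift n x)) : A.tp x x' h = A.act ζ n x x' h' := by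
  have key : ∀ (ζ' : Zp p) (n' : ℤ) (h'' : x' = rot ζ' (shift n' x)),
      A.act ζ' n' x x' h'' = A.act ζ n x x' h' := fun ζ' n' h'' => by
    obtain ⟨rfl, rfl⟩ := rot_shift_inj (h'.symm.trans h'')
    rfl
  exact key _ _ _

/-- A property of families over `(S³ × ℝ) ×_{M_p} (S³ × ℝ)` of being smooth and parallel may be
checked on the graph of each element of `ℤ_p × ℤ`. -/
theorem isPar_of_graph {X : Type} [DiffeologicalSpace X] {E F : HVB X} {a b : X → S3R}
    (ha : DSmooth a) (hb : DSmooth b) (h : ∀ x, toMp p (a x) = toMp p (b x))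
    {ψ : ∀ x, E.fib x →L[ℂ] F.fib x}
    (H : ∀ (ζ : Zp p) (n : ℤ) (X' : Type) (_ : DiffeologicalSpace X') (f : X' → X) (hf : DSmooth f),
      (∀ x, b (f x) = rot ζ (shift n (a (f x)))) →
      HVB.IsPar (E.pb f hf) (F.pb f hf) (fun x => ψ (f x))) : HVB.IsPar E F ψ := by
  refine .of_local_lift fun {n} t u => ?_
  obtain ⟨ζ, m, hm⟩ := exists_rot_shift (p := p) (t.map a ha) (t.map b hb) (fun w => h (t w))
  let X' := {x : X // b x = rot ζ (shift m (a x))}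
  let I : DiffeologicalSpace X' := inducedDiffeology (Subtype.val : X' → X)
  exact ⟨X', I, Subtype.val, fun n q hq => hq, ⟨fun w => ⟨t w, hm w⟩, t.2⟩,
    Filter.Eventually.of_forall fun _ => rfl, H ζ m X' I _ _ fun x => x.2⟩

theorem tp_par {X : Type} [DiffeologicalSpace X] {a b : X → S3R}
    (ha : DSmooth a) (hb : DSmooth b) (h : ∀ x, toMp p (a x) = toMp p (b x)) :
    HVB.IsPar (A.E.pb b hb) (A.E.pb a ha) (fun x => clm (A.tp (a x) (b x) (h x))) := by
  refine isPar_of_graph ha hb h fun ζ n X' _ f hf hab => ?_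
  refine (A.act_par (dSmooth_comp ha hf) (dSmooth_comp hb hf) ζ n hab).congr fun x e => ?_
  rw [A.tp_eq ζ n _ _ (h (f x)) (hab x)]
  rfl

/-- An untwisted equivariant bundle descends to `M_p`. -/
def descentData (A : Tw p 0) : DescentData (toMp p : S3R → Mp p) A.E where
  θ := A.tp
  par := A.tp_par FibProd.dSmooth_fst FibProd.dSmooth_snd fun t => t.2
  cocycle x₀ x₁ x₂ h h' e := by
    obtain ⟨ζ, n, hn⟩ := toMp_eq h
    obtain ⟨ζ', n', hn'⟩ := toMp_eq h'
    have h2 : x₂ = rot (ζ * ζ') (shift (n + n') x₀) := by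
      rw [hn', hn, ← rot_shift, rot_rot, shift_shift, mul_comm, add_comm]
    rw [A.tp_eq ζ n _ _ h hn, A.tp_eq ζ' n' _ _ h' hn', A.tp_eq _ _ _ _ _ h2,
      A.act_act _ _ _ _ _ _ _ hn hn' h2]
    simp

variable {A} in
/-- A fibrewise isometric parallel isomorphism which commutes with the equivariant structures is an
isomorphism. -/
def isoMk {B : Tw p k} (e : ∀ x, A.E.fib x ≃ₗᵢ[ℂ] B.E.fib x)
    (he : HVB.IsPar A.E B.E (fun x => clm (e x)))
    (hφ : ∀ (ζ : Zp p) (x x' : S3R) (h : x' = rot ζ x) (a : A.E.fib x'),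
      e x (A.φ ζ x x' h a) = B.φ ζ x x' h (e x' a))
    (hγ : ∀ (n : ℤ) (x x' : S3R) (h : x' = shift n x) (a : A.E.fib x'),
      e x (A.γ n x x' h a) = B.γ n x x' h (e x' a)) : A ≅ B where
  hom := ⟨⟨fun x => clm (e x), he⟩, hφ, hγ⟩
  inv := ⟨⟨fun x => clm (e x).symm, he.inv (fun x => (e x).symm_apply_apply)
      (fun x => (e x).apply_symm_apply)⟩,
    fun ζ x x' h a => (e x).injective (((e x).apply_symm_apply _).trans
      ((hφ ζ x x' h _).trans (congrArg _ ((e x').apply_symm_apply a))).symm),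
    fun n x x' h a => (e x).injective (((e x).apply_symm_apply _).trans
      ((hγ n x x' h _).trans (congrArg _ ((e x').apply_symm_apply a))).symm)⟩
  hom_inv_id := Hom.ext (HVB.ParHom.ext (funext fun x => ContinuousLinearMap.ext
    fun a => (e x).symm_apply_apply a))
  inv_hom_id := Hom.ext (HVB.ParHom.ext (funext fun x => ContinuousLinearMap.ext
    fun a => (e x).apply_symm_apply a))

/-- The pullback of the descended bundle. -/
def descIso (A : Tw p 0) : (pull p).obj (A.descentData.desc (toMp_subm p)) ≅ A :=
  isoMk (A := (pull p).obj (A.descentData.desc (toMp_subm p))) (A.descentData.κ (toMp_subm p))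
    (A.descentData.κ_par (toMp_subm p))
    (fun ζ x x' h a => by
      have h' : x' = rot ζ (shift 0 x) := by rw [shift_zero]; exact h
      have e := A.descentData.θ_κ (toMp_subm p) x x' (toMp_rot ζ x x' h).symm a
      rw [← A.act_zero ζ x x' h' h, ← A.tp_eq ζ 0 x x' (toMp_rot ζ x x' h).symm h']
      exact e.symm)
    (fun n x x' h a => by
      have h' : x' = rot (1 : Zp p) (shift n x) := by rw [rot_one]; exact h
      have e := A.descentData.θ_κ (toMp_subm p) x x' (toMp_shift n x x' h).symm a
      rw [← A.act_one n x x' h' h, ← A.tp_eq 1 n x x' (toMp_shift n x x' h).symm h']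
      exact e.symm)

/-- An equivariant morphism of pullbacks takes the same values over points with the same image. -/
theorem pull_hom_tr {F F' : HVB (Mp p).carrier} (g : (pull p).obj F ⟶ (pull p).obj F') (x x' : S3R)
    (h : toMp p x' = toMp p x) (e : F.fib (toMp p x')) :
    g.toHom.toFun x (F.tr h e) = F'.tr h (g.toHom.toFun x' e) := by
  obtain ⟨ζ, n, hn⟩ := toMp_eq h.symm
  have h1 := toMp_rot ζ (shift n x) x' hn
  have h2 := toMp_shift (p := p) n x _ rfl
  have e1 := g.map_γ n x _ rfl (F.tr h1 e)
  have e2 := g.map_φ ζ (shift n x) x' hn e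
  change g.toHom.toFun x (F.tr h2 (F.tr h1 e)) = F'.tr h2 (g.toHom.toFun _ (F.tr h1 e)) at e1
  change g.toHom.toFun _ (F.tr h1 e) = F'.tr h1 (g.toHom.toFun x' e) at e2
  rw [e2, F.tr_tr h1 h2 h] at e1
  exact e1.trans (F'.tr_tr h1 h2 h _)

instance : (pull p).Full where
  map_surjective {F F'} g := by
    choose pt hpt using (toMp_subm p).surj
    let ψ : ∀ m, F.fib m →L[ℂ] F'.fib m := fun m =>
      clm (F'.tr (hpt m)) ∘L g.toHom.toFun (pt m) ∘L clm (F.tr (hpt m).symm)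
    have hψ : ∀ x (a : F.fib (toMp p x)), ψ (toMp p x) a = g.toHom.toFun x a := fun x a => by
      change F'.tr (hpt (toMp p x)) (g.toHom.toFun (pt (toMp p x)) (F.tr (hpt (toMp p x)).symm a)) = _
      rw [← pull_hom_tr g x _ (hpt (toMp p x)), F.tr_tr _ _ rfl]
      rfl
    have hl : HVB.IsPar F F' ψ := .of_local_lift fun {n} q u => by
      obtain ⟨σ, hσ⟩ := (toMp_subm p).exists_locSect (q u)
      obtain ⟨q', hq'⟩ := σ.exists_plot q hσ
      refine ⟨S3R.carrier, inferInstance, toMp p, toMp_smooth p, q', ?_,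
        g.toHom.isPar.congr fun x a => (hψ x a).symm⟩
      filter_upwards [hq', (σ.isOpen_dom q).mem_nhds hσ] with w h1 h2
      rw [h1]
      exact σ.sec _ h2
    exact ⟨⟨ψ, hl⟩, Hom.ext (HVB.ParHom.ext (funext fun x => ContinuousLinearMap.ext (hψ x)))⟩

instance : (pull p).Faithful where
  map_injective {F F'} f g h := by
    refine HVB.ParHom.ext (funext fun m => ?_)
    obtain ⟨x, rfl⟩ := (toMp_subm p).surj m
    exact congrFun (congrArg (fun t : Hom _ _ => t.toHom.toFun) h) x

end Tw

/-- A fully faithful functor with given preimages of all objects is an equivalence; its counit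
consists of the given isomorphisms. -/
def equivOfPreimages {C D : Type*} [Category C] [Category D] (F : C ⥤ D) [F.Full] [F.Faithful]
    (G : D → C) (e : ∀ d, F.obj (G d) ≅ d) : C ≌ D where
  functor := F
  inverse :=
    { obj := G
      map := fun f => F.preimage ((e _).hom ≫ f ≫ (e _).inv)
      map_id := fun d => F.map_injective (by simp)
      map_comp := fun f g => F.map_injective (by simp) }
  unitIso := NatIso.ofComponents (fun c => F.preimageIso (e (F.obj c)).symm)
    (fun f => F.map_injective (by simp))
  counitIso := NatIso.ofComponents e (fun f => by simp)
  functor_unitIso_comp c := by simp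

/-- Bundles on `M_p` are the same as equivariant bundles on `S³ × ℝ`. -/
def pullEquiv (p : ℕ) [NeZero p] : HVB (Mp p).carrier ≌ Tw p 0 :=
  equivOfPreimages (Tw.pull p) (fun A => A.descentData.desc (toMp_subm p)) Tw.descIso

/-! ### Sections of the bundle gerbe as twisted equivariant bundles -/

section Ell
variable {p : ℕ} [NeZero p]

/-- The element `[y, 1]` of the fibre of the line bundle of the gerbe over `(y₀, y₁)`, for `y ∈ S³` over
the point of the lens space underlying `y₀`. -/
def ell (y₀ y₁ : Yp p) (h : proj p y₀ = proj p y₁) (y : Sph3) : (cupGerbe p).L.fib (.mk y₀ y₁ h) :=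
  KF.incl (toS2Z (.mk y₀ y₁ h)).s (toS2Z (.mk y₀ y₁ h)).n y 1

theorem norm_ell (y₀ y₁ : Yp p) (h : proj p y₀ = proj p y₁) (y : Sph3)
    (hy : hopf y = lensToS2 p (Yp.x y₀)) : ‖ell y₀ y₁ h y‖ = 1 := by
  have h1 : ‖KF.incl (toS2Z (.mk y₀ y₁ h)).s (toS2Z (.mk y₀ y₁ h)).n y 1‖ = 1 := by
    rw [KF.norm_eq (s := (toS2Z (.mk y₀ y₁ h)).s) _ hy,
      KF.incl_self (s := (toS2Z (.mk y₀ y₁ h)).s) hy, norm_one]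
  exact h1

theorem tr_ell (y₀ y₁ y₀' y₁' : Yp p) (h : proj p y₀ = proj p y₁) (h' : proj p y₀' = proj p y₁')
    (h₀ : y₀ = y₀') (h₁ : y₁ = y₁') (y : Sph3) :
    (cupGerbe p).L.tr ((cupGerbe p).pt_eq h h' h₀ h₁) (ell y₀ y₁ h y) = ell y₀' y₁' h' y := by
  subst h₀ h₁
  rfl

theorem toS2Z_n_eq (y₀ y₁ : Yp p) (h : proj p y₀ = proj p y₁) (n : ℤ) (hn : Yp.r y₁ = Yp.r y₀ + n) :
    (toS2Z (.mk y₀ y₁ h)).n = n := by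
  have : ((round (Yp.r y₁ - Yp.r y₀) : ℤ) : ℝ) = ((n : ℤ) : ℝ) := by
    rw [round_sub h, hn]
    ring
  exact Int.cast_injective this

theorem inner_rot (ζ : Zp p) (y : Sph3) : inner ℂ ((ζ • y : Sph3) : C2) (y : C2)
    = ((((ζ : ℂˣ))⁻¹ : ℂˣ) : ℂ) := by
  change inner ℂ (((ζ : ℂˣ) : ℂ) • (y : C2)) (y : C2) = _
  rw [inner_smul_left, inner_self_eq_norm_sq_to_K, norm_eq_of_mem_sphere]
  have h1 : ‖((ζ : ℂˣ) : ℂ)‖ = 1 := by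
    have := congrArg norm (coe_smul_zp p ζ y)
    rw [norm_smul, norm_eq_of_mem_sphere, norm_eq_of_mem_sphere, mul_one] at this
    exact this.symm
  have h2 : starRingEnd ℂ ((ζ : ℂˣ) : ℂ) * ((ζ : ℂˣ) : ℂ) = 1 := by
    rw [Complex.conj_mul', h1]
    simp
  rw [Units.val_inv_eq_inv_val, eq_inv_of_mul_eq_one_left h2]
  simp

theorem hopf_rot (ζ : Zp p) (y : Sph3) : hopf (ζ • y) = hopf y := hopf_smul _ _

/-- The element `[y, 1]` has the weight `n` for the action of `ℤ_p`; this is the source of the twist. -/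
theorem ell_rot (y₀ y₁ : Yp p) (h : proj p y₀ = proj p y₁) (ζ : Zp p) (y : Sph3)
    (hy : hopf y = lensToS2 p (Yp.x y₀)) :
    ell y₀ y₁ h (ζ • y) = (((ζ : ℂˣ) ^ (toS2Z (.mk y₀ y₁ h)).n : ℂˣ) : ℂ) • ell y₀ y₁ h y := by
  refine KF.ev_inj (s := (toS2Z (.mk y₀ y₁ h)).s) (y := y) hy ?_
  change KF.incl _ _ (ζ • y) 1 y = _ * KF.incl _ _ y 1 y
  rw [KF.incl_apply (s := (toS2Z (.mk y₀ y₁ h)).s) _ hy, KF.incl_self (s := (toS2Z (.mk y₀ y₁ h)).s) hy,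
    inner_rot]
  simp

theorem mul_ell (y₀ y₁ y₂ : Yp p) (h : proj p y₀ = proj p y₁) (h' : proj p y₁ = proj p y₂) (y : Sph3)
    (hy : hopf y = lensToS2 p (Yp.x y₀)) :
    (cupGerbe p).μ y₀ y₁ y₂ h h' (ell y₀ y₁ h y ⊠ ell y₁ y₂ h' y) = ell y₀ y₂ (h.trans h') y := by
  refine KF.ev_inj (s := (toS2Z (.mk y₀ y₂ (h.trans h'))).s) (y := y) hy ?_
  refine (KF.mul_apply rfl (toS2Z_s p h h') (toS2Z_n p h h') (ell y₀ y₁ h y) (ell y₁ y₂ h' y) y).trans ?_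
  change KF.incl (toS2Z (.mk y₀ y₁ h)).s _ y 1 y * KF.incl (toS2Z (.mk y₁ y₂ h')).s _ y 1 y
    = KF.incl (toS2Z (.mk y₀ y₂ (h.trans h'))).s _ y 1 y
  have hy' : hopf y = (toS2Z (.mk y₁ y₂ h')).s := hy.trans (congrArg (lensToS2 p) (proj_eq p h).1)
  rw [KF.incl_self (s := (toS2Z (.mk y₀ y₁ h)).s) hy, KF.incl_self hy',
    KF.incl_self (s := (toS2Z (.mk y₀ y₂ (h.trans h'))).s) hy, one_mul]

/-- The section `[y, 1]` has the covariant derivative `(r₁ - r₀) i Im⟨y, dy⟩ [y, 1]`. -/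
theorem ell_par {X : Type} [DiffeologicalSpace X] {y₀ y₁ : X → Yp p} (h₀ : DSmooth y₀)
    (h₁ : DSmooth y₁) (h : ∀ x, proj p (y₀ x) = proj p (y₁ x)) {y : X → S3} (hy : DSmooth y)
    (hh : ∀ x, hopf (y x) = lensToS2 p (Yp.x (y₀ x))) :
    HVB.IsParTw (fun q u v => (Yp.r (y₁ (q u)) - Yp.r (y₀ (q u))) * hopfForm.val (q.map y hy) u v)
      (HVB.triv X) ((cupGerbe p).L.pb _ (FibProd.dSmooth_mk h₀ h₁ h))
      (fun x => ContinuousLinearMap.toSpanSingleton ℂ (ell (y₀ x) (y₁ x) (h x) (y x))) := by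
  have h1 := incl_par hy (dSmooth_comp toS2Z_smooth (FibProd.dSmooth_mk h₀ h₁ h)) hh
  exact h1.congr (fun q u v => congrArg (· * _) (round_sub (h (q u)))) fun x e => rfl

end Ell

section
variable (p : ℕ) [NeZero p]

/-- The covering `S³ × ℝ → L_p × ℝ`, as a map to the domain of the submersion of the gerbe. -/
def toY (x : S3R) : (cupGerbe p).Y := toYp p x

theorem toY_subm : IsSurjSubm (Z := S3R) (Y := (cupGerbe p).Y) (toY p) := toYp_subm p

variable {p}

theorem toY_rot (ζ : Zp p) (x : S3R) : toY p (rot ζ x) = toY p x := toYp_rot ζ x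

theorem toY_eq {x x' : S3R} (h : toY p x = toY p x') : ∃ ζ : Zp p, x' = rot ζ x := toYp_eq h

theorem proj_toY_shift (n : ℤ) (x : S3R) : proj p (toY p (shift n x)) = proj p (toY p x) :=
  proj_toYp_shift n x

end

section RightIso
variable {V W : Type} [NormedAddCommGroup V] [InnerProductSpace ℂ V]
    [FiniteDimensional ℂ V] [NormedAddCommGroup W] [InnerProductSpace ℂ W] [FiniteDimensional ℂ W]

/-- The isomorphism `V → V ⊗ W` given by a unit vector of a line `W`. -/
def rightIso (V : Type) [NormedAddCommGroup V] [InnerProductSpace ℂ V] [FiniteDimensional ℂ V] {l : W}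
    (hW : Module.finrank ℂ W = 1) (hl : ‖l‖ = 1) : V ≃ₗᵢ[ℂ] Ten V W where
  toFun v := v ⊠ l
  invFun := contract V l
  left_inv v := by simp [inner_self_eq_norm_sq_to_K, hl]
  right_inv := HVB.contract_eq hW hl
  map_add' v v' := add_tmul v v' l
  map_smul' c v := smul_tmul c v l
  norm_map' v := (TensorProduct.norm_tmul v l).trans (by rw [hl, mul_one])

theorem rightIso_apply {l : W} (hW : Module.finrank ℂ W = 1) (hl : ‖l‖ = 1) (v : V) :
    rightIso V hW hl v = v ⊠ l := rfl

end RightIso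

/-- The component in `S³` of a point of `S³ × ℝ`. -/
def S3R.fst (x : S3R) : S3 := S3R.y x

theorem S3R.fst_smooth : DSmooth S3R.fst := S3R.y_smooth.dSmooth

/-- The 1-form `r Im⟨y, dy⟩` along a map to `S³ × ℝ`. -/
def rForm {X : Type} [DiffeologicalSpace X] {x : X → S3R} (hx : DSmooth x) {n : ℕ} (q : Plot X n)
    (u v : Euc n) : ℝ :=
  S3R.r (x (q u)) * hopfForm.val (q.map (fun t => S3R.fst (x t)) (dSmooth_comp S3R.fst_smooth hx)) u v

/-- The twisted equivariant bundle `A` corresponds to the section `S` of the gerbe: there are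
isomorphisms `κ_(z,x) : A_x → E_z`, for `z ∈ Z` and `x ∈ S³ × ℝ` over the same point of `Y`, with
`∇κ = i r Im⟨y, dy⟩ κ`, which identify the action of `ℤ_p` with the descent datum for `S³ × ℝ → Y` and
the action of `ℤ` with the isomorphism of `S`. -/
structure Rep {p : ℕ} [NeZero p] (A : Tw p 1) (S : (cupGerbe p).Sec) where
  κ : ∀ (z : S.Z) (x : S3R), S.ζ z = toY p x → (A.E.fib x ≃ₗᵢ[ℂ] S.E.fib z)
  par : HVB.IsParTw (X := FibProd S.ζ (toY p)) (rForm FibProd.dSmooth_snd)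
    (A.E.pb _ FibProd.dSmooth_snd) (S.E.pb _ FibProd.dSmooth_fst) (fun t => clm (κ t.1.1 t.1.2 t.2))
  map_φ : ∀ (z : S.Z) (ζ : Zp p) (x x' : S3R) (h : S.ζ z = toY p x) (h' : S.ζ z = toY p x')
    (hx : x' = rot ζ x) (e : A.E.fib x'), κ z x h (A.φ ζ x x' hx e) = κ z x' h' e
  map_α : ∀ (z₀ z₁ : S.Z) (x₀ x₁ : S3R) (n : ℤ) (h₀ : S.ζ z₀ = toY p x₀) (h₁ : S.ζ z₁ = toY p x₁)
    (hx : x₁ = shift n x₀) (h : proj p (S.ζ z₀) = proj p (S.ζ z₁)) (e : A.E.fib x₁),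
    S.α z₀ z₁ h (κ z₁ x₁ h₁ e) = κ z₀ x₀ h₀ (A.γ n x₀ x₁ hx e) ⊠ ell (S.ζ z₀) (S.ζ z₁) h (S3R.y x₀)

namespace Rep
variable {p : ℕ} [NeZero p] {A B C : Tw p 1} {S T U : (cupGerbe p).Sec}

theorem hopf_y {y₀ : (cupGerbe p).Y} {x₀ : S3R} (h₀ : y₀ = toY p x₀) :
    hopf (S3R.y x₀) = lensToS2 p (Yp.x y₀) := by
  subst h₀
  rfl

/-- A morphism of sections and a morphism of bundles correspond to each other. -/
def Corr (R : Rep A S) (R' : Rep B T) (f : S ⟶ T) (g : A ⟶ B) : Prop :=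
  ∀ (z : S.Z) (z' : T.Z) (h : S.ζ z = T.ζ z') (x : S3R) (hx : S.ζ z = toY p x) (hx' : T.ζ z' = toY p x)
    (e : A.E.fib x), f.toFun z z' h (R.κ z x hx e) = R'.κ z' x hx' (g.toHom.toFun x e)

variable (R : Rep A S) (R' : Rep B T)

/-- The correspondence of two morphisms at one pair of points implies it at the points shifted by `n`, by the
compatibility of morphisms of sections with the isomorphisms of the sections. -/
theorem κ_shift (f : S ⟶ T) {z₀ z₁ : S.Z} {z₀' z₁' : T.Z} {x₀ x₁ : S3R} {n : ℤ} (hx : x₁ = shift n x₀)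
    (h₀ : S.ζ z₀ = toY p x₀) (h₁ : S.ζ z₁ = toY p x₁) (h₀' : T.ζ z₀' = toY p x₀)
    (h₁' : T.ζ z₁' = toY p x₁) (h : S.ζ z₁ = T.ζ z₁') (h' : S.ζ z₀ = T.ζ z₀') {e : A.E.fib x₁}
    {e' : B.E.fib x₁} (H : f.toFun z₁ z₁' h (R.κ z₁ x₁ h₁ e) = R'.κ z₁' x₁ h₁' e') :
    f.toFun z₀ z₀' h' (R.κ z₀ x₀ h₀ (A.γ n x₀ x₁ hx e)) = R'.κ z₀' x₀ h₀' (B.γ n x₀ x₁ hx e') := by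
  have hM : proj p (S.ζ z₀) = proj p (S.ζ z₁) := by
    rw [h₀, h₁, hx]
    exact (proj_toY_shift n x₀).symm
  have hM' : proj p (T.ζ z₀') = proj p (T.ζ z₁') := by rw [← h, ← h']; exact hM
  have c := f.compat z₀ z₁ z₀' z₁' h' h hM hM' (R.κ z₁ x₁ h₁ e)
  rw [R.map_α z₀ z₁ x₀ x₁ n h₀ h₁ hx hM] at c
  have c2 := c.trans ((congrArg (T.α z₀' z₁' hM') H).trans (R'.map_α z₀' z₁' x₀ x₁ n h₀' h₁' hx hM' e'))
  have c3 := (tmap_tmul (f.toFun z₀ z₀' h') _ _ (ell (S.ζ z₀) (S.ζ z₁) hM (S3R.y x₀))).symm.trans c2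
  have c4 : (clm ((cupGerbe p).L.tr ((cupGerbe p).pt_eq hM hM' h' h))) (ell (S.ζ z₀) (S.ζ z₁) hM (S3R.y x₀))
      = ell (T.ζ z₀') (T.ζ z₁') hM' (S3R.y x₀) := tr_ell _ _ _ _ hM hM' h' h _
  rw [c4] at c3
  exact Gerbe.tmul_right_inj (norm_ell _ _ hM' _ (hopf_y h₀')) c3

/-- The correspondence does not depend on the points of `Z` and `Z'` over the given point of `Y`. -/
theorem κ_indep (f : S ⟶ T) {z₀ z₁ : S.Z} {z₀' z₁' : T.Z} {x : S3R}
    (h₀ : S.ζ z₀ = toY p x) (h₁ : S.ζ z₁ = toY p x) (h₀' : T.ζ z₀' = toY p x)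
    (h₁' : T.ζ z₁' = toY p x) (h : S.ζ z₁ = T.ζ z₁') (h' : S.ζ z₀ = T.ζ z₀') {e : A.E.fib x}
    {e' : B.E.fib x} (H : f.toFun z₁ z₁' h (R.κ z₁ x h₁ e) = R'.κ z₁' x h₁' e') :
    f.toFun z₀ z₀' h' (R.κ z₀ x h₀ e) = R'.κ z₀' x h₀' e' := by
  have c := R.κ_shift R' f (shift_zero x).symm h₀ h₁ h₀' h₁' h h' H
  rwa [A.γ_zero _ _ _ rfl, B.γ_zero _ _ _ rfl] at c

theorem exists_z (S : (cupGerbe p).Sec) (x : S3R) : ∃ z, S.ζ z = toY p x := S.subm.surj _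

/-- The morphism of bundles given by a morphism of sections, at a point. -/
def toTwFun (f : S ⟶ T) (x : S3R) : A.E.fib x →L[ℂ] B.E.fib x :=
  clm (R'.κ _ x (exists_z T x).choose_spec).symm
    ∘L f.toFun _ _ ((exists_z S x).choose_spec.trans (exists_z T x).choose_spec.symm)
    ∘L clm (R.κ _ x (exists_z S x).choose_spec)

theorem toTwFun_spec (f : S ⟶ T) (z : S.Z) (z' : T.Z) (h : S.ζ z = T.ζ z') (x : S3R)
    (hx : S.ζ z = toY p x) (hx' : T.ζ z' = toY p x) (e : A.E.fib x) :
    f.toFun z z' h (R.κ z x hx e) = R'.κ z' x hx' (R.toTwFun R' f x e) :=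
  R.κ_indep R' f hx (exists_z S x).choose_spec hx' (exists_z T x).choose_spec _ _
    ((R'.κ _ x (exists_z T x).choose_spec).apply_symm_apply _).symm

/-- Being smooth and parallel for a family over a space over `S³ × ℝ` may be checked after pulling back
to points of `Z` and `Z'`. -/
theorem isPar_of_sec {S T : (cupGerbe p).Sec} {X : Type} [DiffeologicalSpace X] {a b : X → (cupGerbe p).Y}
    (ha : DSmooth a) (hb : DSmooth b) {E F : HVB X} {ψ : ∀ x, E.fib x →L[ℂ] F.fib x}
    (H : ∀ (X' : Type) (_ : DiffeologicalSpace X') (f : X' → X) (hf : DSmooth f)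
      (z : X' → S.Z) (hz : DSmooth z) (z' : X' → T.Z) (hz' : DSmooth z'),
      (∀ x, S.ζ (z x) = a (f x)) → (∀ x, T.ζ (z' x) = b (f x)) →
      HVB.IsPar (E.pb f hf) (F.pb f hf) (fun x => ψ (f x))) : HVB.IsPar E F ψ := by
  refine .of_local_lift fun {n} q u => ?_
  obtain ⟨σ, hσ⟩ := S.subm.exists_locSect (a (q u))
  obtain ⟨τ, hτ⟩ := T.subm.exists_locSect (b (q u))
  obtain ⟨s, hs⟩ := σ.exists_plot (q.map a ha) hσ
  obtain ⟨t, ht⟩ := τ.exists_plot (q.map b hb) hτ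
  have h1 : ∀ᶠ w in 𝓝 u, S.ζ (s w) = a (q w) := by
    filter_upwards [hs, (σ.isOpen_dom (q.map a ha)).mem_nhds hσ] with w h1 h2
    rw [h1]
    exact σ.sec _ h2
  have h2 : ∀ᶠ w in 𝓝 u, T.ζ (t w) = b (q w) := by
    filter_upwards [ht, (τ.isOpen_dom (q.map b hb)).mem_nhds hτ] with w h1 h2
    rw [h1]
    exact τ.sec _ h2
  obtain ⟨c, hc, hcs, hcu⟩ := exists_retract u (h1.and h2)
  refine ⟨FibProd (fun x : FibProd a S.ζ => b x.1.1) T.ζ, inferInstance, fun x => x.1.1.1.1,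
    fun n q hq => FibProd.dSmooth_fst n _ (FibProd.dSmooth_fst n q hq),
    ⟨fun w => FibProd.mk (FibProd.mk (q (c w)) (s (c w)) (hcs w).1.symm) (t (c w)) (hcs w).2.symm,
      FibProd.isPlot_iff.2 ⟨FibProd.isPlot_iff.2 ⟨isPlot_reparam q.2 hc, isPlot_reparam s.2 hc⟩,
        isPlot_reparam t.2 hc⟩⟩, hcu.mono fun w hw => congrArg q.1 hw, ?_⟩
  exact H _ _ _ _ (fun x => x.1.1.1.2) (fun n q hq => FibProd.dSmooth_snd n _ (FibProd.dSmooth_fst n q hq))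
    (fun x => x.1.2) FibProd.dSmooth_snd (fun x => x.1.1.2.symm) (fun x => x.2.symm)

theorem par_pb {X : Type} [DiffeologicalSpace X] {z : X → S.Z} (hz : DSmooth z) {x : X → S3R}
    (hx : DSmooth x) (h : ∀ t, S.ζ (z t) = toY p (x t)) :
    HVB.IsParTw (rForm hx) (A.E.pb x hx) (S.E.pb z hz) (fun t => clm (R.κ (z t) (x t) (h t))) :=
  R.par.pb (fun t => FibProd.mk (z t) (x t) (h t)) (FibProd.dSmooth_mk hz hx h)

theorem par_pb_symm {X : Type} [DiffeologicalSpace X] {z : X → S.Z} (hz : DSmooth z) {x : X → S3R}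
    (hx : DSmooth x) (h : ∀ t, S.ζ (z t) = toY p (x t)) :
    HVB.IsParTw (fun q u v => -rForm hx q u v) (S.E.pb z hz) (A.E.pb x hx)
      (fun t => clm (R.κ (z t) (x t) (h t)).symm) :=
  (R.par_pb hz hx h).inv (fun t e => (R.κ (z t) (x t) (h t)).symm_apply_apply e)
    (fun t e => (R.κ (z t) (x t) (h t)).apply_symm_apply e)

/-- The morphism of bundles given by a morphism of sections. -/
def toTw (f : S ⟶ T) : A ⟶ B where
  toHom := ⟨R.toTwFun R' f, by
    refine isPar_of_sec (S := S) (T := T) (a := toY p) (b := toY p) (toY_subm p).smooth.dSmooth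
      (toY_subm p).smooth.dSmooth fun X' _ x hx z hz z' hz' h h' => ?_
    have h1 := f.isPar.pb (fun t => FibProd.mk (z t) (z' t) ((h t).trans (h' t).symm))
      (FibProd.dSmooth_mk hz hz' _)
    have h2 := ((R'.par_pb_symm hz' hx h').comp h1.isParTw).comp (R.par_pb hz hx h)
    refine (h2.isPar fun q u v => by ring).congr fun t e => ?_
    refine (R'.κ (z' t) (x t) (h' t)).injective (((R'.κ (z' t) (x t) (h' t)).apply_symm_apply _).trans ?_)
    exact R.toTwFun_spec R' f _ _ _ _ (h t) (h' t) e⟩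
  map_φ ζ x x' hx e := by
    obtain ⟨z, hz⟩ := exists_z S x
    obtain ⟨z', hz'⟩ := exists_z T x
    have e0 : toY p x = toY p x' := by rw [hx, toY_rot]
    apply (R'.κ z' x hz').injective
    refine (R.toTwFun_spec R' f z z' (hz.trans hz'.symm) x hz hz' _).symm.trans ?_
    rw [R.map_φ z ζ x x' hz (hz.trans e0) hx, R'.map_φ z' ζ x x' hz' (hz'.trans e0) hx]
    exact R.toTwFun_spec R' f _ _ _ _ _ _ _
  map_γ n x x' hx e := by
    obtain ⟨z, hz⟩ := exists_z S x
    obtain ⟨z', hz'⟩ := exists_z T x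
    obtain ⟨z₁, hz₁⟩ := exists_z S x'
    obtain ⟨z₁', hz₁'⟩ := exists_z T x'
    apply (R'.κ z' x hz').injective
    refine (R.toTwFun_spec R' f z z' (hz.trans hz'.symm) x hz hz' _).symm.trans ?_
    exact R.κ_shift R' f hx hz hz₁ hz' hz₁' (hz₁.trans hz₁'.symm) _
      (R.toTwFun_spec R' f _ _ _ _ _ _ _)

theorem corr_toTw (f : S ⟶ T) : Corr R R' f (R.toTw R' f) := fun z z' h x hx hx' e =>
  R.toTwFun_spec R' f z z' h x hx hx' e

theorem Corr.unique_right {f : S ⟶ T} {g g' : A ⟶ B} (h : Corr R R' f g) (h' : Corr R R' f g') :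
    g = g' := by
  refine Tw.Hom.ext (HVB.ParHom.ext (funext fun x => ContinuousLinearMap.ext fun e => ?_))
  obtain ⟨z, hz⟩ := exists_z S x
  obtain ⟨z', hz'⟩ := exists_z T x
  exact (R'.κ z' x hz').injective ((h z z' (hz.trans hz'.symm) x hz hz' e).symm.trans
    (h' z z' (hz.trans hz'.symm) x hz hz' e))

theorem exists_x (y : (cupGerbe p).Y) : ∃ x, y = toY p x := ((toY_subm p).surj y).imp fun _ h => h.symm

theorem Corr.unique_left {f f' : S ⟶ T} {g : A ⟶ B} (h : Corr R R' f g) (h' : Corr R R' f' g) :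
    f = f' := by
  refine Gerbe.Sec.Hom.ext (funext fun z => funext fun z' => funext fun hz =>
    ContinuousLinearMap.ext fun e => ?_)
  obtain ⟨x, hx⟩ := exists_x (S.ζ z)
  obtain ⟨e, rfl⟩ := (R.κ z x hx).surjective e
  exact (h z z' hz x hx (hz.symm.trans hx) e).trans (h' z z' hz x hx (hz.symm.trans hx) e).symm

/-- The morphism of sections given by a morphism of bundles, at a point. -/
def toSecFun (g : A ⟶ B) (z : S.Z) (z' : T.Z) (h : S.ζ z = T.ζ z') : S.E.fib z →L[ℂ] T.E.fib z' :=
  clm (R'.κ z' _ (h.symm.trans (exists_x (S.ζ z)).choose_spec)) ∘L g.toHom.toFun _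
    ∘L clm (R.κ z _ (exists_x (S.ζ z)).choose_spec).symm

theorem toSecFun_spec (g : A ⟶ B) (z : S.Z) (z' : T.Z) (h : S.ζ z = T.ζ z') (x : S3R)
    (hx : S.ζ z = toY p x) (hx' : T.ζ z' = toY p x) (e : A.E.fib x) :
    R.toSecFun R' g z z' h (R.κ z x hx e) = R'.κ z' x hx' (g.toHom.toFun x e) := by
  set x₀ := (exists_x (S.ζ z)).choose with hx₀
  have h₀ : S.ζ z = toY p x₀ := (exists_x (S.ζ z)).choose_spec
  obtain ⟨ζ, hζ⟩ := toY_eq (h₀.symm.trans hx)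
  rw [← R.map_φ z ζ x₀ x h₀ hx hζ, ← R'.map_φ z' ζ x₀ x (h.symm.trans h₀) hx' hζ, ← g.map_φ]
  change R'.κ z' x₀ _ (g.toHom.toFun x₀ ((R.κ z x₀ h₀).symm (R.κ z x₀ h₀ _))) = _
  rw [LinearIsometryEquiv.symm_apply_apply]

/-- The morphism of sections given by a morphism of bundles. -/
def toSec (g : A ⟶ B) : S ⟶ T where
  toFun := R.toSecFun R' g
  isPar := by
    refine .of_local_lift fun {n} q u => ?_
    have hq : DSmooth (fun t : FibProd S.ζ T.ζ => S.ζ t.1.1) :=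
      dSmooth_comp S.subm.smooth.dSmooth FibProd.dSmooth_fst
    obtain ⟨s, c, hc, hs, hcu⟩ := (toY_subm p).lift (q.map _ hq) u
    let X' := FibProd (fun t : FibProd S.ζ T.ζ => S.ζ t.1.1) (toY p)
    refine ⟨X', inferInstance, fun t => t.1.1, FibProd.dSmooth_fst,
      ⟨fun w => FibProd.mk (q (c w)) (s w) (hs w).symm, FibProd.isPlot_iff.2 ⟨isPlot_reparam q.2 hc, s.2⟩⟩,
      hcu.mono fun w hw => congrArg q.1 hw, ?_⟩
    have hz : DSmooth (fun t : X' => t.1.1.1.1) :=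
      fun n q hq => FibProd.dSmooth_fst n _ (FibProd.dSmooth_fst n q hq)
    have hz' : DSmooth (fun t : X' => t.1.1.1.2) :=
      fun n q hq => FibProd.dSmooth_snd n _ (FibProd.dSmooth_fst n q hq)
    have hx : DSmooth (fun t : X' => t.1.2) := FibProd.dSmooth_snd
    have h1 := ((R'.par_pb hz' hx fun t => t.1.1.2.symm.trans t.2).comp
      (g.toHom.isPar.pb (fun t : X' => t.1.2) hx).isParTw).comp (R.par_pb_symm hz hx fun t => t.2)
    refine (h1.isPar fun q u v => by ring).congr fun t e => ?_
    obtain ⟨e, rfl⟩ := (R.κ t.1.1.1.1 t.1.2 t.2).surjective e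
    refine Eq.trans ?_ (R.toSecFun_spec R' g _ _ t.1.1.2 _ t.2 (t.1.1.2.symm.trans t.2) e).symm
    exact congrArg (fun e => R'.κ _ _ _ (g.toHom.toFun _ e)) (LinearIsometryEquiv.symm_apply_apply _ e)
  compat z₀ z₁ z₀' z₁' h₀ h₁ h h' e := by
    obtain ⟨x, hx⟩ := exists_x (S.ζ z₀)
    obtain ⟨hl, n, hn⟩ := proj_eq p h
    have hx₁ : S.ζ z₁ = toY p (shift n x) := by
      rw [hx] at hl hn
      exact Prod.ext hl.symm hn
    obtain ⟨e, rfl⟩ := (R.κ z₁ _ hx₁).surjective e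
    rw [R.toSecFun_spec R' g z₁ z₁' h₁ _ hx₁ (h₁.symm.trans hx₁), R.map_α z₀ z₁ x _ n hx hx₁ rfl h]
    refine Eq.trans ?_ (R'.map_α z₀' z₁' x _ n (h₀.symm.trans hx) (h₁.symm.trans hx₁) rfl h' _).symm
    refine (tmap_tmul _ _ _ (ell (S.ζ z₀) (S.ζ z₁) h (S3R.y x))).trans ?_
    rw [R.toSecFun_spec R' g z₀ z₀' h₀ x hx (h₀.symm.trans hx), g.map_γ]
    exact congrArg _ (tr_ell _ _ _ _ h h' h₀ h₁ (S3R.y x))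

theorem corr_toSec (g : A ⟶ B) : Corr R R' (R.toSec R' g) g := fun z z' h x hx hx' e =>
  R.toSecFun_spec R' g z z' h x hx hx' e

theorem Corr.comp {R : Rep A S} {R' : Rep B T} {R'' : Rep C U} {f : S ⟶ T} {f' : T ⟶ U} {g : A ⟶ B}
    {g' : B ⟶ C} (h : Corr R R' f g) (h' : Corr R' R'' f' g') : Corr R R'' (f ≫ f') (g ≫ g') :=
  fun z z' hz x hx hx' e => by
    obtain ⟨w, hw⟩ := exists_z T x
    refine (Gerbe.Sec.Hom.comp_apply f f' z w z' hz (hx.trans hw.symm) (hw.trans hx'.symm) _).trans ?_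
    rw [h z w _ x hx hw, h' w z' _ x hw hx']
    rfl

theorem id_self (S : (cupGerbe p).Sec) (z : S.Z) (e : S.E.fib z) : (𝟙 S : S ⟶ S).toFun z z rfl e = e := by
  change contract _ ((cupGerbe p).unit (S.ζ z)) (S.α z z rfl e) = e
  rw [Gerbe.Sec.α_self, contract_tmul, inner_self_eq_norm_sq_to_K, Gerbe.norm_unit]
  simp

theorem corr_id (R : Rep A S) : Corr R R (𝟙 S) (𝟙 A) := fun z z' hz x hx hx' e =>
  R.κ_indep R (𝟙 S) hx hx hx' hx rfl hz (id_self S z _)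

end Rep

/-- The 1-form `r Im⟨y, dy⟩` on `S³ × ℝ`. -/
def rOne : OneForm S3R.carrier where
  val q u := S3R.r (q u) • hopfForm.val (q.map S3R.fst S3R.fst_smooth) u
  smooth q := (plot_r q).smul (hopfForm.smooth _)
  reparam q h hh u v := by
    have e := hopfForm.reparam (q.map S3R.fst S3R.fst_smooth) h hh u v
    change S3R.r (q (h u)) * hopfForm.val ((q.map S3R.fst S3R.fst_smooth).reparam h hh) u v
      = S3R.r (q (h u)) * hopfForm.val (q.map S3R.fst S3R.fst_smooth) (h u) (fderiv ℝ h u v)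
    rw [e]

/-- The negative of a 1-form. -/
def OneForm.neg {X : Type} [DiffeologicalSpace X] (β : OneForm X) : OneForm X where
  val q u := -β.val q u
  smooth q := (β.smooth q).neg
  reparam q h hh u v := congrArg Neg.neg (β.reparam q h hh u v)

section
variable {p : ℕ} [NeZero p]

/-- The form `Im⟨y, dy⟩` is invariant under `ℤ_p`. -/
theorem hopfForm_eq {n : ℕ} (q₀ q₁ : Plot S3R n) (h : ∀ w, Tw.toMp p (q₀ w) = Tw.toMp p (q₁ w)) (u v : Euc n) :
    hopfForm.val (q₁.map S3R.fst S3R.fst_smooth) u v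
      = hopfForm.val (q₀.map S3R.fst S3R.fst_smooth) u v := by
  obtain ⟨ζ, m, hm⟩ := exists_rot_shift q₀ q₁ h
  set y₀ := q₀.map S3R.fst S3R.fst_smooth
  set y₁ := q₁.map S3R.fst S3R.fst_smooth
  have e : ∀ w, (y₁.toSph w : C2) = ((ζ : ℂˣ) : ℂ) • (y₀.toSph w : C2) := fun w =>
    congrArg (fun t : S3R => ((S3R.y t : Sph3) : C2)) (hm w)
  have hd := ((plot_S3 y₀).contDiffAt (x := u)).differentiableAt (by simp)
  rw [hopfForm_apply, hopfForm_apply, funext e, e, fderiv_fun_const_smul hd, inner_smul_left]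
  change (_ * inner ℂ _ (((ζ : ℂˣ) : ℂ) • fderiv ℝ (fun w => (y₀.toSph w : C2)) u v)).im = _
  rw [inner_smul_right, ← mul_assoc, Complex.conj_mul', Complex.norm_eq_one_of_mem_rootsOfUnity ζ.2]
  simp

theorem rForm_eq {X : Type} [DiffeologicalSpace X] {x x' : X → S3R} (hx : DSmooth x) (hx' : DSmooth x')
    (h : ∀ t, toY p (x t) = toY p (x' t)) {n : ℕ} (q : Plot X n) (u v : Euc n) :
    rForm hx' q u v = rForm hx q u v :=
  congrArg₂ (fun a b : ℝ => a * b) (congrArg (fun y : Yp p => Yp.r y) (h (q u))).symm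
    (hopfForm_eq (p := p) (q.map x hx) (q.map x' hx') (fun w => congrArg (proj p) (h (q w))) u v)

theorem toMp_of_toY {x x' : S3R} (h : toY p x = toY p x') : Tw.toMp p x = Tw.toMp p x' :=
  congrArg (proj p) h

theorem tp_act_one {A : Tw p 1} {x₀ x₁ x₂ : S3R} {ζ ζ' : Zp p} {n n' : ℤ} (hn : x₁ = rot ζ (shift n x₀))
    (hn' : x₂ = rot ζ' (shift n' x₁)) (h : Tw.toMp p x₀ = Tw.toMp p x₁) (h' : Tw.toMp p x₁ = Tw.toMp p x₂)
    (e : A.E.fib x₂) :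
    A.tp x₀ x₁ h (A.tp x₁ x₂ h' e) = (((ζ : ℂˣ) ^ (-n') : ℂˣ) : ℂ) • A.tp x₀ x₂ (h.trans h') e := by
  have h2 : x₂ = rot (ζ * ζ') (shift (n + n') x₀) := by
    rw [hn', hn, ← rot_shift, rot_rot, shift_shift, mul_comm, add_comm]
  rw [A.tp_eq ζ n _ _ h hn, A.tp_eq ζ' n' _ _ h' hn', A.tp_eq _ _ _ _ _ h2,
    A.act_act _ _ _ _ _ _ _ hn hn' h2, neg_one_mul]

/-- The failure of `tp` to be a cocycle is cancelled by the choice of the point of the Hopf fibre. -/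
theorem tp_mul_ell (A : Tw p 1) (x₀ x₁ x₂ : S3R) (h : proj p (toY p x₀) = proj p (toY p x₁))
    (h' : proj p (toY p x₁) = proj p (toY p x₂)) (e : A.E.fib x₂) :
    A.tp x₀ x₁ h (A.tp x₁ x₂ h' e) ⊠ (cupGerbe p).μ _ _ _ h h'
        (ell (toY p x₀) (toY p x₁) h (S3R.y x₀) ⊠ ell (toY p x₁) (toY p x₂) h' (S3R.y x₁))
      = A.tp x₀ x₂ (h.trans h') e ⊠ ell (toY p x₀) (toY p x₂) (h.trans h') (S3R.y x₀) := by
  obtain ⟨ζ, n, hn⟩ := toMp_eq h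
  obtain ⟨ζ', n', hn'⟩ := toMp_eq h'
  have hN : (toS2Z (.mk (toY p x₁) (toY p x₂) h')).n = n' :=
    toS2Z_n_eq _ _ _ _ (by rw [hn']; rfl)
  have hy : S3R.y x₁ = ζ • S3R.y x₀ := by rw [hn]; rfl
  have hl : hopf (S3R.y x₀) = lensToS2 p (Yp.x (toY p x₁)) := by
    have : hopf (S3R.y x₁) = lensToS2 p (Yp.x (toY p x₁)) := rfl
    rw [← this, hy, hopf_rot]
  rw [hy, ell_rot _ _ h' ζ _ hl, hN, tp_act_one hn hn' h h', tmul_smul, map_smul, tmul_smul,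
    mul_ell (toY p x₀) (toY p x₁) (toY p x₂) h h' (S3R.y x₀) rfl, smul_tmul, smul_smul,
    ← Units.val_mul, ← zpow_add]
  simp

/-- The descent datum for `S³ × ℝ → Y` given by `tp` is the action of `ℤ_p`. -/
theorem tp_φ (A : Tw p 1) {z x x' : S3R} {ζ : Zp p} (h : toY p z = toY p x) (h' : toY p z = toY p x')
    (hx : x' = rot ζ x) (e : A.E.fib x') :
    A.tp z x (toMp_of_toY h) (A.φ ζ x x' hx e) = A.tp z x' (toMp_of_toY h') e := by
  obtain ⟨ξ, hξ⟩ := toY_eq h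
  have h1 : x = rot ξ (shift 0 z) := by rw [shift_zero]; exact hξ
  have h2 : x' = rot ζ (shift 0 x) := by rw [shift_zero]; exact hx
  have h3 : x' = rot (ξ * ζ) (shift (0 + 0) z) := by
    rw [hx, hξ, rot_rot, add_zero, shift_zero, mul_comm]
  rw [A.tp_eq ξ 0 z x _ h1, A.tp_eq _ _ z x' _ h3, ← A.act_zero ζ x x' h2 hx, A.act_act _ _ _ _ _ _ _ h1 h2 h3]
  simp

/-- If the points of the fibre product are moved by `ℤ_p`, the twist of the action of `ℤ` cancels the weight of
`[y, 1]`. -/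
theorem tp_γ (A : Tw p 1) {z₀ z₁ x₀ x₁ : S3R} {n : ℤ} (h₀ : toY p z₀ = toY p x₀)
    (h₁ : toY p z₁ = toY p x₁) (hx : x₁ = shift n x₀) (h : proj p (toY p z₀) = proj p (toY p z₁))
    (e : A.E.fib x₁) :
    A.tp z₀ z₁ h (A.tp z₁ x₁ (toMp_of_toY h₁) e) ⊠ ell (toY p z₀) (toY p z₁) h (S3R.y z₀)
      = A.tp z₀ x₀ (toMp_of_toY h₀) (A.γ n x₀ x₁ hx e)
        ⊠ ell (toY p z₀) (toY p z₁) h (S3R.y x₀) := by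
  obtain ⟨ξ, hξ⟩ := toY_eq h₀
  obtain ⟨ξ₁, hξ₁⟩ := toY_eq h₁
  have m0 : x₀ = rot ξ (shift 0 z₀) := by rw [shift_zero]; exact hξ
  have m1 : x₁ = rot ξ₁ (shift 0 z₁) := by rw [shift_zero]; exact hξ₁
  have hz : z₁ = rot (ξ₁⁻¹ * ξ) (shift n z₀) := by
    have h2 : rot ξ₁⁻¹ x₁ = z₁ := by rw [hξ₁, rot_rot, inv_mul_cancel, rot_one]
    rw [← h2, hx, hξ, ← rot_shift, rot_rot]
  have m2 : x₁ = rot (1 : Zp p) (shift n x₀) := by rw [rot_one]; exact hx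
  have m3 : x₁ = rot (ξ₁⁻¹ * ξ * ξ₁) (shift (n + 0) z₀) := by
    rw [mul_comm, mul_inv_cancel_left, add_zero, rot_shift, ← hξ, hx]
  have m4 : x₁ = rot (ξ * 1) (shift (0 + n) z₀) := by
    rw [mul_one, zero_add, rot_shift, ← hξ, hx]
  have hN : (toS2Z (.mk (toY p z₀) (toY p z₁) h)).n = n := toS2Z_n_eq _ _ _ _ (by rw [hz]; rfl)
  have e1 : A.tp z₀ z₁ h (A.tp z₁ x₁ (toMp_of_toY h₁) e) = A.act (ξ * 1) (0 + n) z₀ x₁ m4 e := by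
    rw [A.tp_eq _ _ z₀ z₁ h hz, A.tp_eq _ _ z₁ x₁ _ m1, A.act_act _ _ _ _ _ _ _ hz m1 m3, mul_zero, zpow_zero,
      Units.val_one, one_smul]
    have key : ∀ (ζ : Zp p) (m : ℤ) (h : x₁ = rot ζ (shift m z₀)), ζ = ξ * 1 → m = 0 + n →
        A.act ζ m z₀ x₁ h e = A.act (ξ * 1) (0 + n) z₀ x₁ m4 e := by
      rintro _ _ _ rfl rfl
      rfl
    exact key _ _ _ (by rw [mul_comm, mul_inv_cancel_left, mul_one]) (by ring)
  have e2 : A.tp z₀ x₀ (toMp_of_toY h₀) (A.γ n x₀ x₁ hx e)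
      = (((ξ : ℂˣ) ^ (-n) : ℂˣ) : ℂ) • A.act (ξ * 1) (0 + n) z₀ x₁ m4 e := by
    rw [A.tp_eq _ _ z₀ x₀ _ m0, ← A.act_one n x₀ x₁ m2 hx, A.act_act _ _ _ _ _ _ _ m0 m2 m4, neg_one_mul]
  have e3 : ell (toY p z₀) (toY p z₁) h (S3R.y x₀)
      = (((ξ : ℂˣ) ^ n : ℂˣ) : ℂ) • ell (toY p z₀) (toY p z₁) h (S3R.y z₀) := by
    have : S3R.y x₀ = ξ • S3R.y z₀ := by rw [hξ]; rfl
    rw [this, ell_rot _ _ h ξ _ rfl, hN]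
  rw [e1, e2, e3, tmul_smul, smul_tmul, smul_smul, ← Units.val_mul, ← zpow_add]
  simp

/-- The section of the gerbe given by a twisted equivariant bundle: the submersion is
`S³ × ℝ → L_p × ℝ`, and the connection of the bundle is changed by `i r Im⟨y, dy⟩`. -/
def secOf (A : Tw p 1) : (cupGerbe p).Sec where
  Z := S3R
  ζ := toY p
  subm := toY_subm p
  E := A.E.twist rOne
  α x₀ x₁ h := (A.tp x₀ x₁ h).trans
    (rightIso (A.E.fib x₀) ((cupGerbe p).rank _) (norm_ell (toY p x₀) (toY p x₁) h (S3R.y x₀) rfl))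
  α_par := by
    let X := FibProd (fun x => (cupGerbe p).π (toY p x)) (fun x => (cupGerbe p).π (toY p x))
    have h0 : DSmooth (fun t : X => t.1.1) := FibProd.dSmooth_fst
    have h1 : DSmooth (fun t : X => t.1.2) := FibProd.dSmooth_snd
    have a1 := (A.E.untwist_par rOne).pb (fun t : X => t.1.2) h1
    have a2 := (A.tp_par h0 h1 fun t : X => t.2).isParTw
    have a3 := (A.E.twist_par rOne).pb (fun t : X => t.1.1) h0
    have a4 := (ell_par (dSmooth_comp (toY_subm p).smooth.dSmooth h0)
      (dSmooth_comp (toY_subm p).smooth.dSmooth h1) (fun t : X => t.2)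
      (y := fun t : X => S3R.fst t.1.1) (dSmooth_comp S3R.fst_smooth h0) fun t => rfl).tmulRight
        ((A.E.twist rOne).pb (fun t : X => t.1.1) h0)
    refine ((((a4.comp a3).comp a2).comp a1).isPar fun q u v => ?_).congr fun t e => rfl
    -- The 1-forms `-r₁ η`, `r₀ η` and `(r₁ - r₀) η` for `η = Im⟨y, dy⟩` add up to zero.
    have e := hopfForm_eq (q.map _ h0) (q.map _ h1) (fun w => (q w).2) u v
    change (S3R.r (q u).1.2 - S3R.r (q u).1.1) * hopfForm.val ((q.map _ h0).map S3R.fst S3R.fst_smooth) u v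
      + S3R.r (q u).1.1 * hopfForm.val ((q.map _ h0).map S3R.fst S3R.fst_smooth) u v + 0
      + -(S3R.r (q u).1.2 * hopfForm.val ((q.map _ h1).map S3R.fst S3R.fst_smooth) u v) = 0
    rw [e]
    ring
  cocycle x₀ x₁ x₂ h h' e :=
    (congrArg (tmap (.id ℂ _) (clm ((cupGerbe p).μ _ _ _ h h'))) (congrArg (tassoc _ _ _)
      (tmap_tmul _ _ (A.tp x₁ x₂ h' e) (ell (toY p x₁) (toY p x₂) h' (S3R.y x₁))))).trans <|
    (congrArg (tmap (.id ℂ _) (clm ((cupGerbe p).μ _ _ _ h h')))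
      (tassoc_tmul (A.tp x₀ x₁ h (A.tp x₁ x₂ h' e)) (ell (toY p x₀) (toY p x₁) h (S3R.y x₀))
        (ell (toY p x₁) (toY p x₂) h' (S3R.y x₁)))).trans <|
    (tmap_tmul _ _ _ _).trans (tp_mul_ell A x₀ x₁ x₂ h h' e)

/-- Every twisted equivariant bundle corresponds to a section of the gerbe. -/
def repSecOf (A : Tw p 1) : Rep A (secOf A) where
  κ z x h := A.tp z x (toMp_of_toY h)
  par := by
    let X := FibProd (secOf A).ζ (toY p)
    have h0 : DSmooth (fun t : X => (t.1.1 : S3R)) := FibProd.dSmooth_fst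
    have h1 : DSmooth (fun t : X => t.1.2) := FibProd.dSmooth_snd
    have a2 := (A.tp_par h0 h1 fun t : X => congrArg (proj p) t.2).isParTw
    have a3 := (A.E.twist_par rOne).pb (fun t : X => (t.1.1 : S3R)) h0
    refine (a3.comp a2).congr (fun q u v => ?_) fun t e => rfl
    rw [add_zero]
    exact (rForm_eq h0 h1 (fun t => t.2) q u v).symm
  map_φ z ζ x x' h h' hx e := tp_φ A h h' hx e
  map_α z₀ z₁ x₀ x₁ n h₀ h₁ hx h e := tp_γ A h₀ h₁ hx h e

end

section
variable {p : ℕ} [NeZero p] (S : (cupGerbe p).Sec)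

theorem contract_tmul_self {V W : Type} [NormedAddCommGroup V] [InnerProductSpace ℂ V]
    [FiniteDimensional ℂ V] [NormedAddCommGroup W] [InnerProductSpace ℂ W] [FiniteDimensional ℂ W] {l : W}
    (hl : ‖l‖ = 1) (v : V) : contract V l (v ⊠ l) = v := by
  rw [contract_tmul, inner_self_eq_norm_sq_to_K, hl]
  simp

namespace Rep

/-- The identity of a section is isometric, since it is so after tensoring with the unit of the gerbe. -/
theorem norm_id (z z' : S.Z) (h : S.ζ z = S.ζ z') (e : S.E.fib z) : ‖(𝟙 S : S ⟶ S).toFun z z' h e‖ = ‖e‖ := by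
  have h1 := congrArg norm (S.id_aux z z' h e)
  have h2 := (TensorProduct.norm_tmul _ _).symm.trans h1
  rw [Gerbe.norm_unit', mul_one, LinearIsometryEquiv.norm_map] at h2
  exact h2

theorem id_id (z z' z'' : S.Z) (h : S.ζ z = S.ζ z') (h' : S.ζ z' = S.ζ z'') (e : S.E.fib z) :
    (𝟙 S : S ⟶ S).toFun z' z'' h' ((𝟙 S : S ⟶ S).toFun z z' h e)
      = (𝟙 S : S ⟶ S).toFun z z'' (h.trans h') e := by
  refine (Gerbe.Sec.Hom.comp_apply (𝟙 S : S ⟶ S) (𝟙 S) z z' z'' (h.trans h') h h' e).symm.trans ?_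
  exact congrArg (fun f : S ⟶ S => f.toFun z z'' (h.trans h') e) (Category.id_comp (𝟙 S))

/-- The identity morphism of a section `(ζ : Z → Y, E, α)` is a descent datum for `E` along `ζ`. -/
def descentData : DescentData S.ζ S.E where
  θ z₀ z₁ h :=
    { toFun := (𝟙 S : S ⟶ S).toFun z₁ z₀ h.symm
      invFun := (𝟙 S : S ⟶ S).toFun z₀ z₁ h
      left_inv := fun e => (id_id S _ _ _ _ _ e).trans (id_self S _ e)
      right_inv := fun e => (id_id S _ _ _ _ _ e).trans (id_self S _ e)
      map_add' := map_add _
      map_smul' := map_smul _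
      norm_map' := norm_id S z₁ z₀ h.symm }
  par := ((𝟙 S : S ⟶ S).isPar.pb (fun t : FibProd S.ζ S.ζ => FibProd.mk t.1.2 t.1.1 t.2.symm)
    (FibProd.dSmooth_mk FibProd.dSmooth_snd FibProd.dSmooth_fst fun t => t.2.symm)).congr fun t e => rfl
  cocycle z₀ z₁ z₂ h h' e := id_id S z₂ z₁ z₀ h'.symm h.symm e

/-- The bundle on `Y` obtained from the bundle of a section by descent. -/
def bdl : HVB (cupGerbe p).Y.carrier := (descentData S).desc S.subm

/-- The isomorphism of the pullback of the descended bundle with the bundle of the section. -/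
def bκ (z : S.Z) (y : (cupGerbe p).Y) (h : S.ζ z = y) : (bdl S).fib y ≃ₗᵢ[ℂ] S.E.fib z :=
  ((bdl S).tr h.symm).trans ((descentData S).κ S.subm z)

theorem id_bκ (z z' : S.Z) (y : (cupGerbe p).Y) (h : S.ζ z = y) (h' : S.ζ z' = y)
    (hz : S.ζ z = S.ζ z') (e : (bdl S).fib y) :
    (𝟙 S : S ⟶ S).toFun z z' hz (bκ S z y h e) = bκ S z' y h' e := by
  subst h
  exact (descentData S).θ_κ S.subm z' z h' e

theorem bκ_tr (z : S.Z) (y y' : (cupGerbe p).Y) (h : S.ζ z = y) (h' : S.ζ z = y') (hy : y' = y)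
    (e : (bdl S).fib y') : bκ S z y h ((bdl S).tr hy e) = bκ S z y' h' e := by
  subst hy
  rfl

theorem bκ_par {X : Type} [DiffeologicalSpace X] {z : X → S.Z} (hz : DSmooth z)
    {y : X → (cupGerbe p).Y} (hy : DSmooth y) (h : ∀ t, S.ζ (z t) = y t) :
    HVB.IsPar ((bdl S).pb y hy) (S.E.pb z hz) (fun t => clm (bκ S (z t) (y t) (h t))) :=
  (((descentData S).κ_par S.subm).pb z hz).comp ((bdl S).tr_par y (fun t => S.ζ (z t)) hy
    (dSmooth_comp S.subm.smooth.dSmooth hz) fun t => (h t).symm)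

theorem proj_of_shift {z z' : S.Z} {x x' : S3R} {n : ℤ} (hx : x' = shift n x) (h : S.ζ z = toY p x)
    (h' : S.ζ z' = toY p x') : proj p (S.ζ z) = proj p (S.ζ z') := by
  rw [h, h', hx]
  exact (proj_toY_shift n x).symm

/-- The isomorphism of the section, contracted with the element of the line bundle given by the point
of the Hopf fibre. -/
def bγ (n : ℤ) (x x' : S3R) (hx : x' = shift n x) : (bdl S).fib (toY p x') ≃ₗᵢ[ℂ] (bdl S).fib (toY p x) :=
  (bκ S _ _ (exists_z S x').choose_spec).trans <|
  (S.α _ _ (proj_of_shift S hx (exists_z S x).choose_spec (exists_z S x').choose_spec)).trans <|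
  (rightIso (S.E.fib _) ((cupGerbe p).rank _)
    (norm_ell _ _ (proj_of_shift S hx (exists_z S x).choose_spec (exists_z S x').choose_spec) (S3R.y x)
      (hopf_y (exists_z S x).choose_spec))).symm.trans
  (bκ S _ _ (exists_z S x).choose_spec).symm

/-- The definition of `bγ` chooses points over `x` and `x'`; the identity of `S` carries the formula to all
other points. -/
theorem bγ_spec (n : ℤ) (x x' : S3R) (hx : x' = shift n x) (z z' : S.Z) (h : S.ζ z = toY p x)
    (h' : S.ζ z' = toY p x') (hM : proj p (S.ζ z) = proj p (S.ζ z')) (e : (bdl S).fib (toY p x')) :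
    S.α z z' hM (bκ S z' _ h' e) = bκ S z _ h (bγ S n x x' hx e) ⊠ ell (S.ζ z) (S.ζ z') hM (S3R.y x) := by
  set w := (exists_z S x).choose with hw
  set w' := (exists_z S x').choose with hw'
  have k : S.ζ w = toY p x := (exists_z S x).choose_spec
  have k' : S.ζ w' = toY p x' := (exists_z S x').choose_spec
  have kM : proj p (S.ζ w) = proj p (S.ζ w') := proj_of_shift S hx k k'
  have h0 : S.α w w' kM (bκ S w' _ k' e)
      = bκ S w _ k (bγ S n x x' hx e) ⊠ ell (S.ζ w) (S.ζ w') kM (S3R.y x) := by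
    have := (rightIso (S.E.fib w) ((cupGerbe p).rank _)
      (norm_ell _ _ kM (S3R.y x) (hopf_y k))).apply_symm_apply (S.α w w' kM (bκ S w' _ k' e))
    rw [← this, rightIso_apply]
    congr 1
    exact ((bκ S w _ k).apply_symm_apply _).symm
  have c := (𝟙 S : S ⟶ S).compat w w' z z' (k.trans h.symm) (k'.trans h'.symm) kM hM (bκ S w' _ k' e)
  rw [h0, id_bκ S w' z' _ k' h'] at c
  refine c.symm.trans ((tmap_tmul _ _ _ (ell (S.ζ w) (S.ζ w') kM (S3R.y x))).trans ?_)
  rw [id_bκ S w z _ k h]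
  exact congrArg _ (tr_ell _ _ _ _ kM hM (k.trans h.symm) (k'.trans h'.symm) _)

theorem cocycle_tmul {z z' z'' : S.Z} (m : proj p (S.ζ z) = proj p (S.ζ z'))
    (m' : proj p (S.ζ z') = proj p (S.ζ z'')) {e : S.E.fib z} {e' : S.E.fib z'} {e'' : S.E.fib z''}
    {l : (cupGerbe p).L.fib (.mk (S.ζ z) (S.ζ z') m)} {l' : (cupGerbe p).L.fib (.mk (S.ζ z') (S.ζ z'') m')}
    (h' : S.α z' z'' m' e'' = e' ⊠ l') (h : S.α z z' m e' = e ⊠ l) :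
    S.α z z'' (m.trans m') e'' = e ⊠ (cupGerbe p).μ _ _ _ m m' (l ⊠ l') := by
  refine (S.cocycle z z' z'' m m' e'').symm.trans ?_
  have h1 : tmap (clm (S.α z z' m)) (.id ℂ _) (S.α z' z'' m' e'') = (e ⊠ l) ⊠ l' := by
    refine (congrArg _ h').trans ((tmap_tmul _ _ _ _).trans ?_)
    exact congrArg (· ⊠ l') h
  exact (congrArg (fun t => tmap _ _ (tassoc _ _ _ t)) h1).trans
    ((congrArg _ (tassoc_tmul _ _ _)).trans (tmap_tmul _ _ _ _))

theorem bγ_add (n n' : ℤ) (x x' x'' : S3R) (h : x' = shift n x) (h' : x'' = shift n' x')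
    (h'' : x'' = shift (n + n') x) (e : (bdl S).fib (toY p x'')) :
    bγ S n x x' h (bγ S n' x' x'' h' e) = bγ S (n + n') x x'' h'' e := by
  obtain ⟨z, hz⟩ := exists_z S x
  obtain ⟨z', hz'⟩ := exists_z S x'
  obtain ⟨z'', hz''⟩ := exists_z S x''
  have m := proj_of_shift S h hz hz'
  have m' := proj_of_shift S h' hz' hz''
  have hy : S3R.y x' = S3R.y x := by rw [h]; rfl
  have c0 := bγ_spec S n x x' h z z' hz hz' m (bγ S n' x' x'' h' e)
  have c1 := bγ_spec S n' x' x'' h' z' z'' hz' hz'' m' e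
  rw [hy] at c1
  have c2 := bγ_spec S _ x x'' h'' z z'' hz hz'' (m.trans m') e
  have c3 := cocycle_tmul S m m' c1 c0
  rw [mul_ell _ _ _ m m' _ (hopf_y hz)] at c3
  have c4 := Gerbe.tmul_right_inj (norm_ell _ _ (m.trans m') _ (hopf_y hz)) (c3.symm.trans c2)
  exact (bκ S z _ hz).injective c4

/-- The twisted relation between the actions of `ℤ` and `ℤ_p`, which comes from the weight of `[y, 1]`. -/
theorem bγ_tr (ζ : Zp p) (n : ℤ) (x x₁ x₂ x₃ : S3R) (h₁ : x₁ = shift n x) (h₂ : x₂ = rot ζ x₁)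
    (h₃ : x₃ = rot ζ x) (h₄ : x₂ = shift n x₃) (k : toY p x₂ = toY p x₁) (k' : toY p x₃ = toY p x)
    (e : (bdl S).fib (toY p x₂)) : bγ S n x x₁ h₁ ((bdl S).tr k e)
      = (((ζ : ℂˣ) ^ (1 * n) : ℂˣ) : ℂ) • (bdl S).tr k' (bγ S n x₃ x₂ h₄ e) := by
  obtain ⟨z, hz⟩ := exists_z S x
  obtain ⟨z', hz'⟩ := exists_z S x₁
  have hz₃ : S.ζ z = toY p x₃ := by rw [hz, h₃, toY_rot]
  have hz₂ : S.ζ z' = toY p x₂ := by rw [hz', h₂, toY_rot]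
  have m := proj_of_shift S h₁ hz hz'
  have hN : (toS2Z (.mk (S.ζ z) (S.ζ z') m)).n = n := by
    refine toS2Z_n_eq _ _ _ _ ?_
    rw [hz, hz', h₁]
    rfl
  have hy : S3R.y x₃ = ζ • S3R.y x := by rw [h₃]; rfl
  have c1 := bγ_spec S n x x₁ h₁ z z' hz hz' m ((bdl S).tr k e)
  have c2 := bγ_spec S n x₃ x₂ h₄ z z' hz₃ hz₂ m e
  rw [bκ_tr S z' _ _ hz' hz₂, c2, hy, ell_rot _ _ m ζ _ (hopf_y hz), hN, tmul_smul, ← smul_tmul] at c1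
  have c3 := Gerbe.tmul_right_inj (norm_ell _ _ m _ (hopf_y hz)) c1
  apply (bκ S z _ hz).injective
  refine c3.symm.trans ?_
  rw [one_mul, map_smul]
  exact congrArg _ (bκ_tr S z _ _ hz hz₃ _ _).symm

theorem bκ_symm_par {X : Type} [DiffeologicalSpace X] {z : X → S.Z} (hz : DSmooth z)
    {y : X → (cupGerbe p).Y} (hy : DSmooth y) (h : ∀ t, S.ζ (z t) = y t) :
    HVB.IsPar (S.E.pb z hz) ((bdl S).pb y hy) (fun t => clm (bκ S (z t) (y t) (h t)).symm) :=
  (bκ_par S hz hy h).inv (fun t e => (bκ S (z t) (y t) (h t)).symm_apply_apply e)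
    (fun t e => (bκ S (z t) (y t) (h t)).apply_symm_apply e)

/-- The action of `ℤ` is parallel: the 1-forms from the twisted connections cancel the one from `[y, 1]`. -/
theorem bγ_par (n : ℤ) : HVB.IsPar (X := S3R)
    (((((bdl S).pb (toY p) (toY_subm p).smooth.dSmooth).twist rOne.neg)).pb _ (shift_smooth n))
    (((bdl S).pb (toY p) (toY_subm p).smooth.dSmooth).twist rOne.neg) (fun x => clm (bγ S n x _ rfl)) := by
  refine isPar_of_sec (S := S) (T := S) (a := toY p) (b := fun x => toY p (shift n x))
    (toY_subm p).smooth.dSmooth (dSmooth_comp (toY_subm p).smooth.dSmooth (shift_smooth n))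
    fun X' _ x hx z hz z' hz' h h' => ?_
  have hM : ∀ t, proj p (S.ζ (z t)) = proj p (S.ζ (z' t)) := fun t => proj_of_shift S rfl (h t) (h' t)
  have a1 := (((bdl S).pb (toY p) (toY_subm p).smooth.dSmooth).untwist_par rOne.neg).pb
    (fun t => shift n (x t)) (dSmooth_comp (shift_smooth n) hx)
  have a2 := (bκ_par S hz' (dSmooth_comp (toY_subm p).smooth.dSmooth (dSmooth_comp (shift_smooth n) hx))
    h').isParTw
  have a3 := (S.α_par.pb (fun t => FibProd.mk (z t) (z' t) (hM t))
    (FibProd.dSmooth_mk hz hz' hM)).isParTw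
  have hl := fun t => norm_ell _ _ (hM t) (S3R.y (x t)) (hopf_y (h t))
  have a4 := (ell_par (dSmooth_comp S.subm.smooth.dSmooth hz) (dSmooth_comp S.subm.smooth.dSmooth hz') hM
    (y := fun t => S3R.fst (x t)) (dSmooth_comp S3R.fst_smooth hx) fun t => hopf_y (h t)).contract
      (S.E.pb z hz) (fun t => (cupGerbe p).rank _) hl
  have a5 := (bκ_symm_par S hz (dSmooth_comp (toY_subm p).smooth.dSmooth hx) h).isParTw
  have a6 := (((bdl S).pb (toY p) (toY_subm p).smooth.dSmooth).twist_par rOne.neg).pb x hx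
  refine ((((((a6.comp a5).comp a4).comp a3).comp a2).comp a1).isPar fun q u v => ?_).congr fun t e => ?_
  · have r0 : Yp.r (S.ζ (z (q u))) = S3R.r (x (q u)) := congrArg (fun y : Yp p => Yp.r y) (h (q u))
    have r1 : Yp.r (S.ζ (z' (q u))) = S3R.r (x (q u)) + n := congrArg (fun y : Yp p => Yp.r y) (h' (q u))
    change -(S3R.r (x (q u)) * hopfForm.val (q.map _ (dSmooth_comp S3R.fst_smooth hx)) u v) + 0
      + -((Yp.r (S.ζ (z' (q u))) - Yp.r (S.ζ (z (q u))))
        * hopfForm.val (q.map _ (dSmooth_comp S3R.fst_smooth hx)) u v) + 0 + 0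
      + -(-((S3R.r (x (q u)) + n) * hopfForm.val (q.map _ (dSmooth_comp S3R.fst_smooth hx)) u v)) = 0
    rw [r0, r1]
    ring
  · refine (bκ S (z t) _ (h t)).injective (((bκ S (z t) _ (h t)).apply_symm_apply _).trans ?_)
    change contract (S.E.fib (z t)) _ (S.α (z t) (z' t) (hM t) (bκ S (z' t) _ (h' t) e)) = _
    exact (congrArg _ (bγ_spec S n (x t) (shift n (x t)) rfl (z t) (z' t) (h t) (h' t) (hM t) e)).trans
      (contract_tmul_self (hl t) _)

/-- The twisted equivariant bundle of a section: the pullback to `S³ × ℝ` of the bundle on `Y` given by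
descent, with its connection changed by `-i r Im⟨y, dy⟩`, and with the action of `ℤ` given by the
isomorphism of the section and the point of the Hopf fibre. -/
def tw : Tw p 1 where
  E := ((bdl S).pb (toY p) (toY_subm p).smooth.dSmooth).twist rOne.neg
  φ ζ x x' hx := (bdl S).tr (by rw [hx, toY_rot])
  φ_par ζ := by
    have hr : DSmooth (fun x : S3R => rot ζ x) := rot_smooth ζ
    have a1 := (((bdl S).pb (toY p) (toY_subm p).smooth.dSmooth).untwist_par rOne.neg).pb
      (fun x => rot ζ x) hr
    have a2 := ((bdl S).tr_par (fun x => toY p (rot ζ x)) (toY p)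
      (dSmooth_comp (toY_subm p).smooth.dSmooth hr) (toY_subm p).smooth.dSmooth
      fun x => toY_rot ζ x).isParTw
    have a3 := ((bdl S).pb (toY p) (toY_subm p).smooth.dSmooth).twist_par rOne.neg
    refine (((a3.comp a2).comp a1).isPar fun q u v => ?_).congr fun t e => rfl
    have e := rForm_eq (x := fun x : S3R => x) (fun n p hp => hp) hr (fun x => (toY_rot ζ x).symm) q u v
    change -(rForm (x := fun x : S3R => x) (fun n p hp => hp) q u v) + 0 + - -rForm hr q u v = 0
    rw [e]
    ring
  φ_mul ζ ζ' x x' x'' h h' h'' e := HVB.tr_tr (bdl S) _ _ _ e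
  γ := bγ S
  γ_par := bγ_par S
  γ_add := bγ_add S
  twist ζ n x x₁ x₂ x₃ h₁ h₂ h₃ h₄ e := bγ_tr S ζ n x x₁ x₂ x₃ h₁ h₂ h₃ h₄ _ _ e

/-- Every section of the gerbe corresponds to a twisted equivariant bundle. -/
def repTw : Rep (tw S) S where
  κ z x h := bκ S z _ h
  par := by
    have a1 := (((bdl S).pb (toY p) (toY_subm p).smooth.dSmooth).untwist_par rOne.neg).pb
      (fun t : FibProd S.ζ (toY p) => t.1.2) FibProd.dSmooth_snd
    have a2 := (bκ_par S (z := fun t : FibProd S.ζ (toY p) => t.1.1) FibProd.dSmooth_fst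
      (dSmooth_comp (toY_subm p).smooth.dSmooth FibProd.dSmooth_snd) fun t => t.2).isParTw
    refine (a2.comp a1).congr (fun q u v => ?_) fun t e => rfl
    rw [zero_add]
    exact neg_neg _
  map_φ z ζ x x' h h' hx e := bκ_tr S z _ _ h h' _ e
  map_α z₀ z₁ x₀ x₁ n h₀ h₁ hx h e := bγ_spec S n x₀ x₁ hx z₀ z₁ h₀ h₁ h e

variable {S} in
theorem Corr.congr_right {A B : Tw p 1} {T : (cupGerbe p).Sec} {R : Rep A S} {R' : Rep B T} {f : S ⟶ T}
    {g g' : A ⟶ B} (h : Corr R R' f g) (e : g = g') : Corr R R' f g' := e ▸ h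

end Rep
end

section
variable (p : ℕ) [NeZero p]

/-- The functor from sections of the gerbe to twisted equivariant bundles. -/
def toTwFunctor : (cupGerbe p).Sec ⥤ Tw p 1 where
  obj S := Rep.tw S
  map {S T} f := (Rep.repTw S).toTw (Rep.repTw T) f
  map_id S := ((Rep.repTw S).corr_toTw (Rep.repTw S) (𝟙 S)).unique_right _ _ (Rep.corr_id _)
  map_comp {S T U} f g := ((Rep.repTw S).corr_toTw (Rep.repTw U) (f ≫ g)).unique_right _ _
    (((Rep.repTw S).corr_toTw (Rep.repTw T) f).comp ((Rep.repTw T).corr_toTw (Rep.repTw U) g))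

instance : (toTwFunctor p).Full where
  map_surjective {S T} g := ⟨(Rep.repTw S).toSec (Rep.repTw T) g,
    ((Rep.repTw S).corr_toTw (Rep.repTw T) _).unique_right _ _
      ((Rep.repTw S).corr_toSec (Rep.repTw T) g)⟩

instance : (toTwFunctor p).Faithful where
  map_injective {S T} f f' h := ((Rep.repTw S).corr_toTw (Rep.repTw T) f).unique_left _ _
    (((Rep.repTw S).corr_toTw (Rep.repTw T) f').congr_right h.symm)

variable {p} in
/-- Two bundles which correspond to the same section are isomorphic. -/
def Rep.isoOfSec {A B : Tw p 1} {S : (cupGerbe p).Sec} (R : Rep A S) (R' : Rep B S) : A ≅ B where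
  hom := R.toTw R' (𝟙 S)
  inv := R'.toTw R (𝟙 S)
  hom_inv_id := ((R.corr_toTw R' _).comp (R'.corr_toTw R _)).unique_right _ _
    (by rw [Category.id_comp]; exact Rep.corr_id R)
  inv_hom_id := ((R'.corr_toTw R _).comp (R.corr_toTw R' _)).unique_right _ _
    (by rw [Category.id_comp]; exact Rep.corr_id R')

/-- The equivalence between sections of the gerbe and twisted equivariant bundles. -/
def secEquiv : (cupGerbe p).Sec ≌ Tw p 1 :=
  equivOfPreimages (toTwFunctor p) secOf fun A => (Rep.repTw (secOf A)).isoOfSec (repSecOf A)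

end

/-! ### The bundle metric -/

section HomOf
variable {V W V' W' : Type} [NormedAddCommGroup V] [InnerProductSpace ℂ V] [FiniteDimensional ℂ V]
    [NormedAddCommGroup W] [InnerProductSpace ℂ W] [FiniteDimensional ℂ W]
    [NormedAddCommGroup V'] [InnerProductSpace ℂ V'] [FiniteDimensional ℂ V']
    [NormedAddCommGroup W'] [InnerProductSpace ℂ W'] [FiniteDimensional ℂ W']

/-- The linear form `⟨b_i, -⟩` given by an element of the standard orthonormal basis. -/
def coordDu (V : Type) [NormedAddCommGroup V] [InnerProductSpace ℂ V] [FiniteDimensional ℂ V]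
    (i : Fin (Module.finrank ℂ V)) : Du V :=
  (innerSL ℂ (stdOrthonormalBasis ℂ V i) : StrongDual ℂ V)

theorem sum_coordDu (v : V) : ∑ i, coordDu V i v • stdOrthonormalBasis ℂ V i = v :=
  (stdOrthonormalBasis ℂ V).sum_repr' v

/-- The inverse of `homOf`. -/
def ofHom : (V →L[ℂ] W) →L[ℂ] Ten (Du V) W :=
  LinearMap.toContinuousLinearMap
    { toFun := fun T => ∑ i, coordDu V i ⊠ T (stdOrthonormalBasis ℂ V i)
      map_add' := fun S T => by
        rw [← Finset.sum_add_distrib]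
        exact Finset.sum_congr rfl fun i _ => tmul_add _ _ _
      map_smul' := fun c T => by
        rw [RingHom.id_apply, Finset.smul_sum]
        exact Finset.sum_congr rfl fun i _ => tmul_smul _ _ _ }

theorem ofHom_apply (T : V →L[ℂ] W) :
    ofHom T = ∑ i, coordDu V i ⊠ T (stdOrthonormalBasis ℂ V i) := rfl

@[simp] theorem homOf_ofHom (T : V →L[ℂ] W) : homOf (ofHom T) = T := by
  ext v
  rw [ofHom_apply, map_sum, sum_apply]
  conv_rhs => rw [← sum_coordDu v, map_sum]
  exact Finset.sum_congr rfl fun i _ => by rw [homOf_tmul, rankOne_apply, map_smul]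

@[simp] theorem ofHom_homOf (x : Ten (Du V) W) : ofHom (homOf x) = x := by
  induction x using Ten.induction with
  | h0 => simp only [map_zero]
  | ha x y hx hy => simp only [map_add, hx, hy]
  | ht ξ w =>
    rw [homOf_tmul, ofHom_apply]
    simp only [rankOne_apply, tmul_smul, ← smul_tmul]
    have h : ∑ i, ξ (stdOrthonormalBasis ℂ V i) • coordDu V i = ξ := by
      refine Du.ext fun v => ?_
      conv_rhs => rw [← sum_coordDu v, map_sum]
      have e : ∀ (s : Finset (Fin (Module.finrank ℂ V))), (∑ i ∈ s, ξ (stdOrthonormalBasis ℂ V i) • coordDu V i) v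
          = ∑ i ∈ s, ξ (coordDu V i v • stdOrthonormalBasis ℂ V i) := fun s => by
        classical
        induction s using Finset.induction_on with
        | empty => rfl
        | insert i s hi ih =>
          rw [Finset.sum_insert hi, Finset.sum_insert hi, Du.add_apply, ih, Du.smul_apply, map_smul,
            smul_eq_mul, mul_comm]
      exact e _
    conv_rhs => rw [← h]
    exact (map_sum (LinearMap.toAddMonoidHom ((TensorProduct.mk ℂ (Du V) W).flip w)) _ _).symm

theorem homOf_injective : Function.Injective (homOf : Ten (Du V) W → (V →L[ℂ] W)) :=
  Function.LeftInverse.injective ofHom_homOf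

theorem homOf_tmap (A : V' →L[ℂ] V) (B : W →L[ℂ] W') (x : Ten (Du V) W) :
    homOf (tmap (trp A) B x) = B ∘L homOf x ∘L A := by
  induction x using Ten.induction with
  | h0 => simp only [map_zero]; ext; simp
  | ha x y hx hy => simp only [map_add, hx, hy]; ext; simp
  | ht ξ w => ext v; simp

theorem homOf_tensorIso (e : V ≃ₗᵢ[ℂ] V') (f : W ≃ₗᵢ[ℂ] W') (x : Ten (Du V) W) (v : V) :
    homOf (tensorIso (dualIso e) f x) (e v) = f (homOf x v) := by
  have h : tensorIso (dualIso e) f x = tmap (trp (clm e.symm)) (clm f) x :=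
    congrArg (fun T => T x) (clm_tensorIso (dualIso e) f)
  rw [h, homOf_tmap]
  simp

theorem homOf_tconn {n : ℕ} (A : Euc n →L[ℝ] (V →L[ℂ] V)) (B : Euc n →L[ℝ] (W →L[ℂ] W)) (v : Euc n)
    (x : Ten (Du V) W) :
    homOf (tconn (-(trpR ∘L A)) B v x) = B v ∘L homOf x - homOf x ∘L A v := by
  induction x using Ten.induction with
  | h0 => simp only [map_zero]; ext; simp
  | ha x y hx hy => simp only [map_add, hx, hy]; ext; simp; abel
  | ht ξ w => ext a; simp [tconn_apply, trpR_apply]; abel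

theorem homOf_parallel_iff {n : ℕ} {A : Euc n →L[ℝ] (V →L[ℂ] V)} {B : Euc n →L[ℝ] (W →L[ℂ] W)} {v : Euc n}
    {T DT : V →L[ℂ] W} {N DN : ℂ →L[ℂ] Ten (Du V) W} (hT : T = homOf (N 1)) (hDT : DT = homOf (DN 1)) :
    DN + tconn (-(trpR ∘L A)) B v ∘L N = N ∘L (0 : Euc n →L[ℝ] (ℂ →L[ℂ] ℂ)) v ↔
      DT + B v ∘L T = T ∘L A v := by
  have e2 := homOf_tconn A B v (N 1)
  rw [← hT] at e2
  rw [zero_apply, ContinuousLinearMap.comp_zero]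
  constructor
  · intro e
    have e4 := congrArg (fun T => homOf (T 1)) e
    simp only [add_apply, ContinuousLinearMap.comp_apply, map_add, e2, zero_apply,
      map_zero, ← hDT] at e4
    rwa [← add_sub_assoc, sub_eq_zero] at e4
  · intro e
    refine ContinuousLinearMap.ext_ring (homOf_injective ?_)
    simp only [add_apply, ContinuousLinearMap.comp_apply, map_add, e2, zero_apply,
      map_zero, ← hDT]
    rwa [← add_sub_assoc, sub_eq_zero]

end HomOf

namespace HVB
variable {X : Type} [DiffeologicalSpace X] {E F : HVB X}

theorem mat_homOf (t : ∀ x, (E.dual.tensor F).fib x) {n : ℕ} (q : Plot X n) (i : E.ι) (j : F.ι) (w : Euc n) :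
    mat E F (fun x => homOf (t x)) q i j w = homOf (mat (triv X) (E.dual.tensor F)
      (fun x => ContinuousLinearMap.toSpanSingleton ℂ (t x)) q () (i, j) w (1 : ℂ)) := by
  have e : mat (triv X) (E.dual.tensor F) (fun x => ContinuousLinearMap.toSpanSingleton ℂ (t x)) q ()
      (i, j) w (1 : ℂ) = tmap (trp (E.frame i (q w))) (F.coframe j (q w)) (t (q w)) :=
    congrArg (tmap (trp (E.frame i (q w))) (F.coframe j (q w))) (one_smul ℂ (t (q w)))
  rw [e]
  exact (homOf_tmap _ _ _).symm

/-- Parallel sections of `E^* ⊗ F` are the parallel morphisms `E → F`. -/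
theorem isParSection_iff (t : ∀ x, (E.dual.tensor F).fib x) :
    IsParSection (E.dual.tensor F) t ↔ IsPar E F (fun x => homOf (t x)) := by
  let N : ∀ {n : ℕ} (q : Plot X n) (i : E.ι) (j : F.ι), Euc n → (ℂ →L[ℂ] Ten (Du (E.model i)) (F.model j)) :=
    fun q i j => mat (triv X) (E.dual.tensor F) (fun x => ContinuousLinearMap.toSpanSingleton ℂ (t x)) q () (i, j)
  let M : ∀ {n : ℕ} (q : Plot X n) (i : E.ι) (j : F.ι), Euc n → (E.model i →L[ℂ] F.model j) :=
    fun q i j => mat E F (fun x => homOf (t x)) q i j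
  have hMN : ∀ {n : ℕ} (q : Plot X n) i j w, M q i j w = homOf (N q i j w 1) := fun q i j w => mat_homOf t q i j w
  let J : ∀ V : Type, [NormedAddCommGroup V] → [NormedSpace ℂ V] → V →L[ℂ] (ℂ →L[ℂ] V) := fun V _ _ =>
    (ContinuousLinearMap.toSpanSingletonCLE (𝕜 := ℂ) (E := V) : V →L[ℂ] (ℂ →L[ℂ] V))
  let L : ∀ (i : E.ι) (j : F.ι), (ℂ →L[ℂ] Ten (Du (E.model i)) (F.model j)) →L[ℝ] (E.model i →L[ℂ] F.model j) :=
    fun i j => (homOf ∘L ContinuousLinearMap.apply ℂ _ (1 : ℂ)).restrictScalars ℝ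
  let L' : ∀ (i : E.ι) (j : F.ι), (E.model i →L[ℂ] F.model j) →L[ℝ] (ℂ →L[ℂ] Ten (Du (E.model i)) (F.model j)) :=
    fun i j => (J _ ∘L ofHom).restrictScalars ℝ
  have hN : ∀ {n : ℕ} (q : Plot X n) i j w, N q i j w = L' i j (M q i j w) := fun q i j w => by
    refine ContinuousLinearMap.ext_ring ?_
    rw [hMN]
    change _ = (1 : ℂ) • ofHom (homOf _)
    rw [one_smul, ofHom_homOf]
  have hD : ∀ {n : ℕ} (q : Plot X n) i j u, ContDiffAt ℝ ∞ (N q i j) u → ∀ v,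
      fderiv ℝ (M q i j) u v = homOf (fderiv ℝ (N q i j) u v 1) := by
    intro n q i j u h v
    have e : M q i j = L i j ∘ N q i j := funext (hMN q i j)
    rw [e, ((L i j).hasFDerivAt.comp u (h.differentiableAt (by simp)).hasFDerivAt).fderiv]
    rfl
  constructor
  · refine fun h => .of_at fun q i j u hi hj => ?_
    have h1 : ContDiffAt ℝ ∞ (N q i j) u := h.contDiffAt (i := ()) (j := (i, j)) q trivial ⟨hi, hj⟩
    refine ⟨?_, fun v => (homOf_parallel_iff (hMN q i j u) (hD q i j u h1 v)).1 (h.parallel q () (i, j) u trivial ⟨hi, hj⟩ v)⟩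
    have e : M q i j = fun w => L i j (N q i j w) := funext (hMN q i j)
    change ContDiffAt ℝ ∞ (M q i j) u
    rw [e]
    exact (L i j).contDiff.contDiffAt.comp u h1
  · refine fun h => .of_at fun {n} q i (j : E.ι × F.ι) u hi (hj : q u ∈ E.dom j.1 ∩ F.dom j.2) => ?_
    have h1 : ContDiffAt ℝ ∞ (N q j.1 j.2) u := by
      have e : N q j.1 j.2 = fun w => L' j.1 j.2 (M q j.1 j.2 w) := funext (hN q j.1 j.2)
      rw [e]
      exact (L' j.1 j.2).contDiff.contDiffAt.comp u (h.contDiffAt q hj.1 hj.2)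
    exact ⟨h1, fun v => (homOf_parallel_iff (hMN q j.1 j.2 u) (hD q j.1 j.2 u h1 v)).2 (h.parallel q j.1 j.2 u hj.1 hj.2 v)⟩

end HVB

section
variable {p : ℕ} [NeZero p]

namespace Tw

/-- The bundle on `M_p` given by `Θ(A) ⊗ B`. -/
abbrev homBdl (A B : Tw p 1) : HVB (Mp p).carrier :=
  (pullEquiv p).inverse.obj ((pairing p 1).obj (Opposite.op A, B))

/-- The fibre of the bundle on `M_p` given by an equivariant bundle `C`, at the image of a point `x`, is
the fibre of `C` at `x`. -/
def desIso (C : Tw p 0) (x : S3R) (m : (Mp p).carrier) (h : toMp p x = m) :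
    ((pullEquiv p).inverse.obj C).fib m ≃ₗᵢ[ℂ] C.E.fib x :=
  (((pullEquiv p).inverse.obj C).tr h.symm).trans (C.descentData.κ (toMp_subm p) x)

theorem desIso_par (C : Tw p 0) {X : Type} [DiffeologicalSpace X] {x : X → S3R} (hx : DSmooth x)
    {m : X → (Mp p).carrier} (hm : DSmooth m) (h : ∀ t, toMp p (x t) = m t) :
    HVB.IsPar (((pullEquiv p).inverse.obj C).pb m hm) (C.E.pb x hx)
      (fun t => clm (desIso C (x t) (m t) (h t))) :=
  ((C.descentData.κ_par (toMp_subm p)).pb x hx).comp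
    (((pullEquiv p).inverse.obj C).tr_par m (fun t => toMp p (x t)) hm
      (dSmooth_comp (toMp_smooth p) hx) fun t => (h t).symm)

theorem desIso_tr (C : Tw p 0) (x : S3R) {m m' : (Mp p).carrier} (h : toMp p x = m) (h' : toMp p x = m')
    (hm : m' = m) (v : ((pullEquiv p).inverse.obj C).fib m') :
    desIso C x m h (((pullEquiv p).inverse.obj C).tr hm v) = desIso C x m' h' v := by
  subst hm
  rfl

theorem desIso_φ (C : Tw p 0) (ζ : Zp p) (x x' : S3R) (hx : x' = rot ζ x) {m : (Mp p).carrier}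
    (h : toMp p x = m) (h' : toMp p x' = m) (v : ((pullEquiv p).inverse.obj C).fib m) :
    desIso C x m h v = C.φ ζ x x' hx (desIso C x' m h' v) := by
  subst h'
  exact (descIso C).hom.map_φ ζ x x' hx v

theorem desIso_γ (C : Tw p 0) (n : ℤ) (x x' : S3R) (hx : x' = shift n x) {m : (Mp p).carrier}
    (h : toMp p x = m) (h' : toMp p x' = m) (v : ((pullEquiv p).inverse.obj C).fib m) :
    desIso C x m h v = C.γ n x x' hx (desIso C x' m h' v) := by
  subst h'
  exact (descIso C).hom.map_γ n x x' hx v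

theorem desIso_map {C C' : Tw p 0} (f : C ⟶ C') (x : S3R) {m : (Mp p).carrier} (h : toMp p x = m)
    (v : ((pullEquiv p).inverse.obj C).fib m) :
    desIso C' x m h (((pullEquiv p).inverse.map f).toFun m v) = f.toHom.toFun x (desIso C x m h v) := by
  subst h
  have e := (pullEquiv p).counit.naturality f
  exact congrArg (fun t : (pull p).obj ((pullEquiv p).inverse.obj C) ⟶ C' => t.toHom.toFun x v) e

/-- An invariant parallel section of an equivariant bundle is the pullback of a parallel section. -/
theorem exists_section (C : Tw p 0) (u : ∀ x, C.E.fib x) (hu : HVB.IsParSection C.E u)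
    (hφ : ∀ (ζ : Zp p) (x x' : S3R) (h : x' = rot ζ x), u x = C.φ ζ x x' h (u x'))
    (hγ : ∀ (n : ℤ) (x x' : S3R) (h : x' = shift n x), u x = C.γ n x x' h (u x')) :
    ∃ s : ∀ m, ((pullEquiv p).inverse.obj C).fib m, HVB.IsParSection _ s ∧
      ∀ x m (h : toMp p x = m), desIso C x m h (s m) = u x := by
  have htr : ∀ {m m' : (Mp p).carrier} (h : m = m') (c : ℂ), (HVB.triv (Mp p).carrier).tr h c = c := by
    rintro m _ rfl c
    rfl
  let g : (pull p).obj (HVB.triv (Mp p).carrier) ⟶ C :=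
    ⟨⟨fun x => ContinuousLinearMap.toSpanSingleton ℂ (u x), hu.congr fun x c => rfl⟩,
      fun ζ x x' h c => by
        refine (congrArg (fun c : ℂ => c • u x) (htr _ c)).trans ?_
        rw [hφ ζ x x' h]
        exact (map_smul (C.φ ζ x x' h) (show ℂ from c) (u x')).symm,
      fun n x x' h c => by
        refine (congrArg (fun c : ℂ => c • u x) (htr _ c)).trans ?_
        rw [hγ n x x' h]
        exact (map_smul (C.γ n x x' h) (show ℂ from c) (u x')).symm⟩
  let f := (pull p).preimage (g ≫ (descIso C).inv)
  have hf : (pull p).map f ≫ (descIso C).hom = g := by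
    rw [Functor.map_preimage, Category.assoc, Iso.inv_hom_id, Category.comp_id]
  refine ⟨fun m => f.toFun m (1 : ℂ), f.isPar.congr fun m c => ?_, fun x m h => ?_⟩
  · refine (congrArg (f.toFun m) (mul_one (show ℂ from c)).symm).trans ?_
    exact map_smul (f.toFun m) (show ℂ from c) (1 : ℂ)
  · subst h
    refine (congrArg (fun t : (pull p).obj (HVB.triv (Mp p).carrier) ⟶ C => t.toHom.toFun x (1 : ℂ)) hf).trans ?_
    exact one_smul ℂ (u x)

variable (A B : Tw p 1)

/-- The homomorphism `A_x → B_x` given by an element of the fibre of the bundle on `M_p` given by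
`Θ(A) ⊗ B`. -/
def ev (x : S3R) (m : (Mp p).carrier) (h : toMp p x = m) (v : (homBdl A B).fib m) : A.E.fib x →L[ℂ] B.E.fib x :=
  homOf (desIso ((pairing p 1).obj (Opposite.op A, B)) x m h v : Ten (Du (A.E.fib x)) (B.E.fib x))

theorem ev_φ (ζ : Zp p) (x x' : S3R) (hx : x' = rot ζ x) {m : (Mp p).carrier} (h : toMp p x = m)
    (h' : toMp p x' = m) (v : (homBdl A B).fib m) (e : A.E.fib x') :
    ev A B x m h v (A.φ ζ x x' hx e) = B.φ ζ x x' hx (ev A B x' m h' v e) := by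
  rw [ev, desIso_φ _ ζ x x' hx h h']
  exact homOf_tensorIso (A.φ ζ x x' hx) (B.φ ζ x x' hx) _ e

theorem ev_γ (n : ℤ) (x x' : S3R) (hx : x' = shift n x) {m : (Mp p).carrier} (h : toMp p x = m)
    (h' : toMp p x' = m) (v : (homBdl A B).fib m) (e : A.E.fib x') :
    ev A B x m h v (A.γ n x x' hx e) = B.γ n x x' hx (ev A B x' m h' v e) := by
  rw [ev, desIso_γ _ n x x' hx h h']
  exact homOf_tensorIso (A.γ n x x' hx) (B.γ n x x' hx) _ e

theorem ev_map {A B} {A' B' : Tw p 1} (f : A' ⟶ A) (g : B ⟶ B') (x : S3R) {m : (Mp p).carrier}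
    (h : toMp p x = m) (v : (homBdl A B).fib m) :
    ev A' B' x m h (((pullEquiv p).inverse.map ((pairing p 1).map (X := (Opposite.op A, B))
      (Y := (Opposite.op A', B')) (f.op, g))).toFun m v)
      = g.toHom.toFun x ∘L ev A B x m h v ∘L f.toHom.toFun x := by
  rw [ev, desIso_map]
  exact homOf_tmap _ _ _

theorem ev_injective (x : S3R) (m : (Mp p).carrier) (h : toMp p x = m) :
    Function.Injective (ev A B x m h) :=
  fun _ _ e => (desIso _ x m h).injective (homOf_injective e)

/-- Parallel sections of the bundle given by `Θ(A) ⊗ B` are morphisms `A → B`. -/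
theorem exists_homEquiv : ∃ H : (A ⟶ B) ≃ {s : ∀ m, (homBdl A B).fib m // HVB.IsParSection _ s},
    ∀ g x m (h : toMp p x = m), ev A B x m h ((H g).1 m) = g.toHom.toFun x := by
  have ex : ∀ g : A ⟶ B, ∃ s : ∀ m, (homBdl A B).fib m, HVB.IsParSection _ s ∧
      ∀ x m (h : toMp p x = m), ev A B x m h (s m) = g.toHom.toFun x := fun g => by
    have inv : ∀ (x x' : S3R) (a : A.E.fib x' ≃ₗᵢ[ℂ] A.E.fib x) (b : B.E.fib x' ≃ₗᵢ[ℂ] B.E.fib x),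
        (∀ e, g.toHom.toFun x (a e) = b (g.toHom.toFun x' e)) →
        ofHom (g.toHom.toFun x) = tensorIso (dualIso a) b (ofHom (g.toHom.toFun x')) := by
      intro x x' a b hab
      refine homOf_injective (ContinuousLinearMap.ext fun e => ?_)
      obtain ⟨e, rfl⟩ := a.surjective e
      rw [homOf_tensorIso, homOf_ofHom, homOf_ofHom, hab]
    obtain ⟨s, hs, h⟩ := exists_section ((pairing p 1).obj (Opposite.op A, B))
      (fun x => ofHom (g.toHom.toFun x))
      ((HVB.isParSection_iff _).2 (g.toHom.isPar.congr fun x e =>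
        congrArg (fun T => T e) (homOf_ofHom (g.toHom.toFun x)).symm))
      (fun ζ x x' hx => inv x x' _ _ (g.map_φ ζ x x' hx)) (fun n x x' hx => inv x x' _ _ (g.map_γ n x x' hx))
    exact ⟨s, hs, fun x m hm => (congrArg homOf (h x m hm)).trans (homOf_ofHom _)⟩
  choose s hs h using ex
  refine ⟨⟨fun g => ⟨s g, hs g⟩, fun t => ⟨⟨fun x => ev A B x _ rfl (t.1 _), ?_⟩, ?_, ?_⟩, ?_, ?_⟩, h⟩
  · refine (HVB.isParSection_iff (E := A.E) (F := B.E)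
      (fun x => desIso ((pairing p 1).obj (Opposite.op A, B)) x _ rfl (t.1 _))).1 ?_
    have h1 := desIso_par ((pairing p 1).obj (Opposite.op A, B)) (x := fun x : S3R => x)
      (fun n q hq => hq) (toMp_smooth p) (fun t => rfl)
    refine (h1.comp (HVB.IsPar.pb t.2 (toMp p) (toMp_smooth p))).congr fun x c => ?_
    exact map_smul (desIso ((pairing p 1).obj (Opposite.op A, B)) x (toMp p x) rfl) (show ℂ from c) (t.1 _)
  · intro ζ x x' hx e
    have k := toMp_rot (p := p) ζ x x' hx
    refine (ev_φ A B ζ x x' hx rfl k _ e).trans (congrArg _ ?_)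
    have : ∀ m (k : toMp p x' = m), ev A B x' m k (t.1 m) e = ev A B x' _ rfl (t.1 _) e := by
      rintro _ rfl
      rfl
    exact this _ k
  · intro n x x' hx e
    have k := toMp_shift (p := p) n x x' hx
    refine (ev_γ A B n x x' hx rfl k _ e).trans (congrArg _ ?_)
    have : ∀ m (k : toMp p x' = m), ev A B x' m k (t.1 m) e = ev A B x' _ rfl (t.1 _) e := by
      rintro _ rfl
      rfl
    exact this _ k
  · exact fun g => Hom.ext (HVB.ParHom.ext (funext fun x => h g x _ rfl))
  · refine fun t => Subtype.ext (funext fun m => ?_)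
    obtain ⟨x, rfl⟩ := (toMp_subm p).surj m
    exact ev_injective A B x _ rfl (h _ x _ rfl)

end Tw

namespace Rep
variable (S T : (cupGerbe p).Sec)

/-- The isomorphism of the bundle on `M_p` given by `Θ(Φ S) ⊗ Φ T` with `E^* ⊗ F`, through a point `x`
of `S³ × ℝ`. -/
def met (z : S.Z) (z' : T.Z) (x : S3R) (h : S.ζ z = toY p x) (h' : T.ζ z' = toY p x) (m : (Mp p).carrier)
    (hm : Tw.toMp p x = m) : (Tw.homBdl (tw S) (tw T)).fib m ≃ₗᵢ[ℂ] Ten (Du (S.E.fib z)) (T.E.fib z') :=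
  (Tw.desIso ((Tw.pairing p 1).obj (Opposite.op (tw S), tw T)) x m hm).trans
    (tensorIso (dualIso ((repTw S).κ z x h)) ((repTw T).κ z' x h'))

theorem met_apply (z : S.Z) (z' : T.Z) (x : S3R) (h : S.ζ z = toY p x) (h' : T.ζ z' = toY p x)
    (m : (Mp p).carrier) (hm : Tw.toMp p x = m) (v : (Tw.homBdl (tw S) (tw T)).fib m) (e : (tw S).E.fib x) :
    homOf (met S T z z' x h h' m hm v) ((repTw S).κ z x h e)
      = (repTw T).κ z' x h' (Tw.ev (tw S) (tw T) x m hm v e) :=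
  homOf_tensorIso _ _ _ e

/-- The actions of `ℤ_p` are the descent data of both sections, so the choice of `x` does not matter. -/
theorem met_indep (z : S.Z) (z' : T.Z) (x₀ x : S3R) (h₀ : S.ζ z = toY p x₀) (h₀' : T.ζ z' = toY p x₀)
    (h : S.ζ z = toY p x) (h' : T.ζ z' = toY p x) (m : (Mp p).carrier) (hm₀ : Tw.toMp p x₀ = m)
    (hm : Tw.toMp p x = m) : met S T z z' x₀ h₀ h₀' m hm₀ = met S T z z' x h h' m hm := by
  obtain ⟨ζ, hx⟩ := toY_eq (h₀.symm.trans h)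
  refine LinearIsometryEquiv.ext fun v => homOf_injective (ContinuousLinearMap.ext fun e => ?_)
  obtain ⟨e, rfl⟩ := ((repTw S).κ z x h).surjective e
  rw [met_apply, ← (repTw S).map_φ z ζ x₀ x h₀ h hx, met_apply, ← (repTw T).map_φ z' ζ x₀ x h₀' h' hx]
  exact congrArg _ (Tw.ev_φ _ _ ζ x₀ x hx hm₀ hm v e)

theorem base_eq {z : S.Z} {x : S3R} (h : S.ζ z = toY p x) : Tw.toMp p x = (cupGerbe p).π (S.ζ z) :=
  congrArg (proj p) h.symm

/-- The isomorphism of the bundle on `M_p` given by `Θ(Φ S) ⊗ Φ T` with `E^* ⊗ F`. -/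
def metχ (z : S.Z) (z' : T.Z) (h : S.ζ z = T.ζ z') :
    (Tw.homBdl (tw S) (tw T)).fib ((cupGerbe p).π (S.ζ z)) ≃ₗᵢ[ℂ] Ten (Du (S.E.fib z)) (T.E.fib z') :=
  met S T z z' _ (exists_x (S.ζ z)).choose_spec (h.symm.trans (exists_x (S.ζ z)).choose_spec) _
    (base_eq S (exists_x (S.ζ z)).choose_spec)

theorem metχ_apply (z : S.Z) (z' : T.Z) (hz : S.ζ z = T.ζ z') (x : S3R) (h : S.ζ z = toY p x)
    (h' : T.ζ z' = toY p x) (hm : Tw.toMp p x = (cupGerbe p).π (S.ζ z))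
    (v : (Tw.homBdl (tw S) (tw T)).fib ((cupGerbe p).π (S.ζ z))) (e : (tw S).E.fib x) :
    homOf (metχ S T z z' hz v) ((repTw S).κ z x h e)
      = (repTw T).κ z' x h' (Tw.ev (tw S) (tw T) x _ hm v e) := by
  rw [metχ, met_indep S T z z' _ x _ _ h h' _ _ hm]
  exact met_apply S T z z' x h h' _ hm v e

end Rep
end

section
variable {p : ℕ} [NeZero p]

namespace Rep
variable (S T : (cupGerbe p).Sec)

/-- The 1-forms `i r Im⟨y, dy⟩` of the two sections cancel in `E^* ⊗ F`. -/
theorem metχ_par : HVB.IsPar ((Tw.homBdl (tw S) (tw T)).pb _ (dSmooth_base (cupGerbe p) S T))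
    ((S.E.pb _ FibProd.dSmooth_fst).dual.tensor (T.E.pb _ FibProd.dSmooth_snd))
    (fun t : FibProd S.ζ T.ζ => clm (metχ S T t.1.1 t.1.2 t.2)) := by
  refine .of_local_lift fun {n} q u => ?_
  have hq : DSmooth (fun t : FibProd S.ζ T.ζ => S.ζ t.1.1) :=
    dSmooth_comp S.subm.smooth.dSmooth FibProd.dSmooth_fst
  obtain ⟨s, c, hc, hs, hcu⟩ := (toY_subm p).lift (q.map _ hq) u
  let X' := FibProd (fun t : FibProd S.ζ T.ζ => S.ζ t.1.1) (toY p)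
  refine ⟨X', inferInstance, fun t => t.1.1, FibProd.dSmooth_fst,
    ⟨fun w => FibProd.mk (q (c w)) (s w) (hs w).symm, FibProd.isPlot_iff.2 ⟨isPlot_reparam q.2 hc, s.2⟩⟩,
    hcu.mono fun w hw => congrArg q.1 hw, ?_⟩
  have hz : DSmooth (fun t : X' => t.1.1.1.1) :=
    fun n q hq => FibProd.dSmooth_fst n _ (FibProd.dSmooth_fst n q hq)
  have hz' : DSmooth (fun t : X' => t.1.1.1.2) :=
    fun n q hq => FibProd.dSmooth_snd n _ (FibProd.dSmooth_fst n q hq)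
  have hx : DSmooth (fun t : X' => t.1.2) := FibProd.dSmooth_snd
  have h1 := ((repTw S).par_pb_symm hz hx fun t => t.2).trp
  have h2 := (repTw T).par_pb hz' hx fun t => t.1.1.2.symm.trans t.2
  have h3 := (Tw.desIso_par ((Tw.pairing p 1).obj (Opposite.op (tw S), tw T)) hx
    (m := fun t : X' => (cupGerbe p).π (S.ζ t.1.1.1.1))
    (dSmooth_comp (cupGerbe p).subm.smooth.dSmooth (dSmooth_comp S.subm.smooth.dSmooth hz))
    fun t => base_eq S t.2).isParTw
  refine (((h1.tensor h2).comp h3).isPar fun q u v => by ring).congr fun t e => ?_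
  refine Eq.trans ?_ (congrArg (fun I => I e) (met_indep S T t.1.1.1.1 t.1.1.1.2 _ t.1.2
    _ _ t.2 (t.1.1.2.symm.trans t.2) _ _ (base_eq S t.2))).symm
  exact (DFunLike.congr_fun (clm_tensorIso (dualIso ((repTw S).κ t.1.1.1.1 t.1.2 t.2))
    ((repTw T).κ t.1.1.1.2 t.1.2 (t.1.1.2.symm.trans t.2)))
    (Tw.desIso ((Tw.pairing p 1).obj (Opposite.op (tw S), tw T)) t.1.2 _ (base_eq S t.2) e)).symm

/-- A homomorphism given by an element of the bundle on `M_p` commutes with the isomorphisms of the sections,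
since it commutes with the actions of `ℤ` and both actions use the same element `[y, 1]`. -/
theorem metχ_descent (z₀ z₁ : S.Z) (z₀' z₁' : T.Z) (h₀ : S.ζ z₀ = T.ζ z₀')
    (h₁ : S.ζ z₁ = T.ζ z₁') (h : (cupGerbe p).π (S.ζ z₀) = (cupGerbe p).π (S.ζ z₁))
    (h' : (cupGerbe p).π (T.ζ z₀') = (cupGerbe p).π (T.ζ z₁'))
    (v : (Tw.homBdl (tw S) (tw T)).fib ((cupGerbe p).π (S.ζ z₁))) (e : S.E.fib z₁) :
    tmap (homOf (metχ S T z₀ z₀' h₀ ((Tw.homBdl (tw S) (tw T)).tr h.symm v)))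
        (clm ((cupGerbe p).L.tr ((cupGerbe p).pt_eq h h' h₀ h₁))) (S.α z₀ z₁ h e)
      = T.α z₀' z₁' h' (homOf (metχ S T z₁ z₁' h₁ v) e) := by
  obtain ⟨x, hx⟩ := exists_x (S.ζ z₀)
  obtain ⟨hl, n, hn⟩ := proj_eq p h
  have hx₁ : S.ζ z₁ = toY p (shift n x) := by
    rw [hx] at hl hn
    exact Prod.ext hl.symm hn
  obtain ⟨e, rfl⟩ := ((repTw S).κ z₁ _ hx₁).surjective e
  rw [metχ_apply S T z₁ z₁' h₁ _ hx₁ (h₁.symm.trans hx₁) (base_eq S hx₁),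
    (repTw S).map_α z₀ z₁ x _ n hx hx₁ rfl h]
  refine Eq.trans ?_ ((repTw T).map_α z₀' z₁' x _ n (h₀.symm.trans hx) (h₁.symm.trans hx₁) rfl h' _).symm
  refine (tmap_tmul _ _ _ (ell (S.ζ z₀) (S.ζ z₁) h (S3R.y x))).trans ?_
  rw [metχ_apply S T z₀ z₀' h₀ x hx (h₀.symm.trans hx) (base_eq S hx)]
  refine congrArg₂ (fun a b => (repTw T).κ z₀' x _ a ⊠ b) ?_ (tr_ell _ _ _ _ h h' h₀ h₁ (S3R.y x))
  have k := (base_eq S hx).trans h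
  refine Eq.trans ?_ (Tw.ev_γ (tw S) (tw T) n x _ rfl k (base_eq S hx₁) v e)
  exact congrArg (fun t => homOf t _) (Tw.desIso_tr _ x (base_eq S hx) k h.symm v)

theorem metχ_nat (S S' T T' : (cupGerbe p).Sec) (f : S' ⟶ S) (g : T ⟶ T') (w : S'.Z) (z : S.Z)
    (z' : T.Z) (w' : T'.Z) (h : S'.ζ w = S.ζ z) (h' : S.ζ z = T.ζ z') (h'' : T.ζ z' = T'.ζ w')
    (v : (Tw.homBdl (tw S) (tw T)).fib ((cupGerbe p).π (S.ζ z))) :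
    homOf (metχ S' T' w w' (h.trans (h'.trans h'')) ((Tw.homBdl (tw S') (tw T')).tr
        (congrArg (cupGerbe p).π h.symm) (((pullEquiv p).inverse.map ((Tw.pairing p 1).map
          (X := (Opposite.op (tw S), tw T)) (Y := (Opposite.op (tw S'), tw T'))
          (((toTwFunctor p).map f).op, (toTwFunctor p).map g))).toFun _ v)))
      = g.toFun z' w' h'' ∘L homOf (metχ S T z z' h' v) ∘L f.toFun w z h := by
  obtain ⟨x, hx⟩ := exists_x (S.ζ z)
  have hw := h.trans hx
  have hz' := h'.symm.trans hx
  have hw' := h''.symm.trans hz'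
  refine ContinuousLinearMap.ext fun e => ?_
  obtain ⟨e, rfl⟩ := ((repTw S').κ w x hw).surjective e
  refine (metχ_apply S' T' w w' _ x hw hw' (base_eq S' hw) _ e).trans ?_
  refine Eq.trans ?_ (congrArg (fun t => g.toFun z' w' h'' (homOf (metχ S T z z' h' v) t))
    ((repTw S').corr_toTw (repTw S) f w z h x hw hx e)).symm
  refine Eq.trans ?_ (congrArg (g.toFun z' w' h'')
    (metχ_apply S T z z' h' x hx hz' (base_eq S hx) v _)).symm
  refine Eq.trans ?_ ((repTw T).corr_toTw (repTw T') g z' w' h'' x hz' hw' _).symm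
  refine congrArg ((repTw T').κ w' x hw') ?_
  refine (congrArg (fun t => homOf t e) (Tw.desIso_tr _ x (base_eq S' hw) (base_eq S hx)
    (congrArg (cupGerbe p).π h.symm) _)).trans ?_
  exact congrArg (fun t => t e)
    (Tw.ev_map ((toTwFunctor p).map f) ((toTwFunctor p).map g) x (base_eq S hx) v)

end Rep

/-- The bundle metric on the category of sections. -/
def bundleMetric (p : ℕ) [NeZero p] : BundleMetric (cupGerbe p)
    ((secEquiv p).functor.op.prod (secEquiv p).functor ⋙ Tw.pairing p 1 ⋙ (pullEquiv p).inverse) where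
  χ := Rep.metχ
  χ_par := Rep.metχ_par
  χ_descent := Rep.metχ_descent
  χ_nat := Rep.metχ_nat
  hom S T := (Functor.FullyFaithful.ofFullyFaithful (toTwFunctor p)).homEquiv.trans
    (Tw.exists_homEquiv (Rep.tw S) (Rep.tw T)).choose
  hom_χ S T f z z' h := by
    refine ContinuousLinearMap.ext fun e => ?_
    obtain ⟨x, hx⟩ := Rep.exists_x (S.ζ z)
    obtain ⟨e, rfl⟩ := ((Rep.repTw S).κ z x hx).surjective e
    refine (Rep.metχ_apply S T z z' h x hx (h.symm.trans hx) (Rep.base_eq S hx) _ e).trans ?_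
    refine Eq.trans ?_ ((Rep.repTw S).corr_toTw (Rep.repTw T) f z z' h x hx (h.symm.trans hx) e).symm
    exact congrArg (fun t => (Rep.repTw T).κ z' x (h.symm.trans hx) (t e))
      ((Tw.exists_homEquiv (Rep.tw S) (Rep.tw T)).choose_spec ((toTwFunctor p).map f) x _ (Rep.base_eq S hx))

end

/-! ### The opposite twist -/

section
variable {p : ℕ} [NeZero p] {k : ℤ}

/-- The reflection `(y, r) ↦ (y, -r)` of `S³ × ℝ`. -/
def refl (x : S3R) : S3R := .mk (S3R.y x) (-S3R.r x)

theorem refl_smooth : DSmooth refl :=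
  Mfd.Smooth.dSmooth (X := S3R) (Y := S3R) (S3R.y_smooth.prodMk
    ((show ContDiff ℝ ∞ (fun r : ℝ => -r) from contDiff_neg).contMDiff.comp S3R.r_smooth))

theorem refl_refl (x : S3R) : refl (refl x) = x := Prod.ext rfl (neg_neg (S3R.r x))

theorem refl_shift (n : ℤ) (x : S3R) : refl (shift n x) = shift (-n) (refl x) := by
  refine Prod.ext rfl ?_
  change -(S3R.r x + (n : ℝ)) = -S3R.r x + ((-n : ℤ) : ℝ)
  push_cast
  ring

namespace Tw

/-- The pullback along the reflection, which inverts the twist. -/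
def reflect {l : ℤ} (hl : l = -k) : Tw p k ⥤ Tw p l where
  obj A :=
    { E := A.E.pb refl refl_smooth
      φ := fun ζ x x' h => A.φ ζ (refl x) (refl x') (by rw [h]; rfl)
      φ_par := fun ζ => (A.φ_par ζ).pb refl refl_smooth
      φ_mul := fun ζ ζ' x x' x'' h h' h'' e => A.φ_mul ζ ζ' _ _ _ _ _ _ e
      γ := fun n x x' h => A.γ (-n) (refl x) (refl x') (by rw [h, refl_shift])
      γ_par := fun n => by
        have hs : DSmooth (fun x => refl (shift n x)) := dSmooth_comp refl_smooth (shift_smooth n)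
        have e : ∀ x, refl (shift n x) = shift (-n) (refl x) := refl_shift n
        refine (((A.γ_par (-n)).pb refl refl_smooth).comp (A.E.tr_par (fun x => refl (shift n x))
          (fun x => shift (-n) (refl x)) hs (dSmooth_comp (shift_smooth (-n)) refl_smooth) e)).congr ?_
        intro x v
        have : ∀ (a b : S3R) (h : a = b) (h' : b = shift (-n) (refl x)) (v : A.E.fib a),
            A.γ (-n) (refl x) b h' (A.E.tr h v) = A.γ (-n) (refl x) a (h.trans h') v := by
          rintro a _ rfl h' v
          rfl
        exact this _ _ (e x) rfl v
      γ_add := fun n n' x x' x'' h h' h'' e => by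
        have := A.γ_add (-n) (-n') (refl x) (refl x') (refl x'') (by rw [h, refl_shift])
          (by rw [h', refl_shift]) (by rw [h'', refl_shift, neg_add]) e
        have key : ∀ (m m' : ℤ) (hm : m = m') (h : refl x'' = shift m (refl x))
            (h' : refl x'' = shift m' (refl x)), A.γ m (refl x) (refl x'') h e = A.γ m' (refl x) (refl x'') h' e := by
          rintro m _ rfl h h'
          rfl
        exact this.trans (key _ _ (neg_add n n').symm _ _)
      twist := fun ζ n x x₁ x₂ x₃ h₁ h₂ h₃ h₄ e => by
        subst hl
        rw [neg_mul, ← mul_neg]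
        exact A.twist ζ (-n) _ _ _ _ _ _ _ _ e }
  map f := ⟨⟨_, f.toHom.isPar.pb refl refl_smooth⟩, fun ζ x x' h e => f.map_φ ζ _ _ _ e,
    fun n x x' h e => f.map_γ (-n) _ _ _ e⟩
  map_id _ := rfl
  map_comp _ _ := rfl

/-- Reflecting twice is the identity. -/
def reflectIso {l : ℤ} (hl : l = -k) (hl' : k = -l) : 𝟭 (Tw p k) ≅ reflect hl ⋙ reflect hl' :=
  NatIso.ofComponents (fun A => isoMk (B := (reflect hl').obj ((reflect hl).obj A))
    (fun x => A.E.tr (refl_refl x).symm)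
    (A.E.tr_par (fun x => x) (fun x => refl (refl x)) (fun n q hq => hq)
      (dSmooth_comp refl_smooth refl_smooth) fun x => (refl_refl x).symm)
    (fun ζ x x' h e => by
      have key : ∀ (a a' : S3R) (ha : x = a) (ha' : x' = a') (h' : a' = rot ζ a),
          A.E.tr ha (A.φ ζ x x' h e) = A.φ ζ a a' h' (A.E.tr ha' e) := by
        rintro a a' rfl rfl h'
        rfl
      exact key _ _ (refl_refl x).symm (refl_refl x').symm _)
    (fun n x x' h e => by
      have key : ∀ (a a' : S3R) (m : ℤ) (ha : x = a) (ha' : x' = a') (hm : n = m) (h' : a' = shift m a),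
          A.E.tr ha (A.γ n x x' h e) = A.γ m a a' h' (A.E.tr ha' e) := by
        rintro a a' m rfl rfl rfl h'
        rfl
      exact key _ _ _ (refl_refl x).symm (refl_refl x').symm (neg_neg n).symm _))
    (fun {A B} f => Hom.ext (HVB.ParHom.ext (funext fun x => ContinuousLinearMap.ext fun e =>
      (HVB.tr_nat f.toHom (refl_refl x).symm e).symm)))

/-- The reflection of `ℝ` exchanges the two twists. -/
def reflectEquiv {l : ℤ} (hl : l = -k) (hl' : k = -l) : Tw p k ≌ Tw p l :=
  CategoryTheory.Equivalence.mk (reflect hl) (reflect hl') (reflectIso hl hl') (reflectIso hl' hl).symm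

end Tw
end

/-! ### Čech cocycles which come from transition functions -/

section Log

/-- A logarithm of the phase of complex numbers `b` near `a`, divided by `2πi`. -/
def nearLog (a b : ℂ) : ℝ := (Complex.arg a + Complex.arg (b / a)) / (2 * Real.pi)

theorem exp_arg {a : ℂ} (h : a ≠ 0) : Complex.exp (Complex.arg a * Complex.I) = a / ‖a‖ := by
  rw [eq_div_iff (by simpa using h), mul_comm]
  exact Complex.norm_mul_exp_arg_mul_I a

theorem exp_nearLog {a b : ℂ} (ha : a ≠ 0) (hb : b ≠ 0) :
    Complex.exp (2 * Real.pi * Complex.I * nearLog a b) = b / ‖b‖ := by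
  have h1 : (2 * Real.pi * Complex.I * nearLog a b : ℂ)
      = Complex.arg a * Complex.I + Complex.arg (b / a) * Complex.I := by
    have : (Real.pi : ℂ) ≠ 0 := Complex.ofReal_ne_zero.2 Real.pi_ne_zero
    rw [nearLog]
    push_cast
    field_simp
  have ha' : (‖a‖ : ℂ) ≠ 0 := by simpa using ha
  rw [h1, Complex.exp_add, exp_arg ha, exp_arg (div_ne_zero hb ha), norm_div]
  push_cast
  field_simp

theorem continuousAt_nearLog {a b : ℂ} (h : ‖b - a‖ < ‖a‖) : ContinuousAt (nearLog a) b := by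
  have ha0 : a ≠ 0 := norm_pos_iff.1 ((norm_nonneg _).trans_lt h)
  have h1 : b / a ∈ Complex.slitPlane := by
    have h2 : b / a = 1 + (b - a) / a := by field_simp; ring
    rw [h2]
    exact Complex.mem_slitPlane_of_norm_lt_one (by rwa [norm_div, div_lt_one (norm_pos_iff.2 ha0)])
  have h3 : ContinuousAt (fun b => b / a) b := continuousAt_id.div continuousAt_const ha0
  exact (continuousAt_const.add (ContinuousAt.comp (f := fun b => b / a) (Complex.continuousAt_arg h1) h3)).div_const _

theorem exp_eq_one_iff_int {t : ℝ} (h : Complex.exp (2 * Real.pi * Complex.I * t) = 1) : ∃ n : ℤ, t = n := by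
  obtain ⟨n, hn⟩ := Complex.exp_eq_one_iff.1 h
  refine ⟨n, ?_⟩
  have h2 : (2 * Real.pi * Complex.I : ℂ) ≠ 0 := Complex.two_pi_I_ne_zero
  have : (t : ℂ) = n := mul_left_cancel₀ h2 (by rw [hn]; ring)
  exact_mod_cast this

theorem exp_int (n : ℤ) : Complex.exp (2 * Real.pi * Complex.I * (n : ℝ)) = 1 :=
  Complex.exp_eq_one_iff.2 ⟨n, by push_cast; ring⟩

theorem norm_exp_two_pi (t : ℝ) : ‖Complex.exp (2 * Real.pi * Complex.I * t)‖ = 1 := by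
  have : (2 * Real.pi * Complex.I * t : ℂ) = ((2 * Real.pi * t : ℝ) : ℂ) * Complex.I := by push_cast; ring
  rw [this, Complex.norm_exp_ofReal_mul_I]

end Log

section Cech
variable {X : Type} [TopologicalSpace X]

namespace Cover

/-- The common refinement of two covers. -/
def inf (U V : Cover X) : Cover X where
  U x := U.U x ∩ V.U x
  isOpen x := (U.isOpen x).inter (V.isOpen x)
  mem x := ⟨U.mem x, V.mem x⟩

theorem le_inf_left (U V : Cover X) : U ≤ inf U V := fun _ => Set.inter_subset_left
theorem le_inf_right (U V : Cover X) : V ≤ inf U V := fun _ => Set.inter_subset_right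

instance : IsDirectedOrder (Cover X) := ⟨fun U V => ⟨inf U V, le_inf_left U V, le_inf_right U V⟩⟩

instance : DirectedSystem (fun U : Cover X => U.H 2) (fun _ _ h => Cover.refineH h 2) where
  map_self U x := by
    induction x using QuotientAddGroup.induction_on with
    | H n => rfl
  map_map U V W h h' x := by
    induction x using QuotientAddGroup.induction_on with
    | H n => rfl

/-- The class of a 3-cocycle in `H³(X, ℤ)`. -/
def cls (U : Cover X) : (U.δ 3).ker →+ H3 X :=
  (AddCommGroup.DirectLimit.of (fun U : Cover X => U.H 2) (fun _ _ h => Cover.refineH h 2) U).comp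
    (QuotientAddGroup.mk' _)

theorem cls_refine {U V : Cover X} (h : U ≤ V) (n : (U.δ 3).ker) : V.cls (refineKer h 3 n) = U.cls n :=
  AddCommGroup.DirectLimit.of_f (G := fun U : Cover X => U.H 2) (f := fun _ _ h => Cover.refineH h 2) h
    (QuotientAddGroup.mk n)

/-- A cocycle has the class zero if and only if it becomes a coboundary on a refinement. -/
theorem cls_eq_zero_iff {U : Cover X} {n : (U.δ 3).ker} :
    U.cls n = 0 ↔ ∃ (V : Cover X) (h : U ≤ V) (k : V.Cochain 2), V.δ 2 k = refine h 3 n.1 := by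
  have key : ∀ {V : Cover X} (m : (V.δ 3).ker), (QuotientAddGroup.mk m : V.H 2) = 0 ↔ ∃ k, V.δ 2 k = m.1 := by
    intro V m
    rw [QuotientAddGroup.eq_zero_iff]
    rfl
  constructor
  · intro h
    obtain ⟨V, hV, h0⟩ := AddCommGroup.DirectLimit.of.zero_exact (G := fun U : Cover X => U.H 2)
      (f := fun _ _ h => Cover.refineH h 2) U (QuotientAddGroup.mk n) h
    exact ⟨V, hV, (key (refineKer hV 3 n)).1 h0⟩
  · rintro ⟨V, hV, h0⟩
    rw [← cls_refine hV]
    exact (congrArg (AddCommGroup.DirectLimit.of (fun U : Cover X => U.H 2) (fun _ _ h => Cover.refineH h 2) V)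
      ((key (refineKer hV 3 n)).2 h0)).trans (map_zero _)

theorem δ_apply (U : Cover X) (k : ℕ) (c : U.Cochain k) (x : Fin (k + 2) → X) (m : U.inter x) :
    ((U.δ k c x m : ℤ) : ℝ)
      = ∑ i : Fin (k + 2), (-1 : ℝ) ^ (i : ℕ) * (c (x ∘ i.succAbove) ⟨m, U.inter_succAbove x i m.2⟩ : ℤ) := by
  have : U.δ k c x m = ∑ i : Fin (k + 2), (-1 : ℤ) ^ (i : ℕ) * c (x ∘ i.succAbove) ⟨m, U.inter_succAbove x i m.2⟩ := by
    change (∑ i : Fin (k + 2), (-1 : ℤ) ^ (i : ℕ) • resLC (U.inter_succAbove x i) (c (x ∘ i.succAbove))) m = _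
    refine (congrFun (map_sum (LocallyConstant.coeFnAddMonoidHom : LocallyConstant (U.inter x) ℤ →+ _) _ _) m).trans ?_
    rw [Finset.sum_apply]
    rfl
  rw [this]
  push_cast
  rfl

/-- Continuous integral functions form cochains. -/
theorem exists_cochain (U : Cover X) {k : ℕ} (f : (Fin (k + 1) → X) → X → ℝ)
    (hf : ∀ x, ContinuousOn (f x) (U.inter x)) (hi : ∀ x, ∀ m ∈ U.inter x, ∃ n : ℤ, f x m = n) :
    ∃ c : U.Cochain k, ∀ x (m : U.inter x), ((c x m : ℤ) : ℝ) = f x m := by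
  have h : ∀ x (m : U.inter x), ((round (f x m) : ℤ) : ℝ) = f x m := fun x m => by
    obtain ⟨n, hn⟩ := hi x m m.2
    rw [hn, round_intCast]
  refine ⟨fun x => ⟨fun m => round (f x m), (IsLocallyConstant.iff_continuous _).2 ?_⟩, h⟩
  refine Int.isClosedEmbedding_coe_real.isEmbedding.continuous_iff.2 ?_
  exact (continuousOn_iff_continuous_domRestrict.1 (hf x)).congr fun m => (h x m).symm

theorem mem_inter {U : Cover X} {k : ℕ} {x : Fin (k + 1) → X} {m : X} : m ∈ U.inter x ↔ ∀ i, m ∈ U.U (x i) :=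
  Set.mem_iInter

/-- Over a compact Hausdorff space, a family of unit functions `λ_xy` on `U_x ∩ U_y` has logarithms
after passing to a refinement, up to a change of the index. -/
theorem exists_log [CompactSpace X] [T2Space X] (U : Cover X) (l : X → X → X → ℂ)
    (hl : ∀ x y, ContinuousOn (l x y) (U.U x ∩ U.U y)) (hn : ∀ x y, ∀ m ∈ U.U x ∩ U.U y, ‖l x y m‖ = 1) :
    ∃ (V : Cover X) (τ : X → X) (e : X → X → X → ℝ), U ≤ V ∧ (∀ x, V.U x ⊆ U.U (τ x)) ∧
      (∀ x y, ContinuousOn (e x y) (V.U x ∩ V.U y)) ∧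
      ∀ x y, ∀ m ∈ V.U x ∩ V.U y, Complex.exp (2 * Real.pi * Complex.I * e x y m) = l (τ x) (τ y) m := by
  classical
  obtain ⟨t, ht⟩ := isCompact_univ.elim_finite_subcover U.U U.isOpen fun x _ => Set.mem_iUnion.2 ⟨x, U.mem x⟩
  obtain ⟨O, hO, hOo, hOU⟩ := exists_iUnion_eq_closure_subset (u := fun i : t => U.U i) (fun i => U.isOpen i)
    (fun x => Set.toFinite _) (Set.eq_univ_of_univ_subset fun x hx => by
      obtain ⟨i, hi, hxi⟩ := Set.mem_iUnion₂.1 (ht hx)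
      exact Set.mem_iUnion.2 ⟨⟨i, hi⟩, hxi⟩)
  have hx : ∀ x, ∃ i, x ∈ O i := fun x => Set.mem_iUnion.1 (hO ▸ Set.mem_univ x)
  choose τ hτ using hx
  -- The set `B x i` is a neighbourhood of `x` which avoids the closure of `O_i`, or on which
  -- `λ_{τ x, i}` is close to its value at `x`.
  let B : X → t → Set X := fun x i => if x ∈ closure (O i) then
    {m | m ∈ U.U (τ x) ∩ U.U i ∧ ‖l (τ x) i m - l (τ x) i x‖ < 1} else (closure (O i))ᶜ
  have hB : ∀ x i, IsOpen (B x i) := by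
    intro x i
    by_cases h : x ∈ closure (O i)
    · simp only [B, if_pos h]
      exact ((hl (τ x) i).sub continuousOn_const).norm.isOpen_inter_preimage
        ((U.isOpen _).inter (U.isOpen _)) isOpen_Iio
    · simp only [B, if_neg h]
      exact isClosed_closure.isOpen_compl
  have hBx : ∀ x i, x ∈ B x i := by
    intro x i
    by_cases h : x ∈ closure (O i)
    · simp only [B, if_pos h]
      exact ⟨⟨hOU _ (subset_closure (hτ x)), hOU i h⟩, by simp⟩
    · simp only [B, if_neg h]
      exact h
  refine ⟨⟨fun x => U.U x ∩ (O (τ x) ∩ ⋂ i, B x i), fun x => (U.isOpen x).inter ((hOo _).inter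
    (isOpen_iInter_of_finite (hB x))), fun x => ⟨U.mem x, hτ x, Set.mem_iInter.2 (hBx x)⟩⟩, fun x => τ x,
    fun x y m => nearLog (l (τ x) (τ y) x) (l (τ x) (τ y) m), fun x => Set.inter_subset_left,
    fun x m hm => hOU _ (subset_closure hm.2.1), fun x y m hm => ?_, fun x y m hm => ?_⟩
  all_goals
    obtain ⟨⟨-, hmx, hmB⟩, ⟨-, hmy, -⟩⟩ := hm
    have h1 := Set.mem_iInter.1 hmB (τ y)
    have h2 : x ∈ closure (O (τ y)) := by
      by_contra h
      simp only [B, if_neg h] at h1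
      exact h1 (subset_closure hmy)
    simp only [B, if_pos h2] at h1
    have h3 : x ∈ U.U (τ x) ∩ U.U (τ y) := ⟨hOU _ (subset_closure (hτ x)), hOU _ h2⟩
  · have h4 : ContinuousAt (l (τ x) (τ y)) m := (hl _ _).continuousAt (((U.isOpen _).inter (U.isOpen _)).mem_nhds h1.1)
    exact ((continuousAt_nearLog (by rw [hn _ _ x h3]; exact h1.2)).comp h4).continuousWithinAt
  · have h4 : ∀ z ∈ U.U (τ x) ∩ U.U (τ y), l (τ x) (τ y) z ≠ 0 := fun z hz h0 => by
      have := hn _ _ z hz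
      simp [h0] at this
    rw [exp_nearLog (h4 x h3) (h4 m h1.1), hn _ _ m h1.1, Complex.ofReal_one, div_one]

/-- If `exp(2πi f)` is the coboundary of unit functions `λ_xy`, then the integral cocycle `δf` has the
class zero. -/
theorem cls_eq_zero_of_unit [CompactSpace X] [T2Space X] (U : Cover X) (l : X → X → X → ℂ)
    (hl : ∀ x y, ContinuousOn (l x y) (U.U x ∩ U.U y)) (hn : ∀ x y, ∀ m ∈ U.U x ∩ U.U y, ‖l x y m‖ = 1)
    (f : (Fin 3 → X) → X → ℝ) (hf : ∀ x, ContinuousOn (f x) (U.inter x))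
    (hfl : ∀ x, ∀ m ∈ U.inter x, l (x 0) (x 1) m * l (x 1) (x 2) m
      = Complex.exp (2 * Real.pi * Complex.I * f x m) * l (x 0) (x 2) m)
    (n : (U.δ 3).ker) (hnf : ∀ (x : Fin 4 → X) (m : U.inter x),
      (n.1 x m : ℝ) = ∑ i : Fin 4, (-1 : ℝ) ^ (i : ℕ) * f (x ∘ i.succAbove) m) : U.cls n = 0 := by
  obtain ⟨V, τ, e, hUV, hτ, hec, hel⟩ := exists_log U l hl hn
  -- The logarithm of `λ_xy λ_{y, τ y} λ_{x, τ x}⁻¹`, a cohomologous choice which has a logarithm on `V_x ∩ V_y`.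
  let h : X → X → X → ℝ := fun x y m => f ![x, y, τ y] m - f ![x, τ x, τ y] m + e x y m
  have hU : ∀ {x m}, m ∈ V.U x → m ∈ U.U x := fun h => hUV _ h
  have hhc : ∀ x y, ContinuousOn (h x y) (V.U x ∩ V.U y) := fun x y =>
    (((hf _).mono fun m hm => mem_inter.2 fun i => by
      fin_cases i
      exacts [hU hm.1, hU hm.2, hτ _ hm.2]).sub ((hf _).mono fun m hm => mem_inter.2 fun i => by
      fin_cases i
      exacts [hU hm.1, hτ _ hm.1, hτ _ hm.2])).add (hec x y)
  have hh : ∀ x y, ∀ m ∈ V.U x ∩ V.U y, Complex.exp (2 * Real.pi * Complex.I * h x y m)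
      = l x y m * l y (τ y) m * (l x (τ x) m)⁻¹ := by
    intro x y m hm
    have e1 := hfl ![x, y, τ y] m (mem_inter.2 fun i => by
      fin_cases i
      exacts [hU hm.1, hU hm.2, hτ _ hm.2])
    have e2 := hfl ![x, τ x, τ y] m (mem_inter.2 fun i => by
      fin_cases i
      exacts [hU hm.1, hτ _ hm.1, hτ _ hm.2])
    have e3 := hel x y m hm
    have n1 : l x (τ x) m ≠ 0 := fun h0 => by
      have := hn x (τ x) m ⟨hU hm.1, hτ _ hm.1⟩
      simp [h0] at this
    have n2 : l x (τ y) m ≠ 0 := fun h0 => by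
      have := hn x (τ y) m ⟨hU hm.1, hτ _ hm.2⟩
      simp [h0] at this
    simp only [Matrix.cons_val_zero, Matrix.cons_val_one, Matrix.cons_val] at e1 e2
    have e4 : (2 * Real.pi * Complex.I * h x y m : ℂ) = 2 * Real.pi * Complex.I * f ![x, y, τ y] m
        + 2 * Real.pi * Complex.I * e x y m - 2 * Real.pi * Complex.I * f ![x, τ x, τ y] m := by
      simp only [h]
      push_cast
      ring
    rw [e4, Complex.exp_sub, Complex.exp_add, e3]
    rw [div_eq_iff (Complex.exp_ne_zero _), eq_comm, mul_assoc, mul_comm]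
    have e5 : l (τ x) (τ y) m = Complex.exp (2 * Real.pi * Complex.I * f ![x, τ x, τ y] m) * l x (τ y) m
        * (l x (τ x) m)⁻¹ := by
      rw [← e2]; field_simp
    rw [e5, e1]
    field_simp
  let k : (Fin 3 → X) → X → ℝ := fun x m => f x m - (h (x 1) (x 2) m - h (x 0) (x 2) m + h (x 0) (x 1) m)
  obtain ⟨c, hc⟩ := exists_cochain V k (fun x => by
    have m0 : ∀ {i m}, m ∈ V.inter x → m ∈ V.U (x i) := fun h => mem_inter.1 h _
    exact ((hf x).mono (inter_mono hUV x)).sub ((((hhc _ _).mono fun m hm => ⟨m0 hm, m0 hm⟩).sub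
      ((hhc _ _).mono fun m hm => ⟨m0 hm, m0 hm⟩)).add ((hhc _ _).mono fun m hm => ⟨m0 hm, m0 hm⟩)))
    (fun x m hm => by
      have m0 : ∀ {i}, m ∈ V.U (x i) := fun {i} => mem_inter.1 hm i
      refine exp_eq_one_iff_int ?_
      have e4 : (2 * Real.pi * Complex.I * k x m : ℂ) = 2 * Real.pi * Complex.I * f x m
        - (2 * Real.pi * Complex.I * h (x 1) (x 2) m - 2 * Real.pi * Complex.I * h (x 0) (x 2) m
          + 2 * Real.pi * Complex.I * h (x 0) (x 1) m) := by
        simp only [k]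
        push_cast
        ring
      have nz : ∀ i j, l (x i) (x j) m ≠ 0 := fun i j h0 => by
        have := hn (x i) (x j) m ⟨hU m0, hU m0⟩
        simp [h0] at this
      have nt : ∀ i, l (x i) (τ (x i)) m ≠ 0 := fun i h0 => by
        have := hn (x i) (τ (x i)) m ⟨hU m0, hτ _ m0⟩
        simp [h0] at this
      have e5 := hfl x m (inter_mono hUV x hm)
      rw [e4, Complex.exp_sub, Complex.exp_add, Complex.exp_sub, hh _ _ m ⟨m0, m0⟩, hh _ _ m ⟨m0, m0⟩,
        hh _ _ m ⟨m0, m0⟩]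
      have e6 : Complex.exp (2 * Real.pi * Complex.I * f x m) = l (x 0) (x 1) m * l (x 1) (x 2) m * (l (x 0) (x 2) m)⁻¹ := by
        rw [eq_mul_inv_iff_mul_eq₀ (nz 0 2), e5]
      rw [e6]
      have := nz 0 1; have := nz 1 2; have := nz 0 2
      have := nt 0; have := nt 1; have := nt 2
      field_simp)
  refine cls_eq_zero_iff.2 ⟨V, hUV, c, ?_⟩
  funext x
  ext m
  have h1 := δ_apply V 2 c x m
  have h2 := hnf x ⟨m, inter_mono hUV x m.2⟩
  suffices ((V.δ 2 c x m : ℤ) : ℝ) = (n.1 x ⟨m, inter_mono hUV x m.2⟩ : ℤ) from Int.cast_injective this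
  rw [h1, h2]
  simp only [hc, k]
  simp [Fin.sum_univ_four, Fin.succAbove]
  ring

end Cover
end Cech

/-! ### Transition functions of the bundle gerbe over `S³ × S¹` -/

section Twisted
variable (p : ℕ) [NeZero p]

/-- The covering `S³ × S¹ → L_p × S¹`. -/
def toM (t : Sph3 × Circle) : Mp p := (toLens p t.1, t.2)

theorem continuous_toM : Continuous (toM p) :=
  ((toLens_smooth p).continuous.comp continuous_fst).prodMk continuous_snd

theorem isOpenMap_toM : IsOpenMap (toM p) :=
  IsOpenMap.prodMap (isOpenMap_quotient_mk'_mul (Γ := Zp p) (T := Sph3)) IsOpenMap.id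

theorem toM_surj : Function.Surjective (toM p) := fun m => by
  obtain ⟨y, hy⟩ := Quotient.mk_surjective (Mp.x m)
  exact ⟨(y, Mp.z m), Prod.ext hy rfl⟩

instance : CompactSpace (Mp p).carrier :=
  isCompact_univ_iff.1 (by
    rw [← (toM_surj p).range_eq]
    exact isCompact_range (continuous_toM p))

variable {p}

theorem toM_smul (ζ : Zp p) (t : Sph3 × Circle) : toM p (ζ • t.1, t.2) = toM p t :=
  Prod.ext (Quotient.sound ⟨ζ, rfl⟩) rfl

theorem toM_eq {t t' : Sph3 × Circle} (h : toM p t = toM p t') : ∃ ζ : Zp p, t' = (ζ • t.1, t.2) := by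
  obtain ⟨ζ, hζ⟩ := Quotient.exact (congrArg Prod.fst h).symm
  exact ⟨ζ, Prod.ext hζ.symm (congrArg Prod.snd h).symm⟩

theorem continuousOn_of_comp_toM {F : Type} [TopologicalSpace F] {φ : Mp p → F} {S : Set (Mp p).carrier}
    (hS : IsOpen S) (h : ContinuousOn (fun t => φ (toM p t)) (toM p ⁻¹' S)) : ContinuousOn φ S :=
  (((isOpenMap_toM p).isQuotientMap (continuous_toM p) (toM_surj p)).continuousOn_isOpen_iff (g := φ) hS).2 h

/-- Unit functions on `S³ × S¹` which are invariant under `ℤ_p` come from `M_p`, and a logarithm `f` of their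
coboundary defines the class zero. -/
theorem cls_eq_zero_of_invariant (U : Cover (Mp p).carrier) (l : Mp p → Mp p → Sph3 × Circle → ℂ)
    (hl : ∀ x y, ContinuousOn (l x y) (toM p ⁻¹' (U.U x ∩ U.U y)))
    (hn : ∀ x y t, toM p t ∈ U.U x ∩ U.U y → ‖l x y t‖ = 1)
    (hi : ∀ x y t (ζ : Zp p), toM p t ∈ U.U x ∩ U.U y → l x y (ζ • t.1, t.2) = l x y t)
    (f : (Fin 3 → Mp p) → Mp p → ℝ) (hf : ∀ x, ContinuousOn (f x) (U.inter x))
    (hfl : ∀ x t, toM p t ∈ U.inter x → l (x 0) (x 1) t * l (x 1) (x 2) t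
      = Complex.exp (2 * Real.pi * Complex.I * f x (toM p t)) * l (x 0) (x 2) t)
    (n : (U.δ 3).ker) (hnf : ∀ (x : Fin 4 → Mp p) (m : U.inter x),
      (n.1 x m : ℝ) = ∑ i : Fin 4, (-1 : ℝ) ^ (i : ℕ) * f (x ∘ i.succAbove) m) : U.cls n = 0 := by
  let s : Mp p → Sph3 × Circle := Function.surjInv (toM_surj p)
  have hs : ∀ m, toM p (s m) = m := Function.surjInv_eq (toM_surj p)
  have hls : ∀ x y t, toM p t ∈ U.U x ∩ U.U y → l x y (s (toM p t)) = l x y t := by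
    intro x y t ht
    obtain ⟨ζ, hζ⟩ := toM_eq (hs (toM p t)).symm
    rw [hζ]
    exact hi x y t ζ ht
  refine Cover.cls_eq_zero_of_unit U (fun x y m => l x y (s m)) (fun x y => ?_) (fun x y m hm => ?_) f hf
    (fun x m hm => ?_) n hnf
  · refine continuousOn_of_comp_toM ((U.isOpen x).inter (U.isOpen y)) ?_
    exact (hl x y).congr fun t ht => hls x y t ht
  · exact hn x y _ (by rwa [hs])
  · have := hfl x (s m) (by rwa [hs])
    rwa [hs] at this

/-- The transition functions of the bundle gerbe for local lifts `r_x` of `M_p → S¹` to `ℝ` over the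
sets of a cover, evaluated on `S³ × S¹`: unit functions `g_xy` of weight `r_y - r_x` with respect to
the action of `ℤ_p`, whose coboundary is `exp(2πi f)`. -/
structure IsTwCocycle (U : Cover (Mp p).carrier) (r : Mp p → Mp p → ℝ)
    (g : Mp p → Mp p → Sph3 × Circle → ℂ) (f : (Fin 3 → Mp p) → Mp p → ℝ) : Prop where
  r_cont : ∀ x, ContinuousOn (r x) (U.U x)
  r_exp : ∀ x, ∀ m ∈ U.U x, Circle.exp (2 * Real.pi * r x m) = Mp.z m
  g_cont : ∀ x y, ContinuousOn (g x y) (toM p ⁻¹' (U.U x ∩ U.U y))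
  g_norm : ∀ x y t, toM p t ∈ U.U x ∩ U.U y → ‖g x y t‖ = 1
  g_rot : ∀ x y t (ζ : Zp p) (k : ℤ), toM p t ∈ U.U x ∩ U.U y → r y (toM p t) = r x (toM p t) + k →
    g x y (ζ • t.1, t.2) = ((ζ : ℂˣ) : ℂ) ^ (-k) * g x y t
  f_cont : ∀ x, ContinuousOn (f x) (U.inter x)
  mul : ∀ x t, toM p t ∈ U.inter x → g (x 0) (x 1) t * g (x 1) (x 2) t
    = Complex.exp (2 * Real.pi * Complex.I * f x (toM p t)) * g (x 0) (x 2) t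

/-- The integral cocycle `n` is the coboundary of the real cochain `f`. -/
def IsCobdry {U : Cover (Mp p).carrier} (f : (Fin 3 → Mp p) → Mp p → ℝ) (n : (U.δ 3).ker) : Prop :=
  ∀ (x : Fin 4 → Mp p) (m : U.inter x), (n.1 x m : ℝ) = ∑ i : Fin 4, (-1 : ℝ) ^ (i : ℕ) * f (x ∘ i.succAbove) m

namespace IsTwCocycle
variable {U V : Cover (Mp p).carrier} {r r' : Mp p → Mp p → ℝ} {g g' : Mp p → Mp p → Sph3 × Circle → ℂ}
  {f f' : (Fin 3 → Mp p) → Mp p → ℝ}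

theorem refine (h : IsTwCocycle U r g f) (hUV : U ≤ V) : IsTwCocycle V r g f where
  r_cont x := (h.r_cont x).mono (hUV x)
  r_exp x m hm := h.r_exp x m (hUV x hm)
  g_cont x y := (h.g_cont x y).mono fun t ht => ⟨hUV x ht.1, hUV y ht.2⟩
  g_norm x y t ht := h.g_norm x y t ⟨hUV x ht.1, hUV y ht.2⟩
  g_rot x y t ζ k ht := h.g_rot x y t ζ k ⟨hUV x ht.1, hUV y ht.2⟩
  f_cont x := (h.f_cont x).mono (Cover.inter_mono hUV x)
  mul x t ht := h.mul x t (Cover.inter_mono hUV x ht)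

theorem ne_zero (h : IsTwCocycle U r g f) {x y : Mp p} {t : Sph3 × Circle} (ht : toM p t ∈ U.U x ∩ U.U y) :
    g x y t ≠ 0 := fun h0 => by
  have := h.g_norm x y t ht
  simp [h0] at this

theorem exists_int (h : IsTwCocycle U r g f) (h' : IsTwCocycle U r' g' f') {x y m : Mp p} (hx : m ∈ U.U x)
    (hy : m ∈ U.U y) : ∃ k : ℤ, r' y m = r x m + k :=
  exp_eq ((h.r_exp x m hx).trans (h'.r_exp y m hy).symm)

/-- The `p`-th powers of the transition functions are invariant under `ℤ_p`. -/
theorem smul_cls (h : IsTwCocycle U r g f) {n : (U.δ 3).ker} (hn : IsCobdry f n) : p • U.cls n = 0 := by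
  rw [← map_nsmul]
  refine cls_eq_zero_of_invariant U (fun x y t => g x y t ^ p) (fun x y => (h.g_cont x y).pow p)
    (fun x y t ht => by rw [norm_pow, h.g_norm x y t ht, one_pow]) (fun x y t ζ ht => ?_)
    (fun x m => p * f x m) (fun x => continuousOn_const.mul (h.f_cont x)) (fun x t ht => ?_) _ fun x m => ?_
  · obtain ⟨k, hk⟩ := h.exists_int h ht.1 ht.2
    have hζ : ((ζ : ℂˣ) : ℂ) ^ p = 1 := (mem_rootsOfUnity' p (ζ : ℂˣ)).1 ζ.2
    rw [h.g_rot x y t ζ k ht hk, mul_pow, ← zpow_natCast, ← zpow_mul, mul_comm (-k), zpow_mul, zpow_natCast, hζ,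
      one_zpow, one_mul]
  · have := congrArg (· ^ p) (h.mul x t ht)
    simp only [mul_pow, ← Complex.exp_nat_mul] at this
    rw [this]
    congr 2
    push_cast
    ring
  · have e : ((p • n).1 x m : ℤ) = p * n.1 x m := by
      refine (congrFun (map_nsmul (LocallyConstant.coeFnAddMonoidHom : LocallyConstant (U.inter x) ℤ →+ _)
        p (n.1 x)) m).trans ?_
      simp
    rw [e]
    push_cast
    rw [hn x m, Finset.mul_sum]
    exact Finset.sum_congr rfl fun i _ => by ring

/-- The class does not depend on the choices: two systems of transition functions differ by unit
functions after multiplication with powers of local sections of the Hopf fibration, of the degrees by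
which the lifts `r_x` and `r'_x` differ. -/
theorem cls_unique (h : IsTwCocycle U r g f) (h' : IsTwCocycle U r' g' f') {n n' : (U.δ 3).ker}
    (hn : IsCobdry f n) (hn' : IsCobdry f' n') : U.cls n = U.cls n' := by
  choose b hb using fun x : Mp p => toM_surj p x
  -- The function `u_x` has weight one and is defined where `⟨b_x, y⟩ ≠ 0`.
  let i : Mp p → Sph3 × Circle → ℂ := fun x t => inner ℂ ((b x).1 : C2) (t.1 : C2)
  have hic : ∀ x, Continuous (i x) := fun x =>
    continuous_const.inner (continuous_subtype_val.comp continuous_fst)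
  have hir : ∀ x t (ζ : Zp p), i x (ζ • t.1, t.2) = ((ζ : ℂˣ) : ℂ) * i x t := fun x t ζ => by
    simp only [i]
    rw [coe_smul_zp, inner_smul_right]
  let W : Cover (Mp p).carrier := ⟨fun x => U.U x ∩ toM p '' {t | i x t ≠ 0},
    fun x => (U.isOpen x).inter (isOpenMap_toM p _ (isOpen_ne_fun (hic x) continuous_const)),
    fun x => ⟨U.mem x, b x, by
      simp only [i, Set.mem_ofPred_eq]
      rw [inner_self_eq_norm_sq_to_K, norm_eq_of_mem_sphere]
      simp, hb x⟩⟩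
  have hUW : U ≤ W := fun x => Set.inter_subset_left
  have hi0 : ∀ x t, toM p t ∈ W.U x → i x t ≠ 0 := by
    rintro x t ⟨-, t', ht', htt⟩
    obtain ⟨ζ, rfl⟩ := toM_eq htt
    rw [hir]
    exact mul_ne_zero (Units.ne_zero _) ht'
  suffices W.cls (Cover.refineKer hUW 3 n - Cover.refineKer hUW 3 n') = 0 by
    rw [map_sub, Cover.cls_refine, Cover.cls_refine, sub_eq_zero] at this
    exact this
  replace h := h.refine hUW
  replace h' := h'.refine hUW
  let u : Mp p → Sph3 × Circle → ℂ := fun x t => i x t / ‖i x t‖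
  have hu0 : ∀ x t, toM p t ∈ W.U x → u x t ≠ 0 := fun x t ht =>
    div_ne_zero (hi0 x t ht) (by simpa using hi0 x t ht)
  have hun : ∀ x t, toM p t ∈ W.U x → ‖u x t‖ = 1 := fun x t ht => by
    have := norm_ne_zero_iff.2 (hi0 x t ht)
    simp only [u, norm_div, Complex.norm_real, norm_norm]
    field_simp
  have huc : ∀ x, ContinuousOn (u x) (toM p ⁻¹' W.U x) := fun x =>
    (hic x).continuousOn.div (Complex.continuous_ofReal.comp (hic x).norm).continuousOn fun t ht => by
      simpa using hi0 x t ht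
  have hur : ∀ x t (ζ : Zp p), u x (ζ • t.1, t.2) = ((ζ : ℂˣ) : ℂ) * u x t := fun x t ζ => by
    have hζ : ‖((ζ : ℂˣ) : ℂ)‖ = 1 :=
      Complex.norm_eq_one_of_pow_eq_one ((mem_rootsOfUnity' p (ζ : ℂˣ)).1 ζ.2) (NeZero.ne p)
    simp only [u]
    rw [hir, norm_mul, hζ, one_mul, mul_div_assoc]
  let k : Mp p → Mp p → ℤ := fun x m => round (r' x m - r x m)
  have hk : ∀ x, ∀ m ∈ W.U x, r' x m = r x m + k x m := fun x m hm => by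
    obtain ⟨k', hk'⟩ := h.exists_int h' hm hm
    simp only [k]
    rw [hk', add_sub_cancel_left, round_intCast]
  have hkc : ∀ x, ∀ m ∈ W.U x, ∀ᶠ m' in 𝓝 m, k x m' = k x m := by
    intro x m hm
    have e : ContinuousOn (fun m => ((k x m : ℤ) : ℝ)) (W.U x) :=
      ((h'.r_cont x).sub (h.r_cont x)).congr fun m hm => by
        rw [Pi.sub_apply, hk x m hm]
        ring
    have e' : ContinuousAt (fun m => k x m) m := (Int.isClosedEmbedding_coe_real.isEmbedding.continuousAt_iff).2
      (e.continuousAt ((W.isOpen x).mem_nhds hm))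
    exact e'.eventually (IsOpen.mem_nhds (isOpen_discrete {k x m}) rfl)
  have hukc : ∀ x, ContinuousOn (fun t => u x t ^ k x (toM p t)) (toM p ⁻¹' W.U x) := by
    intro x t ht
    have e1 := (huc x t ht).zpow₀ (k x (toM p t)) (Or.inl (hu0 x t ht))
    have e2 := (continuous_toM p).continuousAt.eventually (hkc x _ ht)
    refine e1.congr_of_eventuallyEq (Filter.Eventually.filter_mono nhdsWithin_le_nhds ?_) rfl
    filter_upwards [e2] with t' ht'
    rw [ht']
  refine cls_eq_zero_of_invariant W
    (fun x y t => g x y t * (g' x y t)⁻¹ * ((u x t ^ k x (toM p t)) * (u y t ^ k y (toM p t))⁻¹))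
    (fun x y => ?_) (fun x y t ht => ?_) (fun x y t ζ ht => ?_) (fun x m => f x m - f' x m)
    (fun x => (h.f_cont x).sub (h'.f_cont x)) (fun x t ht => ?_) _ fun x m => ?_
  · exact ((h.g_cont x y).mul ((h'.g_cont x y).inv₀ fun t ht => h'.ne_zero ht)).mul
      (((hukc x).mono fun t ht => ht.1).mul (((hukc y).mono fun t ht => ht.2).inv₀
        fun t ht => zpow_ne_zero _ (hu0 y t ht.2)))
  · simp [h.g_norm x y t ht, h'.g_norm x y t ht, hun x t ht.1, hun y t ht.2]
  · obtain ⟨j, hj⟩ := h.exists_int h ht.1 ht.2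
    have hj' : r' y (toM p t) = r' x (toM p t) + ((j + k y (toM p t) - k x (toM p t) : ℤ) : ℝ) := by
      rw [hk y _ ht.2, hk x _ ht.1, hj]
      push_cast
      ring
    rw [h.g_rot x y t ζ j ht hj, h'.g_rot x y t ζ _ ht hj', hur, hur, toM_smul]
    have z0 : ((ζ : ℂˣ) : ℂ) ≠ 0 := Units.ne_zero _
    generalize ((ζ : ℂˣ) : ℂ) = z at *
    have := h'.ne_zero ht
    have := zpow_ne_zero (k x (toM p t)) (hu0 x t ht.1)
    have := zpow_ne_zero (k y (toM p t)) (hu0 y t ht.2)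
    rw [mul_zpow, mul_zpow, show -(j + k y (toM p t) - k x (toM p t)) = -j - k y (toM p t) + k x (toM p t) by ring,
      zpow_add₀ z0, zpow_sub₀ z0]
    have := zpow_ne_zero (k x (toM p t)) z0
    have := zpow_ne_zero (k y (toM p t)) z0
    have := zpow_ne_zero (-j) z0
    field_simp
  · have m0 : ∀ i, toM p t ∈ W.U (x i) := Cover.mem_inter.1 ht
    have e := h.mul x t ht
    have e' := h'.mul x t ht
    have q : (2 * Real.pi * Complex.I * ((f x (toM p t) - f' x (toM p t) : ℝ) : ℂ))
      = 2 * Real.pi * Complex.I * f x (toM p t) - 2 * Real.pi * Complex.I * f' x (toM p t) := by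
      push_cast
      ring
    rw [q, Complex.exp_sub]
    have a1 := h'.ne_zero (x := x 0) (y := x 1) ⟨m0 0, m0 1⟩
    have a2 := h'.ne_zero (x := x 1) (y := x 2) ⟨m0 1, m0 2⟩
    have a3 := h'.ne_zero (x := x 0) (y := x 2) ⟨m0 0, m0 2⟩
    have b0 := zpow_ne_zero (k (x 0) (toM p t)) (hu0 _ t (m0 0))
    have b1 := zpow_ne_zero (k (x 1) (toM p t)) (hu0 _ t (m0 1))
    have b2 := zpow_ne_zero (k (x 2) (toM p t)) (hu0 _ t (m0 2))
    have E0 := Complex.exp_ne_zero (2 * Real.pi * Complex.I * f' x (toM p t))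
    generalize Complex.exp (2 * Real.pi * Complex.I * f x (toM p t)) = E at *
    generalize Complex.exp (2 * Real.pi * Complex.I * f' x (toM p t)) = E' at *
    generalize u (x 0) t ^ k (x 0) (toM p t) = u0 at *
    generalize u (x 1) t ^ k (x 1) (toM p t) = u1 at *
    generalize u (x 2) t ^ k (x 2) (toM p t) = u2 at *
    field_simp
    linear_combination (g' (x 0) (x 2) t * E') * e - (E * g (x 0) (x 2) t) * e'
  · have e1 := hn x ⟨m, Cover.inter_mono hUW x m.2⟩
    have e2 := hn' x ⟨m, Cover.inter_mono hUW x m.2⟩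
    have e3 : (Cover.refineKer hUW 3 n - Cover.refineKer hUW 3 n').1 x m
        = n.1 x ⟨m, Cover.inter_mono hUW x m.2⟩ - n'.1 x ⟨m, Cover.inter_mono hUW x m.2⟩ := rfl
    rw [e3]
    push_cast
    rw [e1, e2, ← Finset.sum_sub_distrib]
    exact Finset.sum_congr rfl fun i _ => by ring

end IsTwCocycle
end Twisted

/-! ### The transition functions of a Dixmier–Douady datum -/

/-- A function on an open subset of a manifold is continuous if it is so along all plots. -/
theorem Mfd.continuousOn_of_plots {X : Mfd} {S : Set X.carrier} (hS : IsOpen S) {F : Type} [TopologicalSpace F]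
    {φ : X → F} (h : ∀ (n : ℕ) (q : Plot X n), (∀ u, q u ∈ S) → Continuous (fun u => φ (q u))) :
    ContinuousOn φ S := by
  intro x hx
  let L := toEuclidean (E := X.V)
  let e := extChartAt X.I x
  have h1 : L.symm ⁻¹' (e.target ∩ e.symm ⁻¹' S) ∈ 𝓝 (L (e x)) := by
    refine L.symm.continuous.continuousAt.preimage_mem_nhds ?_
    rw [L.symm_apply_apply]
    refine Filter.inter_mem (extChartAt_target_mem_nhds x) ?_
    refine (continuousAt_extChartAt_symm x).preimage_mem_nhds ?_
    rw [extChartAt_to_inv]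
    exact hS.mem_nhds hx
  obtain ⟨c, hc, hcs, hcu⟩ := exists_retract _ h1
  let q : Plot X (Module.finrank ℝ X.V) := ⟨fun u => e.symm (L.symm (c u)), Mfd.isPlot_iff.2
    ((contMDiffOn_extChartAt_symm x).comp_contMDiff (L.symm.contDiff.comp hc).contMDiff fun u => (hcs u).1)⟩
  have h2 := h _ q fun u => (hcs u).2
  have h3 : ContinuousAt (fun x' => L (e x')) x := L.continuous.continuousAt.comp (continuousAt_extChartAt x)
  refine ContinuousAt.continuousWithinAt (ContinuousAt.congr (f := fun x' => φ (q (L (e x'))))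
    (ContinuousAt.comp (f := fun x' => L (e x')) h2.continuousAt h3) ?_)
  filter_upwards [h3.eventually hcu, extChartAt_source_mem_nhds (I := X.I) x] with x' h4 h5
  change φ (e.symm (L.symm (c (L (e x'))))) = φ x'
  rw [h4, L.symm_apply_apply, e.left_inv h5]

section Datum
variable {p : ℕ} [NeZero p]

theorem toM_dSmooth : DSmooth (X := (S3.prod S1).carrier) (Y := (Mp p).carrier) (toM p) :=
  Mfd.Smooth.dSmooth (X := S3.prod S1) (Y := Mp p)
    (((toLens_smooth p).comp (contMDiff_fst (I := S3.I) (J := S1.I) (M := S3.carrier) (N := S1.carrier))).prodMk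
      (contMDiff_snd (I := S3.I) (J := S1.I) (M := S3.carrier) (N := S1.carrier)))

/-- The sections of the line bundle of the gerbe which define the class are evaluated at the points of the Hopf
fibre, which makes them functions on `S³ × S¹`. -/
theorem IsTwCocycle.exists_of_isDDClass {c : H3 (Mp p).carrier} (h : (cupGerbe p).IsDDClass c) :
    ∃ (U : Cover (Mp p).carrier) (r : Mp p → Mp p → ℝ) (g : Mp p → Mp p → Sph3 × Circle → ℂ)
      (f : (Fin 3 → Mp p) → Mp p → ℝ) (n : (U.δ 3).ker), IsTwCocycle U r g f ∧ IsCobdry f n ∧ U.cls n = c := by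
  classical
  obtain ⟨U, s, hs, hsm, σ, f, n, hσ, hσn, hf, hμ, hn, hc⟩ := h
  let r : Mp p → Mp p → ℝ := fun x m => if h : m ∈ U.U x then Yp.r (s x ⟨m, h⟩) else 0
  let g : Mp p → Mp p → Sph3 × Circle → ℂ := fun x y t =>
    if h : toM p t ∈ U.U x ∩ U.U y then KF.ev t.1 (σ x y (toM p t) h.1 h.2) else 0
  have hr : ∀ x m (h : m ∈ U.U x), r x m = Yp.r (s x ⟨m, h⟩) := fun x m h => dif_pos h
  have hg : ∀ x y t (h : toM p t ∈ U.U x ∩ U.U y), g x y t = KF.ev t.1 (σ x y (toM p t) h.1 h.2) :=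
    fun x y t h => dif_pos h
  have hX : ∀ x (m : U.U x), Yp.x (s x m) = Mp.x (m : Mp p) := fun x m => congrArg Mp.x (hs x m)
  have hhopf : ∀ x t (h : toM p t ∈ U.U x), hopf t.1 = lensToS2 p (Yp.x (s x ⟨toM p t, h⟩)) := fun x t h => by
    rw [hX]
    rfl
  refine ⟨U, r, g, f, n, ⟨fun x => ?_, fun x m hm => ?_, fun x y => ?_, fun x y t ht => ?_,
    fun x y t ζ k ht hk => ?_, hf, fun x t ht => ?_⟩, hn, hc⟩
  · refine Mfd.continuousOn_of_plots (U.isOpen x) fun k q hq => ?_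
    have h1 : IsPlot (fun u => s x ⟨q u, hq u⟩) := hsm x k (fun u => ⟨q u, hq u⟩) q.2
    have h2 : ContDiff ℝ ∞ (fun u => Yp.r (s x ⟨q u, hq u⟩)) :=
      SmoothFun.of_contMDiff (X := Yp p) (Yp.r_smooth p) ⟨_, h1⟩
    exact h2.continuous.congr fun u => (hr x (q u) (hq u)).symm
  · rw [hr x m hm]
    exact congrArg Mp.z (hs x ⟨m, hm⟩)
  · refine Mfd.continuousOn_of_plots (X := S3.prod S1) (((U.isOpen x).inter (U.isOpen y)).preimage (continuous_toM p))
      fun k q hq => ?_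
    let z : Euc k → Sph3 := fun u => (q u).1
    have hqc : Continuous (fun u => (z u : C2)) :=
      continuous_subtype_val.comp (continuous_fst.comp (Mfd.isPlot_iff.1 q.2).continuous)
    let P : Plot (U.U x ∩ U.U y : Set (Mp p).carrier) k := ⟨fun u => ⟨toM p (q u), hq u⟩, toM_dSmooth _ _ q.2⟩
    let Q : Plot S2Z k := Plot.map ⟨fun u => FibProd.mk (s x ⟨toM p (q u), (hq u).1⟩) (s y ⟨toM p (q u), (hq u).2⟩)
        ((hs x ⟨toM p (q u), (hq u).1⟩).trans (hs y ⟨toM p (q u), (hq u).2⟩).symm), FibProd.isPlot_iff.2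
          ⟨hsm x k (fun u => ⟨toM p (q u), (hq u).1⟩) (toM_dSmooth _ _ q.2),
            hsm y k (fun u => ⟨toM p (q u), (hq u).2⟩) (toM_dSmooth _ _ q.2)⟩⟩ (toS2Z (p := p)) toS2Z_smooth
    have hQ : ∀ u, hopf (q u).1 = (Q u).s := fun u => hhopf x (q u) (hq u).1
    rw [continuous_iff_continuousAt]
    intro u
    obtain ⟨τ, hτ⟩ := exists_locSec (Q u).s
    have h1 : ContDiffOn ℝ ∞ (fun w => KF.ev (τ.σ (Q w).s) (σ x y (toM p (q w)) (hq w).1 (hq w).2))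
        {w | (Q w).s ∈ τ.U} := hσ x y P τ
    have hn : {w | (Q w).s ∈ τ.U} ∈ 𝓝 u := (τ.isOpen_dom Q).mem_nhds hτ
    have h2 : ContinuousAt (fun w => inner ℂ (τ.σ (Q w).s : C2) (z w : C2)) u :=
      (τ.contDiffAt Q hτ).continuousAt.inner hqc.continuousAt
    have h3 : ContinuousAt (fun w => inner ℂ (τ.σ (Q w).s : C2) (z w : C2) ^ (-(Q u).n)
        * KF.ev (τ.σ (Q w).s) (σ x y (toM p (q w)) (hq w).1 (hq w).2)) u := by
      refine (h2.zpow₀ _ (Or.inl fun h0 => ?_)).mul (h1.continuousOn.continuousAt hn)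
      exact one_ne_zero ((KF.inner_norm ((τ.hopf_σ _ hτ).trans (hQ u).symm)).symm.trans (norm_eq_zero.2 h0))
    refine h3.congr ?_
    filter_upwards [hn] with w hw
    rw [hg x y (q w) (hq w), show (Q u).n = (Q w).n from plot_Z Q u w]
    exact (KF.apply_eq (n := (Q w).n) (s := (Q w).s) (σ x y (toM p (q w)) (hq w).1 (hq w).2)
      ((τ.hopf_σ _ hw).trans (hQ w).symm)).symm
  · rw [hg x y t ht, ← hσn x y (toM p t) ht.1 ht.2]
    exact (KF.norm_eq _ (hhopf x t ht.1)).symm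
  · have ht' : toM p (ζ • t.1, t.2) ∈ U.U x ∩ U.U y := by rwa [toM_smul]
    have e : ∀ m (hm : m = toM p t) h1 h2, KF.ev (ζ • t.1) (σ x y m h1 h2)
        = KF.ev (ζ • t.1) (σ x y (toM p t) ht.1 ht.2) := by
      rintro m rfl _ _
      rfl
    rw [hg x y t ht, hg x y _ ht', e _ (toM_smul ζ t)]
    have hN : round (Yp.r (s y ⟨toM p t, ht.2⟩) - Yp.r (s x ⟨toM p t, ht.1⟩)) = k := by
      rw [← hr y _ ht.2, ← hr x _ ht.1, hk, add_sub_cancel_left, round_intCast]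
    have h1 := (show KF _ _ from σ x y (toM p t) ht.1 ht.2).2.1 (rootsOfUnitytoCircle p ζ) t.1
    rw [← hN]
    exact h1
  · have m0 : ∀ i, toM p t ∈ U.U (x i) := Cover.mem_inter.1 ht
    rw [hg _ _ t ⟨m0 0, m0 1⟩, hg _ _ t ⟨m0 1, m0 2⟩, hg _ _ t ⟨m0 0, m0 2⟩]
    have h1 := (hs (x 0) ⟨toM p t, m0 0⟩).trans (hs (x 1) ⟨toM p t, m0 1⟩).symm
    have h2 := (hs (x 1) ⟨toM p t, m0 1⟩).trans (hs (x 2) ⟨toM p t, m0 2⟩).symm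
    have h3 := congrArg (KF.ev t.1) (hμ x (toM p t) (m0 0) (m0 1) (m0 2))
    exact ((KF.mul_apply rfl (toS2Z_s p h1 h2) (toS2Z_n p h1 h2) (σ (x 0) (x 1) (toM p t) (m0 0) (m0 1))
      (σ (x 1) (x 2) (toM p t) (m0 1) (m0 2)) t.1).symm.trans h3).trans ((KF.ev t.1).map_smul _ _)

end Datum

/-! ### Existence of the Dixmier–Douady class -/

section Phase

/-- The phase of `⟨b, y⟩`. -/
def phase (b y : Sph3) : ℂ := inner ℂ (b : C2) (y : C2) / ‖(inner ℂ (b : C2) (y : C2) : ℂ)‖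

theorem norm_phase {b y : Sph3} (h : (inner ℂ (b : C2) (y : C2) : ℂ) ≠ 0) : ‖phase b y‖ = 1 := by
  have := norm_ne_zero_iff.2 h
  rw [phase, norm_div, Complex.norm_real, norm_norm, div_self this]

theorem inner_hopf (b : Sph3) {y y' : Sph3} (h : hopf y = hopf y') : (inner ℂ (b : C2) (y' : C2) : ℂ)
    = inner ℂ (y : C2) (y' : C2) * inner ℂ (b : C2) (y : C2) := by
  conv_lhs => rw [hopf_eq h]
  rw [inner_smul_right]

theorem norm_inner_hopf (b : Sph3) {y y' : Sph3} (h : hopf y = hopf y') :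
    ‖(inner ℂ (b : C2) (y' : C2) : ℂ)‖ = ‖(inner ℂ (b : C2) (y : C2) : ℂ)‖ := by
  rw [inner_hopf b h, norm_mul, KF.inner_norm h, one_mul]

theorem phase_hopf (b : Sph3) {y y' : Sph3} (h : hopf y = hopf y') :
    phase b y' = inner ℂ (y : C2) (y' : C2) * phase b y := by
  rw [phase, phase, norm_inner_hopf b h, inner_hopf b h, mul_div_assoc]

theorem inner_mul_inner_hopf (b c : Sph3) {y y' : Sph3} (h : hopf y = hopf y') :
    (inner ℂ (b : C2) (y' : C2) * inner ℂ (y' : C2) (c : C2) : ℂ)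
      = inner ℂ (b : C2) (y : C2) * inner ℂ (y : C2) (c : C2) := by
  rw [← inner_conj_symm (y' : C2), ← inner_conj_symm (y : C2) (c : C2), inner_hopf b h, inner_hopf c h, map_mul]
  have h3 := Complex.conj_mul' (inner ℂ (y : C2) (y' : C2) : ℂ)
  rw [KF.inner_norm h] at h3
  push_cast at h3
  linear_combination (inner ℂ (b : C2) (y : C2) * starRingEnd ℂ (inner ℂ (c : C2) (y : C2))) * h3

theorem phase_mul_inv {b c y : Sph3} (hb : (inner ℂ (b : C2) (y : C2) : ℂ) ≠ 0)
    (hc : (inner ℂ (c : C2) (y : C2) : ℂ) ≠ 0) : phase b y * (phase c y)⁻¹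
      = inner ℂ (b : C2) (y : C2) * inner ℂ (y : C2) (c : C2)
        / ‖(inner ℂ (b : C2) (y : C2) * inner ℂ (y : C2) (c : C2) : ℂ)‖ := by
  rw [norm_mul, ← inner_conj_symm (y : C2) (c : C2), RCLike.norm_conj, phase, phase]
  have h3 := Complex.conj_mul' (inner ℂ (c : C2) (y : C2) : ℂ)
  generalize (inner ℂ (b : C2) (y : C2) : ℂ) = B at *
  generalize (inner ℂ (c : C2) (y : C2) : ℂ) = C at *
  have hB : (‖B‖ : ℂ) ≠ 0 := by simpa using hb
  have hC : (‖C‖ : ℂ) ≠ 0 := by simpa using hc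
  push_cast
  field_simp
  linear_combination -h3

theorem contDiffAt_phase (b : Sph3) {k : ℕ} {F : Euc k → Sph3} {u : Euc k}
    (hF : ContDiffAt ℝ ∞ (fun w => (F w : C2)) u) (h : (inner ℂ (b : C2) (F u : C2) : ℂ) ≠ 0) (n : ℤ) :
    ContDiffAt ℝ ∞ (fun w => phase b (F w) ^ n) u := by
  have h1 : ContDiffAt ℝ ∞ (fun w => (inner ℂ (b : C2) (F w : C2) : ℂ)) u := contDiffAt_const.inner ℂ hF
  have h3 : ContDiffAt ℝ ∞ (fun w => ((‖(inner ℂ (b : C2) (F w : C2) : ℂ)‖ : ℝ) : ℂ)) u :=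
    Complex.ofRealCLM.contDiff.contDiffAt.comp u (h1.norm ℝ h)
  have h2 : ContDiffAt ℝ ∞ (fun w => phase b (F w)) u := by
    simp only [phase, div_eq_mul_inv]
    exact h1.mul (h3.inv (by simpa using h))
  have h0 : phase b (F u) ≠ 0 := fun h0 => by
    have := norm_phase h
    simp [h0] at this
  have cz : ContDiffAt ℝ ∞ (fun z : ℂ => z ^ n) (phase b (F u)) :=
    ((analyticAt_id.zpow h0 : AnalyticAt ℂ (fun z : ℂ => z ^ n) _)).contDiffAt.restrict_scalars ℝ
  exact ContDiffAt.comp (g := fun z : ℂ => z ^ n) u cz h2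

/-- The `n`-th power of the section of the Hopf line bundle which is given by the points `y` with
`⟨b, y⟩ > 0`. -/
def phaseSec (b : Sph3) (s : Sph2) (n : ℤ) : KF s n := KF.incl s n (KF.pt s) (phase b (KF.pt s) ^ (-n))

theorem phaseSec_apply (b : Sph3) {s : Sph2} {n : ℤ} {y : Sph3} (h : hopf y = s) :
    KF.ev y (phaseSec b s n) = phase b y ^ (-n) := by
  rw [phase_hopf b ((KF.hopf_pt s).trans h.symm), mul_zpow]
  exact KF.incl_apply _ h _

/-- If `y` is close to the lines through `b` and `c`, then `⟨b, y⟩ ⟨y, c⟩` is close to `⟨b, c⟩`. -/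
theorem norm_inner_mul_sub_lt {b c y : C2} (hb : ‖b‖ = 1) (hc : ‖c‖ = 1) (hy : ‖y‖ = 1)
    (h : 3 / 4 < ‖(inner ℂ b y : ℂ)‖ ^ 2) (h' : 3 / 4 < ‖(inner ℂ c y : ℂ)‖ ^ 2) :
    ‖(inner ℂ b y * inner ℂ y c - inner ℂ b c : ℂ)‖ < ‖(inner ℂ b c : ℂ)‖ := by
  have key : ∀ d : C2, ‖d‖ = 1 → 3 / 4 < ‖(inner ℂ d y : ℂ)‖ ^ 2 → ‖d - (inner ℂ y d : ℂ) • y‖ ≤ 1 / 2 := by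
    intro d hd h
    have e : ‖d - (inner ℂ y d : ℂ) • y‖ ^ 2 = 1 - ‖(inner ℂ d y : ℂ)‖ ^ 2 := by
      rw [norm_sub_sq (𝕜 := ℂ), hd, norm_smul, hy, inner_smul_right, ← inner_conj_symm, RCLike.norm_conj,
        Complex.conj_mul']
      have : (((‖(inner ℂ d y : ℂ)‖ : ℂ) ^ 2)).re = ‖(inner ℂ d y : ℂ)‖ ^ 2 := by norm_cast
      linear_combination (-2) * this
    nlinarith [norm_nonneg (d - (inner ℂ y d : ℂ) • y)]
  have e : (inner ℂ b y * inner ℂ y c - inner ℂ b c : ℂ)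
      = - inner ℂ (b - (inner ℂ y b : ℂ) • y) (c - (inner ℂ y c : ℂ) • y) := by
    rw [inner_sub_left, inner_sub_right, inner_sub_right, inner_smul_left, inner_smul_right, inner_smul_left,
      inner_smul_right, inner_conj_symm, inner_self_eq_norm_sq_to_K, hy]
    simp
    ring
  have h1 : ‖(inner ℂ b y * inner ℂ y c - inner ℂ b c : ℂ)‖ ≤ 1 / 4 := by
    rw [e, norm_neg]
    refine (norm_inner_le_norm _ _).trans ?_
    have := mul_le_mul (key b hb h) (key c hc h') (norm_nonneg _) (by norm_num)
    linarith
  have h2 : 3 / 4 ≤ ‖(inner ℂ b y * inner ℂ y c : ℂ)‖ := by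
    rw [norm_mul, ← inner_conj_symm y c, RCLike.norm_conj]
    have h3 : (3 / 4 : ℝ) ≤ ‖(inner ℂ b y : ℂ)‖ * ‖(inner ℂ c y : ℂ)‖ := by
      by_contra! h3
      have h4 : 0 ≤ ‖(inner ℂ b y : ℂ)‖ * ‖(inner ℂ c y : ℂ)‖ := by positivity
      nlinarith
    exact h3
  have h3 := norm_sub_norm_le (inner ℂ b y * inner ℂ y c : ℂ) (inner ℂ b y * inner ℂ y c - inner ℂ b c : ℂ)
  rw [sub_sub_cancel] at h3
  linarith

end Phase

section Existence
variable (p : ℕ) [NeZero p]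

/-- Over the sets `U_x` where `y` is close to the Hopf fibre of `b_x` and the circle coordinate has the lift `r_x`,
the powers of the phase of `⟨b_x, y⟩` are transition functions. Their coboundary has the logarithm
`(r_z - r_y) θ_xy`, where `θ_xy` is a logarithm of the quotient of the phases: the cup product of the class of
the circle with the Chern class of the Hopf bundle. -/
theorem exists_isDDClass : ∃ c, (cupGerbe p).IsDDClass c := by
  classical
  choose b hb using fun x : Mp p => toM_surj p x
  choose a ha using fun x : Mp p => show ∃ a : ℝ, Circle.exp (2 * Real.pi * a) = Mp.z x from
    ⟨_, localLog_exp 0 _⟩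
  choose A hA hAs using fun x : Mp p => localLog_smooth (a x)
  have hzc : Continuous (Mp.z : Mp p → Circle) := (Mp.z_smooth p).continuous
  -- The bound `3/4` keeps `⟨b_x, y⟩ ⟨y, b_y⟩` in a disc around `⟨b_x, b_y⟩` which does not contain zero.
  let U : Cover (Mp p).carrier := ⟨fun x => Mp.z ⁻¹' interior (A x) ∩
      toM p '' {t | 3 / 4 < ‖(inner ℂ ((b x).1 : C2) (t.1 : C2) : ℂ)‖ ^ 2},
    fun x => (isOpen_interior.preimage hzc).inter (isOpenMap_toM p _ (isOpen_lt continuous_const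
      ((continuous_const.inner (continuous_subtype_val.comp continuous_fst)).norm.pow 2))),
    fun x => ⟨by
      have := mem_interior_iff_mem_nhds.2 (hA x)
      rwa [ha] at this, b x, by
      rw [Set.mem_ofPred_eq, inner_self_eq_norm_sq_to_K, norm_eq_of_mem_sphere]
      norm_num, hb x⟩⟩
  have hUb : ∀ x t, toM p t ∈ U.U x → 3 / 4 < ‖(inner ℂ ((b x).1 : C2) (t.1 : C2) : ℂ)‖ ^ 2 := by
    rintro x t ⟨-, t', ht', htt⟩
    obtain ⟨ζ, rfl⟩ := toM_eq htt
    have h1 := norm_inner_hopf (b x).1 (y := t'.1) (y' := ζ • t'.1) (hopf_smul _ _).symm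
    exact lt_of_lt_of_eq ht' (congrArg (· ^ 2) h1.symm)
  have hU0 : ∀ x t, toM p t ∈ U.U x → (inner ℂ ((b x).1 : C2) (t.1 : C2) : ℂ) ≠ 0 := fun x t ht h0 => by
    have := hUb x t ht
    rw [h0] at this
    norm_num at this
  let r : Mp p → Mp p → ℝ := fun x m => localLog (a x) (Mp.z m)
  let s : ∀ x, U.U x → Yp p := fun x m => Yp.mk (Mp.x m.1) (r x m.1)
  have hs : ∀ x m, proj p (s x m) = m := fun x m => Prod.ext rfl (localLog_exp _ _)
  have hsm : ∀ x, DSmooth (s x) := by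
    intro x k q hq
    have hq' : ContMDiff 𝓘(ℝ, Euc k) (Mp p).I ∞ (fun u => (q u).1) := Mfd.isPlot_iff.1 hq
    have h1 : ContMDiff 𝓘(ℝ, Euc k) 𝓘(ℝ, ℝ) ∞ (fun u => r x (q u).1) :=
      (hAs x).comp_contMDiff ((Mp.z_smooth p).comp hq') fun u => interior_subset (q u).2.1
    exact ((Mp.x_smooth p).comp hq').prodMk h1
  let N : Mp p → Mp p → Mp p → ℤ := fun x y m => round (r y m - r x m)
  have hN : ∀ x y m, ((N x y m : ℤ) : ℝ) = r y m - r x m := fun x y m => by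
    obtain ⟨k, hk⟩ := exp_eq ((localLog_exp (a x) (Mp.z m)).trans (localLog_exp (a y) (Mp.z m)).symm)
    simp only [N, r]
    rw [hk, add_sub_cancel_left, round_intCast]
  -- The logarithm of the quotient of the phases of `⟨b_x, y⟩` and `⟨b_y, y⟩`.
  let w : Mp p → Mp p → Sph3 × Circle → ℂ := fun x y t =>
    inner ℂ ((b x).1 : C2) (t.1 : C2) * inner ℂ (t.1 : C2) ((b y).1 : C2)
  let θ : Mp p → Mp p → Mp p → ℝ := fun x y m =>
    nearLog (inner ℂ ((b x).1 : C2) ((b y).1 : C2)) (w x y (Function.surjInv (toM_surj p) m))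
  have hwc : ∀ x y, Continuous (w x y) := fun x y =>
    (continuous_const.inner (continuous_subtype_val.comp continuous_fst)).mul
      ((continuous_subtype_val.comp continuous_fst).inner continuous_const)
  have hθ : ∀ x y t, θ x y (toM p t) = nearLog (inner ℂ ((b x).1 : C2) ((b y).1 : C2)) (w x y t) := by
    intro x y t
    obtain ⟨ζ, hζ⟩ := toM_eq (Function.surjInv_eq (toM_surj p) (toM p t)).symm
    have h1 : hopf t.1 = hopf (ζ • t.1) := (hopf_smul _ _).symm
    simp only [θ, w]
    rw [hζ]
    exact congrArg _ (inner_mul_inner_hopf (b x).1 (b y).1 h1)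
  have hnear : ∀ x y t, toM p t ∈ U.U x ∩ U.U y →
      ‖w x y t - inner ℂ ((b x).1 : C2) ((b y).1 : C2)‖ < ‖(inner ℂ ((b x).1 : C2) ((b y).1 : C2) : ℂ)‖ := fun x y t ht =>
    norm_inner_mul_sub_lt (norm_eq_of_mem_sphere _) (norm_eq_of_mem_sphere _) (norm_eq_of_mem_sphere _)
      (hUb x t ht.1) (hUb y t ht.2)
  have hθc : ∀ x y, ContinuousOn (θ x y) (U.U x ∩ U.U y) := fun x y =>
    continuousOn_of_comp_toM ((U.isOpen x).inter (U.isOpen y)) fun t ht => by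
      refine ContinuousAt.continuousWithinAt ?_
      rw [funext fun t => hθ x y t]
      exact (continuousAt_nearLog (hnear x y t ht)).comp (hwc x y).continuousAt
  have hθe : ∀ x y t, toM p t ∈ U.U x ∩ U.U y → Complex.exp (2 * Real.pi * Complex.I * θ x y (toM p t))
      = phase (b x).1 t.1 * (phase (b y).1 t.1)⁻¹ := by
    intro x y t ht
    have hx := hU0 x t ht.1
    have hy := hU0 y t ht.2
    have hy' : (inner ℂ (t.1 : C2) ((b y).1 : C2) : ℂ) ≠ 0 := fun h => hy (inner_eq_zero_symm.1 h)
    rw [hθ, exp_nearLog (norm_pos_iff.1 ((norm_nonneg _).trans_lt (hnear x y t ht))) (mul_ne_zero hx hy')]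
    exact (phase_mul_inv hx hy).symm
  let f : (Fin 3 → Mp p) → Mp p → ℝ := fun x m => (r (x 2) m - r (x 1) m) * θ (x 0) (x 1) m
  have hrc : ∀ x, ContinuousOn (r x) (U.U x) := fun x =>
    (hAs x).continuousOn.comp hzc.continuousOn fun m hm => interior_subset hm.1
  have m0 : ∀ {k : ℕ} {x : Fin (k + 1) → Mp p} {m : Mp p}, m ∈ U.inter x → ∀ i, m ∈ U.U (x i) :=
    fun h => Cover.mem_inter.1 h
  have hfc : ∀ x, ContinuousOn (f x) (U.inter x) := fun x =>
    (((hrc _).mono fun m hm => m0 hm 2).sub ((hrc _).mono fun m hm => m0 hm 1)).mul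
      ((hθc _ _).mono fun m hm => ⟨m0 hm 0, m0 hm 1⟩)
  have hsum : ∀ (x : Fin 4 → Mp p) (m : Mp p), ∑ i : Fin 4, (-1 : ℝ) ^ (i : ℕ) * f (x ∘ i.succAbove) m
      = (r (x 3) m - r (x 2) m) * (θ (x 1) (x 2) m - θ (x 0) (x 2) m + θ (x 0) (x 1) m) := by
    intro x m
    rw [Fin.sum_univ_four]
    change (-1 : ℝ) ^ 0 * ((r (x 3) m - r (x 2) m) * θ (x 1) (x 2) m)
      + (-1 : ℝ) ^ 1 * ((r (x 3) m - r (x 2) m) * θ (x 0) (x 2) m)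
      + (-1 : ℝ) ^ 2 * ((r (x 3) m - r (x 1) m) * θ (x 0) (x 1) m)
      + (-1 : ℝ) ^ 3 * ((r (x 2) m - r (x 1) m) * θ (x 0) (x 1) m) = _
    ring
  obtain ⟨n, hn⟩ := U.exists_cochain (k := 3) (fun x m => ∑ i : Fin 4, (-1 : ℝ) ^ (i : ℕ) * f (x ∘ i.succAbove) m)
    (fun x => continuousOn_finsetSum _ fun i _ => continuousOn_const.mul ((hfc _).mono (U.inter_succAbove x i)))
    (fun x m hm => by
      obtain ⟨t, rfl⟩ := toM_surj p m
      have h0 : ∀ i, phase (b (x i)).1 t.1 ≠ 0 := fun i h => by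
        have := norm_phase (hU0 (x i) t (m0 hm i))
        simp [h] at this
      obtain ⟨k, hk⟩ := exp_eq_one_iff_int (t := θ (x 1) (x 2) (toM p t) - θ (x 0) (x 2) (toM p t)
          + θ (x 0) (x 1) (toM p t)) (by
        have e : (2 * Real.pi * Complex.I * ((θ (x 1) (x 2) (toM p t) - θ (x 0) (x 2) (toM p t)
          + θ (x 0) (x 1) (toM p t) : ℝ) : ℂ)) = 2 * Real.pi * Complex.I * θ (x 1) (x 2) (toM p t)
            - 2 * Real.pi * Complex.I * θ (x 0) (x 2) (toM p t)
            + 2 * Real.pi * Complex.I * θ (x 0) (x 1) (toM p t) := by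
          push_cast
          ring
        rw [e, Complex.exp_add, Complex.exp_sub, hθe _ _ t ⟨m0 hm _, m0 hm _⟩, hθe _ _ t ⟨m0 hm _, m0 hm _⟩,
          hθe _ _ t ⟨m0 hm _, m0 hm _⟩]
        have := h0 0
        have := h0 1
        have := h0 2
        field_simp)
      exact ⟨N (x 2) (x 3) (toM p t) * k, by
        rw [hsum, hk]
        push_cast
        rw [hN]⟩)
  have hδ : U.δ 3 n = 0 := by
    funext x
    ext m
    refine Int.cast_injective (α := ℝ) ?_
    rw [Cover.δ_apply]
    simp only [hn, hsum]
    rw [Fin.sum_univ_five]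
    change (-1 : ℝ) ^ 0 * ((r (x 4) m - r (x 3) m) * (θ (x 2) (x 3) m - θ (x 1) (x 3) m + θ (x 1) (x 2) m))
      + (-1 : ℝ) ^ 1 * ((r (x 4) m - r (x 3) m) * (θ (x 2) (x 3) m - θ (x 0) (x 3) m + θ (x 0) (x 2) m))
      + (-1 : ℝ) ^ 2 * ((r (x 4) m - r (x 3) m) * (θ (x 1) (x 3) m - θ (x 0) (x 3) m + θ (x 0) (x 1) m))
      + (-1 : ℝ) ^ 3 * ((r (x 4) m - r (x 2) m) * (θ (x 1) (x 2) m - θ (x 0) (x 2) m + θ (x 0) (x 1) m))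
      + (-1 : ℝ) ^ 4 * ((r (x 3) m - r (x 2) m) * (θ (x 1) (x 2) m - θ (x 0) (x 2) m + θ (x 0) (x 1) m))
      = ((0 : ℤ) : ℝ)
    push_cast
    ring
  refine ⟨_, U, s, hs, hsm, fun x y m hx hy => phaseSec (b x).1 (lensToS2 p (Mp.x m)) (N x y m), f, ⟨n, hδ⟩,
    fun x y k P τ => ?_, fun x y m hx hy => ?_, hfc, fun x m h0 h1 h2 => ?_, hn, rfl⟩
  · let Q : Plot S2Z k := Plot.map ⟨fun u => FibProd.mk (s x ⟨(P u).1, (P u).2.1⟩) (s y ⟨(P u).1, (P u).2.2⟩)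
        ((hs x ⟨(P u).1, (P u).2.1⟩).trans (hs y ⟨(P u).1, (P u).2.2⟩).symm), FibProd.isPlot_iff.2
          ⟨hsm x k (fun u => ⟨(P u).1, (P u).2.1⟩) P.2, hsm y k (fun u => ⟨(P u).1, (P u).2.2⟩) P.2⟩⟩
      (toS2Z (p := p)) toS2Z_smooth
    intro u hu
    replace hu : (Q u).s ∈ τ.U := hu
    have h1 : (inner ℂ ((b x).1 : C2) (τ.σ (Q u).s : C2) : ℂ) ≠ 0 := by
      obtain ⟨t, ht⟩ := toM_surj p (P u).1
      have e : hopf t.1 = hopf (τ.σ (Q u).s) := by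
        rw [τ.hopf_σ _ hu]
        exact congrArg (fun m : Mp p => lensToS2 p (Mp.x m)) ht
      rw [← norm_ne_zero_iff, norm_inner_hopf _ e, norm_ne_zero_iff]
      exact hU0 x t (ht ▸ (P u).2.1)
    refine ((contDiffAt_phase (b x).1 (τ.contDiffAt Q hu) h1 (-(Q u).n)).congr_of_eventuallyEq ?_).contDiffWithinAt
    filter_upwards [(τ.isOpen_dom Q).mem_nhds hu] with v hv
    rw [show (Q u).n = (Q v).n from plot_Z Q u v]
    exact phaseSec_apply (b x).1 (τ.hopf_σ _ hv)
  · obtain ⟨t, rfl⟩ := toM_surj p m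
    have e := phaseSec_apply (b x).1 (s := lensToS2 p (Mp.x (toM p t))) (n := N x y (toM p t)) (y := t.1) rfl
    refine (KF.norm_eq (phaseSec (b x).1 (lensToS2 p (Mp.x (toM p t))) (N x y (toM p t))) (y := t.1) rfl).trans ?_
    refine (congrArg norm e).trans ?_
    rw [norm_zpow, norm_phase (hU0 x t hx), one_zpow]
  · obtain ⟨t, rfl⟩ := toM_surj p m
    have hh1 := (hs (x 0) ⟨toM p t, h0⟩).trans (hs (x 1) ⟨toM p t, h1⟩).symm
    have hh2 := (hs (x 1) ⟨toM p t, h1⟩).trans (hs (x 2) ⟨toM p t, h2⟩).symm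
    refine KF.ev_inj (s := lensToS2 p (Mp.x (toM p t))) (n := N (x 0) (x 2) (toM p t)) (y := t.1) rfl ?_
    refine (KF.mul_apply rfl (toS2Z_s p hh1 hh2) (toS2Z_n p hh1 hh2)
      (phaseSec (b (x 0)).1 (lensToS2 p (Mp.x (toM p t))) (N (x 0) (x 1) (toM p t)))
      (phaseSec (b (x 1)).1 (lensToS2 p (Mp.x (toM p t))) (N (x 1) (x 2) (toM p t))) t.1).trans ?_
    have e := fun x y => phaseSec_apply (b x).1 (s := lensToS2 p (Mp.x (toM p t))) (n := N x y (toM p t)) (y := t.1) rfl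
    refine (congrArg₂ (· * ·) (e (x 0) (x 1)) (e (x 1) (x 2))).trans (Eq.symm ?_)
    refine (congrArg (_ * ·) (e (x 0) (x 2))).trans ?_
    have e1 : (2 * Real.pi * Complex.I * f x (toM p t) : ℂ)
        = N (x 1) (x 2) (toM p t) * (2 * Real.pi * Complex.I * θ (x 0) (x 1) (toM p t)) := by
      have : (((N (x 1) (x 2) (toM p t) : ℤ) : ℝ) : ℂ) = ((r (x 2) (toM p t) - r (x 1) (toM p t) : ℝ) : ℂ) :=
        congrArg _ (hN _ _ _)
      rw [Complex.ofReal_intCast] at this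
      rw [this]
      simp only [f]
      push_cast
      ring
    have e2 : N (x 0) (x 2) (toM p t) = N (x 0) (x 1) (toM p t) + N (x 1) (x 2) (toM p t) := by
      refine Int.cast_injective (α := ℝ) ?_
      push_cast
      rw [hN, hN, hN]
      ring
    have z0 : ∀ i, toM p t ∈ U.U (x i) → phase (b (x i)).1 t.1 ≠ 0 := fun i hi h => by
      have := norm_phase (hU0 (x i) t hi)
      simp [h] at this
    rw [e1, Complex.exp_int_mul, hθe _ _ t ⟨h0, h1⟩, e2, neg_add, zpow_add₀ (z0 0 h0), mul_zpow, inv_zpow,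
      ← zpow_neg]
    have := zpow_ne_zero (N (x 1) (x 2) (toM p t)) (z0 0 h0)
    rw [zpow_neg (phase (b (x 0)).1 t.1) (N (x 1) (x 2) (toM p t))]
    field_simp

end Existence

/-! ### Line bundles over balls are trivial -/

section Trivial

/-- A continuous family of projections on a ball has a nowhere vanishing fixed vector: the fixed
vectors are transported along the radii by projecting them in small steps. -/
theorem exists_fixed_of_projections {E W : Type} [NormedAddCommGroup E] [NormedSpace ℝ E]
    [FiniteDimensional ℝ E] [NormedAddCommGroup W] [NormedSpace ℂ W] {P : E → W →L[ℂ] W} {R : ℝ} (hR : 0 < R)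
    (hP : ContinuousOn P (Metric.closedBall 0 R)) (hPP : ∀ e w, P e (P e w) = P e w) (h0 : ∃ w, P 0 w ≠ 0) :
    ∃ v : E → W, ContinuousOn v (Metric.closedBall 0 R) ∧ ∀ e ∈ Metric.closedBall 0 R, v e ≠ 0 ∧ P e (v e) = v e := by
  obtain ⟨w, hw⟩ := h0
  have hu := (isCompact_closedBall (0 : E) R).uniformContinuousOn_of_continuous hP
  obtain ⟨δ, hδ, hδP⟩ := Metric.uniformContinuousOn_iff.1 hu 1 one_pos
  -- After `N` steps of length at most `δ` the boundary of the ball is reached; consecutive projections are at a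
  -- distance less than one, so that no vector in the image of one is in the kernel of the next.
  obtain ⟨N, hN⟩ := exists_nat_gt (R / δ)
  have hN0 : (0 : ℝ) < N := lt_of_le_of_lt (by positivity) hN
  let v : ℕ → E → W := fun k => Nat.rec (fun _ => P 0 w) (fun k v e => P (((k + 1 : ℕ) / N : ℝ) • e) (v e)) k
  have hmem : ∀ k : ℕ, k ≤ N → ∀ e ∈ Metric.closedBall (0 : E) R, ((k / N : ℝ) • e) ∈ Metric.closedBall (0 : E) R := by
    intro k hk e he
    rw [mem_closedBall_zero_iff] at he ⊢
    have h1 : (k / N : ℝ) ≤ 1 := (div_le_one hN0).2 (by exact_mod_cast hk)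
    rw [norm_smul, Real.norm_of_nonneg (by positivity)]
    exact (mul_le_of_le_one_left (norm_nonneg e) h1).trans he
  have key : ∀ k : ℕ, k ≤ N → ContinuousOn (v k) (Metric.closedBall 0 R) ∧ ∀ e ∈ Metric.closedBall (0 : E) R,
      v k e ≠ 0 ∧ P ((k / N : ℝ) • e) (v k e) = v k e := by
    intro k
    induction k with
    | zero =>
      intro _
      refine ⟨continuousOn_const, fun e he => ⟨hw, ?_⟩⟩
      rw [Nat.cast_zero, zero_div, zero_smul]
      exact hPP 0 w
    | succ k ih =>
      intro hk
      obtain ⟨h1, h2⟩ := ih (by omega)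
      refine ⟨(hP.comp (continuous_const_smul _).continuousOn (hmem _ hk)).clm_apply h1, fun e he => ⟨?_, hPP _ _⟩⟩
      intro h3
      obtain ⟨h4, h5⟩ := h2 e he
      have h6 := hδP _ (hmem k (by omega) e he) _ (hmem _ hk e he) (by
        rw [dist_eq_norm, ← sub_smul, norm_smul]
        have e1 : (k / N : ℝ) - ((k + 1 : ℕ) / N : ℝ) = -(1 / N) := by
          push_cast
          field_simp
          ring
        rw [e1, norm_neg, Real.norm_of_nonneg (by positivity)]
        rw [mem_closedBall_zero_iff] at he
        rw [div_lt_iff₀ hδ] at hN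
        rw [one_div, inv_mul_lt_iff₀ hN0]
        exact he.trans_lt hN)
      have h7 := (P ((k / N : ℝ) • e) - P (((k + 1 : ℕ) / N : ℝ) • e)).le_opNorm (v k e)
      have h3' : P (((k + 1 : ℕ) / N : ℝ) • e) (v k e) = 0 := h3
      rw [sub_apply, h5, h3', sub_zero] at h7
      rw [dist_eq_norm] at h6
      have h8 := norm_pos_iff.2 h4
      nlinarith
  obtain ⟨h1, h2⟩ := key N le_rfl
  refine ⟨v N, h1, fun e he => ?_⟩
  have := h2 e he
  rwa [div_self hN0.ne', one_smul] at this

theorem continuousOn_mul_of_tsupport {E : Type} [TopologicalSpace E] {c : E → ℝ} {γ : E → ℂ} {A B : Set E}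
    (hA : IsOpen A) (hB : IsOpen B) (hc : Continuous c) (hcB : tsupport c ⊆ B) (hγ : ContinuousOn γ (A ∩ B)) :
    ContinuousOn (fun e => (c e : ℂ) * γ e) A := by
  intro e he
  by_cases h : e ∈ tsupport c
  · have h1 := hγ.continuousAt ((hA.inter hB).mem_nhds ⟨he, hcB h⟩)
    exact ((Complex.continuous_ofReal.comp hc).continuousAt.mul h1).continuousWithinAt
  · refine ContinuousAt.continuousWithinAt (continuousAt_const (y := (0 : ℂ)) |>.congr ?_)
    filter_upwards [(isClosed_tsupport c).isOpen_compl.mem_nhds h] with e' he'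
    rw [image_eq_zero_of_notMem_tsupport he', Complex.ofReal_zero, zero_mul]

/-- A cocycle of unit functions on a ball is a coboundary. The functions `c_i` are the square roots of a partition
of unity; they embed the line bundle of the cocycle into a trivial bundle, as the image of a projection. -/
theorem exists_trivialization {E X ι : Type} [NormedAddCommGroup E] [NormedSpace ℝ E] [FiniteDimensional ℝ E]
    [Fintype ι] {Ω : X → Set E} (hΩ : ∀ x, IsOpen (Ω x)) {Γ : X → X → E → ℂ}
    (hΓ : ∀ x y, ContinuousOn (Γ x y) (Ω x ∩ Ω y)) (hΓn : ∀ x y, ∀ e ∈ Ω x ∩ Ω y, ‖Γ x y e‖ = 1)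
    (hΓm : ∀ x y z e, e ∈ Ω x → e ∈ Ω y → e ∈ Ω z → Γ x y e * Γ y z e = Γ x z e)
    {j : ι → X} {c : ι → E → ℝ} (hc : ∀ i, Continuous (c i)) (hcs : ∀ i, tsupport (c i) ⊆ Ω (j i))
    (hc1 : ∀ e, ∑ i, c i e ^ 2 = 1) {R : ℝ} (hR : 0 < R) :
    ∃ a : X → E → ℂ, (∀ x, ContinuousOn (a x) (Ω x ∩ Metric.closedBall 0 R)) ∧
      (∀ x, ∀ e ∈ Ω x ∩ Metric.closedBall 0 R, ‖a x e‖ = 1) ∧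
      ∀ x y e, e ∈ Ω x → e ∈ Ω y → e ∈ Metric.closedBall 0 R → a x e = Γ x y e * a y e := by
  classical
  have hcΩ : ∀ i e, c i e ≠ 0 → e ∈ Ω (j i) := fun i e h => hcs i (subset_tsupport _ h)
  have hcc : ∀ i x, ContinuousOn (fun e => (c i e : ℂ) * Γ x (j i) e) (Ω x) := fun i x =>
    continuousOn_mul_of_tsupport (hΩ x) (hΩ (j i)) (hc i) (hcs i) (hΓ x (j i))
  -- The projection onto the line bundle, which is a subbundle of a trivial bundle.
  let Q : ι → ι → E → ℂ := fun i k e => (c i e : ℂ) * ((c k e : ℂ) * Γ (j i) (j k) e)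
  have hQ : ∀ i k, Continuous (Q i k) := fun i k => by
    rw [← continuousOn_univ]
    refine continuousOn_mul_of_tsupport isOpen_univ (hΩ (j i)) (hc i) (hcs i) ?_
    rw [Set.univ_inter]
    exact hcc k (j i)
  have hQQ : ∀ i l e, ∑ k, Q i k e * Q k l e = Q i l e := by
    intro i l e
    have h1 : ∀ k, Q i k e * Q k l e = (c k e : ℂ) ^ 2 * Q i l e := by
      intro k
      simp only [Q]
      by_cases hi : c i e = 0
      · simp [hi]
      by_cases hk : c k e = 0
      · simp [hk]
      by_cases hl : c l e = 0
      · simp [hl]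
      rw [← hΓm (j i) (j k) (j l) e (hcΩ i e hi) (hcΩ k e hk) (hcΩ l e hl)]
      ring
    rw [Finset.sum_congr rfl fun k _ => h1 k, ← Finset.sum_mul]
    have h2 : (∑ k, (c k e : ℂ) ^ 2) = 1 := by exact_mod_cast congrArg (fun t : ℝ => (t : ℂ)) (hc1 e)
    rw [h2, one_mul]
  let P : E → (ι → ℂ) →L[ℂ] (ι → ℂ) := fun e => ∑ i, ∑ k, Q i k e •
    (ContinuousLinearMap.proj (R := ℂ) (φ := fun _ : ι => ℂ) k).smulRight (Pi.single i (1 : ℂ))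
  have hP : ∀ e w i, P e w i = ∑ k, Q i k e * w k := by
    intro e w i
    simp only [P, sum_apply, Finset.sum_apply, smul_apply,
      ContinuousLinearMap.smulRight_apply, ContinuousLinearMap.proj_apply, Pi.smul_apply, smul_eq_mul]
    rw [Finset.sum_comm]
    refine Finset.sum_congr rfl fun k _ => ?_
    rw [Finset.sum_eq_single i (fun i' _ h => by simp [Pi.single_eq_of_ne' h]) (by simp)]
    simp
  have hPc : Continuous P := continuous_finsetSum _ fun i _ => continuous_finsetSum _ fun k _ =>
    (hQ i k).smul continuous_const
  have hPP : ∀ e w, P e (P e w) = P e w := by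
    intro e w
    funext i
    rw [hP, hP]
    simp only [hP, Finset.mul_sum, ← mul_assoc]
    rw [Finset.sum_comm]
    refine Finset.sum_congr rfl fun l _ => ?_
    rw [← Finset.sum_mul, hQQ]
  obtain ⟨v, hv, hv'⟩ := exists_fixed_of_projections hR hPc.continuousOn hPP (by
    obtain ⟨i, -, hi⟩ := Finset.exists_ne_zero_of_sum_ne_zero (s := Finset.univ) (f := fun i => c i (0 : E) ^ 2)
      (by rw [hc1]; exact one_ne_zero)
    have hi' : c i (0 : E) ≠ 0 := fun h => hi (by simp [h])
    refine ⟨Pi.single i 1, fun h => ?_⟩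
    have h1 := congrFun h i
    rw [hP] at h1
    have hm := hcΩ i 0 hi'
    have h2 : Γ (j i) (j i) 0 ≠ 0 := fun h => by
      have := hΓn (j i) (j i) 0 ⟨hm, hm⟩
      simp [h] at this
    rw [Finset.sum_eq_single i (fun k _ h => by simp [Pi.single_eq_of_ne h]) (by simp)] at h1
    simp [Q, hi', h2] at h1)
  -- The coordinates of the fixed vector in the local trivializations of the line bundle.
  let b : X → E → ℂ := fun x e => ∑ k, (c k e : ℂ) * Γ x (j k) e * v e k
  have hb : ∀ x y e, e ∈ Ω x → e ∈ Ω y → b x e = Γ x y e * b y e := by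
    intro x y e hx hy
    simp only [b, Finset.mul_sum]
    refine Finset.sum_congr rfl fun k _ => ?_
    by_cases hk : c k e = 0
    · simp [hk]
    rw [← hΓm x y (j k) e hx hy (hcΩ k e hk)]
    ring
  have hb0 : ∀ x e, e ∈ Ω x → e ∈ Metric.closedBall (0 : E) R → b x e ≠ 0 := by
    intro x e hx he
    obtain ⟨h1, h2⟩ := hv' e he
    obtain ⟨i, hi⟩ := Function.ne_iff.1 h1
    have h3 := congrFun h2 i
    rw [hP] at h3
    have h4 : v e i = c i e * b (j i) e := by
      rw [← h3]
      simp only [b, Q, Finset.mul_sum]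
      exact Finset.sum_congr rfl fun k _ => by ring
    have h5 : c i e ≠ 0 := fun h => hi (by rw [h4, h]; simp)
    have h6 : b (j i) e ≠ 0 := fun h => hi (by rw [h4, h]; simp)
    rw [hb x (j i) e hx (hcΩ i e h5)]
    refine mul_ne_zero (fun h => ?_) h6
    have := hΓn x (j i) e ⟨hx, hcΩ i e h5⟩
    simp [h] at this
  have hbc : ∀ x, ContinuousOn (b x) (Ω x ∩ Metric.closedBall 0 R) := fun x =>
    continuousOn_finsetSum _ fun k _ => ((hcc k x).mono Set.inter_subset_left).mul
      ((continuous_apply k).comp_continuousOn (hv.mono Set.inter_subset_right))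
  refine ⟨fun x e => b x e / ‖b x e‖, fun x => (hbc x).div (Complex.continuous_ofReal.comp_continuousOn (hbc x).norm)
    fun e he => by simpa using hb0 x e he.1 he.2, fun x e he => ?_, fun x y e hx hy he => ?_⟩
  · have := norm_ne_zero_iff.2 (hb0 x e he.1 he.2)
    rw [norm_div, Complex.norm_real, norm_norm, div_self this]
  · simp only []
    rw [hb x y e hx hy, norm_mul, hΓn x y e ⟨hx, hy⟩, one_mul, mul_div_assoc]

/-- Continuous functions on a vector space with values in the circle have logarithms. -/
theorem exists_circle_lift {E : Type} [NormedAddCommGroup E] [NormedSpace ℝ E] [FiniteDimensional ℝ E]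
    {F : E → ℂ} (hF : Continuous F) (hn : ∀ e, ‖F e‖ = 1) :
    ∃ φ : E → ℝ, Continuous φ ∧ ∀ e, Complex.exp (2 * Real.pi * Complex.I * φ e) = F e := by
  let f : C(E, Circle) := ⟨fun e => ⟨F e, mem_sphere_zero_iff_norm.2 (hn e)⟩, hF.subtype_mk _⟩
  have hcov := Circle.isCoveringMap_exp
  obtain ⟨a, ha⟩ : ∃ a : ℝ, Circle.exp a = f 0 := ⟨_, Circle.exp_arg (f 0)⟩
  obtain ⟨φ, ⟨-, hφ⟩, -⟩ := hcov.existsUnique_continuousMap_lifts f 0 a ha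
  refine ⟨fun e => φ e / (2 * Real.pi), φ.continuous.div_const _, fun e => ?_⟩
  have h1 : (Circle.exp (φ e) : ℂ) = F e := congrArg (fun z : Circle => (z : ℂ)) (congrFun hφ e)
  rw [← h1, Circle.coe_exp]
  congr 1
  have : (Real.pi : ℂ) ≠ 0 := Complex.ofReal_ne_zero.2 Real.pi_ne_zero
  push_cast
  field_simp

end Trivial

/-! ### The lower bound for the order of the Dixmier–Douady class -/

section PartitionOfUnity
variable {X : Type} [TopologicalSpace X]

namespace Cover

theorem exists_partition [CompactSpace X] [T2Space X] (V : Cover X) :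
    ∃ (t : Finset X) (ρ : t → X → ℝ), (∀ i, Continuous (ρ i)) ∧ (∀ i m, 0 ≤ ρ i m) ∧
      (∀ i, tsupport (ρ i) ⊆ V.U i) ∧ ∀ m, ∑ i, ρ i m = 1 := by
  obtain ⟨t, ht⟩ := isCompact_univ.elim_finite_subcover V.U V.isOpen fun x _ => Set.mem_iUnion.2 ⟨x, V.mem x⟩
  obtain ⟨ρ, hρ⟩ := PartitionOfUnity.exists_isSubordinate isClosed_univ (fun i : t => V.U i)
    (fun i => V.isOpen i) fun x hx => by
      obtain ⟨i, hi, hxi⟩ := Set.mem_iUnion₂.1 (ht hx)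
      exact Set.mem_iUnion.2 ⟨⟨i, hi⟩, hxi⟩
  refine ⟨t, fun i => ρ i, fun i => (ρ i).continuous, fun i => ρ.nonneg i, hρ, fun m => ?_⟩
  rw [← finsum_eq_sum_of_fintype]
  exact ρ.sum_eq_one (Set.mem_univ m)

/-- Continuous real 2-cocycles are coboundaries, by averaging over the first index with a partition of unity. -/
theorem exists_real_primitive [CompactSpace X] [T2Space X] (V : Cover X) (F : (Fin 3 → X) → X → ℝ)
    (hF : ∀ x, ContinuousOn (F x) (V.inter x))
    (hδ : ∀ (x : Fin 4 → X), ∀ m ∈ V.inter x, ∑ i : Fin 4, (-1 : ℝ) ^ (i : ℕ) * F (x ∘ i.succAbove) m = 0) :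
    ∃ h : X → X → X → ℝ, (∀ x y, ContinuousOn (h x y) (V.U x ∩ V.U y)) ∧
      ∀ x, ∀ m ∈ V.inter x, h (x 1) (x 2) m - h (x 0) (x 2) m + h (x 0) (x 1) m = F x m := by
  obtain ⟨t, ρ, hρ, -, hρs, hρ1⟩ := V.exists_partition
  refine ⟨fun x y m => ∑ i, ρ i m * F ![i, x, y] m, fun x y => continuousOn_finsetSum _ fun i _ => ?_,
    fun x m hm => ?_⟩
  · have e : ContinuousOn (fun m => (ρ i m : ℂ) * (F ![i, x, y] m : ℂ)) (V.U x ∩ V.U y) :=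
      continuousOn_mul_of_tsupport ((V.isOpen x).inter (V.isOpen y)) (V.isOpen i) (hρ i) (hρs i)
        (Complex.continuous_ofReal.comp_continuousOn ((hF ![i, x, y]).mono fun m hm => mem_inter.2 fun l => by
          fin_cases l
          exacts [hm.2, hm.1.1, hm.1.2]))
    refine (Complex.continuous_re.comp_continuousOn e).congr fun m _ => ?_
    simp only [Function.comp_apply]
    rw [← Complex.ofReal_mul, Complex.ofReal_re]
  · have m0 := mem_inter.1 hm
    have key : ∀ i, ρ i m * F ![i, x 1, x 2] m - ρ i m * F ![i, x 0, x 2] m + ρ i m * F ![i, x 0, x 1] m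
        = ρ i m * F x m := by
      intro i
      by_cases hi : ρ i m = 0
      · simp [hi]
      have hmi : m ∈ V.U i := hρs i (subset_tsupport _ hi)
      have e := hδ ![i, x 0, x 1, x 2] m (mem_inter.2 fun l => by
        fin_cases l
        exacts [hmi, m0 0, m0 1, m0 2])
      rw [Fin.sum_univ_four] at e
      have e0 : ![(i : X), x 0, x 1, x 2] ∘ Fin.succAbove 0 = x := by
        funext l
        fin_cases l <;> rfl
      have e1 : ![(i : X), x 0, x 1, x 2] ∘ Fin.succAbove 1 = ![(i : X), x 1, x 2] := by
        funext l
        fin_cases l <;> rfl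
      have e2 : ![(i : X), x 0, x 1, x 2] ∘ Fin.succAbove 2 = ![(i : X), x 0, x 2] := by
        funext l
        fin_cases l <;> rfl
      have e3 : ![(i : X), x 0, x 1, x 2] ∘ Fin.succAbove 3 = ![(i : X), x 0, x 1] := by
        funext l
        fin_cases l <;> rfl
      rw [e0, e1, e2, e3] at e
      have e' : F ![i, x 1, x 2] m - F ![i, x 0, x 2] m + F ![i, x 0, x 1] m = F x m := by
        norm_num at e
        linarith
      rw [← e']
      ring
    rw [← Finset.sum_sub_distrib, ← Finset.sum_add_distrib, Finset.sum_congr rfl fun i _ => key i,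
      ← Finset.sum_mul, hρ1, one_mul]

end Cover

theorem exists_continuousOn_glue {E ι : Type} [TopologicalSpace E] {S : Set E} {Ω : ι → Set E}
    (hΩ : ∀ x, IsOpen (Ω x)) (hS : ∀ e ∈ S, ∃ x, e ∈ Ω x) {f : ι → E → ℂ}
    (hf : ∀ x, ContinuousOn (f x) (Ω x ∩ S)) (hfe : ∀ x y, ∀ e ∈ S, e ∈ Ω x → e ∈ Ω y → f x e = f y e) :
    ∃ F : E → ℂ, ContinuousOn F S ∧ ∀ x, ∀ e ∈ S, e ∈ Ω x → F e = f x e := by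
  classical
  let F : E → ℂ := fun e => if h : ∃ x, e ∈ Ω x then f h.choose e else 0
  have hF : ∀ x, ∀ e ∈ S, e ∈ Ω x → F e = f x e := fun x e he hx => by
    have h : ∃ x, e ∈ Ω x := ⟨x, hx⟩
    simp only [F, dif_pos h]
    exact hfe _ _ e he h.choose_spec hx
  refine ⟨F, fun e he => ?_, hF⟩
  obtain ⟨x, hx⟩ := hS e he
  have h1 : ContinuousWithinAt (f x) (S ∩ Ω x) e := by
    rw [Set.inter_comm]
    exact hf x e ⟨hx, he⟩
  rw [← continuousWithinAt_inter ((hΩ x).mem_nhds hx)]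
  exact h1.congr (fun e' he' => hF x e' he'.1 he'.2) (hF x e he hx)

theorem exists_int_of_continuous {q : ℝ → ℝ} (hq : Continuous q) (hi : ∀ θ, ∃ n : ℤ, q θ = n) :
    ∃ n : ℤ, ∀ θ, q θ = n := by
  choose n hn using hi
  have hc : Continuous n := Int.isClosedEmbedding_coe_real.isEmbedding.continuous_iff.2
    (hq.congr fun θ => hn θ)
  exact ⟨n 0, fun θ => (hn θ).trans (by rw [PreconnectedSpace.constant inferInstance hc])⟩

end PartitionOfUnity

section Disc

/-- The radial retraction of the plane onto the unit disc. -/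
def discRet (z : ℂ) : ℂ := z / (max 1 ‖z‖ : ℝ)

theorem continuous_discRet : Continuous discRet :=
  continuous_id.div (Complex.continuous_ofReal.comp (continuous_const.max continuous_norm)) fun z => by
    have : (0 : ℝ) < max 1 ‖z‖ := by positivity
    exact_mod_cast this.ne'

theorem norm_discRet (z : ℂ) : ‖discRet z‖ ≤ 1 := by
  have h : (0 : ℝ) < max 1 ‖z‖ := by positivity
  rw [discRet, norm_div, Complex.norm_real, Real.norm_of_nonneg h.le, div_le_one h]
  exact le_max_right _ _

theorem discRet_eq {z : ℂ} (hz : ‖z‖ ≤ 1) : discRet z = z := by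
  rw [discRet, max_eq_left hz, Complex.ofReal_one, div_one]

variable (p : ℕ) [NeZero p]

/-- The primitive root of unity `exp(2πi/p)`. -/
def primRoot : ℂ := Complex.exp (2 * Real.pi * Complex.I * (1 / p : ℝ))

theorem primRoot_pow : primRoot p ^ p = 1 := by
  rw [primRoot, ← Complex.exp_nat_mul]
  have : (p : ℂ) ≠ 0 := by exact_mod_cast NeZero.ne p
  convert Complex.exp_two_pi_mul_I using 2
  push_cast
  field_simp

theorem norm_primRoot : ‖primRoot p‖ = 1 := norm_exp_two_pi _

/-- A winding number argument. Let `F` and `D` be unit functions on the disc and on `S¹ × [0, 1]`. If the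
quotient `F(ζz) / F(z)` is `ζ⁻ᵐ D(z, 1) / D(z, 0)` for `ζ = exp(2πi/p)` and the product of `D` over each
orbit of `ζ` is one, then `p` divides `m`. -/
theorem dvd_of_unit_functions {m : ℕ} {F : ℂ → ℂ} {D : ℂ × ℝ → ℂ}
    (hF : ContinuousOn F (Metric.closedBall 0 1)) (hFn : ∀ z, ‖z‖ ≤ 1 → ‖F z‖ = 1)
    (hD : ContinuousOn D {e | ‖e.1‖ = 1 ∧ e.2 ∈ Set.Icc (0 : ℝ) 1})
    (hDn : ∀ z r, ‖z‖ = 1 → r ∈ Set.Icc (0 : ℝ) 1 → ‖D (z, r)‖ = 1)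
    (hFD : ∀ z, ‖z‖ = 1 → F (primRoot p * z) * D (z, 0)
      = Complex.exp (2 * Real.pi * Complex.I * (-(m / p) : ℝ)) * (F z * D (z, 1)))
    (hDp : ∀ z r, ‖z‖ = 1 → r ∈ Set.Icc (0 : ℝ) 1 → ∏ j ∈ Finset.range p, D (primRoot p ^ j * z, r) = 1) :
    p ∣ m := by
  have hp : (p : ℝ) ≠ 0 := by exact_mod_cast NeZero.ne p
  have h0 : (0 : ℝ) ∈ Set.Icc (0 : ℝ) 1 := ⟨le_rfl, zero_le_one⟩
  have h1 : (1 : ℝ) ∈ Set.Icc (0 : ℝ) 1 := ⟨zero_le_one, le_rfl⟩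
  obtain ⟨φ, hφ, hφF⟩ := exists_circle_lift (F := fun z => F (discRet z))
    (hF.comp_continuous continuous_discRet fun z => mem_closedBall_zero_iff.2 (norm_discRet z))
    fun z => hFn _ (norm_discRet z)
  -- The function `D` is pulled back to `ℝ × ℝ`, by the exponential and by clamping to `[0, 1]`, to have a logarithm.
  let ex : ℝ → ℂ := fun θ => Complex.exp (2 * Real.pi * Complex.I * θ)
  have hex : Continuous ex := by fun_prop
  have hexn : ∀ θ, ‖ex θ‖ = 1 := fun θ => norm_exp_two_pi θ
  let cl : ℝ → ℝ := fun r => (Set.projIcc 0 1 zero_le_one r : ℝ)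
  have hcl : Continuous cl := continuous_subtype_val.comp continuous_projIcc
  have hcl1 : ∀ r, cl r ∈ Set.Icc (0 : ℝ) 1 := fun r => (Set.projIcc 0 1 zero_le_one r).2
  have hcle : ∀ r ∈ Set.Icc (0 : ℝ) 1, cl r = r := fun r hr => by
    simp only [cl]
    rw [Set.projIcc_of_mem zero_le_one hr]
  obtain ⟨d, hd, hdD⟩ := exists_circle_lift (F := fun e : ℝ × ℝ => D (ex e.1, cl e.2))
    (hD.comp_continuous ((hex.comp continuous_fst).prodMk (hcl.comp continuous_snd)) fun e => ⟨hexn _, hcl1 _⟩)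
    fun e => hDn _ _ (hexn _) (hcl1 _)
  have hadd : ∀ s t, ex (s + t) = ex s * ex t := fun s t => by
    simp only [ex]
    rw [← Complex.exp_add]
    congr 1
    push_cast
    ring
  have hsub : ∀ s t, ex (s - t) = ex s / ex t := fun s t => by
    rw [eq_div_iff (Complex.exp_ne_zero _), ← hadd, sub_add_cancel]
  have hζ : ∀ θ, ex (θ + 1 / p) = primRoot p * ex θ := fun θ => by rw [hadd, mul_comm]; rfl
  have hφF' : ∀ θ, ex (φ (ex θ)) = F (ex θ) := fun θ => (hφF _).trans (by rw [discRet_eq (hexn θ).le])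
  have hdD' : ∀ θ, ∀ r ∈ Set.Icc (0 : ℝ) 1, ex (d (θ, r)) = D (ex θ, r) := fun θ r hr =>
    (hdD _).trans (by rw [hcle r hr])
  -- The relation between `F` and `D` holds for the logarithms up to an integer `c`, which is constant.
  obtain ⟨c, hc⟩ := exists_int_of_continuous
    (q := fun θ => φ (ex (θ + 1 / p)) - φ (ex θ) + d (θ, 0) - d (θ, 1) + m / p) (by fun_prop) fun θ => by
    refine exp_eq_one_iff_int ?_
    change ex _ = 1
    have e := hFD (ex θ) (hexn θ)
    rw [← hζ, ← hφF', ← hφF', ← hdD' θ 0 h0, ← hdD' θ 1 h1] at e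
    change _ = ex (-(m / p)) * _ at e
    rw [← hadd, ← hadd, ← hadd] at e
    rw [show φ (ex (θ + 1 / p)) - φ (ex θ) + d (θ, 0) - d (θ, 1) + m / p
      = (φ (ex (θ + 1 / p)) + d (θ, 0)) - (-(m / p) + (φ (ex θ) + d (θ, 1))) by ring, hsub, e,
      div_self (Complex.exp_ne_zero _)]
  -- The sum of the logarithms of `D` over an orbit is an integer, which does not depend on the height.
  obtain ⟨s, hs⟩ := exists_int_of_continuous
    (q := fun r => ∑ j ∈ Finset.range p, d (j * (1 / p), cl r)) (by fun_prop) fun r => by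
    refine exp_eq_one_iff_int ?_
    rw [← hDp 1 (cl r) norm_one (hcl1 r)]
    push_cast
    rw [Finset.mul_sum, Complex.exp_sum]
    refine Finset.prod_congr rfl fun j _ => (hdD' (j * (1 / p)) _ (hcl1 r)).trans ?_
    congr 2
    simp only [ex, primRoot]
    rw [mul_one, ← Complex.exp_nat_mul]
    congr 1
    push_cast
    ring
  have hs0 := hs 0
  have hs1 := hs 1
  rw [hcle 0 h0] at hs0
  rw [hcle 1 h1] at hs1
  have tel : ∑ j ∈ Finset.range p, (φ (ex ((j + 1 : ℕ) * (1 / p))) - φ (ex (j * (1 / p)))) = 0 := by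
    rw [Finset.sum_range_sub (fun j : ℕ => φ (ex (j * (1 / p))))]
    have e1 : ex ((p : ℕ) * (1 / p)) = ex ((0 : ℕ) * (1 / p)) := by
      rw [mul_one_div_cancel hp]
      simp [ex]
    rw [e1, sub_self]
  -- Adding up the relation over an orbit, all terms but `m` and `p c` cancel.
  have sum : ∑ j ∈ Finset.range p, (φ (ex (j * (1 / p) + 1 / p)) - φ (ex (j * (1 / p))) + d (j * (1 / p), 0)
      - d (j * (1 / p), 1) + m / p) = ∑ j ∈ Finset.range p, (c : ℝ) := Finset.sum_congr rfl fun j _ => hc _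
  rw [Finset.sum_add_distrib, Finset.sum_sub_distrib, Finset.sum_add_distrib, hs0, hs1, Finset.sum_const,
    Finset.sum_const, Finset.card_range, nsmul_eq_mul, nsmul_eq_mul, mul_div_cancel₀ _ hp] at sum
  have tel' : ∑ j ∈ Finset.range p, (φ (ex (j * (1 / p) + 1 / p)) - φ (ex (j * (1 / p)))) = 0 := by
    rw [← tel]
    refine Finset.sum_congr rfl fun j _ => ?_
    rw [Nat.cast_succ, add_mul, one_mul]
  rw [tel'] at sum
  have : (m : ℤ) = p * c := by
    have : (m : ℝ) = p * c := by linarith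
    exact_mod_cast this
  exact Int.natCast_dvd_natCast.1 ⟨c, this⟩

end Disc

section Order
variable {p : ℕ} [NeZero p]

/-- The map from the solid cylinder to `S³ × S¹` which takes the disc to a disc in `S³` whose boundary is
a fibre of the Hopf fibration, and the interval to a full turn of `S¹`. It is extended to the whole space
by the retraction onto the disc. -/
def box (e : ℂ × ℝ) : Sph3 × Circle :=
  (⟨!₂[discRet e.1, ((√(1 - ‖discRet e.1‖ ^ 2) : ℝ) : ℂ)], by
    have h := norm_discRet e.1
    rw [mem_sphere_zero_iff_norm, EuclideanSpace.norm_eq, Fin.sum_univ_two]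
    have h2 : 0 ≤ 1 - ‖discRet e.1‖ ^ 2 := by nlinarith [norm_nonneg (discRet e.1)]
    simp [abs_of_nonneg (Real.sqrt_nonneg _), Real.sq_sqrt h2]⟩, Circle.exp (2 * Real.pi * e.2))

theorem continuous_box : Continuous box := by
  refine Continuous.prodMk (Continuous.subtype_mk ((PiLp.continuous_toLp 2 _).comp (continuous_pi fun i => ?_)) _)
    (by fun_prop)
  have := continuous_discRet
  fin_cases i
  · exact this.comp continuous_fst
  · change Continuous fun e : ℂ × ℝ => ((√(1 - ‖discRet e.1‖ ^ 2) : ℝ) : ℂ)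
    fun_prop

theorem box_one (z : ℂ) : box (z, 1) = box (z, 0) :=
  Prod.ext rfl (by simp [box])

/-- The generator of `ℤ_p`. -/
def zpGen (p : ℕ) [NeZero p] : Zp p :=
  rootsOfUnity.mkOfPowEq (primRoot p) (primRoot_pow p)

theorem coe_zpGen : ((zpGen p : ℂˣ) : ℂ) = primRoot p := rfl

theorem box_rot {z : ℂ} (hz : ‖z‖ = 1) (r : ℝ) :
    box (primRoot p * z, r) = (zpGen p • (box (z, r)).1, (box (z, r)).2) := by
  have hz' : ‖primRoot p * z‖ = 1 := by rw [norm_mul, norm_primRoot, hz, one_mul]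
  refine Prod.ext (Subtype.ext ?_) rfl
  rw [coe_smul_zp, coe_zpGen]
  ext i
  simp only [box, discRet_eq hz'.le, discRet_eq hz.le, hz, hz']
  fin_cases i <;> simp

namespace IsTwCocycle
variable {U : Cover (Mp p).carrier} {r : Mp p → Mp p → ℝ} {g : Mp p → Mp p → Sph3 × Circle → ℂ}
  {f : (Fin 3 → Mp p) → Mp p → ℝ}

/-- If the `m`-fold class vanishes, then the `m`-th powers of the transition functions can be corrected by
functions on `M_p` to a strict cocycle. -/
theorem exists_strict (h : IsTwCocycle U r g f) {n : (U.δ 3).ker} (hn : IsCobdry f n) {m : ℕ}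
    (hm : m • U.cls n = 0) :
    ∃ (V : Cover (Mp p).carrier) (G : Mp p → Mp p → Sph3 × Circle → ℂ), U ≤ V ∧
      (∀ x y, ContinuousOn (G x y) (toM p ⁻¹' (V.U x ∩ V.U y))) ∧
      (∀ x y t, toM p t ∈ V.U x ∩ V.U y → ‖G x y t‖ = 1) ∧
      (∀ x y t (ζ : Zp p) (k : ℤ), toM p t ∈ V.U x ∩ V.U y → r y (toM p t) = r x (toM p t) + k →
        G x y (ζ • t.1, t.2) = ((ζ : ℂˣ) : ℂ) ^ (-(m * k)) * G x y t) ∧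
      ∀ x y z t, toM p t ∈ V.U x → toM p t ∈ V.U y → toM p t ∈ V.U z → G x y t * G y z t = G x z t := by
  classical
  rw [← map_nsmul, Cover.cls_eq_zero_iff] at hm
  obtain ⟨V, hUV, k, hk⟩ := hm
  have hV := h.refine hUV
  let kf : (Fin 3 → Mp p) → Mp p → ℝ := fun x q => if hq : q ∈ V.inter x then (k x ⟨q, hq⟩ : ℤ) else 0
  have hkf : ∀ x q (hq : q ∈ V.inter x), kf x q = (k x ⟨q, hq⟩ : ℤ) := fun x q hq => dif_pos hq
  have hkc : ∀ x, ContinuousOn (kf x) (V.inter x) := fun x => by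
    rw [continuousOn_iff_continuous_domRestrict]
    exact ((continuous_of_discreteTopology (f := fun i : ℤ => (i : ℝ))).comp (k x).continuous).congr fun q => (hkf x q q.2).symm
  have hsmul : ∀ x (q : U.inter x), ((m • n).1 x q : ℤ) = m * n.1 x q := fun x q => by
    refine (congrFun (map_nsmul (LocallyConstant.coeFnAddMonoidHom : LocallyConstant (U.inter x) ℤ →+ _)
      m (n.1 x)) q).trans ?_
    simp
  -- If `k` is an integral cochain with `δk = m n`, then `m f - k` is a real cocycle.
  obtain ⟨b, hbc, hb⟩ := V.exists_real_primitive (fun x q => m * f x q - kf x q)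
    (fun x => (continuousOn_const.mul (hV.f_cont x)).sub (hkc x)) fun x q hq => by
    have e1 := V.δ_apply 2 k x ⟨q, hq⟩
    rw [hk] at e1
    have e2 := hn x ⟨q, Cover.inter_mono hUV x hq⟩
    have e3 : (Cover.refine hUV 3 (m • n).1 x ⟨q, hq⟩ : ℤ) = m * n.1 x ⟨q, Cover.inter_mono hUV x hq⟩ :=
      hsmul x ⟨q, Cover.inter_mono hUV x hq⟩
    rw [e3] at e1
    push_cast at e1
    rw [e2] at e1
    simp only [mul_sub, Finset.sum_sub_distrib]
    rw [sub_eq_zero]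
    refine Eq.trans ?_ (e1.trans ?_)
    · rw [Finset.mul_sum]
      exact Finset.sum_congr rfl fun i _ => by ring
    · exact Finset.sum_congr rfl fun i _ => by rw [hkf _ _ (V.inter_succAbove x i hq)]
  refine ⟨V, fun x y t => g x y t ^ m * Complex.exp (2 * Real.pi * Complex.I * (-b x y (toM p t) : ℝ)), hUV,
    fun x y => ?_, fun x y t ht => ?_, fun x y t ζ j ht hj => ?_, fun x y z t hx hy hz => ?_⟩
  · refine ((hV.g_cont x y).pow m).mul (Complex.continuous_exp.comp_continuousOn (continuousOn_const.mul
      (Complex.continuous_ofReal.comp_continuousOn ?_)))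
    exact ((hbc x y).comp (continuous_toM p).continuousOn fun t ht => ht).neg
  · rw [norm_mul, norm_pow, hV.g_norm x y t ht, norm_exp_two_pi, one_pow, one_mul]
  · beta_reduce
    rw [toM_smul, hV.g_rot x y t ζ j ht hj, mul_pow, ← zpow_natCast, ← zpow_mul, ← mul_assoc,
      show -j * (m : ℤ) = -(m * j) by ring]
  · have hq : toM p t ∈ V.inter ![x, y, z] := Cover.mem_inter.2 fun i => by
      fin_cases i
      exacts [hx, hy, hz]
    have e1 := hb ![x, y, z] _ hq
    have e2 := congrArg (· ^ m) (hV.mul ![x, y, z] t hq)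
    simp only [Matrix.cons_val_zero, Matrix.cons_val_one, Matrix.cons_val, mul_pow] at e1 e2
    rw [hkf _ _ hq, ← Complex.exp_nat_mul] at *
    generalize k ![x, y, z] ⟨toM p t, hq⟩ = K at e1
    have e3 : Complex.exp (2 * Real.pi * Complex.I * (-b x y (toM p t) : ℝ))
        * Complex.exp (2 * Real.pi * Complex.I * (-b y z (toM p t) : ℝ))
        * Complex.exp (m * (2 * Real.pi * Complex.I * f ![x, y, z] (toM p t)))
        = Complex.exp (2 * Real.pi * Complex.I * (-b x z (toM p t) : ℝ)) := by
      rw [← Complex.exp_add, ← Complex.exp_add]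
      have e4 : (m * f ![x, y, z] (toM p t) : ℝ) = b y z (toM p t) - b x z (toM p t) + b x y (toM p t) + K := by
        rw [e1]
        ring
      have e5 : (m * (2 * Real.pi * Complex.I * f ![x, y, z] (toM p t)) : ℂ)
          = 2 * Real.pi * Complex.I * ((m * f ![x, y, z] (toM p t) : ℝ) : ℂ) := by
        push_cast
        ring
      rw [e5, e4]
      refine Eq.trans ?_ ((congrArg (_ * ·) (exp_int K)).trans (mul_one _))
      rw [← Complex.exp_add]
      congr 1
      push_cast
      ring
    beta_reduce
    rw [← e3]
    calc _ = (g x y t ^ m * g y z t ^ m) * (Complex.exp (2 * Real.pi * Complex.I * (-b x y (toM p t) : ℝ))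
        * Complex.exp (2 * Real.pi * Complex.I * (-b y z (toM p t) : ℝ))) := by ring
      _ = _ := by
        rw [e2]
        ring

/-- The order of the class is a multiple of `p`: over the solid cylinder a strict cocycle is a coboundary
`a`, and the quotients of `a` over the ends and along the rotated boundary satisfy the winding number
relation. -/
theorem dvd_of_nsmul_cls_eq_zero (h : IsTwCocycle U r g f) {n : (U.δ 3).ker} (hn : IsCobdry f n) {m : ℕ}
    (hm : m • U.cls n = 0) : p ∣ m := by
  obtain ⟨V, G, hUV, hGc, hGn, hGr, hGm⟩ := h.exists_strict hn hm
  replace h := h.refine hUV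
  obtain ⟨T, ρ, hρ, hρ0, hρs, hρ1⟩ := V.exists_partition
  let q : ℂ × ℝ → Mp p := fun e => toM p (box e)
  have hq : Continuous q := (continuous_toM p).comp continuous_box
  let Ω : Mp p → Set (ℂ × ℝ) := fun x => q ⁻¹' V.U x
  have hΩ : ∀ x, IsOpen (Ω x) := fun x => (V.isOpen x).preimage hq
  have hΩc : ∀ e, e ∈ Ω (q e) := fun e => V.mem (q e)
  obtain ⟨a, hac, han, haG⟩ := exists_trivialization hΩ (Γ := fun x y e => G x y (box e))
    (fun x y => (hGc x y).comp continuous_box.continuousOn fun e he => he) (fun x y e he => hGn x y _ he)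
    (fun x y z e hx hy hz => hGm x y z _ hx hy hz) (j := fun i : T => (i : Mp p))
    (c := fun i e => √(ρ i (q e))) (fun i => Real.continuous_sqrt.comp ((hρ i).comp hq))
    (fun i => by
      have h1 : (q ⁻¹' tsupport (ρ i)) ⊆ Ω i := Set.preimage_mono (hρs i)
      have h2 : (Function.support fun e => √(ρ i (q e))) ⊆ q ⁻¹' tsupport (ρ i) := fun e he =>
        subset_tsupport (ρ i) fun h0 => he (by simp only [h0, Real.sqrt_zero])
      exact (closure_minimal h2 ((isClosed_tsupport (ρ i)).preimage hq)).trans h1)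
    (fun e => by
      rw [← hρ1 (q e)]
      exact Finset.sum_congr rfl fun i _ => Real.sq_sqrt (hρ0 i _)) one_pos
  have hball : ∀ {z : ℂ} {s : ℝ}, ‖z‖ ≤ 1 → s ∈ Set.Icc (0 : ℝ) 1 → (z, s) ∈ Metric.closedBall (0 : ℂ × ℝ) 1 :=
    fun {z s} hz hs => by
      rw [mem_closedBall_zero_iff, Prod.norm_def]
      exact max_le hz (by rw [Real.norm_of_nonneg hs.1]; exact hs.2)
  have h0 : (0 : ℝ) ∈ Set.Icc (0 : ℝ) 1 := ⟨le_rfl, zero_le_one⟩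
  have h1 : (1 : ℝ) ∈ Set.Icc (0 : ℝ) 1 := ⟨zero_le_one, le_rfl⟩
  have ha0 : ∀ {x e}, e ∈ Ω x → e ∈ Metric.closedBall (0 : ℂ × ℝ) 1 → a x e ≠ 0 := fun {x e} he hb h0 => by
    have := han x e ⟨he, hb⟩
    simp [h0] at this
  have hG0 : ∀ {x y e}, e ∈ Ω x → e ∈ Ω y → G x y (box e) ≠ 0 := fun {x y e} hx hy h0 => by
    have := hGn x y _ ⟨hx, hy⟩
    simp [h0] at this
  have hΩ1 : ∀ {x z}, (z, (0 : ℝ)) ∈ Ω x → (z, (1 : ℝ)) ∈ Ω x := fun {x z} hz => by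
    change toM p (box (z, 1)) ∈ V.U x
    rw [box_one]
    exact hz
  have hrot : ∀ {z : ℂ}, ‖z‖ = 1 → ∀ s, q (primRoot p * z, s) = q (z, s) := fun {z} hz s => by
    simp only [q]
    rw [box_rot hz, toM_smul]
  have hrn : ∀ {z : ℂ}, ‖z‖ = 1 → ‖primRoot p * z‖ = 1 := fun {z} hz => by rw [norm_mul, norm_primRoot, hz, one_mul]
  have hΩr : ∀ {x z s}, ‖z‖ = 1 → (z, s) ∈ Ω x → (primRoot p * z, s) ∈ Ω x := fun {x z s} hz hx => by
    change q _ ∈ V.U x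
    rw [hrot hz]
    exact hx
  -- The quotient of the values at the ends does not depend on the trivialization.
  obtain ⟨F, hFc, hF⟩ := exists_continuousOn_glue (S := Metric.closedBall (0 : ℂ) 1)
    (Ω := fun x => (fun z => (z, (0 : ℝ))) ⁻¹' Ω x) (fun x => (hΩ x).preimage (by fun_prop))
    (fun z _ => ⟨_, hΩc (z, 0)⟩) (f := fun x z => a x (z, 1) / a x (z, 0))
    (fun x => ((hac x).comp (f := fun z : ℂ => (z, (1 : ℝ))) (by fun_prop)
      fun z hz => ⟨hΩ1 hz.1, hball (mem_closedBall_zero_iff.1 hz.2) h1⟩).div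
      ((hac x).comp (f := fun z : ℂ => (z, (0 : ℝ))) (by fun_prop)
        fun z hz => ⟨hz.1, hball (mem_closedBall_zero_iff.1 hz.2) h0⟩)
      fun z hz => ha0 hz.1 (hball (mem_closedBall_zero_iff.1 hz.2) h0))
    (fun x y z hz hx hy => by
      have hz' := mem_closedBall_zero_iff.1 hz
      have e0 := haG x y _ hx hy (hball hz' h0)
      have e1 := haG x y _ (hΩ1 hx) (hΩ1 hy) (hball hz' h1)
      rw [box_one] at e1
      rw [e0, e1, mul_div_mul_left _ _ (hG0 (e := (z, 0)) hx hy)])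
  -- The quotient along the rotation, corrected by the lift `r_x` minus the height.
  let tw : Mp p → ℂ × ℝ → ℂ := fun x e =>
    Complex.exp (2 * Real.pi * Complex.I * (-(m / p * (r x (q e) - e.2)) : ℝ))
  have htw : ∀ {x y e}, e ∈ Ω x → e ∈ Ω y → ∃ k : ℤ, r y (q e) = r x (q e) + k ∧
      tw y e = primRoot p ^ (-(m * k)) * tw x e := fun {x y e} hx hy => by
    obtain ⟨k, hk⟩ := h.exists_int h hx hy
    refine ⟨k, hk, ?_⟩
    simp only [tw, primRoot]
    rw [hk, ← Complex.exp_int_mul, ← Complex.exp_add]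
    congr 1
    push_cast
    ring
  obtain ⟨D, hDc, hD⟩ := exists_continuousOn_glue (S := {e : ℂ × ℝ | ‖e.1‖ = 1 ∧ e.2 ∈ Set.Icc (0 : ℝ) 1})
    hΩ (fun e _ => ⟨_, hΩc e⟩) (f := fun x e => a x (primRoot p * e.1, e.2) / a x e * tw x e)
    (fun x => (((hac x).comp (f := fun e : ℂ × ℝ => (primRoot p * e.1, e.2)) (by fun_prop)
      fun e he => ⟨hΩr he.2.1 he.1, hball (hrn he.2.1).le he.2.2⟩).div
      ((hac x).mono fun e he => ⟨he.1, hball he.2.1.le he.2.2⟩)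
      fun e he => ha0 he.1 (hball he.2.1.le he.2.2)).mul
      (Complex.continuous_exp.comp_continuousOn (continuousOn_const.mul
        (Complex.continuous_ofReal.comp_continuousOn (continuousOn_const.mul
          (((h.r_cont x).comp hq.continuousOn fun e he => he.1).sub continuousOn_snd)).neg))))
    (fun x y e he hx hy => by
      have e0 := haG x y _ hx hy (hball he.1.le he.2)
      have e1 := haG x y _ (hΩr he.1 hx) (hΩr he.1 hy) (hball (hrn he.1).le he.2)
      obtain ⟨k, hk, hkt⟩ := htw hx hy
      have e2 := hGr x y (box e) (zpGen p) k ⟨hx, hy⟩ hk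
      have hk' := ha0 hy (hball he.1.le he.2)
      have hg' := hG0 hx hy
      beta_reduce at e1 ⊢
      rw [box_rot he.1, e2, coe_zpGen] at e1
      rw [e0, e1, hkt]
      field_simp)
  have hDa : ∀ {x z s}, ‖z‖ = 1 → s ∈ Set.Icc (0 : ℝ) 1 → (z, s) ∈ Ω x →
      D (z, s) = a x (primRoot p * z, s) / a x (z, s) * tw x (z, s) := fun {x z s} hz hs hx =>
    hD x (z, s) ⟨hz, hs⟩ hx
  have hFa : ∀ {x z}, ‖z‖ ≤ 1 → (z, (0 : ℝ)) ∈ Ω x → F z = a x (z, 1) / a x (z, 0) := fun {x z} hz hx =>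
    hF x z (mem_closedBall_zero_iff.2 hz) hx
  refine dvd_of_unit_functions p hFc (fun z hz => ?_) hDc (fun z s hz hs => ?_) (fun z hz => ?_)
    (fun z s hz hs => ?_)
  · rw [hFa hz (hΩc (z, 0)), norm_div, han _ _ ⟨hΩ1 (hΩc (z, 0)), hball hz h1⟩, han _ _ ⟨hΩc (z, 0), hball hz h0⟩,
      div_one]
  · have hx := hΩc (z, s)
    rw [hDa hz hs hx, norm_mul, norm_div, han _ _ ⟨hΩr hz hx, hball (hrn hz).le hs⟩, han _ _ ⟨hx, hball hz.le hs⟩,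
      norm_exp_two_pi, div_one, one_mul]
  · have hx := hΩc (z, 0)
    generalize q (z, 0) = x at hx
    have hx1 := hΩ1 hx
    rw [hFa hz.le hx, hFa (hrn hz).le (hΩr hz hx), hDa hz h0 hx, hDa hz h1 hx1]
    have n1 := ha0 hx (hball hz.le h0)
    have n2 := ha0 hx1 (hball hz.le h1)
    have n3 := ha0 (hΩr hz hx) (hball (hrn hz).le h0)
    have e : tw x (z, 0) = Complex.exp (2 * Real.pi * Complex.I * (-(m / p) : ℝ)) * tw x (z, 1) := by
      simp only [tw]
      rw [← Complex.exp_add, show q (z, 1) = q (z, 0) from congrArg (toM p) (box_one z)]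
      congr 1
      push_cast
      ring
    rw [e]
    field_simp
  · -- The quotients telescope, since the orbit of `z` is a single point of `M_p`.
    have hx := hΩc (z, s)
    obtain ⟨k, hk⟩ : ∃ k : ℤ, r (q (z, s)) (q (z, s)) - s = k := by
      have e := h.r_exp _ _ hx
      rw [show Mp.z (q (z, s)) = Circle.exp (2 * Real.pi * s) from rfl] at e
      obtain ⟨k, hk⟩ := exp_eq e.symm
      exact ⟨k, by rw [hk]; ring⟩
    have hj : ∀ j : ℕ, ‖primRoot p ^ j * z‖ = 1 ∧ q (primRoot p ^ j * z, s) = q (z, s) := fun j => by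
      induction j with
      | zero => exact ⟨by simpa using hz, by simp⟩
      | succ j ih =>
        rw [pow_succ', mul_assoc]
        exact ⟨hrn ih.1, (hrot ih.1 s).trans ih.2⟩
    have hjx : ∀ j : ℕ, (primRoot p ^ j * z, s) ∈ Ω (q (z, s)) := fun j => by
      change q _ ∈ V.U _
      rw [(hj j).2]
      exact hx
    have hk' : ∀ j : ℕ, tw (q (z, s)) (primRoot p ^ j * z, s)
        = Complex.exp (2 * Real.pi * Complex.I * (-(m / p * k) : ℝ)) := fun j => by
      simp only [tw]
      rw [(hj j).2, hk]
    have tel : ∀ N : ℕ, ∏ j ∈ Finset.range N, D (primRoot p ^ j * z, s) = a (q (z, s)) (primRoot p ^ N * z, s)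
        / a (q (z, s)) (z, s) * Complex.exp (2 * Real.pi * Complex.I * (-(m / p * k) : ℝ)) ^ N := fun N => by
      induction N with
      | zero => simp [div_self (ha0 hx (hball hz.le hs))]
      | succ N ih =>
        have n1 := ha0 (hjx N) (hball (hj N).1.le hs)
        rw [Finset.prod_range_succ, ih, hDa (hj N).1 hs (hjx N), hk', pow_succ' (primRoot p), mul_assoc (primRoot p),
          pow_succ]
        field_simp
    rw [tel, primRoot_pow, one_mul, div_self (ha0 hx (hball hz.le hs)), one_mul, ← Complex.exp_nat_mul]
    refine Eq.trans ?_ (exp_int (-(m * k)))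
    have hp' : (p : ℂ) ≠ 0 := by exact_mod_cast NeZero.ne p
    congr 1
    push_cast
    field_simp
end IsTwCocycle

/-- Two data for the class are compared on a common refinement of their covers. -/
theorem isDDClass_unique {c c' : H3 (Mp p).carrier} (h : (cupGerbe p).IsDDClass c) (h' : (cupGerbe p).IsDDClass c') :
    c = c' := by
  obtain ⟨U, r, g, f, n, ht, hn, rfl⟩ := IsTwCocycle.exists_of_isDDClass h
  obtain ⟨U', r', g', f', n', ht', hn', rfl⟩ := IsTwCocycle.exists_of_isDDClass h'
  rw [← Cover.cls_refine (Cover.le_inf_left U U'), ← Cover.cls_refine (Cover.le_inf_right U U')]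
  exact (ht.refine (Cover.le_inf_left U U')).cls_unique (ht'.refine (Cover.le_inf_right U U'))
    (fun x m => hn x ⟨m, Cover.inter_mono (Cover.le_inf_left U U') x m.2⟩)
    (fun x m => hn' x ⟨m, Cover.inter_mono (Cover.le_inf_right U U') x m.2⟩)

theorem addOrderOf_isDDClass {c : H3 (Mp p).carrier} (h : (cupGerbe p).IsDDClass c) : addOrderOf c = p := by
  obtain ⟨U, r, g, f, n, ht, hn, rfl⟩ := IsTwCocycle.exists_of_isDDClass h
  exact Nat.dvd_antisymm (addOrderOf_dvd_of_nsmul_eq_zero (ht.smul_cls hn))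
    (ht.dvd_of_nsmul_cls_eq_zero hn (addOrderOf_nsmul_eq_zero _))

theorem exists_ddClass (p : ℕ) [NeZero p] : ∃ c : H3 (Mp p).carrier,
    (∀ c', (cupGerbe p).IsDDClass c' ↔ c' = c) ∧ addOrderOf c = p := by
  obtain ⟨c, hc⟩ := exists_isDDClass p
  exact ⟨c, fun c' => ⟨fun h => isDDClass_unique h hc, fun h => h ▸ hc⟩, addOrderOf_isDDClass hc⟩

end Order

end CupGerbe

end

theorem mainTheorem5 (p : ℕ) [NeZero p] :
    (CupGerbe.cupGerbe p).IsCurving (CupGerbe.cupCurving p) ∧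
    (CupGerbe.cupGerbe p).HasCurvature (CupGerbe.cupCurving p) (CupGerbe.cupCurvature p) ∧
    (∃ c : CupGerbe.H3 (CupGerbe.Mp p).carrier,
      (∀ c', (CupGerbe.cupGerbe p).IsDDClass c' ↔ c' = c) ∧ addOrderOf c = p) ∧
    (∃ D : CupGerbe.HVB (CupGerbe.Mp p).carrier ≌ CupGerbe.Tw p 0, D.functor = CupGerbe.Tw.pull p ∧
      ∃ Φ : (CupGerbe.cupGerbe p).Sec ≌ CupGerbe.Tw p 1,
        Nonempty (CupGerbe.BundleMetric (CupGerbe.cupGerbe p)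
          (Φ.functor.op.prod Φ.functor ⋙ CupGerbe.Tw.pairing p 1 ⋙ D.inverse))) ∧
    Nonempty ((CupGerbe.cupGerbe p).Sec ≌ CupGerbe.Tw p (-1)) := by
  refine ⟨CupGerbe.cupGerbe_isCurving p, CupGerbe.cupGerbe_hasCurvature p, CupGerbe.exists_ddClass p,
    ⟨CupGerbe.pullEquiv p, rfl, CupGerbe.secEquiv p, ⟨CupGerbe.bundleMetric p⟩⟩,
    ⟨(CupGerbe.secEquiv p).trans (CupGerbe.Tw.reflectEquiv (k := 1) (l := -1) rfl (by norm_num))⟩⟩
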